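/- **Notation.** All operators are *rational differential operators*: (matrices of) operators $\sum_m c_m(r)\,\partial_r^m$, a finite sum with $c_m\in\mathbb C(r)$, multiplied by composition. The parameters are $M,\omega,\mathcal B\in\mathbb C$ (mass, frequency, angular momentum parameter; in applications $\mathcal B=l(l+1)$). Put $f=1-\frac{2M}{r}$, $f_1=\frac{2M}{r}$, $\mathcal A=\mathcal B(\mathcal B-2)$, $\alpha=(12M\omega)^2+\mathcal A^2$, $X=\frac{f_1}{r^2}\bigl(\mathcal B+\tfrac12 f_1\bigr)$, $$\mathcal D_s=\partial_r f\partial_r-\frac{\mathcal B+(1-s^2)f_1}{r^2}+\frac{\omega^2}{f},\qquad \mathcal D_2^+=\partial_r f\partial_r-\frac{(\mathcal B-2)\bigl(\mathcal A+3(\mathcal B-2)f_1\bigr)+9(\mathcal B-2)f_1^2+9f_1^3}{r^2(\mathcal B-2+3f_1)^2}+\frac{\omega^2}{f}.$$ For a vector $w$ of rational functions let $L(w)=\mathrm{diag}_i\bigl(\partial_r\, w_i f\,\partial_r+(\tfrac{\omega^2}{f}-\tfrac{\mathcal B}{r^2})w_i\bigr)$. Let $E$ be one of the radial mode operators of the scalar,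 vector (odd, even) and Lichnerowicz (odd, even) wave operators on Schwarzschild: - scalar: $E=L(r^2)$; odd vector: $E=L(\mathcal B r^2)+\mathcal B f_1$; - even vector: $E=L(-\tfrac{r^2}{f},fr^2,\mathcal B r^2)+{\rm i}\omega r\tfrac{f_1}{f}\begin{bmatrix}0&1&0\\-1&0&0\\0&0&0\end{bmatrix}+\begin{bmatrix}0&0&0\\0&-2f^2&2\mathcal B f\\0&2\mathcal B f&\mathcal B f_1\end{bmatrix}$; - odd Lichnerowicz: $E=L(-\tfrac{2\mathcal B r^2}{f},2\mathcal B fr^2,\tfrac{\mathcal A}2r^2)-2{\rm i}\omega r\tfrac{f_1}{f}\begin{bmatrix}0&-\mathcal B&0\\\mathcal B&0&0\\0&0&0\end{bmatrix}+\begin{bmatrix}-\tfrac{4\mathcal B f_1}{f}&0&0\\0&4\mathcal B f(3f_1-2)&2\mathcal A f\\0&2\mathcal A f&\mathcal A\end{bmatrix}$; - even Lichnerowicz: $E=L(-2r^2,-\tfrac{2\mathcal B r^2}{f},\tfrac{r^2}{f^2},f^2r^2,2r^2,2\mathcal B fr^2,\tfrac{\mathcal A}{2}r^2)-2{\rm i}\omega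 r\tfrac{f_1}{f}J+Q$, where the only nonzero entries of $J$ are $J_{13}=-\tfrac1f$, $J_{31}=\tfrac1f$, $J_{14}=-f$, $J_{41}=f$, $J_{26}=-\mathcal B$, $J_{62}=\mathcal B$, and $Q$ is symmetric with nonzero entries (up to symmetry) $Q_{11}=\tfrac{2(f^2+1)}{f}$, $Q_{12}=-4\mathcal B$, $Q_{22}=-\tfrac{4\mathcal B f_1}{f}$, $Q_{33}=\tfrac{f_1^2}{2f^3}$, $Q_{34}=-\tfrac{f_1(f_1+4f)}{2f}$, $Q_{35}=\tfrac{2f_1}{f}$, $Q_{44}=\tfrac{f(f_1^2-8f^2)}{2}$, $Q_{45}=-2f(3f_1-2)$, $Q_{46}=4\mathcal B f^2$, $Q_{55}=4(2f_1-1)$, $Q_{56}=-4\mathcal B f$, $Q_{66}=4\mathcal B f(3f_1-2)$, $Q_{67}=2\mathcal A f$, $Q_{77}=\mathcal A$. Let $\tilde E$ be, respectively, $$\tfrac1{\omega^2}\mathcal D_0,\quad \tfrac{\mathcal B}{\omega^2}\mathcal D_1,\quad \tfrac1{\omega^2}\begin{bmatrix}\mathcal D_0&0&-X\\0&\mathcal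 B\mathcal D_1&0\\0&0&\mathcal D_0\end{bmatrix},\quad -\tfrac2{\omega^2}\begin{bmatrix}\mathcal B\mathcal D_1&0&\tfrac13\mathcal B^2\tfrac{f_1}{r^2}\\0&\mathcal A\mathcal D_2&0\\0&0&\mathcal B\mathcal D_1\end{bmatrix},$$ $$-\tfrac2{\omega^2}\begin{bmatrix}\mathcal D_0&0&-X&0&X&0&\tfrac{f_1^2}{8r^2}(7\mathcal B+2)\\0&\mathcal B\mathcal D_1&0&0&0&-\tfrac53\mathcal B^2\tfrac{f_1}{r^2}&0\\0&0&\mathcal D_0&0&0&0&X\\0&0&0&\alpha\mathcal A\mathcal D_2&0&0&0\\0&0&0&0&\mathcal D_0&0&-X\\0&0&0&0&0&\mathcal B\mathcal D_1&0\\0&0&0&0&0&0&\mathcal D_0\end{bmatrix}.$$ An *equivalence diagram* between $E$ and $\tilde E$ consists of operator matrices $k,k',\bar k,\bar k',h,\tilde h$ with $$\tilde Ek=k'E,\quad E\bar k=\bar k'\tilde E,\quad \bar kk=1-hE,\quad \bar k'k'=1-Eh,\quad k\bar k=1-\tilde h\tilde E,\quad k'\bar k'=1-\tilde E\tilde h.$$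 Call the parameters *regular* if $\omega\neq0$ and moreover $\mathcal B\ne0$ (vector), $\mathcal B\neq0,2$ (odd Lichnerowicz), $\mathcal B\ne0,2$ and $\alpha\ne0$ (even Lichnerowicz). The mass $M$ is arbitrary, including $M=0$. **Theorem.** In each of the five cases: 1. $E$ has order 2; its coefficients are polynomials in $M,\omega,\mathcal B,r$ divided by powers of $r(r-2M)$, and (for $\mathcal B\ne0$ in the vector and $\mathcal B\neq0,2$ in the Lichnerowicz cases) its leading coefficient matrix is invertible at every $r\ne0,2M$: the only singular points are $r=0,2M,\infty$. 2. $\tilde E$ is upper triangular with rational coefficients, its diagonal entries are nonzero constants times operators $\mathcal D_s$, $s\in\{0,1,2\}$, and there is an equivalence diagram between $E$ and $\tilde E$ for all regular parameters, whose operators have order at most $1$ and poles in $r$ only at $r=0,2M$. 3. The operators of this diagram depend rationally on $\omega,\mathcal B$ (and $M$), with poles only at $\omega=0$ and, in the vector cases, $\mathcal B=0$, in the Lichnerowicz cases, $\mathcal B=0,2$; in the even Lichnerowicz case there are additional poles at $\alpha=0$, that is $\omega=\pm{\rm i}\frac{\mathcal A}{12M}$, and both signs really occur among the poles of the six operators.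 In that case, if $\alpha\mathcal A\mathcal D_2$ is replaced in $\tilde E$ by $\mathcal A\mathcal D_2^+$, giving $\tilde E^+$, there is an equivalence diagram between $E$ and $\tilde E^+$ for all $\omega\ne0$, $\mathcal B\ne0,2$, of operators $k_+,\bar k_+,\dots$ of order at most $1$, rational in all the parameters and $r$, whose denominators involve only $r$, $r-2M$, $\omega$, $\mathcal B$, $\mathcal B-2$ and $r(\mathcal B-2+3f_1)=(\mathcal B-2)r+6M$, the last factor being actually present. It arises by the Chandrasekhar transformation: for $\alpha\neq0$, up to homotopy (terms $g\tilde E^+$, respectively $g'E$), $\bar k_+$ is $\bar k$ with its 4th column composed on the right with $\frac1\alpha C_-$, and $k_+$ is $k$ with its 4th row composed on the left with $C_+$, where $C_\pm=\pm12Mf\partial_r+\mathcal A+\frac{36Mff_1}{r(\mathcal B-2+3f_1)}$. 4. As $M\to0$ at fixed $\omega,\mathcal B$ (regular at $M=0$) and fixed $r\ne0$, all coefficients of $E$, $\tilde E$ and of the six operators of the diagram converge to finite limits, their values at $M=0$, where the diagram is still an equivalence diagram and $\tilde E$ is diagonal. 5. For regular parameters with $M>0$, every off-diagonal entry of $\tilde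 E$ has the form $\frac{\Delta_0(r)}f+\Delta_1(r)\partial_r$ with $\Delta_0,\Delta_1$ rational and bounded on $(2M,\infty)$. 6. There is a permutation of the rows and columns of $\tilde E$ after which $\tilde E$ is still upper triangular and is block diagonal with respect to the blocks of equal spin $s$. Let $M>0$, $\mathcal B=l(l+1)$ with an integer $l\ge0$ (scalar), $l\geq1$ (vector), $l\ge2$ (Lichnerowicz), and let $\omega\in\mathbb C$ with $4{\rm i}M\omega\notin\mathbb Z$ (for instance any real $\omega\ne0$). Then every rational automorphism of $\tilde E$, that is every pair $(T,T')$ of matrices of rational differential operators with $\tilde ET=T'\tilde E$, is up to homotopy a constant matrix: $T=C+h\tilde E$, $T'=C+\tilde Eh$ with a matrix $h$ of rational differential operators and a constant matrix $C$ such that $\tilde EC=C\tilde E$; here $C$ is block diagonal with respect to the equal spin blocks and, in the permuted order, upper triangular within each block, with the single exception of the $s=0$ block in the even Lichnerowicz case. In that block there do exist commuting constant $C$, block diagonal with respect to spin, that are not upper triangular. 7. There is a constant matrix $\Sigma$ with $\Sigma^2=1$, $\Sigma^*=\Sigma$ such that $(\Sigma\tilde E)^*=\Sigma\tilde E$ for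 all real regular $M,\omega,\mathcal B$, where $^*$ is the formal adjoint: transpose the matrix, and $\bigl(\sum c_m\partial_r^m\bigr)^*=\sum(-1)^m\partial_r^m\,\overline{c_m}$ for real $r$. -/

import Mathlib

open Filter Topology

noncomputable section

namespace Schw

/-! ## Rational differential operators in one variable -/

/-- The differential field `ℂ(r)`. -/
abbrev RatFun := RatFunc ℂ

/-- The radial coordinate `r`. -/
def r : RatFun := RatFunc.X

/-- A complex constant, as a rational function of `r`. -/
def con (z : ℂ) : RatFun := RatFunc.C z

/-- The derivative of a rational function by the quotient rule. -/
def derivFun (x : RatFun) : RatFun :=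
  (algebraMap (Polynomial ℂ) RatFun (Polynomial.derivative x.num) *
      algebraMap (Polynomial ℂ) RatFun x.denom -
    algebraMap (Polynomial ℂ) RatFun x.num *
      algebraMap (Polynomial ℂ) RatFun (Polynomial.derivative x.denom)) /
    algebraMap (Polynomial ℂ) RatFun x.denom ^ 2

theorem algebraMap_ne_zero' {q : Polynomial ℂ} (hq : q ≠ 0) :
    algebraMap (Polynomial ℂ) RatFun q ≠ 0 := by
  simpa using hq

/-- The quotient rule holds for every representation as a quotient of polynomials. -/
theorem derivFun_div (a q : Polynomial ℂ) (hq : q ≠ 0) :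
    derivFun (algebraMap (Polynomial ℂ) RatFun a / algebraMap (Polynomial ℂ) RatFun q) =
      (algebraMap (Polynomial ℂ) RatFun (Polynomial.derivative a) *
          algebraMap (Polynomial ℂ) RatFun q -
        algebraMap (Polynomial ℂ) RatFun a *
          algebraMap (Polynomial ℂ) RatFun (Polynomial.derivative q)) /
        algebraMap (Polynomial ℂ) RatFun q ^ 2 := by
  set x : RatFun := algebraMap (Polynomial ℂ) RatFun a / algebraMap (Polynomial ℂ) RatFun q with hx
  have hd : x.denom ≠ 0 := RatFunc.denom_ne_zero x
  have key : x.num * q = a * x.denom := (RatFunc.num_mul_eq_mul_denom_iff hq).2 hx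
  have key' : Polynomial.derivative x.num * q + x.num * Polynomial.derivative q =
      Polynomial.derivative a * x.denom + a * Polynomial.derivative x.denom := by
    rw [← Polynomial.derivative_mul, ← Polynomial.derivative_mul, key]
  have h1 := congrArg (algebraMap (Polynomial ℂ) RatFun) key
  have h2 := congrArg (algebraMap (Polynomial ℂ) RatFun) key'
  simp only [map_mul, map_add] at h1 h2
  have hQ := algebraMap_ne_zero' hq
  have hD := algebraMap_ne_zero' hd
  unfold derivFun
  rw [div_eq_div_iff (pow_ne_zero 2 hD) (pow_ne_zero 2 hQ)]
  linear_combination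
    (algebraMap (Polynomial ℂ) RatFun q * algebraMap (Polynomial ℂ) RatFun x.denom) * h2 -
    (algebraMap (Polynomial ℂ) RatFun (Polynomial.derivative x.denom) *
        algebraMap (Polynomial ℂ) RatFun q +
      algebraMap (Polynomial ℂ) RatFun (Polynomial.derivative q) *
        algebraMap (Polynomial ℂ) RatFun x.denom) * h1

theorem derivFun_add (x y : RatFun) : derivFun (x + y) = derivFun x + derivFun y := by
  have hx := algebraMap_ne_zero' (RatFunc.denom_ne_zero x)
  have hy := algebraMap_ne_zero' (RatFunc.denom_ne_zero y)
  have h : x + y =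
      algebraMap (Polynomial ℂ) RatFun (x.num * y.denom + x.denom * y.num) /
        algebraMap (Polynomial ℂ) RatFun (x.denom * y.denom) := by
    conv_lhs => rw [← RatFunc.num_div_denom x, ← RatFunc.num_div_denom y]
    rw [div_add_div _ _ hx hy]
    simp only [map_mul, map_add]
  rw [h, derivFun_div _ _ (mul_ne_zero (RatFunc.denom_ne_zero x) (RatFunc.denom_ne_zero y))]
  unfold derivFun
  simp only [map_mul, map_add, Polynomial.derivative_mul]
  field_simp
  ring

theorem derivFun_smul (c : ℂ) (x : RatFun) : derivFun (c • x) = c • derivFun x := by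
  have h : c • x =
      algebraMap (Polynomial ℂ) RatFun (Polynomial.C c * x.num) /
        algebraMap (Polynomial ℂ) RatFun x.denom := by
    conv_lhs => rw [← RatFunc.num_div_denom x]
    rw [map_mul, mul_div_assoc, RatFunc.algebraMap_C, RatFunc.smul_eq_C_mul]
  rw [h, derivFun_div _ _ (RatFunc.denom_ne_zero x), RatFunc.smul_eq_C_mul]
  unfold derivFun
  simp only [map_mul, Polynomial.derivative_C_mul, RatFunc.algebraMap_C]
  rw [← mul_div_assoc]
  congr 1
  ring

/-- Scalar operators on `ℂ(r)`; multiplication is composition. The rational differential operators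
are those satisfying `IsDiffOp` below; an operator identity between such operators holds here iff
it holds between their coefficients. -/
abbrev Op := Module.End ℂ RatFun

/-- The derivation `∂_r`. -/
def D : Op where
  toFun := derivFun
  map_add' := derivFun_add
  map_smul' := derivFun_smul

/-- The operator of multiplication by a rational function. -/
def mul (a : RatFun) : Op := LinearMap.mulLeft ℂ a

/-- The operator `∑_{m ≤ d} c_m(r) ∂_r^m`. -/
def opOf (d : ℕ) (c : ℕ → RatFun) : Op := ∑ m ∈ Finset.range (d + 1), mul (c m) * D ^ m

/-- Square matrices of operators; multiplication is the matrix product with composition of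
entries. -/
abbrev OpMatrix (n : ℕ) := Matrix (Fin n) (Fin n) Op

/-- A rational differential operator (of arbitrary finite order). -/
def IsDiffOp (P : Op) : Prop := ∃ d c, P = opOf d c

/-- A matrix of rational differential operators. -/
def IsDiffOpMatrix {n : ℕ} (P : OpMatrix n) : Prop := ∀ i j, IsDiffOp (P i j)

/-- A constant matrix, as an operator of order zero. -/
def constOp {n : ℕ} (S : Matrix (Fin n) (Fin n) ℂ) : OpMatrix n := S.map fun z => mul (con z)

theorem nonZeroDivisors_le_comap_conj :
    nonZeroDivisors (Polynomial ℂ) ≤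
      (nonZeroDivisors (Polynomial ℂ)).comap (Polynomial.mapRingHom (starRingEnd ℂ)) :=
  nonZeroDivisors_le_comap_nonZeroDivisors_of_injective _
    (Polynomial.map_injective _ (starRingEnd ℂ).injective)

/-- Complex conjugation of the coefficients of a rational function (that is, complex conjugation
of its values for real `r`). -/
def conj : RatFun →+* RatFun :=
  RatFunc.mapRingHom (Polynomial.mapRingHom (starRingEnd ℂ)) nonZeroDivisors_le_comap_conj

/-- `Q` is the formal adjoint of `P`: if `P = ∑ c_m ∂^m` then `Q = ∑ (-1)^m ∂^m c̄_m`. -/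
def IsFormalAdjoint (P Q : Op) : Prop :=
  ∃ (d : ℕ) (c : ℕ → RatFun), P = opOf d c ∧
    Q = ∑ m ∈ Finset.range (d + 1), (-1 : ℂ) ^ m • (D ^ m * mul (conj (c m)))

/-- Formal self-adjointness of a matrix of operators (adjoint of the transposed entries). -/
def IsFormallySelfAdjoint {n : ℕ} (P : OpMatrix n) : Prop :=
  ∀ i j, IsFormalAdjoint (P i j) (P j i)

/-! ## Equivalence of single-operator equations up to homotopy -/

/-- The arrows of an equivalence diagram between `E` (left column) and `E'` (right column): the
morphisms `(k, k')` and `(k̄, k̄')` and the homotopies `h`, `h̃`. -/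
structure Arrows (n : ℕ) where
  k : OpMatrix n
  k' : OpMatrix n
  kbar : OpMatrix n
  kbar' : OpMatrix n
  h : OpMatrix n
  htilde : OpMatrix n

/-- `(k, k') : E → E'` and `(k̄, k̄') : E' → E` are morphisms (cochain maps of one-operator
complexes) and are mutually inverse up to the homotopies `h`, `h̃`, at both places of the
complexes. -/
structure IsEquivalence {n : ℕ} (E E' : OpMatrix n) (a : Arrows n) : Prop where
  morphism : E' * a.k = a.k' * E
  morphism_bar : E * a.kbar = a.kbar' * E'
  left_inv : a.kbar * a.k = 1 - a.h * E
  left_inv' : a.kbar' * a.k' = 1 - E * a.h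
  right_inv : a.k * a.kbar = 1 - a.htilde * E'
  right_inv' : a.k' * a.kbar' = 1 - E' * a.htilde

/-! ## Parameters and dependence on parameters -/

/-- Mass `M`, frequency `ω` and angular momentum parameter `B = 𝓑_l`. -/
structure Params where
  M : ℂ
  ω : ℂ
  B : ℂ

namespace Params

variable (p : Params)

/-- `𝓐_l = 𝓑_l (𝓑_l - 2)` -/
def A : ℂ := p.B * (p.B - 2)

/-- `α = (12 M ω)² + 𝓐_l²` -/
def α : ℂ := (12 * p.M * p.ω) ^ 2 + p.A ^ 2

/-- `f₁ = 2M/r` -/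
def f₁ : RatFun := con (2 * p.M) / r

/-- `f = 1 - 2M/r` -/
def f : RatFun := 1 - p.f₁

/-- The parameters are real. -/
def IsReal : Prop := p.M.im = 0 ∧ p.ω.im = 0 ∧ p.B.im = 0

end Params

/-- On the parameters satisfying `dom`, the family `a` of rational functions of `r` is
`N(M, ω, 𝓑_l, r) / δ^m` for one polynomial `N` and one exponent `m`. -/
def IsRationalFamily (dom : Params → Prop) (δ : Params → RatFun) (a : Params → RatFun) : Prop :=
  ∃ (N : MvPolynomial (Fin 4) ℂ) (m : ℕ), ∀ p, dom p →
    a p = MvPolynomial.aeval ![con p.M, con p.ω, con p.B, r] N / δ p ^ m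

/-- The coefficient of `∂_r^m` in the `(i, j)` entry is `c m i j p`, for all parameters in `dom`;
the order is at most `d`. -/
def HasCoeffs {n : ℕ} (dom : Params → Prop) (d : ℕ) (P : Params → OpMatrix n)
    (c : ℕ → Fin n → Fin n → Params → RatFun) : Prop :=
  ∀ p, dom p → ∀ i j, P p i j = opOf d fun m => c m i j p

/-- A family of matrices of differential operators of order at most `d`, whose coefficients depend
rationally on `M`, `ω`, `𝓑_l` and `r`, with denominators only powers of `δ`. -/
def IsRationalOpFamily {n : ℕ} (dom : Params → Prop) (δ : Params → RatFun) (d : ℕ)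
    (P : Params → OpMatrix n) : Prop :=
  ∃ c, HasCoeffs dom d P c ∧ ∀ m i j, IsRationalFamily dom δ (c m i j)

/-- All six arrows are rational families of operators of order at most one. -/
def IsRationalArrowFamily {n : ℕ} (dom : Params → Prop) (δ : Params → RatFun)
    (a : Params → Arrows n) : Prop :=
  IsRationalOpFamily dom δ 1 (fun p => (a p).k) ∧
  IsRationalOpFamily dom δ 1 (fun p => (a p).k') ∧
  IsRationalOpFamily dom δ 1 (fun p => (a p).kbar) ∧
  IsRationalOpFamily dom δ 1 (fun p => (a p).kbar') ∧
  IsRationalOpFamily dom δ 1 (fun p => (a p).h) ∧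
  IsRationalOpFamily dom δ 1 (fun p => (a p).htilde)

/-- The value of a rational function at a point (used away from its poles). -/
def evalAt (z : ℂ) (a : RatFun) : ℂ := RatFunc.eval (RingHom.id ℂ) z a

/-- As `M → 0`, with `ω` and `𝓑_l` fixed, every coefficient of `P` has a finite limit at every
point `r ≠ 0`, namely the corresponding coefficient of `P` at `M = 0`. -/
def HasMasslessLimit {n : ℕ} (dom : Params → Prop) (d : ℕ) (P : Params → OpMatrix n) : Prop :=
  ∃ c, HasCoeffs dom d P c ∧ ∀ ω B, dom ⟨0, ω, B⟩ → ∀ m, m ≤ d → ∀ i j, ∀ z : ℂ, z ≠ 0 →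
    Tendsto (fun M : ℂ => evalAt z (c m i j ⟨M, ω, B⟩)) (𝓝[≠] 0)
      (𝓝 (evalAt z (c m i j ⟨0, ω, B⟩)))

/-! ## The radial mode operators -/

/-- The five systems of radial mode equations: scalar, odd and even vector, odd and even
Lichnerowicz wave equation. -/
inductive Sector
  | scalar
  | vecOdd
  | vecEven
  | lichOdd
  | lichEven

namespace Sector

/-- Number of components. -/
@[reducible] def dim : Sector → ℕ
  | scalar => 1
  | vecOdd => 1
  | vecEven => 3
  | lichOdd => 3
  | lichEven => 7

/-- Spins of the Regge–Wheeler operators on the diagonal of the triangular form. -/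
def spin : (s : Sector) → Fin s.dim → ℕ
  | scalar => ![0]
  | vecOdd => ![1]
  | vecEven => ![0, 1, 0]
  | lichOdd => ![1, 2, 1]
  | lichEven => ![0, 1, 0, 2, 0, 1, 0]

/-- The least angular momentum `l` for which all the components of the modes are present. -/
def minL : Sector → ℕ
  | scalar => 0
  | vecOdd => 1
  | vecEven => 1
  | lichOdd => 2
  | lichEven => 2

/-- Product of the angular momentum factors that must not vanish. -/
def angular : Sector → Params → ℂ
  | scalar, _ => 1
  | vecOdd, p => p.B
  | vecEven, p => p.B
  | lichOdd, p => p.B * (p.B - 2)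
  | lichEven, p => p.B * (p.B - 2)

/-- The product of `ω`, the angular momentum factors and, for the even Lichnerowicz sector, the
factor `α` which vanishes at the algebraically special frequencies. -/
def polar : Sector → Params → ℂ
  | lichEven, p => p.ω * (p.B * (p.B - 2)) * p.α
  | s, p => p.ω * s.angular p

/-- The non-exceptional parameters. -/
def regular (s : Sector) (p : Params) : Prop := s.polar p ≠ 0

end Sector

/-- `r (r - 2M)` -/
def radialDen (p : Params) : RatFun := r * (r - con (2 * p.M))

/-- The operator `∂_r (w f) ∂_r + (ω²/f - 𝓑_l/r²) w`. -/
def kineticOp (p : Params) (w : RatFun) : Op :=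
  D * mul (w * p.f) * D + mul ((con (p.ω ^ 2) / p.f - con p.B / r ^ 2) * w)

/-- The operator matrix with diagonal `∂_r (w_i f) ∂_r + (ω²/f - 𝓑_l/r²) w_i`, plus a matrix of
rational functions. -/
def waveForm {n : ℕ} (p : Params) (w : Fin n → RatFun) (Q : Matrix (Fin n) (Fin n) RatFun) : OpMatrix n :=
  Matrix.diagonal (fun i => kineticOp p (w i)) + Q.map mul

/-- Scalar wave operator: `∂_r f r² ∂_r + ω² r²/f - 𝓑_l`. -/
def scalarOp (p : Params) : OpMatrix 1 :=
  waveForm p ![r ^ 2] 0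

/-- Odd sector of the vector wave operator. -/
def vecOddOp (p : Params) : OpMatrix 1 :=
  waveForm p ![con p.B * r ^ 2] !![con p.B * p.f₁]

/-- Even sector of the vector wave operator, acting on `(v_t, v_r, u)`. -/
def vecEvenOp (p : Params) : OpMatrix 3 :=
  let f := p.f
  let f₁ := p.f₁
  let B := con p.B
  waveForm p ![-r ^ 2 / f, f * r ^ 2, B * r ^ 2]
    ((con (Complex.I * p.ω) * r * (f₁ / f)) •
        !![0, 1, 0;
           -1, 0, 0;
           0, 0, 0] +
      !![0, 0, 0;
         0, -2 * f ^ 2, 2 * B * f;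
         0, 2 * B * f, B * f₁])

/-- Odd sector of the Lichnerowicz wave operator, acting on `(h_t, h_r, h_2)`. -/
def lichOddOp (p : Params) : OpMatrix 3 :=
  let f := p.f
  let f₁ := p.f₁
  let B := con p.B
  let A := con p.A
  waveForm p ![-2 * B * r ^ 2 / f, 2 * B * f * r ^ 2, A / 2 * r ^ 2]
    ((-2 * con (Complex.I * p.ω) * r * (f₁ / f)) •
        !![0, -B, 0;
           B, 0, 0;
           0, 0, 0] +
      !![-4 * B * f₁ / f, 0, 0;
         0, 4 * B * f * (3 * f₁ - 2), 2 * A * f;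
         0, 2 * A * f, A])

/-- Even sector of the Lichnerowicz wave operator, acting on
`(h_tr, j_t, h_tt, h_rr, K, j_r, G)`. -/
def lichEvenOp (p : Params) : OpMatrix 7 :=
  let f := p.f
  let f₁ := p.f₁
  let B := con p.B
  let A := con p.A
  waveForm p
    ![-2 * r ^ 2, -2 * B * r ^ 2 / f, r ^ 2 / f ^ 2, f ^ 2 * r ^ 2, 2 * r ^ 2, 2 * B * f * r ^ 2,
      A / 2 * r ^ 2]
    ((-2 * con (Complex.I * p.ω) * r * (f₁ / f)) •
        !![0, 0, -1 / f, -f, 0, 0, 0;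
           0, 0, 0, 0, 0, -B, 0;
           1 / f, 0, 0, 0, 0, 0, 0;
           f, 0, 0, 0, 0, 0, 0;
           0, 0, 0, 0, 0, 0, 0;
           0, B, 0, 0, 0, 0, 0;
           0, 0, 0, 0, 0, 0, 0] +
      !![2 * (f ^ 2 + 1) / f, -4 * B, 0, 0, 0, 0, 0;
         -4 * B, -4 * B * f₁ / f, 0, 0, 0, 0, 0;
         0, 0, f₁ ^ 2 / (2 * f ^ 3), -f₁ * (f₁ + 4 * f) / (2 * f), 2 * f₁ / f, 0, 0;
         0, 0, -f₁ * (f₁ + 4 * f) / (2 * f), f * (f₁ ^ 2 - 8 * f ^ 2) / 2, -2 * f * (3 * f₁ - 2),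
           4 * B * f ^ 2, 0;
         0, 0, 2 * f₁ / f, -2 * f * (3 * f₁ - 2), 4 * (2 * f₁ - 1), -4 * B * f, 0;
         0, 0, 0, 4 * B * f ^ 2, -4 * B * f, 4 * B * f * (3 * f₁ - 2), 2 * A * f;
         0, 0, 0, 0, 0, 2 * A * f, A])

/-- The radial mode operator `E` of each sector. -/
def waveOp : (s : Sector) → Params → OpMatrix s.dim
  | .scalar => scalarOp
  | .vecOdd => vecOddOp
  | .vecEven => vecEvenOp
  | .lichOdd => lichOddOp
  | .lichEven => lichEvenOp

/-! ## Regge–Wheeler and Zerilli operators and the triangular systems -/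

/-- The spin-`s` Regge–Wheeler operator
`𝓓_s = ∂_r f ∂_r - (𝓑_l + (1 - s²) f₁)/r² + ω²/f`. -/
def RW (p : Params) (s : ℕ) : Op :=
  D * mul p.f * D - mul ((con p.B + con (1 - (s : ℂ) ^ 2) * p.f₁) / r ^ 2) +
    mul (con (p.ω ^ 2) / p.f)

/-- `𝓑_l - 2 + 3 f₁` -/
def zerilliFactor (p : Params) : RatFun := con (p.B - 2) + 3 * p.f₁

/-- The Zerilli operator `𝓓_2⁺`. -/
def zerilli (p : Params) : Op :=
  D * mul p.f * D -
    mul ((con (p.B - 2) * (con p.A + 3 * con (p.B - 2) * p.f₁) + 9 * con (p.B - 2) * p.f₁ ^ 2 +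
        9 * p.f₁ ^ 3) / (r ^ 2 * zerilliFactor p ^ 2)) +
    mul (con (p.ω ^ 2) / p.f)

/-- The Chandrasekhar transformation operators
`12 M f 𝓒_± = ± 12 M f ∂_r + 𝓐_l + 36 M f f₁ / (r (𝓑_l - 2 + 3 f₁))` (`ε = ± 1`). -/
def chandra (p : Params) (ε : ℂ) : Op :=
  mul (con (ε * 12 * p.M) * p.f) * D +
    mul (con p.A + con (36 * p.M) * p.f * p.f₁ / (r * zerilliFactor p))

/-- The constant factors of the Regge–Wheeler operators on the diagonal. -/
def diagConst : (s : Sector) → Params → Fin s.dim → ℂ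
  | .scalar, p => ![1 / p.ω ^ 2]
  | .vecOdd, p => ![p.B / p.ω ^ 2]
  | .vecEven, p => ![1 / p.ω ^ 2, p.B / p.ω ^ 2, 1 / p.ω ^ 2]
  | .lichOdd, p => ![-2 * p.B / p.ω ^ 2, -2 * p.A / p.ω ^ 2, -2 * p.B / p.ω ^ 2]
  | .lichEven, p => ![-2 / p.ω ^ 2, -2 * p.B / p.ω ^ 2, -2 / p.ω ^ 2, -2 * (p.α * p.A) / p.ω ^ 2,
      -2 / p.ω ^ 2, -2 * p.B / p.ω ^ 2, -2 / p.ω ^ 2]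

/-- The coupling function `X = (f₁/r²)(𝓑_l + f₁/2)` between spin-0 components. -/
def couplingX (p : Params) : RatFun := p.f₁ / r ^ 2 * (con p.B + p.f₁ / 2)

/-- Off-diagonal part of the triangular system, even vector sector. -/
def vecEvenCoupling (p : Params) : Matrix (Fin 3) (Fin 3) RatFun :=
  con (1 / p.ω ^ 2) •
    !![0, 0, -couplingX p;
       0, 0, 0;
       0, 0, 0]

/-- Off-diagonal part of the triangular system, odd Lichnerowicz sector. -/
def lichOddCoupling (p : Params) : Matrix (Fin 3) (Fin 3) RatFun :=
  con (-2 / p.ω ^ 2) •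
    !![0, 0, con p.B ^ 2 / 3 * (p.f₁ / r ^ 2);
       0, 0, 0;
       0, 0, 0]

/-- Off-diagonal part of the triangular system, even Lichnerowicz sector. -/
def lichEvenCoupling (p : Params) : Matrix (Fin 7) (Fin 7) RatFun :=
  let X := couplingX p
  let Y := p.f₁ ^ 2 / (8 * r ^ 2) * (7 * con p.B + 2)
  let Z := -(5 / 3) * con p.B ^ 2 * (p.f₁ / r ^ 2)
  con (-2 / p.ω ^ 2) •
    !![0, 0, -X, 0, X, 0, Y;
       0, 0, 0, 0, 0, Z, 0;
       0, 0, 0, 0, 0, 0, X;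
       0, 0, 0, 0, 0, 0, 0;
       0, 0, 0, 0, 0, 0, -X;
       0, 0, 0, 0, 0, 0, 0;
       0, 0, 0, 0, 0, 0, 0]

/-- The off-diagonal coupling functions of each sector. -/
def coupling : (s : Sector) → Params → Matrix (Fin s.dim) (Fin s.dim) RatFun
  | .scalar => fun _ => 0
  | .vecOdd => fun _ => 0
  | .vecEven => vecEvenCoupling
  | .lichOdd => lichOddCoupling
  | .lichEven => lichEvenCoupling

/-- The Regge–Wheeler system `Ẽ` of each sector. -/
def rwSystem (s : Sector) (p : Params) : OpMatrix s.dim :=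
  Matrix.diagonal (fun i => diagConst s p i • RW p (s.spin i)) + (coupling s p).map mul

/-- `Ẽ` with the diagonal entries `-2 α 𝓐_l 𝓓_2/ω²` replaced by `-2 𝓐_l 𝓓_2⁺/ω²`. -/
def zerilliSystem (s : Sector) (p : Params) : OpMatrix s.dim :=
  Matrix.of fun i j =>
    if i = j ∧ s.spin i = 2 then (-2 * p.A / p.ω ^ 2) • zerilli p else rwSystem s p i j

/-- The diagonal matrix with `T` at the spin-2 places and the identity elsewhere. -/
def onSpinTwo (s : Sector) (T : Op) : OpMatrix s.dim :=
  Matrix.diagonal fun i => if s.spin i = 2 then T else 1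

/-- The parameters at which the Zerilli form is considered: only `ω = 0` and `𝓑_l = 0, 2` are
excluded. -/
def zerilliRegular (p : Params) : Prop := p.ω * (p.B * (p.B - 2)) ≠ 0

/-- A black hole of mass `M > 0`, a physical angular momentum and a frequency at which the
exponents `± 2iMω` of the horizon `r = 2M` do not differ by an integer (in particular `ω ≠ 0`;
every real `ω ≠ 0` qualifies). -/
def IsNonResonant (s : Sector) (p : Params) : Prop :=
  (∃ m : ℝ, 0 < m ∧ p.M = m) ∧ (∃ l : ℕ, s.minL ≤ l ∧ p.B = l * (l + 1)) ∧
    ∀ n : ℤ, 4 * Complex.I * p.M * p.ω ≠ n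

end Schw

end

open Schw

noncomputable section

namespace Schw

/-! ### The derivation of ℂ(r), constants, and filtered algebra of operator matrices -/

section

/-! Everything is algebra of operator matrices over ℂ(r), written in terms of D = f∂_r. After
rescaling the components by powers of f and by 1/r, E = L R S⁻¹ with R = D² + R₁D + R₀, and Ẽ = U A
with A = D² - W, where L, S, U are invertible and diagonal. An equivalence diagram then amounts to
first-order operators P = a + bD and Q = q₀ + q₁D with AP = P'R, RQ = Q'A and PQ ≡ C modulo
multiples of A, for an invertible constant matrix C commuting with W (`Hat.IsHat`).

Only P has to be tabulated. With G the diagonal matrix of leading coefficients, GR is symmetric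
under formal transposition combined with ω ↦ -ω, while A is symmetric under ω ↦ -ω combined with
reflection in the antidiagonal. Hence Q can be taken as G⁻¹ times the adjoint of P (`bar_of_morph`).
The relation PQ ≡ C need not be expanded either: the remainder of PQ - C modulo A is an endomorphism
of A, and since W → -ω² ≠ 0 at infinity, an endomorphism that vanishes at infinity vanishes to all
orders there (`endo_eq_zero`). So it is enough to compare values at r = ∞. Finally PQC⁻¹ ≡ 1 implies
QC⁻¹P ≡ 1 modulo R, because the spaces of remainders are finite dimensional over ℂ(r)
(`Hat.IsHat.left_inv`), and the relations between the companions P', Q' follow by cancelling a monic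
factor (`Hat.IsHat.isEquivalence`). The remaining conditions are polynomial identities in 1/r, M, 𝓑,
iω and, for the Zerilli form, the inverse of the Zerilli factor; they are decided by computation
with lists of integer terms (`RadPoly`, `System.Valid`) and transported to ℂ(r) by
`System.Valid.isHat`.

The statements on poles follow because the coefficients of the arrows lie in a ring of families with
prescribed denominators, closed under derivation. The massless limit is continuity of such
quotients. In the even Lichnerowicz sector α enters because the spin-2 row of P is divided by α.
Applying 𝓒₊ to the undivided row gives α times the Zerilli row modulo R, which is why the Zerilli
form has no pole at α = 0. That a pole is really present is seen on one entry of k at special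
parameters.

For the automorphisms, division by A reduces T to u + vD. The couplings are strictly upper
triangular, so the entries can be treated one by one from the lower left corner, and each one solves
the equations of a first-order morphism between two Regge–Wheeler operators with a source φ₃r⁻³ +
φ₄r⁻⁴ times f (`ModeEq`). Comparing leading terms at ∞, at ordinary points, at the horizon (where
non-resonance is used) and at r = 0 leaves v a polynomial of degree at most two in 1/r. Comparing
coefficients then gives v = 0 and u constant, and the vanishing of the sources says that the
constant matrix commutes with the couplings (`ModeEq.classify`, `endo_classification`).

Self-adjointness is the antidiagonal symmetry again, with Σ the reversal of the components. -/

theorem algebraMap_num_denom (x : RatFun) :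
    x = algebraMap (Polynomial ℂ) RatFun x.num / algebraMap (Polynomial ℂ) RatFun x.denom :=
  (RatFunc.num_div_denom x).symm

theorem derivFun_mul (x y : RatFun) : derivFun (x * y) = x * derivFun y + y * derivFun x := by
  have hx := algebraMap_ne_zero' (RatFunc.denom_ne_zero x)
  have hy := algebraMap_ne_zero' (RatFunc.denom_ne_zero y)
  have h : x * y =
      algebraMap (Polynomial ℂ) RatFun (x.num * y.num) /
        algebraMap (Polynomial ℂ) RatFun (x.denom * y.denom) := by
    conv_lhs => rw [algebraMap_num_denom x, algebraMap_num_denom y]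
    rw [div_mul_div_comm]
    simp only [map_mul]
  rw [h, derivFun_div _ _ (mul_ne_zero (RatFunc.denom_ne_zero x) (RatFunc.denom_ne_zero y))]
  conv_rhs => rw [algebraMap_num_denom x, algebraMap_num_denom y]
  rw [derivFun_div _ _ (RatFunc.denom_ne_zero x), derivFun_div _ _ (RatFunc.denom_ne_zero y)]
  simp only [map_mul, map_add, Polynomial.derivative_mul]
  field_simp
  ring

/-- The derivation `d/dr` of `ℂ(r)`. -/
def der : Derivation ℂ RatFun RatFun := Derivation.mk' D derivFun_mul

theorem derivFun_eq (x : RatFun) : derivFun x = der x := rfl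

theorem D_apply (x : RatFun) : D x = der x := rfl

theorem con_eq_algebraMap (z : ℂ) : con z = algebraMap ℂ RatFun z := rfl

@[simp] theorem der_con (z : ℂ) : der (con z) = 0 := by
  rw [con_eq_algebraMap]; exact der.map_algebraMap z

@[simp] theorem der_r : der r = 1 := by
  have h := derivFun_div Polynomial.X 1 one_ne_zero
  simp only [map_one, div_one, Polynomial.derivative_X, Polynomial.derivative_one, map_zero,
    mul_one, mul_zero, sub_zero, one_pow, RatFunc.algebraMap_X] at h
  exact h

theorem r_ne_zero : r ≠ 0 := RatFunc.X_ne_zero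

theorem con_inj {a b : ℂ} : con a = con b ↔ a = b :=
  (RatFunc.C (K := ℂ)).injective.eq_iff

@[simp] theorem con_zero : con 0 = 0 := map_zero RatFunc.C
@[simp] theorem con_one : con 1 = 1 := map_one RatFunc.C
theorem con_add (a b : ℂ) : con (a + b) = con a + con b := map_add RatFunc.C a b
theorem con_sub (a b : ℂ) : con (a - b) = con a - con b := map_sub RatFunc.C a b
theorem con_neg (a : ℂ) : con (-a) = -con a := map_neg RatFunc.C a
theorem con_mul (a b : ℂ) : con (a * b) = con a * con b := map_mul RatFunc.C a b
theorem con_pow (a : ℂ) (n : ℕ) : con (a ^ n) = con a ^ n := map_pow RatFunc.C a n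
theorem con_inv (a : ℂ) : con a⁻¹ = (con a)⁻¹ := map_inv₀ RatFunc.C a
theorem con_div (a b : ℂ) : con (a / b) = con a / con b := map_div₀ RatFunc.C a b
theorem con_ofNat (n : ℕ) [n.AtLeastTwo] : con ofNat(n) = ofNat(n) :=
  map_ofNat RatFunc.C n
theorem con_natCast (n : ℕ) : con n = n := map_natCast RatFunc.C n
theorem con_intCast (n : ℤ) : con n = n := map_intCast RatFunc.C n
theorem con_ne_zero {a : ℂ} (h : a ≠ 0) : con a ≠ 0 := by
  rw [← con_zero, Ne, con_inj]; exact h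

/-! ### Matrices of operators -/

/-- Multiplication operators, as a ring homomorphism. -/
def mulHom : RatFun →+* Op where
  toFun := mul
  map_one' := by ext x; simp [mul]
  map_zero' := by ext x; simp [mul]
  map_mul' a b := by ext x; simp [mul]
  map_add' a b := by ext x; simp [mul, add_mul]

theorem mulHom_apply (a : RatFun) : mulHom a = mul a := rfl

@[simp] theorem mul_apply' (a x : RatFun) : mul a x = a * x := rfl

theorem mul_injective : Function.Injective mul := fun a b h => by
  simpa using LinearMap.congr_fun h 1

theorem D_mul (g z : RatFun) :
    mul g * D * mul z = mul (g * der z) + mul z * (mul g * D) := by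
  ext x
  simp only [Module.End.mul_apply, mul_apply', D_apply, LinearMap.add_apply, Derivation.leibniz,
    smul_eq_mul]
  ring

section Matrices

variable {n : ℕ}

/-- Matrices of rational functions. -/
abbrev FunMatrix (n : ℕ) := Matrix (Fin n) (Fin n) RatFun

/-- Multiplication by a matrix of rational functions. -/
def MM : FunMatrix n →+* OpMatrix n := mulHom.mapMatrix

theorem MM_apply (a : FunMatrix n) (i j : Fin n) : MM a i j = mul (a i j) := rfl

theorem MM_eq_map (a : FunMatrix n) : MM a = a.map mul := rfl

theorem MM_injective : Function.Injective (MM : FunMatrix n → OpMatrix n) := fun a b h => by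
  ext i j
  exact mul_injective (congrFun (congrFun h i) j)

/-- The derivation `g ∂_r` in each component. -/
def DD (g : RatFun) : OpMatrix n := Matrix.scalar (Fin n) (mul g * D)

/-- Entrywise derivative along `g ∂_r`. -/
def dm (g : RatFun) (a : FunMatrix n) : FunMatrix n := a.map fun z => g * der z

theorem dm_apply (g : RatFun) (a : FunMatrix n) (i j : Fin n) : dm g a i j = g * der (a i j) := rfl

theorem dm_add (g : RatFun) (a b : FunMatrix n) : dm g (a + b) = dm g a + dm g b := by
  ext i j; simp [dm_apply, mul_add]

theorem dm_neg (g : RatFun) (a : FunMatrix n) : dm g (-a) = -dm g a := by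
  ext i j; simp [dm_apply]

theorem dm_sub (g : RatFun) (a b : FunMatrix n) : dm g (a - b) = dm g a - dm g b := by
  ext i j; simp [dm_apply, mul_sub]

theorem dm_mul (g : RatFun) (a b : FunMatrix n) : dm g (a * b) = dm g a * b + a * dm g b := by
  ext i j
  simp only [dm_apply, Matrix.mul_apply, Matrix.add_apply, map_sum, Derivation.leibniz,
    smul_eq_mul, Finset.mul_sum, ← Finset.sum_add_distrib]
  refine Finset.sum_congr rfl fun k _ => ?_
  ring

theorem dm_zero (g : RatFun) : dm g (0 : FunMatrix n) = 0 := by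
  ext i j; simp [dm_apply]

theorem dm_one (g : RatFun) : dm g (1 : FunMatrix n) = 0 := by
  ext i j; by_cases h : i = j <;> simp [dm_apply, h]

theorem DD_mul_MM (g : RatFun) (a : FunMatrix n) :
    DD g * MM a = MM (dm g a) + MM a * DD g := by
  ext1 i j
  simp only [DD, Matrix.scalar_apply, Matrix.diagonal_mul, Matrix.mul_diagonal, Matrix.add_apply,
    MM_apply, dm_apply]
  exact D_mul g (a i j)

/-- `X` is an operator of order at most `N` in `DD g` with leading coefficient `a`. -/
def HasLead (g : RatFun) : ℕ → FunMatrix n → OpMatrix n → Prop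
  | 0, a, X => X = MM a
  | N + 1, a, X => ∃ b Y, HasLead g N b Y ∧ X = MM a * DD g ^ (N + 1) + Y

variable {g : RatFun}

theorem HasLead.add {N : ℕ} : ∀ {a b : FunMatrix n} {X Y : OpMatrix n}, HasLead g N a X →
    HasLead g N b Y → HasLead g N (a + b) (X + Y) := by
  induction N with
  | zero => intro a b X Y hX hY; simp only [HasLead] at *; rw [hX, hY, map_add]
  | succ N ih =>
    rintro a b X Y ⟨c, X', hc, rfl⟩ ⟨d, Y', hd, rfl⟩
    exact ⟨c + d, X' + Y', ih hc hd, by rw [map_add]; noncomm_ring⟩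

theorem HasLead.left_mul {N : ℕ} (c : FunMatrix n) : ∀ {a : FunMatrix n} {X : OpMatrix n},
    HasLead g N a X → HasLead g N (c * a) (MM c * X) := by
  induction N with
  | zero => intro a X hX; simp only [HasLead] at *; rw [hX, map_mul]
  | succ N ih =>
    rintro a X ⟨b, X', hb, rfl⟩
    exact ⟨c * b, MM c * X', ih hb, by rw [map_mul]; noncomm_ring⟩

theorem HasLead.neg {N : ℕ} {a : FunMatrix n} {X : OpMatrix n} (h : HasLead g N a X) :
    HasLead g N (-a) (-X) := by
  have := h.left_mul (-1)
  simpa using this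

theorem HasLead.sub {N : ℕ} {a b : FunMatrix n} {X Y : OpMatrix n} (h : HasLead g N a X)
    (h' : HasLead g N b Y) : HasLead g N (a - b) (X - Y) := by
  rw [sub_eq_add_neg, sub_eq_add_neg]; exact h.add h'.neg

theorem HasLead.succ {N : ℕ} {a : FunMatrix n} {X : OpMatrix n} (h : HasLead g N a X) :
    HasLead g (N + 1) 0 X := ⟨a, X, h, by simp⟩

theorem HasLead.lift {N : ℕ} {a : FunMatrix n} {X : OpMatrix n} (h : HasLead g N a X) (k : ℕ) :
    ∃ b, HasLead g (N + k) b X := by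
  induction k with
  | zero => exact ⟨a, h⟩
  | succ k ih => obtain ⟨b, hb⟩ := ih; exact ⟨0, hb.succ⟩

theorem HasLead.mul_DD {N : ℕ} : ∀ {a : FunMatrix n} {X : OpMatrix n},
    HasLead g N a X → HasLead g (N + 1) a (X * DD g) := by
  induction N with
  | zero =>
    intro a X hX; simp only [HasLead] at hX
    exact ⟨0, 0, by simp [HasLead], by simp [hX]⟩
  | succ N ih =>
    rintro a X ⟨b, X', hb, rfl⟩
    exact ⟨b, X' * DD g, ih hb, by rw [add_mul, mul_assoc, ← pow_succ]⟩

/-- Moving a function matrix to the left through a power of `DD g` creates only terms of lower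
order. The auxiliary claim is proved for all matrices at once because derivatives of `c` appear. -/
theorem HasLead.mul_MM {N : ℕ} (c : FunMatrix n) : ∀ {a : FunMatrix n} {X : OpMatrix n},
    HasLead g N a X → HasLead g N (a * c) (X * MM c) := by
  induction N generalizing c with
  | zero => intro a X hX; simp only [HasLead] at *; rw [hX, map_mul]
  | succ N ih =>
    rintro a X ⟨b, X', hb, rfl⟩
    have key : ∀ (M : ℕ) (c : FunMatrix n), ∃ b Y, (M ≤ N → HasLead g M b Y) ∧
        DD g ^ (M + 1) * MM c = MM c * DD g ^ (M + 1) + Y := by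
      intro M
      induction M with
      | zero => intro c; exact ⟨dm g c, MM (dm g c), fun _ => rfl, by simp [DD_mul_MM, add_comm]⟩
      | succ M ihM =>
        intro c
        obtain ⟨b₁, Y₁, h₁, e₁⟩ := ihM c
        obtain ⟨b₂, Y₂, h₂, e₂⟩ := ihM (dm g c)
        refine ⟨b₁ + dm g c, Y₁ * DD g + DD g ^ (M + 1) * MM (dm g c), fun h => ?_, ?_⟩
        · refine (h₁ (by omega)).mul_DD.add ?_
          rw [e₂]
          exact ⟨b₂, Y₂, h₂ (by omega), rfl⟩
        · rw [pow_succ (DD g) (M + 1), mul_assoc, DD_mul_MM, mul_add, ← mul_assoc, e₁]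
          noncomm_ring
    obtain ⟨d, Y, hY, e⟩ := key N c
    refine ⟨a * d + b * c, MM a * Y + X' * MM c, ((hY le_rfl).left_mul a).add (ih c hb), ?_⟩
    rw [add_mul, mul_assoc, e, map_mul]
    noncomm_ring

theorem HasLead.exists_of_zero {N : ℕ} {X : OpMatrix n} (h : HasLead g (N + 1) 0 X) :
    ∃ b, HasLead g N b X := by
  obtain ⟨b, Y, hY, rfl⟩ := h
  exact ⟨b, by simpa using hY⟩

/-- Commutator with multiplication by `r`. -/
def adR (X : OpMatrix n) : OpMatrix n :=
  X * MM (Matrix.scalar (Fin n) r) - MM (Matrix.scalar (Fin n) r) * X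

theorem scalar_comm (z : RatFun) (a : FunMatrix n) :
    Matrix.scalar (Fin n) z * a = a * Matrix.scalar (Fin n) z := by
  ext i j; simp [mul_comm]

theorem MM_scalar_comm (z : RatFun) (a : FunMatrix n) :
    MM (Matrix.scalar (Fin n) z) * MM a = MM a * MM (Matrix.scalar (Fin n) z) := by
  rw [← map_mul, ← map_mul, scalar_comm]

/-- Since [g∂, r] = g, the commutator with r differentiates the symbol: the order drops by one and
the leading coefficient is multiplied by (N + 1)g. This is the device that recovers leading
coefficients from an operator given only as a linear map. -/
theorem HasLead.adR {N : ℕ} : ∀ {a : FunMatrix n} {X : OpMatrix n}, HasLead g (N + 1) a X →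
    HasLead g N (((N : RatFun) + 1) • (a * Matrix.scalar (Fin n) g)) (adR X) := by
  have hD : dm g (Matrix.scalar (Fin n) r) = Matrix.scalar (Fin n) g := by
    ext i j; by_cases h : i = j <;> simp [dm_apply, h]
  have key : ∀ M : ℕ, HasLead g M (((M : RatFun) + 1) • Matrix.scalar (Fin n) g)
      (Schw.adR (DD g ^ (M + 1))) := by
    intro M
    induction M with
    | zero =>
      simp only [HasLead, Nat.cast_zero, zero_add, one_smul, pow_one, Schw.adR, DD_mul_MM, hD]
      abel
    | succ M ih =>
      have e : Schw.adR (DD g ^ (M + 1 + 1) : OpMatrix n) = Schw.adR (DD g ^ (M + 1)) * DD g +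
          DD g ^ (M + 1) * MM (Matrix.scalar (Fin n) g) := by
        simp only [Schw.adR]
        rw [pow_succ (DD g) (M + 1), mul_assoc, DD_mul_MM, hD]
        noncomm_ring
      rw [e]
      have h1 : HasLead g (M + 1) (1 : FunMatrix n) (DD g ^ (M + 1)) :=
        ⟨0, 0, by
          have : ∀ k, HasLead g k (0 : FunMatrix n) 0 := by
            intro k; induction k with
            | zero => simp [HasLead]
            | succ k ih => exact ih.succ
          exact this M, by simp⟩
      have := ih.mul_DD.add (h1.mul_MM (Matrix.scalar (Fin n) g))
      convert this using 1
      push_cast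
      rw [one_mul, add_smul, one_smul]
  induction N with
  | zero =>
    rintro a X ⟨b, Y, hY, rfl⟩
    simp only [HasLead] at hY
    subst hY
    have k0 := key 0
    simp only [HasLead, Nat.cast_zero, zero_add, one_smul, pow_one] at k0 ⊢
    have : Schw.adR (MM a * DD g + MM b) = MM a * Schw.adR (DD g) := by
      simp only [Schw.adR, add_mul, mul_add, ← mul_assoc, MM_scalar_comm]
      noncomm_ring
    rw [this, k0, map_mul]
  | succ N ih =>
    rintro a X ⟨b, Y, hY, rfl⟩
    have e : Schw.adR (MM a * DD g ^ (N + 1 + 1) + Y) =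
        MM a * Schw.adR (DD g ^ (N + 1 + 1)) + Schw.adR Y := by
      simp only [Schw.adR, add_mul, mul_add, ← mul_assoc, MM_scalar_comm, mul_sub]
      abel
    rw [e]
    have := ((key (N + 1)).left_mul a).add (ih hY).succ
    convert this using 1
    rw [add_zero, Matrix.mul_smul]

/-- Repeated commutators with r lead down to order zero, where multiplication operators are
faithful; the factors (N + 1)g picked up on the way are invertible. -/
theorem HasLead.eq_zero (hg : g ≠ 0) {N : ℕ} : ∀ {a : FunMatrix n}, HasLead g N a 0 → a = 0 := by
  induction N with
  | zero => intro a h; simp only [HasLead] at h; exact MM_injective (by rw [← h, map_zero])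
  | succ N ih =>
    intro a h
    have h1 := h.adR
    have e : Schw.adR (0 : OpMatrix n) = 0 := by simp [Schw.adR]
    rw [e] at h1
    have h2 := ih h1
    have hN : (N : RatFun) + 1 ≠ 0 := by exact_mod_cast Nat.succ_ne_zero N
    have h3 := (smul_eq_zero.1 h2).resolve_left hN
    ext i j
    have h4 := congrFun (congrFun h3 i) j
    simpa [hg] using h4

theorem HasLead.unique (hg : g ≠ 0) {N : ℕ} {a b : FunMatrix n} {X : OpMatrix n}
    (h : HasLead g N a X) (h' : HasLead g N b X) : a = b := by
  have := h.sub h'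
  rw [sub_self] at this
  exact sub_eq_zero.1 (this.eq_zero hg)

/-! ### Operators of order one and division by monic operators of order two -/

/-- The operator `a + b (g ∂_r)`. -/
def op1 (g : RatFun) (a b : FunMatrix n) : OpMatrix n := MM a + MM b * DD g

/-- The monic operator `(g ∂_r)² + R₁ (g ∂_r) + R₀`. -/
def op2 (g : RatFun) (R₁ R₀ : FunMatrix n) : OpMatrix n := DD g ^ 2 + MM R₁ * DD g + MM R₀

theorem op1_hasLead (g : RatFun) (a b : FunMatrix n) : HasLead g 1 b (op1 g a b) :=
  ⟨a, MM a, rfl, by simp [op1, add_comm]⟩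

theorem op2_hasLead (g : RatFun) (R₁ R₀ : FunMatrix n) : HasLead g 2 1 (op2 g R₁ R₀) :=
  ⟨R₁, op1 g R₀ R₁, op1_hasLead g R₀ R₁, by simp [op2, op1]; abel⟩

theorem op1_eq_zero (hg : g ≠ 0) {a b : FunMatrix n} (h : op1 g a b = 0) : a = 0 ∧ b = 0 := by
  have hb : b = 0 := (h ▸ op1_hasLead g a b).eq_zero hg
  subst hb
  exact ⟨MM_injective (by simpa [op1] using h), rfl⟩

theorem op1_sub (g : RatFun) (a b c d : FunMatrix n) :
    op1 g a b - op1 g c d = op1 g (a - c) (b - d) := by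
  simp only [op1, map_sub]; noncomm_ring

theorem HasLead.mul_op2 {N : ℕ} {a : FunMatrix n} {X : OpMatrix n} (R₁ R₀ : FunMatrix n)
    (h : HasLead g N a X) : HasLead g (N + 2) a (X * op2 g R₁ R₀) := by
  have e : X * op2 g R₁ R₀ = X * DD g * DD g + (X * MM R₁ * DD g + X * MM R₀) := by
    simp only [op2]; noncomm_ring
  rw [e]
  have := h.mul_DD.mul_DD.add (((h.mul_MM R₁).mul_DD.add (h.mul_MM R₀).succ).succ)
  simpa using this

/-- Operators of finite order. -/
def FinOrd (g : RatFun) (X : OpMatrix n) : Prop := ∃ N a, HasLead g N a X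

/-- Multiplication by a monic operator keeps the leading coefficient of `Y` and raises the order by
two. As the right side has order one, the leading coefficients of `Y` vanish one after the other.
This gives uniqueness of division with remainder, hence cancellation of monic factors. -/
theorem eq_zero_of_mul_op2_eq_op1 (hg : g ≠ 0) {R₁ R₀ u v : FunMatrix n} {Y : OpMatrix n}
    (hY : FinOrd g Y) (h : Y * op2 g R₁ R₀ = op1 g u v) : Y = 0 := by
  obtain ⟨N, a, ha⟩ := hY
  induction N generalizing a with
  | zero =>
    have h1 := ha.mul_op2 R₁ R₀
    have h2 := (op1_hasLead g u v).succ
    rw [← h] at h2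
    have h3 := h1.unique hg h2
    subst h3
    simpa [HasLead] using ha
  | succ N ih =>
    have h1 := ha.mul_op2 R₁ R₀
    have h2 : HasLead g (N + 1 + 2) 0 (op1 g u v) := by
      obtain ⟨b, hb⟩ := (op1_hasLead g u v).lift (N + 1)
      have := hb.succ
      convert this using 1
      omega
    rw [← h] at h2
    have h3 := h1.unique hg h2
    subst h3
    obtain ⟨b, hb⟩ := ha.exists_of_zero
    exact ih b hb

theorem mul_op2_cancel (hg : g ≠ 0) {R₁ R₀ : FunMatrix n} {Y : OpMatrix n}
    (hY : FinOrd g Y) (h : Y * op2 g R₁ R₀ = 0) : Y = 0 :=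
  eq_zero_of_mul_op2_eq_op1 hg hY (u := 0) (v := 0) (by rw [h]; simp [op1])

theorem FinOrd.add {X Y : OpMatrix n} (hX : FinOrd g X) (hY : FinOrd g Y) : FinOrd g (X + Y) := by
  obtain ⟨N, a, ha⟩ := hX
  obtain ⟨M, b, hb⟩ := hY
  obtain ⟨a', ha'⟩ := ha.lift M
  obtain ⟨b', hb'⟩ := hb.lift N
  exact ⟨N + M, _, ha'.add (by rwa [add_comm] at hb')⟩

theorem FinOrd.mul_MM {X : OpMatrix n} (hX : FinOrd g X) (c : FunMatrix n) :
    FinOrd g (X * MM c) := by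
  obtain ⟨N, a, ha⟩ := hX
  exact ⟨N, _, ha.mul_MM c⟩

theorem FinOrd.mul_DD {X : OpMatrix n} (hX : FinOrd g X) : FinOrd g (X * DD g) := by
  obtain ⟨N, a, ha⟩ := hX
  exact ⟨N + 1, _, ha.mul_DD⟩

theorem FinOrd.neg {X : OpMatrix n} (hX : FinOrd g X) : FinOrd g (-X) := by
  obtain ⟨N, a, ha⟩ := hX
  exact ⟨N, _, ha.neg⟩

theorem FinOrd.sub {X Y : OpMatrix n} (hX : FinOrd g X) (hY : FinOrd g Y) : FinOrd g (X - Y) := by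
  rw [sub_eq_add_neg]; exact hX.add hY.neg

theorem FinOrd.mM (a : FunMatrix n) : FinOrd g (MM a) := ⟨0, a, rfl⟩

theorem FinOrd.mul_op1 {X : OpMatrix n} (hX : FinOrd g X) (a b : FunMatrix n) :
    FinOrd g (X * op1 g a b) := by
  rw [op1, mul_add, ← mul_assoc]; exact (hX.mul_MM a).add (hX.mul_MM b).mul_DD

theorem FinOrd.op1 (a b : FunMatrix n) : FinOrd g (op1 g a b) := ⟨1, b, op1_hasLead g a b⟩
theorem FinOrd.op2 (a b : FunMatrix n) : FinOrd g (op2 g a b) := ⟨2, 1, op2_hasLead g a b⟩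

/-- Division with remainder by a monic operator of order two. -/
theorem exists_div_op2 (R₁ R₀ : FunMatrix n) {X : OpMatrix n} (hX : FinOrd g X) :
    ∃ Y u v, FinOrd g Y ∧ X = op1 g u v + Y * op2 g R₁ R₀ := by
  obtain ⟨N, a, ha⟩ := hX
  induction N using Nat.strong_induction_on generalizing X a with
  | _ N ih =>
    match N, ha with
    | 0, ha => exact ⟨0, a, 0, ⟨0, 0, by simp [HasLead]⟩, by simpa [op1, HasLead] using ha⟩
    | 1, ha =>
      obtain ⟨b, Y, hY, rfl⟩ := ha
      simp only [HasLead] at hY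
      exact ⟨0, b, a, ⟨0, 0, by simp [HasLead]⟩, by simp [op1, hY, add_comm]⟩
    | N + 2, ha =>
      have hp : HasLead g N a (MM a * DD g ^ N) := by
        have h0 : ∀ k, HasLead g k (0 : FunMatrix n) 0 := by
          intro k; induction k with
          | zero => simp [HasLead]
          | succ k ih => exact ih.succ
        cases N with
        | zero => simp [HasLead]
        | succ N => exact ⟨0, 0, h0 N, by simp⟩
      have h1 := ha.sub (hp.mul_op2 R₁ R₀)
      rw [sub_self] at h1
      obtain ⟨b, hb⟩ := h1.exists_of_zero
      obtain ⟨Y, u, v, hY, e⟩ := ih (N + 1) (by omega) b hb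
      refine ⟨Y + MM a * DD g ^ N, u, v, hY.add ⟨N, a, hp⟩, ?_⟩
      rw [sub_eq_iff_eq_add] at e
      rw [e, add_mul, add_assoc]

/-- The only second-order term of the product is `b * d` times the square of `DD g`, so the quotient
has order zero. The divisor is left free because products are reduced modulo the wave side and
modulo the triangular side. -/
theorem op1_mul_op1 (g : RatFun) (a b c d : FunMatrix n) (R₁ R₀ : FunMatrix n) :
    op1 g a b * op1 g c d =
      op1 g (a * c + b * dm g c - b * d * R₀) (a * d + b * c + b * dm g d - b * d * R₁) +
        MM (b * d) * op2 g R₁ R₀ := by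
  have h : op1 g a b * op1 g c d = MM a * MM c + MM a * MM d * DD g + MM b * (DD g * MM c) +
      MM b * (DD g * MM d) * DD g := by
    simp only [op1]; noncomm_ring
  rw [h, DD_mul_MM, DD_mul_MM]
  simp only [op1, op2, map_add, map_sub, map_mul]
  noncomm_ring

theorem MM_mul_op1 (g : RatFun) (s a b : FunMatrix n) :
    MM s * op1 g a b = op1 g (s * a) (s * b) := by
  simp only [op1, map_mul]; noncomm_ring

theorem op1_mul_MM (g : RatFun) (s a b : FunMatrix n) :
    op1 g a b * MM s = op1 g (a * s + b * dm g s) (b * s) := by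
  have h : op1 g a b * MM s = MM a * MM s + MM b * (DD g * MM s) := by
    simp only [op1]; noncomm_ring
  rw [h, DD_mul_MM]
  simp only [op1, map_add, map_mul]
  noncomm_ring

end Matrices

end

/-! ### First-order intertwiners and the abstract equivalence diagram -/

section

section Hat

variable {n : ℕ} {g : RatFun}

theorem op2_mul_op1 (A₁ A₀ a b : FunMatrix n) : op2 g A₁ A₀ * op1 g a b =
    MM (dm g (dm g a) + A₁ * dm g a + A₀ * a) +
      MM (2 * dm g a + dm g (dm g b) + A₁ * a + A₁ * dm g b + A₀ * b) * DD g +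
      MM (a + 2 * dm g b + A₁ * b) * DD g ^ 2 + MM b * DD g ^ 3 := by
  have h : ∀ c : FunMatrix n, DD g ^ 2 * MM c =
      MM (dm g (dm g c)) + 2 * MM (dm g c) * DD g + MM c * DD g ^ 2 := by
    intro c
    rw [pow_two, mul_assoc, DD_mul_MM, mul_add, ← mul_assoc, DD_mul_MM, DD_mul_MM]
    noncomm_ring
  have e : op2 g A₁ A₀ * op1 g a b = DD g ^ 2 * MM a + DD g ^ 2 * MM b * DD g +
      MM A₁ * (DD g * MM a) + MM A₁ * (DD g * MM b) * DD g + MM A₀ * MM a +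
      MM A₀ * MM b * DD g := by
    simp only [op1, op2]; noncomm_ring
  rw [e, h, h, DD_mul_MM, DD_mul_MM]
  simp only [map_add, map_mul, map_ofNat]
  noncomm_ring

theorem op1_mul_op2 (R₁ R₀ s b : FunMatrix n) : op1 g s b * op2 g R₁ R₀ =
    MM (s * R₀ + b * dm g R₀) + MM (s * R₁ + b * dm g R₁ + b * R₀) * DD g +
      MM (s + b * R₁) * DD g ^ 2 + MM b * DD g ^ 3 := by
  have e : op1 g s b * op2 g R₁ R₀ = MM s * DD g ^ 2 + MM s * MM R₁ * DD g + MM s * MM R₀ +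
      MM b * DD g ^ 3 + MM b * (DD g * MM R₁) * DD g + MM b * (DD g * MM R₀) := by
    simp only [op1, op2]; noncomm_ring
  rw [e, DD_mul_MM, DD_mul_MM]
  simp only [map_add, map_mul]
  noncomm_ring

/-- First-order intertwiners between monic second order operators, in terms of coefficients. -/
theorem op2_intertwine {A₁ A₀ R₁ R₀ a b s : FunMatrix n}
    (hs : s = a + 2 * dm g b + A₁ * b - b * R₁)
    (h₁ : 2 * dm g a + dm g (dm g b) + A₁ * a + A₁ * dm g b + A₀ * b =
      s * R₁ + b * dm g R₁ + b * R₀)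
    (h₀ : dm g (dm g a) + A₁ * dm g a + A₀ * a = s * R₀ + b * dm g R₀) :
    op2 g A₁ A₀ * op1 g a b = op1 g s b * op2 g R₁ R₀ := by
  rw [op2_mul_op1, op1_mul_op2, h₁, h₀, hs]
  congr 3
  noncomm_ring

/-- The monic form `(g ∂)² - W` of the triangular system. -/
def tri (g : RatFun) (W : FunMatrix n) : OpMatrix n := op2 g 0 (-W)

/-- Coefficient data of an equivalence between `L ((g ∂)² + R₁ (g ∂) + R₀) S⁻¹` and
`U ((g ∂)² - W)`. -/
structure Hat (n : ℕ) where
  (a b q₀ q₁ R₁ R₀ W L Li S Si U Ui C Ci : FunMatrix n)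

namespace Hat

/-- The coefficient of order zero in the companion of `a + b (g ∂)`. -/
def s (g : RatFun) (H : Hat n) : FunMatrix n := H.a + 2 * dm g H.b - H.b * H.R₁

/-- The coefficient of order zero in the companion of `q₀ + q₁ (g ∂)`. -/
def t (g : RatFun) (H : Hat n) : FunMatrix n := H.q₀ + 2 * dm g H.q₁ + H.R₁ * H.q₁

/-- The operator on the left of the diagram. -/
def E (g : RatFun) (H : Hat n) : OpMatrix n := MM H.L * op2 g H.R₁ H.R₀ * MM H.Si

/-- The operator on the right of the diagram. -/
def E' (g : RatFun) (H : Hat n) : OpMatrix n := MM H.U * tri g H.W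

/-- The arrows of the diagram. -/
def arrows (g : RatFun) (H : Hat n) : Arrows n where
  k := op1 g H.a H.b * MM H.Si
  k' := MM H.U * op1 g (H.s g) H.b * MM H.Li
  kbar := MM H.S * op1 g H.q₀ H.q₁ * MM H.Ci
  kbar' := MM H.L * op1 g (H.t g) H.q₁ * MM (H.Ci * H.Ui)
  h := MM (-(H.S * (H.q₁ * H.Ci * H.b) * H.Li))
  htilde := MM (-(H.b * H.q₁ * H.Ci * H.Ui))

/-- The equations satisfied by the coefficients. -/
structure IsHat (g : RatFun) (H : Hat n) : Prop where
  L_mul : H.L * H.Li = 1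
  S_mul : H.S * H.Si = 1
  U_mul : H.U * H.Ui = 1
  C_mul : H.C * H.Ci = 1
  dC : dm g H.C = 0
  C_comm : H.C * H.W = H.W * H.C
  morph₁ : 2 * dm g H.a + dm g (dm g H.b) - H.W * H.b =
    H.s g * H.R₁ + H.b * dm g H.R₁ + H.b * H.R₀
  morph₀ : dm g (dm g H.a) - H.W * H.a = H.s g * H.R₀ + H.b * dm g H.R₀
  bar₁ : 2 * dm g H.q₀ + dm g (dm g H.q₁) + H.R₁ * H.q₀ + H.R₁ * dm g H.q₁ + H.R₀ * H.q₁ =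
    -(H.q₁ * H.W)
  bar₀ : dm g (dm g H.q₀) + H.R₁ * dm g H.q₀ + H.R₀ * H.q₀ =
    -(H.t g * H.W + H.q₁ * dm g H.W)
  comp₁ : H.a * H.q₁ + H.b * H.q₀ + H.b * dm g H.q₁ = 0
  comp₀ : H.a * H.q₀ + H.b * dm g H.q₀ + H.b * H.q₁ * H.W = H.C

variable {H : Hat n}

theorem IsHat.tri_mul (h : H.IsHat g) :
    tri g H.W * op1 g H.a H.b = op1 g (H.s g) H.b * op2 g H.R₁ H.R₀ := by
  refine op2_intertwine (by simp [s]) ?_ ?_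
  · rw [← h.morph₁]; noncomm_ring
  · rw [← h.morph₀]; noncomm_ring

theorem IsHat.mul_tri (h : H.IsHat g) :
    op2 g H.R₁ H.R₀ * op1 g H.q₀ H.q₁ = op1 g (H.t g) H.q₁ * tri g H.W := by
  refine op2_intertwine (by simp [t]) ?_ ?_
  · rw [h.bar₁, dm_zero]; noncomm_ring
  · rw [h.bar₀, dm_neg]; noncomm_ring

theorem IsHat.comp (h : H.IsHat g) :
    op1 g H.a H.b * op1 g H.q₀ H.q₁ = MM H.C + MM (H.b * H.q₁) * tri g H.W := by
  rw [tri, op1_mul_op1 g _ _ _ _ 0 (-H.W)]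
  congr 1
  have h0 : H.a * H.q₀ + H.b * dm g H.q₀ - H.b * H.q₁ * -H.W = H.C := by
    rw [← h.comp₀]; noncomm_ring
  have h1 : H.a * H.q₁ + H.b * H.q₀ + H.b * dm g H.q₁ - H.b * H.q₁ * 0 = 0 := by
    rw [mul_zero, sub_zero, h.comp₁]
  rw [h0, h1]; simp [op1]

theorem IsHat.dCi (h : H.IsHat g) : dm g H.Ci = 0 := by
  have e : dm g (H.Ci * H.C) = 0 := by rw [mul_eq_one_comm.1 h.C_mul, dm_one]
  rw [dm_mul, h.dC, mul_zero, add_zero] at e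
  have := congrArg (· * H.Ci) e
  simpa [mul_assoc, h.C_mul] using this

theorem IsHat.Ci_comm (h : H.IsHat g) : H.Ci * H.W = H.W * H.Ci := by
  calc H.Ci * H.W = H.Ci * (H.W * H.C) * H.Ci := by
        rw [mul_assoc, mul_assoc H.W, h.C_mul, mul_one]
    _ = H.Ci * H.C * H.W * H.Ci := by rw [← h.C_comm]; noncomm_ring
    _ = H.W * H.Ci := by rw [mul_eq_one_comm.1 h.C_mul, one_mul]

theorem tri_comm {W c : FunMatrix n} (hd : dm g c = 0) (hc : c * W = W * c) :
    tri g W * MM c = MM c * tri g W := by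
  have hD : DD g * MM c = MM c * DD g := by rw [DD_mul_MM, hd, map_zero, zero_add]
  have hD2 : DD g ^ 2 * MM c = MM c * DD g ^ 2 := by
    rw [pow_two, mul_assoc, hD, ← mul_assoc, hD, mul_assoc]
  simp only [tri, op2, map_zero, zero_mul, add_zero, add_mul, mul_add, hD2, ← map_mul]
  congr 2
  rw [neg_mul, mul_neg, hc]

theorem IsHat.tri_comm_C (h : H.IsHat g) : tri g H.W * MM H.C = MM H.C * tri g H.W :=
  tri_comm h.dC h.C_comm

theorem IsHat.tri_comm_Ci (h : H.IsHat g) : tri g H.W * MM H.Ci = MM H.Ci * tri g H.W :=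
  tri_comm h.dCi h.Ci_comm

theorem IsHat.comp_Ci (h : H.IsHat g) : op1 g H.a H.b * (op1 g H.q₀ H.q₁ * MM H.Ci) =
    1 + MM (H.b * H.q₁ * H.Ci) * tri g H.W := by
  rw [← mul_assoc, h.comp, add_mul, mul_assoc, h.tri_comm_Ci, ← map_mul, h.C_mul, map_one,
    ← mul_assoc, ← map_mul]

/-- Remainder of `(v₀ + v₁ (g ∂)) (a + b (g ∂))` modulo `(g ∂)² + R₁ (g ∂) + R₀`. -/
def remMap (g : RatFun) (a b R₁ R₀ : FunMatrix n) :
    (FunMatrix n × FunMatrix n) →ₗ[RatFun] (FunMatrix n × FunMatrix n) where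
  toFun v := (v.1 * a + v.2 * dm g a - v.2 * b * R₀,
    v.1 * b + v.2 * a + v.2 * dm g b - v.2 * b * R₁)
  map_add' v w := by
    ext1 <;> simp only [Prod.fst_add, Prod.snd_add, add_mul] <;> abel
  map_smul' c v := by
    ext1 <;> simp only [Prod.smul_fst, Prod.smul_snd, Matrix.smul_mul, RingHom.id_apply,
      smul_add, smul_sub]

theorem op1_mul_rem (g : RatFun) (a b R₁ R₀ : FunMatrix n) (v : FunMatrix n × FunMatrix n) :
    op1 g v.1 v.2 * op1 g a b = op1 g (remMap g a b R₁ R₀ v).1 (remMap g a b R₁ R₀ v).2 +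
      MM (v.2 * b) * op2 g R₁ R₀ := op1_mul_op1 g v.1 v.2 a b R₁ R₀

/-- A one-sided inverse is two-sided for reasons of dimension. Right multiplication by P = a + bD
and by QC⁻¹ induces ℂ(r)-linear maps `Φ` and `Ψ` between the spaces of remainders modulo the two
monic operators, both modelled on pairs of n × n matrices. The relation `comp_Ci` says ΨΦ = 1, so ΦΨ
= 1, and its value at the operator 1 is the claim. -/
theorem IsHat.left_inv (hg : g ≠ 0) (h : H.IsHat g) :
    op1 g H.q₀ H.q₁ * MM H.Ci * op1 g H.a H.b =
      1 + MM (H.q₁ * H.Ci * H.b) * op2 g H.R₁ H.R₀ := by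
  set c₀ := H.q₀ * H.Ci
  set c₁ := H.q₁ * H.Ci
  have hc : op1 g H.q₀ H.q₁ * MM H.Ci = op1 g c₀ c₁ := by
    rw [op1_mul_MM, h.dCi, mul_zero, add_zero]
  set Φ := remMap g H.a H.b H.R₁ H.R₀
  set Ψ := remMap g c₀ c₁ 0 (-H.W)
  have hΨΦ : Ψ * Φ = 1 := by
    refine LinearMap.ext fun v => ?_
    have e1 := op1_mul_rem g H.a H.b H.R₁ H.R₀ v
    have e2 := op1_mul_rem g c₀ c₁ 0 (-H.W) (Φ v)
    have e3 : op1 g v.1 v.2 * op1 g H.a H.b * op1 g c₀ c₁ =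
        op1 g v.1 v.2 + op1 g v.1 v.2 * MM (H.b * H.q₁ * H.Ci) * tri g H.W := by
      rw [mul_assoc, ← hc, h.comp_Ci, mul_add, mul_one, ← mul_assoc]
    have e4 : op2 g H.R₁ H.R₀ * op1 g c₀ c₁ = op1 g (H.t g) H.q₁ * MM H.Ci * tri g H.W := by
      rw [← hc, ← mul_assoc, h.mul_tri, mul_assoc, h.tri_comm_Ci, mul_assoc]
    -- Reducing (v₀ + v₁D)PQC⁻¹ modulo D² - W in two ways leaves a multiple of this monic operator
    -- equal to an operator of order one. Both therefore vanish, and the two remainders agree.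
    have e5 : (MM ((Φ v).2 * c₁) + MM (v.2 * H.b) * (op1 g (H.t g) H.q₁ * MM H.Ci) -
        op1 g v.1 v.2 * MM (H.b * H.q₁ * H.Ci)) * tri g H.W =
        op1 g (v.1 - (Ψ (Φ v)).1) (v.2 - (Ψ (Φ v)).2) := by
      rw [← op1_sub, sub_mul, add_mul, sub_eq_sub_iff_add_eq_add, mul_assoc (MM (v.2 * H.b)), ← e4]
      rw [e1, add_mul, e2] at e3
      rw [← e3, tri]
      noncomm_ring
    have hfin : FinOrd g (MM ((Φ v).2 * c₁) + MM (v.2 * H.b) * (op1 g (H.t g) H.q₁ * MM H.Ci) -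
        op1 g v.1 v.2 * MM (H.b * H.q₁ * H.Ci)) := by
      refine (FinOrd.add (FinOrd.mM _) ?_).sub ((FinOrd.op1 _ _).mul_MM _)
      rw [← mul_assoc]
      exact ((FinOrd.mM _).mul_op1 _ _).mul_MM _
    have e6 := eq_zero_of_mul_op2_eq_op1 hg hfin e5
    rw [e6, zero_mul] at e5
    obtain ⟨e7, e8⟩ := op1_eq_zero hg e5.symm
    exact Prod.ext (sub_eq_zero.1 e7).symm (sub_eq_zero.1 e8).symm
  -- Here finite dimension over ℂ(r) is used: a left inverse of an endomorphism is a right inverse.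
  have hΦΨ : Φ * Ψ = 1 := mul_eq_one_comm.1 hΨΦ
  have hone := op1_mul_rem g c₀ c₁ 0 (-H.W) (1, 0)
  have hid : op1 g (1 : FunMatrix n) 0 = 1 := by simp [op1]
  have hΨ1 : Ψ (1, 0) = (c₀, c₁) := by
    refine Prod.ext ?_ ?_ <;> simp [Ψ, remMap]
  have h2 := op1_mul_rem g H.a H.b H.R₁ H.R₀ (c₀, c₁)
  have h3 : Φ (c₀, c₁) = (1, 0) := by rw [← hΨ1]; exact LinearMap.congr_fun hΦΨ (1, 0)
  rw [hc, h2, show remMap g H.a H.b H.R₁ H.R₀ (c₀, c₁) = (1, 0) from h3, hid]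

theorem MM_mul_eq_one {a b : FunMatrix n} (h : a * b = 1) : MM a * MM b = 1 := by
  rw [← map_mul, h, map_one]

/-- The coefficient equations give an equivalence diagram. -/
theorem IsHat.isEquivalence (hg : g ≠ 0) (h : H.IsHat g) :
    IsEquivalence (H.E g) (H.E' g) (H.arrows g) := by
  have hL := MM_mul_eq_one h.L_mul
  have hL' := MM_mul_eq_one (mul_eq_one_comm.1 h.L_mul)
  have hS' := MM_mul_eq_one (mul_eq_one_comm.1 h.S_mul)
  have hS := MM_mul_eq_one h.S_mul
  have hU' := MM_mul_eq_one (mul_eq_one_comm.1 h.U_mul)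
  have hU := MM_mul_eq_one h.U_mul
  -- The relations between the companions P', Q' need no further coefficient equations: after right
  -- multiplication by the monic operator they follow from those between P and Q, and the factor can
  -- be cancelled.
  have hPQ : op1 g (H.s g) H.b * op1 g (H.t g) H.q₁ = MM H.C + tri g H.W * MM (H.b * H.q₁) := by
    rw [← sub_eq_zero]
    refine mul_op2_cancel hg (R₁ := 0) (R₀ := -H.W) ?_ ?_
    · refine ((FinOrd.op1 _ _).mul_op1 _ _).sub ((FinOrd.mM _).add ?_)
      exact (FinOrd.op2 _ _).mul_MM _
    · change (_ - _) * tri g H.W = 0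
      rw [sub_mul, mul_assoc, ← h.mul_tri, ← mul_assoc, ← h.tri_mul, mul_assoc, h.comp, mul_add,
        add_mul, h.tri_comm_C, mul_assoc, sub_self]
  have hQP : op1 g (H.t g) H.q₁ * MM H.Ci * op1 g (H.s g) H.b =
      1 + op2 g H.R₁ H.R₀ * MM (H.q₁ * H.Ci * H.b) := by
    rw [← sub_eq_zero]
    refine mul_op2_cancel hg (R₁ := H.R₁) (R₀ := H.R₀) ?_ ?_
    · refine (((FinOrd.op1 _ _).mul_MM _).mul_op1 _ _).sub (FinOrd.add ?_ ?_)
      · rw [← map_one MM]; exact FinOrd.mM _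
      · exact (FinOrd.op2 _ _).mul_MM _
    · have e : op1 g (H.t g) H.q₁ * MM H.Ci * op1 g (H.s g) H.b * op2 g H.R₁ H.R₀ =
          op2 g H.R₁ H.R₀ * (op1 g H.q₀ H.q₁ * MM H.Ci * op1 g H.a H.b) := by
        rw [mul_assoc, ← h.tri_mul, mul_assoc, ← mul_assoc (MM H.Ci), ← h.tri_comm_Ci,
          ← mul_assoc, ← mul_assoc, ← h.mul_tri]
        noncomm_ring
      rw [sub_mul, e, h.left_inv hg]
      noncomm_ring
  have e2 : MM (H.b * H.q₁ * H.Ci * H.Ui) * (MM H.U * tri g H.W) =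
      MM (H.b * H.q₁ * H.Ci) * tri g H.W := by
    rw [map_mul, mul_assoc, ← mul_assoc (MM H.Ui), hU', one_mul]
  constructor
  · simp only [E, E', arrows]
    calc MM H.U * tri g H.W * (op1 g H.a H.b * MM H.Si)
        = MM H.U * (tri g H.W * op1 g H.a H.b) * MM H.Si := by noncomm_ring
      _ = MM H.U * op1 g (H.s g) H.b * (1 * op2 g H.R₁ H.R₀) * MM H.Si := by
        rw [h.tri_mul]; noncomm_ring
      _ = _ := by rw [← hL']; noncomm_ring
  · simp only [E, E', arrows]
    calc MM H.L * op2 g H.R₁ H.R₀ * MM H.Si * (MM H.S * op1 g H.q₀ H.q₁ * MM H.Ci)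
        = MM H.L * op2 g H.R₁ H.R₀ * (MM H.Si * MM H.S) * op1 g H.q₀ H.q₁ * MM H.Ci := by
          noncomm_ring
      _ = MM H.L * (op2 g H.R₁ H.R₀ * op1 g H.q₀ H.q₁) * MM H.Ci := by
          rw [hS']; noncomm_ring
      _ = MM H.L * op1 g (H.t g) H.q₁ * (tri g H.W * MM H.Ci) := by
          rw [h.mul_tri]; noncomm_ring
      _ = MM H.L * op1 g (H.t g) H.q₁ * MM H.Ci * (1 * tri g H.W) := by
          rw [h.tri_comm_Ci]; noncomm_ring
      _ = _ := by rw [← hU', map_mul]; noncomm_ring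
  · simp only [E, arrows]
    calc MM H.S * op1 g H.q₀ H.q₁ * MM H.Ci * (op1 g H.a H.b * MM H.Si)
        = MM H.S * (op1 g H.q₀ H.q₁ * MM H.Ci * op1 g H.a H.b) * MM H.Si := by noncomm_ring
      _ = MM H.S * MM H.Si +
          MM H.S * MM (H.q₁ * H.Ci * H.b) * (1 * op2 g H.R₁ H.R₀) * MM H.Si := by
          rw [h.left_inv hg]; noncomm_ring
      _ = _ := by rw [hS, ← hL', map_neg]; simp only [map_mul]; noncomm_ring
  · simp only [E, arrows]
    calc MM H.L * op1 g (H.t g) H.q₁ * MM (H.Ci * H.Ui) * (MM H.U * op1 g (H.s g) H.b * MM H.Li)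
        = MM H.L * op1 g (H.t g) H.q₁ * MM H.Ci * (MM H.Ui * MM H.U) * op1 g (H.s g) H.b *
            MM H.Li := by rw [map_mul]; noncomm_ring
      _ = MM H.L * (op1 g (H.t g) H.q₁ * MM H.Ci * op1 g (H.s g) H.b) * MM H.Li := by
          rw [hU']; noncomm_ring
      _ = MM H.L * MM H.Li + MM H.L * op2 g H.R₁ H.R₀ * (1 * MM (H.q₁ * H.Ci * H.b)) * MM H.Li := by
          rw [hQP]; noncomm_ring
      _ = _ := by rw [hL, ← hS', map_neg]; simp only [map_mul]; noncomm_ring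
  · simp only [E', arrows]
    rw [map_neg, neg_mul, e2, sub_neg_eq_add, ← h.comp_Ci]
    calc op1 g H.a H.b * MM H.Si * (MM H.S * op1 g H.q₀ H.q₁ * MM H.Ci)
        = op1 g H.a H.b * (MM H.Si * MM H.S) * (op1 g H.q₀ H.q₁ * MM H.Ci) := by noncomm_ring
      _ = _ := by rw [hS']; noncomm_ring
  · simp only [E', arrows]
    calc MM H.U * op1 g (H.s g) H.b * MM H.Li * (MM H.L * op1 g (H.t g) H.q₁ * MM (H.Ci * H.Ui))
        = MM H.U * op1 g (H.s g) H.b * (MM H.Li * MM H.L) * op1 g (H.t g) H.q₁ *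
            MM (H.Ci * H.Ui) := by noncomm_ring
      _ = MM H.U * (op1 g (H.s g) H.b * op1 g (H.t g) H.q₁) * MM (H.Ci * H.Ui) := by
          rw [hL']; noncomm_ring
      _ = MM H.U * (MM H.C * MM H.Ci) * MM H.Ui +
          MM H.U * tri g H.W * MM (H.b * H.q₁ * H.Ci * H.Ui) := by
          rw [hPQ]; simp only [map_mul]; noncomm_ring
      _ = _ := by
          rw [← map_mul MM H.C, h.C_mul, map_one, mul_one, hU, map_neg]; noncomm_ring

end Hat

end Hat

end

section

/-! ### Computing with polynomials in the parameters and `1/r` -/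

/-- A term `c x^i u^j B^k w^l y^n`. -/
structure Term where
  (c : ℤ) (i j k l n : ℕ)

/-- Polynomials in `x, u, B, w, y` with integer coefficients, as lists of terms. -/
structure RadPoly where
  terms : List Term

namespace Term

/-- The lexicographic order of the monomials. -/
def lt (s t : Term) : Bool :=
  bif Nat.beq s.i t.i then bif Nat.beq s.j t.j then bif Nat.beq s.k t.k then
    bif Nat.beq s.l t.l then Nat.blt s.n t.n else Nat.blt s.l t.l
    else Nat.blt s.k t.k else Nat.blt s.j t.j else Nat.blt s.i t.i

/-- Equality of the underlying monomials. -/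
def sameMon (s t : Term) : Bool :=
  Nat.beq s.i t.i && (Nat.beq s.j t.j && (Nat.beq s.k t.k && (Nat.beq s.l t.l && Nat.beq s.n t.n)))

/-- The product of two terms. -/
def mul (s t : Term) : Term :=
  ⟨s.c * t.c, s.i + t.i, s.j + t.j, s.k + t.k, s.l + t.l, s.n + t.n⟩

/-- The value of a term. -/
def ev {K : Type*} [CommRing K] (v : Fin 5 → K) (t : Term) : K :=
  t.c * (v 0 ^ t.i * v 1 ^ t.j * v 2 ^ t.k * v 3 ^ t.l * v 4 ^ t.n)

theorem ev_mul {K : Type*} [CommRing K] (v : Fin 5 → K) (s t : Term) :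
    (s.mul t).ev v = s.ev v * t.ev v := by
  simp only [ev, mul, Int.cast_mul]; ring

end Term

/-- Insertion of a term in the sum of two lists. -/
def addAux (s : Term) (F : List Term → List Term) : List Term → List Term
  | [] => s :: F []
  | t :: q => bif s.sameMon t then bif s.c + t.c == 0 then F q else { s with c := s.c + t.c } :: F q
      else bif s.lt t then s :: F (t :: q) else t :: addAux s F q

/-- Merging two lists of terms. -/
def addList : List Term → List Term → List Term
  | [] => fun q => q
  | s :: p => addAux s (addList p)

/-- The product of two lists of terms. -/
def mulList : List Term → List Term → List Term
  | [] => fun _ => []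
  | s :: p => fun q => addList (q.map s.mul) (mulList p q)

namespace RadPoly

instance : Add RadPoly := ⟨fun p q => ⟨addList p.terms q.terms⟩⟩
instance : Mul RadPoly := ⟨fun p q => ⟨mulList p.terms q.terms⟩⟩
instance : Neg RadPoly := ⟨fun p => ⟨p.terms.map fun t => { t with c := -t.c }⟩⟩
instance : Sub RadPoly := ⟨fun p q => p + -q⟩
instance : Zero RadPoly := ⟨⟨[]⟩⟩
instance : One RadPoly := ⟨⟨[⟨1, 0, 0, 0, 0, 0⟩]⟩⟩
instance (n : ℕ) [n.AtLeastTwo] : OfNat RadPoly n := ⟨⟨[⟨n, 0, 0, 0, 0, 0⟩]⟩⟩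

/-- Powers. -/
def pow (p : RadPoly) : ℕ → RadPoly
  | 0 => 1
  | n + 1 => pow p n * p

instance : Pow RadPoly ℕ := ⟨pow⟩

/-- The variables: `x = 1/r`, `u = M/6`, `B`, `w = iω`, `y = 1/(B - 2 + 36 u x)`. -/
def x : RadPoly := ⟨[⟨1, 1, 0, 0, 0, 0⟩]⟩
def u : RadPoly := ⟨[⟨1, 0, 1, 0, 0, 0⟩]⟩
def B : RadPoly := ⟨[⟨1, 0, 0, 1, 0, 0⟩]⟩
def w : RadPoly := ⟨[⟨1, 0, 0, 0, 1, 0⟩]⟩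
def y : RadPoly := ⟨[⟨1, 0, 0, 0, 0, 1⟩]⟩

/-- The derivative for `x' = -x²(1 - 12 u x)` and `y' = 36 u x² (1 - 12 u x) y²`. -/
def deriv (p : RadPoly) : RadPoly :=
  ⟨p.terms.foldr (fun t q =>
    addList (bif t.i == 0 then [] else [⟨-(t.c * t.i), t.i + 1, t.j, t.k, t.l, t.n⟩,
      ⟨12 * (t.c * t.i), t.i + 2, t.j + 1, t.k, t.l, t.n⟩])
    (addList (bif t.n == 0 then [] else [⟨36 * (t.c * t.n), t.i + 2, t.j + 1, t.k, t.l, t.n + 1⟩,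
      ⟨-432 * (t.c * t.n), t.i + 3, t.j + 2, t.k, t.l, t.n + 1⟩]) q)) []⟩

/-- The substitution `w ↦ -w`. -/
def negw (p : RadPoly) : RadPoly :=
  ⟨p.terms.map fun t => { t with c := bif t.l % 2 == 0 then t.c else -t.c }⟩

/-- Multiplication by `z^N` and substitution of `1/z` for `y`. -/
def clearY (z : RadPoly) (N : ℕ) (p : RadPoly) : RadPoly :=
  ⟨p.terms.foldr (fun t q => addList (mulList [{ t with n := 0 }] (z ^ (N - t.n)).terms) q) []⟩

/-- All the coefficients vanish. -/
def isZero (p : RadPoly) : Bool := p.terms.all fun t => t.c == 0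

/-- The exponents of `y` are at most `N`. -/
def degY (N : ℕ) (p : RadPoly) : Bool := p.terms.all fun t => t.c == 0 || Nat.ble t.n N

/-- The terms without `x`. -/
def at0 (p : RadPoly) : RadPoly := ⟨p.terms.filter fun t => t.i == 0⟩

/-- All terms are divisible by `x^k`. -/
def isOrd (k : ℕ) (p : RadPoly) : Bool := p.terms.all fun t => t.c == 0 || Nat.ble k t.i

/-- The sum of a list of polynomials. -/
def sum {n : ℕ} (F : Fin n → RadPoly) : RadPoly := ((List.finRange n).map F).foldr (· + ·) 0

section Eval

variable {K : Type*} [CommRing K] (v : Fin 5 → K)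

/-- The value of a list of terms. -/
def evList (l : List Term) : K := (l.map (Term.ev v)).sum

theorem evList_nil : evList v [] = 0 := rfl

theorem evList_cons (t : Term) (l : List Term) : evList v (t :: l) = t.ev v + evList v l := by
  simp [evList]

/-- The value of a polynomial. -/
def ev (p : RadPoly) : K := evList v p.terms

/-- Correctness does not require sorted lists. The order of monomials only serves to bring equal
monomials together, so that cancellation happens and lists stay short. -/
theorem evList_addList : ∀ p q : List Term, evList v (addList p q) = evList v p + evList v q := by
  intro p
  induction p with
  | nil => intro q; simp [addList, evList_nil]
  | cons s p ih =>
    intro q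
    simp only [addList]
    induction q with
    | nil => simp [addAux, evList_cons, ih, add_assoc]
    | cons t q ihq =>
      simp only [addAux]
      by_cases h : s.sameMon t
      · simp only [h, cond_true, evList_cons]
        have e : Term.ev v { s with c := s.c + t.c } = s.ev v + t.ev v := by
          simp only [Term.sameMon, Bool.and_eq_true, Nat.beq_eq] at h
          obtain ⟨h1, h2, h3, h4, h5⟩ := h
          simp only [Term.ev, h1, h2, h3, h4, h5, Int.cast_add]; ring
        by_cases h0 : s.c + t.c = 0
        · have h1 : s.ev v + t.ev v = 0 := by rw [← e]; simp [Term.ev, h0]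
          simp only [h0, beq_self_eq_true, cond_true, ih]
          linear_combination -h1
        · simp only [beq_false_of_ne h0, cond_false, evList_cons, ih]
          rw [e]; ring
      · rw [Bool.not_eq_true] at h
        simp only [h, cond_false]
        cases s.lt t
        · simp only [cond_false, evList_cons, ihq]; ring
        · simp only [cond_true, evList_cons, ih]; ring

theorem evList_mulList (p q : List Term) : evList v (mulList p q) = evList v p * evList v q := by
  induction p with
  | nil => simp [mulList, evList_nil]
  | cons s p ih =>
    have e : evList v (q.map s.mul) = s.ev v * evList v q := by
      clear ih
      induction q with
      | nil => simp [evList_nil]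
      | cons t q ih => rw [List.map_cons, evList_cons, evList_cons, ih, Term.ev_mul]; ring
    simp only [mulList, evList_addList, evList_cons, ih, e]; ring

@[simp] theorem ev_add (p q : RadPoly) : ev v (p + q) = ev v p + ev v q := evList_addList v _ _
@[simp] theorem ev_mul (p q : RadPoly) : ev v (p * q) = ev v p * ev v q := evList_mulList v _ _
@[simp] theorem ev_neg (p : RadPoly) : ev v (-p) = -ev v p := by
  change evList v (p.terms.map _) = -evList v p.terms
  induction p.terms with
  | nil => simp [evList_nil]
  | cons t q ih =>
    rw [List.map_cons, evList_cons, evList_cons, ih]; simp only [Term.ev, Int.cast_neg]; ring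
@[simp] theorem ev_sub (p q : RadPoly) : ev v (p - q) = ev v p - ev v q := by
  change ev v (p + -q) = _
  rw [ev_add, ev_neg, sub_eq_add_neg]
@[simp] theorem ev_zero : ev v 0 = 0 := rfl
@[simp] theorem ev_one : ev v 1 = 1 := by
  change evList v [_] = 1; simp [evList, Term.ev]
@[simp] theorem ev_ofNat (n : ℕ) [n.AtLeastTwo] : ev v (ofNat(n) : RadPoly) = ofNat(n) := by
  change evList v [_] = _
  simp [evList, Term.ev]; rfl
@[simp] theorem ev_pow (p : RadPoly) (n : ℕ) : ev v (p ^ n) = ev v p ^ n := by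
  change ev v (pow p n) = _
  induction n with
  | zero => simp [pow]
  | succ n ih => rw [pow, ev_mul, ih, pow_succ]
@[simp] theorem ev_x : ev v x = v 0 := by simp [ev, x, evList, Term.ev]
@[simp] theorem ev_u : ev v u = v 1 := by simp [ev, u, evList, Term.ev]
@[simp] theorem ev_B : ev v B = v 2 := by simp [ev, B, evList, Term.ev]
@[simp] theorem ev_w : ev v w = v 3 := by simp [ev, w, evList, Term.ev]
@[simp] theorem ev_y : ev v y = v 4 := by simp [ev, y, evList, Term.ev]

theorem ev_sum {n : ℕ} (F : Fin n → RadPoly) : ev v (sum F) = ∑ i, ev v (F i) := by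
  rw [← List.sum_ofFn, List.ofFn_eq_map]
  unfold sum
  induction List.finRange n with
  | nil => simp
  | cons a l ih => simpa using ih

theorem ev_eq_zero {p : RadPoly} (h : p.isZero = true) : ev v p = 0 := by
  unfold isZero at h
  unfold ev
  revert h
  induction p.terms with
  | nil => intro _; rfl
  | cons t l ih =>
    intro h
    simp only [List.all_cons, Bool.and_eq_true, beq_iff_eq] at h
    rw [evList_cons, ih h.2]; simp [Term.ev, h.1]

theorem ev_at0 (h : v 0 = 0) (p : RadPoly) : ev v p.at0 = ev v p := by
  unfold at0 ev
  induction p.terms with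
  | nil => rfl
  | cons t l ih =>
    rw [List.filter_cons, evList_cons]
    split
    · rw [evList_cons, ih]
    · next h' =>
      rw [ih]
      simp only [beq_iff_eq] at h'
      simp [Term.ev, h, zero_pow h']

theorem ev_negw (p : RadPoly) : ev v p.negw = ev ![v 0, v 1, v 2, -v 3, v 4] p := by
  unfold negw ev
  induction p.terms with
  | nil => rfl
  | cons t l ih =>
    rw [List.map_cons, evList_cons, evList_cons, ih]
    congr 1
    simp only [Term.ev, Matrix.cons_val]
    rcases Nat.even_or_odd t.l with h | h
    · have h1 := Nat.even_iff.1 h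
      simp [h1, h.neg_pow]
    · have h1 := Nat.odd_iff.1 h
      simp [h1, h.neg_pow]

/-- From zy = 1 one gets z^N y^n = z^(N-n) for n ≤ N. The alternative N = 0 covers the systems
without y, for which z is not required to be invertible. -/
theorem ev_clearY {z : RadPoly} {N : ℕ} {p : RadPoly} (hz : N = 0 ∨ ev v z * v 4 = 1) (hN : p.degY N = true) :
    ev v (clearY z N p) = ev v z ^ N * ev v p := by
  unfold degY at hN
  unfold clearY
  change evList v (List.foldr _ _ _) = _ * evList v p.terms
  revert hN
  induction p.terms with
  | nil => intro _; simp [evList_nil]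
  | cons t l ih =>
    intro hN
    simp only [List.all_cons, Bool.and_eq_true, Bool.or_eq_true, beq_iff_eq, Nat.ble_eq] at hN
    rw [List.foldr_cons, evList_addList, ih hN.2, evList_mulList, evList_cons, evList_cons,
      evList_nil]
    have e1 : evList v (z ^ (N - t.n)).terms = ev v z ^ (N - t.n) := ev_pow v z _
    have e2 : Term.ev v t = Term.ev v { t with n := 0 } * v 4 ^ t.n := by simp [Term.ev]; ring
    rcases hN.1 with h0 | hN
    · simp [Term.ev, h0]
    have e3 : ev v z ^ N * v 4 ^ t.n = ev v z ^ (N - t.n) := by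
      rcases hz with rfl | hz
      · simp [Nat.le_zero.1 hN]
      obtain ⟨k, rfl⟩ := Nat.exists_eq_add_of_le hN
      rw [Nat.add_sub_cancel_left, pow_add, mul_comm (ev v z ^ t.n), mul_assoc, ← mul_pow, hz,
        one_pow, mul_one]
    rw [e1, e2, mul_add, ← e3]; ring

/-- The polynomial vanishes when `y` is the inverse of `z`. -/
def isZeroY (z : RadPoly) (N : ℕ) (p : RadPoly) : Bool :=
  p.isZero || (p.degY N && (clearY z N p).isZero)

/-- After the powers of y are cleared, vanishing is a question about honest polynomials; the factor
z^N introduced in this way is invertible at the values considered. -/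
theorem ev_eq_zero_of_isZeroY {z : RadPoly} {N : ℕ} {p : RadPoly} (hz : N = 0 ∨ ev v z * v 4 = 1)
    (h : isZeroY z N p = true) : ev v p = 0 := by
  rw [isZeroY, Bool.or_eq_true, Bool.and_eq_true] at h
  rcases h with h | h
  · exact ev_eq_zero v h
  have h1 := ev_clearY v hz h.1
  rw [ev_eq_zero v h.2] at h1
  rcases hz with rfl | hz
  · simpa using h1.symm
  have h2 : (ev v z * v 4) ^ N * ev v p = 0 := by rw [mul_pow, mul_right_comm, ← h1, zero_mul]
  simpa [hz] using h2

/-- A derivation is determined by its values on the five variables. The prescribed value on y is the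
one forced by y being inverse to B - 2 + 36ux, and the derivation meant is f∂_r. -/
theorem ev_deriv {d : K → K} (hadd : ∀ a b, d (a + b) = d a + d b)
    (hmul : ∀ a b, d (a * b) = a * d b + b * d a)
    (h0 : d (v 0) = -v 0 ^ 2 * (1 - 12 * v 1 * v 0)) (h1 : d (v 1) = 0) (h2 : d (v 2) = 0)
    (h3 : d (v 3) = 0) (h4 : d (v 4) = 36 * v 1 * v 0 ^ 2 * (1 - 12 * v 1 * v 0) * v 4 ^ 2)
    (p : RadPoly) : ev v p.deriv = d (ev v p) := by
  have hone : d 1 = 0 := by simpa using hmul 1 1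
  have hz : d 0 = 0 := by simpa using hadd 0 0
  have hpow : ∀ (a : K) (n : ℕ), a * d (a ^ n) = n * a ^ n * d a := by
    intro a n
    induction n with
    | zero => simp [hone]
    | succ n ih => rw [pow_succ, hmul, mul_add, mul_left_comm a a, ih]; push_cast; ring
  have hpow0 : ∀ (a : K) (n : ℕ), d a = 0 → d (a ^ n) = 0 := by
    intro a n ha
    induction n with
    | zero => simpa using hone
    | succ n ih => rw [pow_succ, hmul, ih, ha]; ring
  have hi : ∀ n : ℕ, d (v 0 ^ n) = -(n * v 0 ^ (n + 1)) * (1 - 12 * v 1 * v 0) := by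
    intro n
    induction n with
    | zero => simp [hone]
    | succ n ih => rw [pow_succ, hmul, ih, h0]; push_cast; ring
  have hn : ∀ n : ℕ, d (v 4 ^ n) =
      n * v 4 ^ (n + 1) * (36 * v 1 * v 0 ^ 2 * (1 - 12 * v 1 * v 0)) := by
    intro n
    induction n with
    | zero => simp [hone]
    | succ n ih => rw [pow_succ, hmul, ih, h4]; push_cast; ring
  have hnat : ∀ n : ℕ, d (n : K) = 0 := by
    intro n
    induction n with
    | zero => simpa using hz
    | succ n ih => rw [Nat.cast_succ, hadd, ih, hone, add_zero]
  have hneg : ∀ a, d (-a) = -d a := fun a => by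
    rw [eq_neg_iff_add_eq_zero, ← hadd, neg_add_cancel, hz]
  have hint : ∀ n : ℤ, d (n : K) = 0 := by
    intro n
    obtain ⟨m, rfl | rfl⟩ := n.eq_nat_or_neg
    · simpa using hnat m
    · rw [Int.cast_neg, hneg, Int.cast_natCast, hnat, neg_zero]
  unfold deriv ev
  change evList v (List.foldr _ _ _) = d (evList v p.terms)
  induction p.terms with
  | nil => simpa [evList_nil] using hz.symm
  | cons t l ih =>
    rw [List.foldr_cons, evList_addList, evList_addList, ih, evList_cons v t l, hadd, ← add_assoc]
    congr 1
    have e1 : evList v (bif t.i == 0 then [] else [⟨-(t.c * t.i), t.i + 1, t.j, t.k, t.l, t.n⟩,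
        ⟨12 * (t.c * t.i), t.i + 2, t.j + 1, t.k, t.l, t.n⟩]) =
        evList v [⟨-(t.c * t.i), t.i + 1, t.j, t.k, t.l, t.n⟩,
        ⟨12 * (t.c * t.i), t.i + 2, t.j + 1, t.k, t.l, t.n⟩] := by
      by_cases h : t.i = 0
      · simp [h, evList, Term.ev]
      · simp [beq_false_of_ne h]
    have e2 : evList v (bif t.n == 0 then [] else
        [⟨36 * (t.c * t.n), t.i + 2, t.j + 1, t.k, t.l, t.n + 1⟩,
        ⟨-432 * (t.c * t.n), t.i + 3, t.j + 2, t.k, t.l, t.n + 1⟩]) =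
        evList v [⟨36 * (t.c * t.n), t.i + 2, t.j + 1, t.k, t.l, t.n + 1⟩,
        ⟨-432 * (t.c * t.n), t.i + 3, t.j + 2, t.k, t.l, t.n + 1⟩] := by
      by_cases h : t.n = 0
      · simp [h, evList, Term.ev]
      · simp [beq_false_of_ne h]
    rw [e1, e2]
    simp only [evList_cons, evList_nil, Term.ev, hmul, hi, hn, hint, hpow0 _ _ h1, hpow0 _ _ h2,
      hpow0 _ _ h3]
    push_cast
    ring

end Eval

end RadPoly

end

section

/-! ### Leading terms of rational functions at the points of the Riemann sphere -/

/-- A point of the Riemann sphere: its local ring, a uniformizer `t` and the multiple `e ∂_r` of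
the derivation for which `t` is an eigenfunction. -/
structure Place where
  O : Subring RatFun
  t : RatFun
  e : RatFun
  con_mem : ∀ c, con c ∈ O
  t_mem : t ∈ O
  t_ne_zero : t ≠ 0
  inv_notMem : t⁻¹ ∉ O
  e_t : e * der t = t
  e_mem : ∀ z ∈ O, e * der z ∈ O
  residue : ∀ z ∈ O, ∃ c, ∃ o ∈ O, z = con c + t * o
  scale : ∀ z, z ≠ 0 → ∃ n : ℤ, t ^ n * z ∈ O ∧ (t ^ n * z)⁻¹ ∈ O

namespace Place

variable (P : Place)

/-- `z = c t^n + O(t^(n+1))` -/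
def Lead (n : ℤ) (c : ℂ) (z : RatFun) : Prop := ∃ o ∈ P.O, z = P.t ^ n * (con c + P.t * o)

variable {P} {n m : ℤ} {c d : ℂ} {z z' : RatFun}

theorem Lead.mul (h : P.Lead n c z) (h' : P.Lead m d z') : P.Lead (n + m) (c * d) (z * z') := by
  obtain ⟨o, ho, rfl⟩ := h
  obtain ⟨o', ho', rfl⟩ := h'
  refine ⟨con c * o' + o * con d + P.t * o * o', ?_, ?_⟩
  · exact P.O.add_mem (P.O.add_mem (P.O.mul_mem (P.con_mem c) ho') (P.O.mul_mem ho (P.con_mem d)))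
      (P.O.mul_mem (P.O.mul_mem P.t_mem ho) ho')
  · rw [zpow_add₀ P.t_ne_zero, con_mul]; ring

theorem Lead.add (h : P.Lead n c z) (h' : P.Lead n d z') : P.Lead n (c + d) (z + z') := by
  obtain ⟨o, ho, rfl⟩ := h
  obtain ⟨o', ho', rfl⟩ := h'
  exact ⟨o + o', P.O.add_mem ho ho', by rw [con_add]; ring⟩

theorem Lead.neg (h : P.Lead n c z) : P.Lead n (-c) (-z) := by
  obtain ⟨o, ho, rfl⟩ := h
  exact ⟨-o, P.O.neg_mem ho, by rw [con_neg]; ring⟩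

theorem Lead.sub (h : P.Lead n c z) (h' : P.Lead n d z') : P.Lead n (c - d) (z - z') := by
  rw [sub_eq_add_neg, sub_eq_add_neg]; exact h.add h'.neg

theorem lead_zero (P : Place) (n : ℤ) : P.Lead n 0 0 := ⟨0, P.O.zero_mem, by simp⟩

theorem lead_con (P : Place) (c : ℂ) : P.Lead 0 c (con c) := ⟨0, P.O.zero_mem, by simp⟩

theorem lead_one (P : Place) : P.Lead 0 1 1 := by simpa using P.lead_con 1

theorem lead_t (P : Place) : P.Lead 1 1 P.t := ⟨0, P.O.zero_mem, by simp⟩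

theorem Lead.con_mul (a : ℂ) (h : P.Lead n c z) : P.Lead n (a * c) (con a * z) := by
  simpa using (P.lead_con a).mul h

theorem Lead.of_lt (h : P.Lead n c z) (hm : m < n) : P.Lead m 0 z := by
  obtain ⟨o, ho, rfl⟩ := h
  obtain ⟨k, rfl⟩ : ∃ k : ℕ, n = m + 1 + k := ⟨(n - m - 1).toNat, by omega⟩
  refine ⟨P.t ^ k * (con c + P.t * o), ?_, ?_⟩
  · exact P.O.mul_mem (P.O.pow_mem P.t_mem k) (P.O.add_mem (P.con_mem c) (P.O.mul_mem P.t_mem ho))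
  · rw [zpow_add₀ P.t_ne_zero, zpow_add₀ P.t_ne_zero, zpow_one, zpow_natCast, con_zero]; ring

theorem Lead.exists_succ (h : P.Lead n 0 z) : ∃ c, P.Lead (n + 1) c z := by
  obtain ⟨o, ho, rfl⟩ := h
  obtain ⟨c, o', ho', rfl⟩ := P.residue o ho
  exact ⟨c, o', ho', by rw [zpow_add₀ P.t_ne_zero, con_zero]; simp; ring⟩

theorem Lead.mem (h : P.Lead 0 c z) : z ∈ P.O := by
  obtain ⟨o, ho, rfl⟩ := h
  simpa using P.O.add_mem (P.con_mem c) (P.O.mul_mem P.t_mem ho)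

/-- If c were nonzero, the relation c + t·o = 0 would exhibit t⁻¹ as an element of the local ring.
-/
theorem Lead.eq_zero (h : P.Lead n c 0) : c = 0 := by
  obtain ⟨o, ho, h⟩ := h
  by_contra hc
  have h1 := (mul_eq_zero.1 h.symm).resolve_left (zpow_ne_zero n P.t_ne_zero)
  apply P.inv_notMem
  have h2 : P.t⁻¹ = con (-c⁻¹) * o := by
    rw [con_neg, con_inv]
    have := P.t_ne_zero
    have := con_ne_zero hc
    field_simp
    linear_combination h1
  rw [h2]
  exact P.O.mul_mem (P.con_mem _) ho

theorem Lead.unique (h : P.Lead n c z) (h' : P.Lead n d z) : c = d := by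
  have := h.sub h'
  rw [sub_self] at this
  exact sub_eq_zero.1 this.eq_zero

/-- A suitable power of t makes z a unit of the local ring, and a unit has nonzero residue, since
otherwise t would be invertible. -/
theorem exists_lead (P : Place) (hz : z ≠ 0) : ∃ n c, c ≠ 0 ∧ P.Lead n c z := by
  obtain ⟨n, h1, h2⟩ := P.scale z hz
  obtain ⟨c, o, ho, e⟩ := P.residue _ h1
  refine ⟨-n, c, ?_, o, ho, ?_⟩
  · rintro rfl
    apply P.inv_notMem
    rw [con_zero, zero_add] at e
    have h3 : P.t⁻¹ = o * (P.t ^ n * z)⁻¹ := by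
      have hne : P.t ^ n * z ≠ 0 := mul_ne_zero (zpow_ne_zero n P.t_ne_zero) hz
      rw [eq_mul_inv_iff_mul_eq₀ hne, e, inv_mul_cancel_left₀ P.t_ne_zero]
    rw [h3]
    exact P.O.mul_mem ho h2
  · rw [← e, ← mul_assoc, ← zpow_add₀ P.t_ne_zero]; simp

theorem Lead.inv (h : P.Lead n c z) (hc : c ≠ 0) : P.Lead (-n) c⁻¹ z⁻¹ := by
  have hz : z ≠ 0 := fun h0 => hc (Lead.eq_zero (h0 ▸ h))
  obtain ⟨m, d, hd, h'⟩ := P.exists_lead (inv_ne_zero hz)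
  have h1 := h.mul h'
  rw [mul_inv_cancel₀ hz] at h1
  rcases lt_trichotomy (n + m) 0 with h2 | h2 | h2
  · exact absurd (h1.unique (P.lead_one.of_lt h2)) (mul_ne_zero hc hd)
  · have h3 : c * d = 1 := by rw [h2] at h1; exact h1.unique P.lead_one
    rw [show -n = m by omega, inv_eq_of_mul_eq_one_right h3]
    exact h'
  · exact absurd (P.lead_one.unique (h1.of_lt h2)) one_ne_zero

/-- The derivation `e ∂_r`, multiplying leading coefficients by the order. -/
theorem Lead.der (h : P.Lead n c z) : P.Lead n (n * c) (P.e * der z) := by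
  obtain ⟨o, ho, rfl⟩ := h
  have ht : ∀ n : ℤ, P.e * Schw.der (P.t ^ n) = n * P.t ^ n := by
    intro n
    rw [Derivation.leibniz_zpow]
    simp only [smul_eq_mul, zsmul_eq_mul]
    rw [show P.e * ((n : RatFun) * (P.t ^ (n - 1) * Schw.der P.t)) =
      n * (P.t ^ (n - 1) * (P.e * Schw.der P.t)) by ring, P.e_t, ← zpow_add_one₀ P.t_ne_zero]
    simp
  refine ⟨n * o + o + P.e * Schw.der o, ?_, ?_⟩
  · refine P.O.add_mem (P.O.add_mem (P.O.mul_mem ?_ ho) ho) (P.e_mem o ho)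
    exact intCast_mem P.O n
  · simp only [Derivation.leibniz, smul_eq_mul, map_add, der_con, zero_add]
    have h1 := ht n
    have h2 := P.e_t
    rw [Schw.con_mul, con_intCast]
    linear_combination (con c + P.t * o) * h1 + P.t ^ n * o * h2

/-- The finite point `c`. -/
def at_ (c : ℂ) : Place where
  O :=
    { carrier := {z | ∃ a q : Polynomial ℂ, q.eval c ≠ 0 ∧
        z = algebraMap (Polynomial ℂ) RatFun a / algebraMap (Polynomial ℂ) RatFun q}
      mul_mem' := by
        rintro _ _ ⟨a, q, hq, rfl⟩ ⟨a', q', hq', rfl⟩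
        refine ⟨a * a', q * q', by simp [hq, hq'], ?_⟩
        rw [map_mul, map_mul, div_mul_div_comm]
      one_mem' := ⟨1, 1, by simp, by simp⟩
      add_mem' := by
        rintro _ _ ⟨a, q, hq, rfl⟩ ⟨a', q', hq', rfl⟩
        refine ⟨a * q' + q * a', q * q', by simp [hq, hq'], ?_⟩
        rw [div_add_div]
        · simp
        · exact algebraMap_ne_zero' (by rintro rfl; simp at hq)
        · exact algebraMap_ne_zero' (by rintro rfl; simp at hq')
      zero_mem' := ⟨0, 1, by simp, by simp⟩
      neg_mem' := by
        rintro _ ⟨a, q, hq, rfl⟩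
        exact ⟨-a, q, hq, by rw [map_neg]; exact (neg_div _ _).symm⟩ }
  t := r - con c
  e := r - con c
  con_mem a := ⟨Polynomial.C a, 1, by simp, by simp [con]⟩
  t_mem := ⟨Polynomial.X - Polynomial.C c, 1, by simp, by simp [con, r]⟩
  t_ne_zero := by
    have := algebraMap_ne_zero' (Polynomial.X_sub_C_ne_zero c)
    simpa [r, con] using this
  inv_notMem := by
    rintro ⟨a, q, hq, h⟩
    have hq0 : q ≠ 0 := by rintro rfl; simp at hq
    have ht : r - con c = algebraMap (Polynomial ℂ) RatFun (Polynomial.X - Polynomial.C c) := by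
      simp [r, con]
    have h0 := algebraMap_ne_zero' (Polynomial.X_sub_C_ne_zero c)
    rw [ht, eq_div_iff (algebraMap_ne_zero' hq0), inv_mul_eq_iff_eq_mul₀ h0, ← map_mul] at h
    have := RatFunc.algebraMap_injective ℂ h
    rw [this] at hq
    simp at hq
  e_t := by simp
  e_mem := by
    rintro _ ⟨a, q, hq, rfl⟩
    have hq0 : q ≠ 0 := by rintro rfl; simp at hq
    refine ⟨(Polynomial.X - Polynomial.C c) *
      (Polynomial.derivative a * q - a * Polynomial.derivative q), q ^ 2, by simp [hq], ?_⟩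
    rw [← derivFun_eq, derivFun_div _ _ hq0]
    simp [r, con]
    ring
  residue := by
    rintro _ ⟨a, q, hq, rfl⟩
    have hq0 : q ≠ 0 := by rintro rfl; simp at hq
    obtain ⟨b, hb⟩ : Polynomial.X - Polynomial.C c ∣ a - Polynomial.C (a.eval c / q.eval c) * q := by
      rw [Polynomial.dvd_iff_isRoot]; simp [hq]
    refine ⟨a.eval c / q.eval c, _, ⟨b, q, hq, rfl⟩, ?_⟩
    have hb' := congrArg (algebraMap (Polynomial ℂ) RatFun) hb
    simp only [map_sub, map_mul, RatFunc.algebraMap_C, RatFunc.algebraMap_X] at hb'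
    have := algebraMap_ne_zero' hq0
    rw [← mul_div_assoc, eq_comm, ← eq_sub_iff_add_eq, eq_sub_iff_add_eq]
    simp only [con, r]
    field_simp
    linear_combination -hb'
  scale := by
    intro z hz
    have hd := RatFunc.denom_ne_zero z
    have hn : z.num ≠ 0 := by simpa using hz
    obtain ⟨a, ha, ha'⟩ := Polynomial.exists_eq_pow_rootMultiplicity_mul_and_not_dvd z.num hn c
    obtain ⟨q, hq, hq'⟩ := Polynomial.exists_eq_pow_rootMultiplicity_mul_and_not_dvd z.denom hd c
    rw [Polynomial.dvd_iff_isRoot] at ha' hq'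
    set k := z.num.rootMultiplicity c
    set l := z.denom.rootMultiplicity c
    have ht : r - con c = algebraMap (Polynomial ℂ) RatFun (Polynomial.X - Polynomial.C c) := by
      simp [r, con]
    have h0 : r - con c ≠ 0 := by rw [ht]; exact algebraMap_ne_zero' (Polynomial.X_sub_C_ne_zero c)
    have hq0 : q ≠ 0 := by rintro rfl; simp at hq'
    have e : (r - con c) ^ ((l : ℤ) - k) * z =
        algebraMap (Polynomial ℂ) RatFun a / algebraMap (Polynomial ℂ) RatFun q := by
      conv_lhs => rw [algebraMap_num_denom z, ha, hq]
      rw [map_mul, map_mul, map_pow, map_pow, ← ht, zpow_sub₀ h0, zpow_natCast, zpow_natCast]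
      have := algebraMap_ne_zero' hq0
      field_simp
    refine ⟨l - k, ?_, ?_⟩
    · rw [e]; exact ⟨a, q, hq', rfl⟩
    · rw [e]; exact ⟨q, a, ha', by rw [inv_div]⟩

/-- The point at infinity. -/
def infty : Place where
  O :=
    { carrier := {z | ∃ a q : Polynomial ℂ, q ≠ 0 ∧ a.natDegree ≤ q.natDegree ∧
        z = algebraMap (Polynomial ℂ) RatFun a / algebraMap (Polynomial ℂ) RatFun q}
      mul_mem' := by
        rintro _ _ ⟨a, q, hq, h, rfl⟩ ⟨a', q', hq', h', rfl⟩
        refine ⟨a * a', q * q', mul_ne_zero hq hq', ?_, ?_⟩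
        · rw [Polynomial.natDegree_mul hq hq']
          exact Polynomial.natDegree_mul_le.trans (add_le_add h h')
        · rw [map_mul, map_mul, div_mul_div_comm]
      one_mem' := ⟨1, 1, by simp, by simp, by simp⟩
      add_mem' := by
        rintro _ _ ⟨a, q, hq, h, rfl⟩ ⟨a', q', hq', h', rfl⟩
        refine ⟨a * q' + q * a', q * q', mul_ne_zero hq hq', ?_, ?_⟩
        · rw [Polynomial.natDegree_mul hq hq']
          refine (Polynomial.natDegree_add_le _ _).trans (max_le ?_ ?_)
          · exact Polynomial.natDegree_mul_le.trans (by omega)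
          · exact Polynomial.natDegree_mul_le.trans (by omega)
        · rw [div_add_div _ _ (algebraMap_ne_zero' hq) (algebraMap_ne_zero' hq')]
          simp
      zero_mem' := ⟨0, 1, by simp, by simp, by simp⟩
      neg_mem' := by
        rintro _ ⟨a, q, hq, h, rfl⟩
        exact ⟨-a, q, hq, by simpa using h, by rw [map_neg]; exact (neg_div _ _).symm⟩ }
  t := r⁻¹
  e := -r
  con_mem a := ⟨Polynomial.C a, 1, by simp, by simp, by simp [con]⟩
  t_mem := ⟨1, Polynomial.X, Polynomial.X_ne_zero, by simp, by simp [r]⟩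
  t_ne_zero := inv_ne_zero r_ne_zero
  inv_notMem := by
    rintro ⟨a, q, hq, h, e⟩
    rw [inv_inv, eq_div_iff (algebraMap_ne_zero' hq)] at e
    have : Polynomial.X * q = a := RatFunc.algebraMap_injective ℂ (by rw [map_mul, ← e]; simp [r])
    rw [← this, Polynomial.natDegree_X_mul hq] at h
    omega
  e_t := by
    rw [Derivation.leibniz_inv]
    have := r_ne_zero
    simp
    field_simp
  e_mem := by
    rintro _ ⟨a, q, hq, h, rfl⟩
    refine ⟨-(Polynomial.X *
      (Polynomial.derivative a * q - a * Polynomial.derivative q)), q ^ 2, pow_ne_zero 2 hq, ?_, ?_⟩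
    · rw [Polynomial.natDegree_neg, Polynomial.natDegree_pow]
      -- For deg q > 0 differentiation lowers the degree enough to absorb the factor X coming from
      -- -r. For deg q = 0 numerator and denominator are both constants and the derivative is zero.
      by_cases hd : q.natDegree = 0
      · obtain ⟨α, hα⟩ := Polynomial.natDegree_eq_zero.1 hd
        obtain ⟨β, hβ⟩ := Polynomial.natDegree_eq_zero.1 (Nat.le_zero.1 (hd ▸ h))
        simp [← hα, ← hβ]
      · refine Polynomial.natDegree_mul_le.trans ?_
        have h1 : (Polynomial.derivative a * q - a * Polynomial.derivative q).natDegree ≤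
            q.natDegree - 1 + q.natDegree := by
          refine (Polynomial.natDegree_sub_le _ _).trans (max_le ?_ ?_)
          · refine Polynomial.natDegree_mul_le.trans ?_
            have := Polynomial.natDegree_derivative_le a
            omega
          · refine Polynomial.natDegree_mul_le.trans ?_
            have := Polynomial.natDegree_derivative_le q
            omega
        have h2 := Polynomial.natDegree_X_le (R := ℂ)
        omega
    · rw [← derivFun_eq, derivFun_div _ _ hq]
      simp [r]
      ring
  residue := by
    rintro _ ⟨a, q, hq, h, rfl⟩
    set k := a.coeff q.natDegree / q.leadingCoeff with hk
    have hl : q.leadingCoeff ≠ 0 := Polynomial.leadingCoeff_ne_zero.2 hq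
    refine ⟨k, _, ⟨Polynomial.X * (a - Polynomial.C k * q), q, hq, ?_, rfl⟩, ?_⟩
    · by_cases h0 : a - Polynomial.C k * q = 0
      · simp [h0]
      · rw [Polynomial.natDegree_X_mul h0]
        have h1 : (a - Polynomial.C k * q).natDegree ≤ q.natDegree :=
          (Polynomial.natDegree_sub_le _ _).trans
            (max_le h (Polynomial.natDegree_C_mul_le _ _))
        rcases h1.lt_or_eq with h2 | h2
        · exact h2
        · exfalso
          apply h0
          rw [← Polynomial.leadingCoeff_eq_zero, Polynomial.leadingCoeff, h2]
          simp only [Polynomial.coeff_sub, Polynomial.coeff_C_mul, Polynomial.coeff_natDegree, hk]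
          field_simp
          ring
    · have h1 := algebraMap_ne_zero' hq
      have h2 := r_ne_zero
      simp only [map_mul, map_sub, RatFunc.algebraMap_C, RatFunc.algebraMap_X]
      change _ = con k + r⁻¹ * (r * (_ - con k * _) / _)
      field_simp
      ring
  scale := by
    intro z hz
    have hd := RatFunc.denom_ne_zero z
    have hn : z.num ≠ 0 := by simpa using hz
    set k := z.num.natDegree with hk
    set l := z.denom.natDegree with hl
    have h1 := algebraMap_ne_zero' hd
    have h2 := r_ne_zero
    have h3 := algebraMap_ne_zero' hn
    have e : r⁻¹ ^ ((k : ℤ) - l) * z = algebraMap (Polynomial ℂ) RatFun (Polynomial.X ^ l * z.num) /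
        algebraMap (Polynomial ℂ) RatFun (Polynomial.X ^ k * z.denom) := by
      conv_lhs => rw [algebraMap_num_denom z]
      rw [map_mul, map_mul, map_pow, map_pow, RatFunc.algebraMap_X, inv_zpow, zpow_sub₀ h2,
        zpow_natCast, zpow_natCast]
      change (r ^ k / r ^ l)⁻¹ * _ = r ^ l * _ / (r ^ k * _)
      field_simp
    have hX := Polynomial.X_ne_zero (R := ℂ)
    refine ⟨k - l, ?_, ?_⟩
    · rw [e]
      refine ⟨_, _, mul_ne_zero (pow_ne_zero _ hX) hd, ?_, rfl⟩
      rw [Polynomial.natDegree_mul (pow_ne_zero _ hX) hd,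
        Polynomial.natDegree_mul (pow_ne_zero _ hX) hn]
      simp [← hk, ← hl, add_comm]
    · rw [e, inv_div]
      refine ⟨_, _, mul_ne_zero (pow_ne_zero _ hX) hn, ?_, rfl⟩
      rw [Polynomial.natDegree_mul (pow_ne_zero _ hX) hd,
        Polynomial.natDegree_mul (pow_ne_zero _ hX) hn]
      simp [← hk, ← hl, add_comm]

end Place

end

/-! ### Orders of vanishing, and rigidity of endomorphisms at infinity -/

section

namespace Place

variable {P : Place} {n m : ℤ} {z z' : RatFun}

/-- `z = O(t^n)` -/
def Ord (P : Place) (n : ℤ) (z : RatFun) : Prop := ∃ c, P.Lead n c z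

theorem Ord.add (h : P.Ord n z) (h' : P.Ord n z') : P.Ord n (z + z') :=
  ⟨_, h.choose_spec.add h'.choose_spec⟩

theorem Ord.sub (h : P.Ord n z) (h' : P.Ord n z') : P.Ord n (z - z') :=
  ⟨_, h.choose_spec.sub h'.choose_spec⟩

theorem Ord.mul (h : P.Ord n z) (h' : P.Ord m z') : P.Ord (n + m) (z * z') :=
  ⟨_, h.choose_spec.mul h'.choose_spec⟩

theorem ord_zero (n : ℤ) : P.Ord n 0 := ⟨_, P.lead_zero n⟩

theorem Ord.sum {ι : Type*} {s : Finset ι} {F : ι → RatFun} (h : ∀ i ∈ s, P.Ord n (F i)) :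
    P.Ord n (∑ i ∈ s, F i) :=
  Finset.sum_induction F (P.Ord n) (fun _ _ => Ord.add) (ord_zero n) h

theorem Ord.of_le (h : P.Ord n z) (hm : m ≤ n) : P.Ord m z := by
  rcases hm.lt_or_eq with h' | rfl
  · exact ⟨0, h.choose_spec.of_lt h'⟩
  · exact h

theorem Ord.der (h : P.Ord n z) : P.Ord n (P.e * der z) := ⟨_, h.choose_spec.der⟩

theorem Lead.ord {c : ℂ} (h : P.Lead n c z) : P.Ord n z := ⟨c, h⟩

theorem eq_zero_of_ord (N : ℤ) (h : ∀ n, N ≤ n → P.Ord n z) : z = 0 := by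
  by_contra hz
  obtain ⟨n, c, hc, h'⟩ := P.exists_lead hz
  obtain ⟨d, hd⟩ := h (max N (n + 1)) (le_max_left _ _)
  exact hc (h'.unique (hd.of_lt (lt_of_lt_of_le (lt_add_one n) (le_max_right _ _))))

/-- The derivation e∂_r multiplies the coefficient of t^n by n, so for n ≠ 0 it loses no leading
term. -/
theorem Ord.succ_of_der (h : P.Ord n z) (hn : n ≠ 0) (h' : P.Ord (n + 1) (P.e * Schw.der z)) :
    P.Ord (n + 1) z := by
  obtain ⟨c, hc⟩ := h
  obtain ⟨d, hd⟩ := h'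
  have h1 := hc.der.unique (hd.of_lt (lt_add_one n))
  have h2 : c = 0 := (mul_eq_zero.1 h1).resolve_left (by exact_mod_cast hn)
  exact (h2 ▸ hc).exists_succ

end Place

section Infinity

variable {n : ℕ} {g : RatFun}

/-- Every entry is `O(r^(-N))` at infinity. -/
def OrdM (N : ℤ) (A : FunMatrix n) : Prop := ∀ i j, Place.infty.Ord N (A i j)

/-- Every entry has a finite value at infinity. -/
def LeadM (A₀ : Matrix (Fin n) (Fin n) ℂ) (A : FunMatrix n) : Prop :=
  ∀ i j, Place.infty.Lead 0 (A₀ i j) (A i j)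

theorem OrdM.sub {N : ℤ} {A A' : FunMatrix n} (h : OrdM N A) (h' : OrdM N A') :
    OrdM N (A - A') := fun i j => (h i j).sub (h' i j)

theorem OrdM.mul {N N' : ℤ} {A A' : FunMatrix n} (h : OrdM N A) (h' : OrdM N' A') :
    OrdM (N + N') (A * A') := fun i j => by
  rw [Matrix.mul_apply]; exact Place.Ord.sum fun k _ => (h i k).mul (h' k j)

theorem OrdM.of_le {N N' : ℤ} {A : FunMatrix n} (h : OrdM N A) (hN : N' ≤ N) : OrdM N' A :=
  fun i j => (h i j).of_le hN

/-- With t = 1/r and e = -r one has g∂_r = (-tg)(e∂_r): the eigenderivation keeps the order and the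
factor t raises it by one. -/
theorem ord_dd (hg : Place.infty.Lead 0 1 g) {N : ℤ} {z : RatFun} (h : Place.infty.Ord N z) :
    Place.infty.Ord (N + 1) (g * der z) := by
  have h1 := ((Place.infty.lead_t.neg.mul hg).ord).mul h.der
  have e : -Place.infty.t * g * (Place.infty.e * der z) = g * der z := by
    change -r⁻¹ * g * (-r * _) = _
    have := r_ne_zero
    field_simp
  rw [e] at h1
  exact h1.of_le (by omega)

/-- If the derivative vanishes one order beyond what is automatic, then so does the function. Order
zero is excluded because of the constants. -/
theorem ord_of_dd (hg : Place.infty.Lead 0 1 g) {N : ℤ} {z : RatFun} (hN : N ≠ 0)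
    (h : Place.infty.Ord N z) (h' : Place.infty.Ord (N + 2) (g * der z)) :
    Place.infty.Ord (N + 1) z := by
  refine h.succ_of_der hN ?_
  have h1 := ((Place.infty.lead_t.neg.mul hg).inv (by simp)).ord.mul h'
  have hg0 : g ≠ 0 := by rintro rfl; exact one_ne_zero hg.eq_zero
  have e : (-Place.infty.t * g)⁻¹ * (g * der z) = Place.infty.e * der z := by
    change (-r⁻¹ * g)⁻¹ * _ = -r * _
    have := r_ne_zero
    field_simp
  rw [e] at h1
  exact h1.of_le (by omega)

theorem OrdM.dm (hg : Place.infty.Lead 0 1 g) {N : ℤ} {A : FunMatrix n} (h : OrdM N A) :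
    OrdM (N + 1) (dm g A) := fun i j => ord_dd hg (h i j)

theorem OrdM.of_dm (hg : Place.infty.Lead 0 1 g) {N : ℤ} {A : FunMatrix n} (hN : N ≠ 0)
    (h : OrdM N A) (h' : OrdM (N + 2) (Schw.dm g A)) : OrdM (N + 1) A :=
  fun i j => ord_of_dd hg hN (h i j) (h' i j)

theorem LeadM.add {A A' : FunMatrix n} {A₀ A₀' : Matrix (Fin n) (Fin n) ℂ} (h : LeadM A₀ A)
    (h' : LeadM A₀' A') : LeadM (A₀ + A₀') (A + A') := fun i j => (h i j).add (h' i j)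

theorem LeadM.sub {A A' : FunMatrix n} {A₀ A₀' : Matrix (Fin n) (Fin n) ℂ} (h : LeadM A₀ A)
    (h' : LeadM A₀' A') : LeadM (A₀ - A₀') (A - A') := fun i j => (h i j).sub (h' i j)

theorem Place.Lead.sum {P : Place} {ι : Type*} {s : Finset ι} {N : ℤ} {F : ι → RatFun}
    {c : ι → ℂ} (h : ∀ i ∈ s, P.Lead N (c i) (F i)) : P.Lead N (∑ i ∈ s, c i) (∑ i ∈ s, F i) := by
  classical
  induction s using Finset.induction_on with
  | empty => simpa using P.lead_zero N
  | insert a s ha ih =>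
    rw [Finset.sum_insert ha, Finset.sum_insert ha]
    exact (h a (by simp)).add (ih fun i hi => h i (by simp [hi]))

theorem LeadM.mul {A A' : FunMatrix n} {A₀ A₀' : Matrix (Fin n) (Fin n) ℂ} (h : LeadM A₀ A)
    (h' : LeadM A₀' A') : LeadM (A₀ * A₀') (A * A') := fun i j => by
  rw [Matrix.mul_apply, Matrix.mul_apply]
  exact Place.Lead.sum fun k _ => by simpa using (h i k).mul (h' k j)

theorem LeadM.ord {A : FunMatrix n} {A₀ : Matrix (Fin n) (Fin n) ℂ} (h : LeadM A₀ A) :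
    OrdM 0 A := fun i j => (h i j).ord

theorem LeadM.dm (hg : Place.infty.Lead 0 1 g) {A : FunMatrix n} {A₀ : Matrix (Fin n) (Fin n) ℂ}
    (h : LeadM A₀ A) : LeadM 0 (dm g A) := fun i j => by
  obtain ⟨c, hc⟩ := h.ord.dm hg i j
  exact hc.of_lt (by norm_num)

theorem OrdM.of_lead {A : FunMatrix n} (h : LeadM 0 A) : OrdM 1 A := fun i j =>
  (h i j).exists_succ

/-- Solutions of the equations of an endomorphism of `(g ∂)² - W` which vanish at infinity. -/
theorem endo_eq_zero (hg : Place.infty.Lead 0 1 g) {κ : ℂ} (hκ : κ ≠ 0) {W V u v : FunMatrix n}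
    (hW : W = Matrix.scalar (Fin n) (con κ) + V) (hV : OrdM 2 V)
    (h₁ : 2 * dm g u + dm g (dm g v) - W * v = -(v * W))
    (h₀ : dm g (dm g u) - W * u = -((u + 2 * dm g v) * W + v * dm g W))
    (hu : OrdM 1 u) (hv : OrdM 1 v) : u = 0 ∧ v = 0 := by
  have hdW : dm g W = dm g V := by
    rw [hW, dm_add]
    have : dm g (Matrix.scalar (Fin n) (con κ)) = 0 := by
      ext i j; by_cases h : i = j <;> simp [dm_apply, h]
    rw [this, zero_add]
  have hcomm : ∀ a : FunMatrix n, W * a - a * W = V * a - a * V := by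
    intro a; rw [hW, add_mul, mul_add, scalar_comm]; abel
  have half : ∀ {N : ℤ} {A : FunMatrix n}, OrdM N (2 * A) → OrdM N A := by
    intro N A h i j
    have h1 := (Place.infty.lead_con (1 / 2)).ord.mul (h i j)
    have e : con (1 / 2) * (2 * A : FunMatrix n) i j = A i j := by
      rw [two_mul, Matrix.add_apply, ← two_mul, ← mul_assoc, con_div, con_one, con_ofNat]
      simp
    rwa [e, zero_add] at h1
  have key : ∀ N : ℕ, OrdM (N + 1) u ∧ OrdM (N + 1) v := by
    intro N
    induction N with
    | zero => simpa using ⟨hu, hv⟩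
    | succ N ih =>
      obtain ⟨hu, hv⟩ := ih
      have hN : (N : ℤ) + 1 ≠ 0 := by omega
      -- The scalar part of W drops out of the commutator, so the first equation reads 2Du = [V, v]
      -- - D²v. Both terms have order N + 3, because V has order 2 and each derivative gains one.
      have hu' : OrdM (N + 1 + 1) u := by
        refine OrdM.of_dm hg hN hu (half ?_)
        have e : 2 * dm g u = V * v - v * V - dm g (dm g v) := by
          rw [← hcomm, eq_sub_iff_add_eq, ← sub_eq_zero, ← sub_eq_zero.2 h₁]; abel
        rw [e]
        refine OrdM.sub (OrdM.sub ((hV.mul hv).of_le ?_) ((hv.mul hV).of_le ?_))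
          (((hv.dm hg).dm hg).of_le ?_) <;> omega
      refine ⟨by exact_mod_cast hu', ?_⟩
      -- In the second equation the scalar part κ survives in the term 2(Dv)W. Solving for 2κDv
      -- expresses it by terms of order at least N + 3, where the improved order of u is used.
      have hv' : OrdM (N + 1 + 1) v := by
        refine OrdM.of_dm hg hN hv ?_
        have e : 2 * (Matrix.scalar (Fin n) (con κ) * dm g v) = V * u - u * V - dm g (dm g u) -
            dm g v * V - dm g v * V - v * dm g V := by
          rw [← hcomm, ← hdW, scalar_comm]
          have h2 : dm g v * W = dm g v * Matrix.scalar (Fin n) (con κ) + dm g v * V := by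
            rw [hW, mul_add]
          have h3 := sub_eq_zero.2 h₀
          have h4 : (u + 2 * dm g v) * W = u * W + dm g v * W + dm g v * W := by noncomm_ring
          rw [h4, h2] at h3
          rw [← sub_eq_zero, ← h3]
          noncomm_ring
        have h5 : OrdM (N + 1 + 2) (Matrix.scalar (Fin n) (con κ) * dm g v) := by
          refine half ?_
          rw [e]
          refine OrdM.sub (OrdM.sub (OrdM.sub (OrdM.sub (OrdM.sub ((hV.mul hu').of_le ?_)
            ((hu'.mul hV).of_le ?_)) (((hu'.dm hg).dm hg).of_le ?_))
            (((hv.dm hg).mul hV).of_le ?_)) (((hv.dm hg).mul hV).of_le ?_))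
            ((hv.mul (hV.dm hg)).of_le ?_) <;> omega
        intro i j
        have h6 := ((Place.infty.lead_con κ).inv hκ).ord.mul (h5 i j)
        have e2 : (con κ)⁻¹ * (Matrix.scalar (Fin n) (con κ) * dm g v) i j = dm g v i j := by
          rw [Matrix.scalar_apply, Matrix.diagonal_mul, inv_mul_cancel_left₀ (con_ne_zero hκ)]
        rw [e2] at h6
        exact h6.of_le (by omega)
      exact_mod_cast hv'
  constructor
  · ext i j
    refine Place.eq_zero_of_ord (P := Place.infty) 1 fun N hN => ?_
    exact ((key (N - 1).toNat).1 i j).of_le (by omega)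
  · ext i j
    refine Place.eq_zero_of_ord (P := Place.infty) 1 fun N hN => ?_
    exact ((key (N - 1).toNat).2 i j).of_le (by omega)

/-- The equations of a morphism `u + v (g ∂)` between systems `(g ∂)² - W`. -/
theorem endo_equations (hg : g ≠ 0) {W W' u v : FunMatrix n} {Y : OpMatrix n} (hY : FinOrd g Y)
    (h : tri g W' * op1 g u v = Y * tri g W) :
    Y = op1 g (u + 2 * dm g v) v ∧ 2 * dm g u + dm g (dm g v) - W' * v = -(v * W) ∧
      dm g (dm g u) - W' * u = -((u + 2 * dm g v) * W + v * dm g W) := by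
  have e1 := op2_mul_op1 (g := g) 0 (-W') u v
  have e2 := op1_mul_op2 (g := g) 0 (-W) (u + 2 * dm g v) v
  -- Comparison of the top orders leaves only one candidate for the companion. The difference from
  -- it, times a monic operator, equals an operator of order one whose two coefficients are the
  -- equations sought.
  have e3 : (Y - op1 g (u + 2 * dm g v) v) * op2 g 0 (-W) =
      op1 g (dm g (dm g u) - W' * u + ((u + 2 * dm g v) * W + v * dm g W))
        (2 * dm g u + dm g (dm g v) - W' * v + v * W) := by
    rw [sub_mul, e2, ← tri, ← h, tri, e1]
    simp only [op1, map_add, map_sub, map_mul, map_neg, dm_neg, dm_zero, mul_neg, neg_mul, zero_mul,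
      mul_zero, map_zero]
    noncomm_ring
  have e4 := eq_zero_of_mul_op2_eq_op1 hg (hY.sub (FinOrd.op1 _ _)) e3
  rw [e4, zero_mul] at e3
  obtain ⟨h0, h1⟩ := op1_eq_zero hg e3.symm
  exact ⟨sub_eq_zero.1 e4, eq_neg_of_add_eq_zero_left h1, eq_neg_of_add_eq_zero_left h0⟩

namespace Hat

variable {H : Hat n}

/-- The equations of the composite follow from its value at infinity. -/
theorem isHat_of_infty (hg : Place.infty.Lead 0 1 g)
    {κ : ℂ} (hκ : κ ≠ 0) {V : FunMatrix n} (hW : H.W = Matrix.scalar (Fin n) (con κ) + V)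
    (hV : OrdM 2 V)
    (L_mul : H.L * H.Li = 1) (S_mul : H.S * H.Si = 1) (U_mul : H.U * H.Ui = 1)
    (C_mul : H.C * H.Ci = 1) (dC : dm g H.C = 0) (C_comm : H.C * H.W = H.W * H.C)
    (morph₁ : 2 * dm g H.a + dm g (dm g H.b) - H.W * H.b =
      H.s g * H.R₁ + H.b * dm g H.R₁ + H.b * H.R₀)
    (morph₀ : dm g (dm g H.a) - H.W * H.a = H.s g * H.R₀ + H.b * dm g H.R₀)
    (bar₁ : 2 * dm g H.q₀ + dm g (dm g H.q₁) + H.R₁ * H.q₀ + H.R₁ * dm g H.q₁ + H.R₀ * H.q₁ =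
      -(H.q₁ * H.W))
    (bar₀ : dm g (dm g H.q₀) + H.R₁ * dm g H.q₀ + H.R₀ * H.q₀ =
      -(H.t g * H.W + H.q₁ * dm g H.W))
    (lead₁ : LeadM 0 (H.a * H.q₁ + H.b * H.q₀ + H.b * dm g H.q₁))
    (lead₀ : LeadM 0 (H.a * H.q₀ + H.b * dm g H.q₀ + H.b * H.q₁ * H.W - H.C)) : H.IsHat g := by
  have hg0 : g ≠ 0 := by rintro rfl; exact one_ne_zero hg.eq_zero
  have tri_mul : tri g H.W * op1 g H.a H.b = op1 g (H.s g) H.b * op2 g H.R₁ H.R₀ := by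
    refine op2_intertwine (by simp [s]) ?_ ?_
    · rw [← morph₁]; noncomm_ring
    · rw [← morph₀]; noncomm_ring
  have mul_tri : op2 g H.R₁ H.R₀ * op1 g H.q₀ H.q₁ = op1 g (H.t g) H.q₁ * tri g H.W := by
    refine op2_intertwine (by simp [t]) ?_ ?_
    · rw [bar₁, dm_zero]; noncomm_ring
    · rw [bar₀, dm_neg]; noncomm_ring
  set v := H.a * H.q₁ + H.b * H.q₀ + H.b * dm g H.q₁ with hv
  set u := H.a * H.q₀ + H.b * dm g H.q₀ + H.b * H.q₁ * H.W - H.C with hu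
  have hPQ : op1 g H.a H.b * op1 g H.q₀ H.q₁ =
      op1 g u v + MM H.C + MM (H.b * H.q₁) * tri g H.W := by
    rw [tri, op1_mul_op1 g _ _ _ _ 0 (-H.W)]
    congr 1
    rw [hu, hv]
    simp only [op1, map_add, map_sub, map_mul, mul_neg, map_neg, mul_zero, map_zero]
    noncomm_ring
  -- The remainder u + vD of PQ - C modulo D² - W is an endomorphism of D² - W, because PQ, C and
  -- every multiple of that operator are. It vanishes at infinity by assumption, hence everywhere.
  have hT : tri g H.W * op1 g u v = (op1 g (H.s g) H.b * op1 g (H.t g) H.q₁ - MM H.C -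
      tri g H.W * MM (H.b * H.q₁)) * tri g H.W := by
    have e : op1 g u v = op1 g H.a H.b * op1 g H.q₀ H.q₁ - MM H.C -
        MM (H.b * H.q₁) * tri g H.W := by rw [hPQ]; abel
    rw [e, mul_sub, mul_sub, ← mul_assoc, tri_mul, mul_assoc, mul_tri, tri_comm dC C_comm]
    noncomm_ring
  have hfin : FinOrd g (op1 g (H.s g) H.b * op1 g (H.t g) H.q₁ - MM H.C -
      tri g H.W * MM (H.b * H.q₁)) :=
    (((FinOrd.op1 _ _).mul_op1 _ _).sub (FinOrd.mM _)).sub ((FinOrd.op2 _ _).mul_MM _)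
  obtain ⟨-, h1, h0⟩ := endo_equations hg0 hfin hT
  obtain ⟨hu0, hv0⟩ := endo_eq_zero hg hκ hW hV h1 h0 (OrdM.of_lead lead₀) (OrdM.of_lead lead₁)
  exact ⟨L_mul, S_mul, U_mul, C_mul, dC, C_comm, morph₁, morph₀, bar₁, bar₀, hv0,
    sub_eq_zero.1 hu0⟩

end Hat

end Infinity

end

section

/-! ### Systems with polynomial coefficients -/

/-- Square matrices of polynomials. -/
def PMat (n : ℕ) := Fin n → Fin n → RadPoly

namespace PMat

variable {n : ℕ}

instance : Add (PMat n) := ⟨fun a b i j => a i j + b i j⟩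
instance : Sub (PMat n) := ⟨fun a b i j => a i j - b i j⟩
instance : Mul (PMat n) := ⟨fun a b i j => RadPoly.sum fun k => a i k * b k j⟩

/-- Entrywise derivative. -/
def d (a : PMat n) : PMat n := fun i j => (a i j).deriv

/-- The terms without `x`. -/
def at0 (a : PMat n) : PMat n := fun i j => (a i j).at0

/-- Diagonal matrices. -/
def diag (a : Fin n → RadPoly) : PMat n := fun i j => bif i == j then a i else 0

/-- The matrix of values. -/
def ev {K : Type*} [CommRing K] (v : Fin 5 → K) (a : PMat n) : Matrix (Fin n) (Fin n) K :=
  Matrix.of fun i j => (a i j).ev v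

section

variable {K : Type*} [CommRing K] (v : Fin 5 → K)

theorem ev_apply (a : PMat n) (i j : Fin n) : a.ev v i j = (a i j).ev v := rfl

theorem ev_add (a b : PMat n) : (a + b).ev v = a.ev v + b.ev v := by
  ext i j; exact RadPoly.ev_add v _ _

theorem ev_sub (a b : PMat n) : (a - b).ev v = a.ev v - b.ev v := by
  ext i j; exact RadPoly.ev_sub v _ _

theorem ev_mul (a b : PMat n) : (a * b).ev v = a.ev v * b.ev v := by
  ext i j
  rw [Matrix.mul_apply]
  exact (RadPoly.ev_sum v _).trans (by simp [ev_apply])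

theorem ev_diag (a : Fin n → RadPoly) : (diag a).ev v = Matrix.diagonal fun i => (a i).ev v := by
  ext i j
  rw [ev_apply, diag, Matrix.diagonal_apply]
  by_cases h : i = j
  · simp [h]
  · simp [h, beq_false_of_ne h]

end

end PMat

/-- Coefficients of a system of the form `G⁻¹ (D G D)` plus lower order, where `D = f ∂_r` and `G`
is the diagonal matrix of `κ f^e`, of a triangular system `D² - W`, and of a first order operator
`a + b D`. -/
structure System (n : ℕ) where
  /-- twice the constants `κ` -/
  (κ : Fin n → RadPoly)
  /-- the constants `δ/κ` -/
  (κi : Fin n → RadPoly)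
  (δ : RadPoly)
  (e : Fin n → ℕ)
  (R W a b : PMat n)
  (C Ci : PMat n)
  (den : RadPoly)
  (ν : Fin n → RadPoly)
  /-- bound for the degrees in `y` -/
  (N : ℕ)

namespace System

open RadPoly

variable {n : ℕ} (S : System n)

/-- `B - 2 + 3 f₁` -/
def zer : RadPoly := B - 2 + 36 * u * x

/-- The diagonal matrix of first order coefficients. -/
def R₁ : PMat n := .diag fun i => ⟨[⟨12 * S.e i, 2, 1, 0, 0, 0⟩]⟩

/-- The companion of `a`. -/
def s : PMat n := S.a + S.b.d + S.b.d - S.b * S.R₁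

/-- The adjoint operator, first order coefficient. -/
def c₁ : PMat n := fun i j => -(S.b j.rev i).negw

/-- The adjoint operator, coefficient of order zero. -/
def c₀ : PMat n := fun i j => (S.s j.rev i - (S.b j.rev i).deriv).negw

/-- All entries vanish. -/
def IsZ (A : PMat n) : Prop := ∀ i j, isZeroY zer S.N (A i j) = true

instance (A : PMat n) : Decidable (S.IsZ A) := inferInstanceAs (Decidable (∀ _ _, _))

/-- All entries vanish at infinity. -/
def IsZ₀ (A : PMat n) : Prop := ∀ i j, isZeroY (B - 2) S.N (A i j) = true

instance (A : PMat n) : Decidable (S.IsZ₀ A) := inferInstanceAs (Decidable (∀ _ _, _))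

/-- The polynomial identities behind an equivalence diagram. -/
structure Valid : Prop where
  κ_mul : ∀ i, (S.κ i * S.κi i - 2 * S.δ).isZero = true
  symm : ∀ i j, (S.κ i * (1 - 12 * u * x) ^ S.e i * S.R i j -
    S.κ j * (1 - 12 * u * x) ^ S.e j * (S.R j i).negw).isZero = true
  morph₁ : S.IsZ (S.a.d + S.a.d + S.b.d.d - S.W * S.b - S.s * S.R₁ - S.b * S.R₁.d - S.b * S.R)
  morph₀ : S.IsZ (S.a.d.d - S.W * S.a - S.s * S.R - S.b * S.R.d)
  W_symm : ∀ i j, (S.W (Fin.rev j) (Fin.rev i) - (S.W i j).negw).isZero = true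
  W_infty : ∀ i j, ((S.W - .diag fun _ => w ^ 2 : PMat n) i j).isOrd 2 = true
  comp₁ : S.IsZ₀ (S.a.at0 * (.diag S.κi * S.c₁.at0) + S.b.at0 * (.diag S.κi * S.c₀.at0))
  comp₀ : S.IsZ₀ (S.a.at0 * (.diag S.κi * S.c₀.at0) +
    S.b.at0 * (.diag S.κi * S.c₁.at0) * (.diag fun _ => w ^ 2) - S.C)
  C_mul : S.IsZ (S.C * S.Ci - .diag fun i => S.den * S.ν i)
  C_comm : S.IsZ (S.C * S.W - S.W * S.C)
  dC : S.IsZ S.C.d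
  dδ : S.δ.deriv.isZero = true
  dν : ∀ i, (S.ν i).deriv.isZero = true
  dκi : ∀ i, (S.κi i).deriv.isZero = true
  ν_comm : S.IsZ (.diag S.ν * S.W - S.W * .diag S.ν)

end System

end

/-! ### Coefficient tables of the five sectors and of the Zerilli form -/

section

namespace System

open RadPoly

/-- The potential of the Regge–Wheeler operator of spin `s`. -/
def pot (s : ℕ) : RadPoly :=
  (1 - 12 * u * x) * x ^ 2 * (B + ⟨[⟨12 * (1 - s ^ 2), 1, 1, 0, 0, 0⟩]⟩) + w ^ 2

/-- The scalar system. -/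
def scalar : System 1 where
  κ := ![2]
  κi := ![1]
  δ := 1
  e := ![0]
  R :=
    ![![⟨[⟨-1, 0, 0, 0, 2, 0⟩, ⟨-1, 2, 0, 1, 0, 0⟩, ⟨-12, 3, 1, 0, 0, 0⟩, ⟨12, 3, 1, 1, 0, 0⟩,
        ⟨144, 4, 2, 0, 0, 0⟩]⟩]]
  W :=
    ![![pot 0]]
  a :=
    ![![⟨[⟨1, 0, 0, 0, 0, 0⟩]⟩]]
  b :=
    ![![0]]
  C :=
    ![![⟨[⟨1, 0, 0, 0, 0, 0⟩]⟩]]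
  Ci :=
    ![![⟨[⟨1, 0, 0, 0, 0, 0⟩]⟩]]
  den := 1
  ν := ![1]
  N := 0

/-- The odd vector system. -/
def vecOdd : System 1 where
  κ := ![2 * B]
  κi := ![1]
  δ := B
  e := ![0]
  R :=
    ![![⟨[⟨-1, 0, 0, 0, 2, 0⟩, ⟨-1, 2, 0, 1, 0, 0⟩, ⟨12, 3, 1, 1, 0, 0⟩]⟩]]
  W :=
    ![![pot 1]]
  a :=
    ![![⟨[⟨1, 0, 0, 0, 0, 0⟩]⟩]]
  b :=
    ![![0]]
  C :=
    ![![⟨[⟨1, 0, 0, 0, 0, 0⟩]⟩]]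
  Ci :=
    ![![⟨[⟨1, 0, 0, 0, 0, 0⟩]⟩]]
  den := 1
  ν := ![1]
  N := 0

/-- The even vector system. -/
def vecEven : System 3 where
  κ := ![-2, 2, 2 * B]
  κi := ![-B, B, 1]
  δ := B
  e := ![1, 1, 0]
  R :=
    ![![⟨[⟨-1, 0, 0, 0, 2, 0⟩, ⟨-1, 2, 0, 1, 0, 0⟩, ⟨-24, 3, 1, 0, 0, 0⟩, ⟨12, 3, 1, 1, 0, 0⟩,
        ⟨288, 4, 2, 0, 0, 0⟩]⟩, ⟨[⟨-12, 2, 1, 0, 1, 0⟩]⟩, 0],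
      ![⟨[⟨-12, 2, 1, 0, 1, 0⟩]⟩, ⟨[⟨-1, 0, 0, 0, 2, 0⟩, ⟨-2, 2, 0, 0, 0, 0⟩, ⟨-1, 2, 0, 1, 0, 0⟩,
        ⟨24, 3, 1, 0, 0, 0⟩, ⟨12, 3, 1, 1, 0, 0⟩]⟩, ⟨[⟨2, 2, 0, 1, 0, 0⟩, ⟨-24, 3, 1, 1, 0, 0⟩]⟩],
      ![0, ⟨[⟨2, 2, 0, 0, 0, 0⟩, ⟨-48, 3, 1, 0, 0, 0⟩, ⟨288, 4, 2, 0, 0, 0⟩]⟩, ⟨[⟨-1, 0, 0, 0, 2,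
        0⟩, ⟨-1, 2, 0, 1, 0, 0⟩, ⟨12, 3, 1, 1, 0, 0⟩]⟩]]
  W :=
    ![![pot 0, 0, (12 * x ^ 3 * u * B + 72 * x ^ 4 * u ^ 2) * (1 - 12 * u * x)],
      ![0, pot 1, 0],
      ![0, 0, pot 0]]
  a :=
    ![![⟨[⟨-2, 0, 0, 0, 1, 0⟩, ⟨12, 1, 1, 0, 1, 0⟩]⟩, ⟨[⟨2, 1, 0, 1, 0, 0⟩, ⟨-12, 2, 1, 0, 0, 0⟩,
        ⟨-24, 2, 1, 1, 0, 0⟩]⟩, ⟨[⟨12, 2, 1, 1, 0, 0⟩]⟩],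
      ![⟨[⟨1, 0, 0, 0, 1, 0⟩]⟩, ⟨[⟨12, 2, 1, 0, 0, 0⟩]⟩, ⟨[⟨-1, 1, 0, 1, 0, 0⟩]⟩],
      ![⟨[⟨2, 0, 0, 0, 1, 0⟩]⟩, ⟨[⟨2, 1, 0, 0, 0, 0⟩]⟩, ⟨[⟨-2, 1, 0, 1, 0, 0⟩]⟩]]
  b :=
    ![![0, ⟨[⟨-12, 1, 1, 0, 0, 0⟩]⟩, ⟨[⟨-2, 0, 0, 1, 0, 0⟩]⟩],
      ![0, ⟨[⟨1, 0, 0, 0, 0, 0⟩]⟩, ⟨[⟨1, 0, 0, 0, 0, 0⟩]⟩],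
      ![0, ⟨[⟨2, 0, 0, 0, 0, 0⟩]⟩, 0]]
  C :=
    ![![⟨[⟨-4, 0, 0, 1, 2, 0⟩]⟩, 0, ⟨[⟨4, 0, 0, 1, 2, 0⟩, ⟨-4, 0, 0, 2, 2, 0⟩]⟩],
      ![0, ⟨[⟨-1, 0, 0, 0, 2, 0⟩]⟩, 0],
      ![0, 0, ⟨[⟨-4, 0, 0, 1, 2, 0⟩]⟩]]
  Ci :=
    ![![⟨[⟨-1, 0, 0, 0, 0, 0⟩]⟩, 0, ⟨[⟨-1, 0, 0, 0, 0, 0⟩, ⟨1, 0, 0, 1, 0, 0⟩]⟩],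
      ![0, ⟨[⟨-4, 0, 0, 1, 0, 0⟩]⟩, 0],
      ![0, 0, ⟨[⟨-1, 0, 0, 0, 0, 0⟩]⟩]]
  den := 4 * B * w ^ 2
  ν := ![1, 1, 1]
  N := 0

/-- The odd Lichnerowicz system. -/
def lichOdd : System 3 where
  κ := ![-4 * B, 4 * B, -2 * B + B ^ 2]
  κi := ![2 - B, -2 + B, 4]
  δ := -4 * B + 2 * B ^ 2
  e := ![1, 1, 0]
  R :=
    ![![⟨[⟨-1, 0, 0, 0, 2, 0⟩, ⟨-1, 2, 0, 1, 0, 0⟩, ⟨12, 3, 1, 1, 0, 0⟩]⟩, ⟨[⟨-12, 2, 1, 0, 1,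
        0⟩]⟩, 0],
      ![⟨[⟨-12, 2, 1, 0, 1, 0⟩]⟩, ⟨[⟨-1, 0, 0, 0, 2, 0⟩, ⟨-4, 2, 0, 0, 0, 0⟩, ⟨-1, 2, 0, 1, 0, 0⟩,
        ⟨96, 3, 1, 0, 0, 0⟩, ⟨12, 3, 1, 1, 0, 0⟩, ⟨-576, 4, 2, 0, 0, 0⟩]⟩, ⟨[⟨-2, 2, 0, 0, 0, 0⟩,
        ⟨1, 2, 0, 1, 0, 0⟩, ⟨24, 3, 1, 0, 0, 0⟩, ⟨-12, 3, 1, 1, 0, 0⟩]⟩],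
      ![0, ⟨[⟨4, 2, 0, 0, 0, 0⟩, ⟨-96, 3, 1, 0, 0, 0⟩, ⟨576, 4, 2, 0, 0, 0⟩]⟩, ⟨[⟨-1, 0, 0, 0, 2,
        0⟩, ⟨2, 2, 0, 0, 0, 0⟩, ⟨-1, 2, 0, 1, 0, 0⟩, ⟨-36, 3, 1, 0, 0, 0⟩, ⟨12, 3, 1, 1, 0, 0⟩,
        ⟨144, 4, 2, 0, 0, 0⟩]⟩]]
  W :=
    ![![pot 1, 0, (-4 * x ^ 3 * u * B) * (1 - 12 * u * x)],
      ![0, pot 2, 0],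
      ![0, 0, pot 1]]
  a :=
    ![![⟨[⟨12, 0, 0, 1, 1, 0⟩, ⟨-72, 1, 1, 1, 1, 0⟩, ⟨-288, 2, 2, 0, 1, 0⟩]⟩, ⟨[⟨-24, 0, 1, 0, 2,
        0⟩, ⟨8, 1, 0, 1, 0, 0⟩, ⟨-4, 1, 0, 2, 0, 0⟩, ⟨-48, 2, 1, 0, 0, 0⟩, ⟨24, 2, 1, 1, 0, 0⟩,
        ⟨48, 2, 1, 2, 0, 0⟩, ⟨1152, 3, 2, 0, 0, 0⟩, ⟨-576, 3, 2, 1, 0, 0⟩, ⟨-6912, 4, 3, 0, 0,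
        0⟩]⟩, ⟨[⟨4, 1, 0, 1, 0, 0⟩, ⟨-2, 1, 0, 2, 0, 0⟩, ⟨-24, 2, 1, 0, 0, 0⟩, ⟨36, 2, 1, 1, 0,
        0⟩, ⟨-12, 2, 1, 2, 0, 0⟩, ⟨288, 3, 2, 0, 0, 0⟩, ⟨-144, 3, 2, 1, 0, 0⟩]⟩],
      ![⟨[⟨2, 0, 0, 0, 1, 0⟩]⟩, ⟨[⟨-2, 1, 0, 0, 0, 0⟩, ⟨48, 2, 1, 0, 0, 0⟩]⟩, ⟨[⟨-1, 1, 0, 0, 0,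
        0⟩, ⟨-1, 1, 0, 1, 0, 0⟩, ⟨36, 2, 1, 0, 0, 0⟩]⟩],
      ![⟨[⟨12, 0, 0, 1, 1, 0⟩]⟩, ⟨[⟨24, 1, 0, 1, 0, 0⟩, ⟨-144, 2, 1, 1, 0, 0⟩]⟩, ⟨[⟨12, 1, 0, 1,
        0, 0⟩, ⟨-6, 1, 0, 2, 0, 0⟩]⟩]]
  b :=
    ![![⟨[⟨-24, 0, 1, 0, 1, 0⟩]⟩, ⟨[⟨-48, 1, 1, 0, 0, 0⟩, ⟨72, 1, 1, 1, 0, 0⟩, ⟨576, 2, 2, 0, 0,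
        0⟩]⟩, ⟨[⟨-4, 0, 0, 1, 0, 0⟩, ⟨2, 0, 0, 2, 0, 0⟩, ⟨-24, 1, 1, 0, 0, 0⟩, ⟨12, 1, 1, 1, 0,
        0⟩]⟩],
      ![0, ⟨[⟨2, 0, 0, 0, 0, 0⟩]⟩, ⟨[⟨3, 0, 0, 0, 0, 0⟩]⟩],
      ![0, ⟨[⟨12, 0, 0, 1, 0, 0⟩]⟩, 0]]
  C :=
    ![![⟨[⟨-288, 0, 0, 2, 2, 0⟩, ⟨144, 0, 0, 3, 2, 0⟩]⟩, 0, ⟨[⟨-352, 0, 0, 2, 2, 0⟩, ⟨208, 0, 0,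
        3, 2, 0⟩, ⟨-16, 0, 0, 4, 2, 0⟩]⟩],
      ![0, ⟨[⟨-36, 0, 0, 0, 2, 0⟩]⟩, 0],
      ![0, 0, ⟨[⟨-288, 0, 0, 2, 2, 0⟩, ⟨144, 0, 0, 3, 2, 0⟩]⟩]]
  Ci :=
    ![![⟨[⟨9, 0, 0, 0, 0, 0⟩]⟩, 0, ⟨[⟨-11, 0, 0, 0, 0, 0⟩, ⟨1, 0, 0, 1, 0, 0⟩]⟩],
      ![0, ⟨[⟨72, 0, 0, 2, 0, 0⟩, ⟨-36, 0, 0, 3, 0, 0⟩]⟩, 0],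
      ![0, 0, ⟨[⟨9, 0, 0, 0, 0, 0⟩]⟩]]
  den := 1296 * B ^ 2 * (B - 2) * w ^ 2
  ν := ![1, 1, 1]
  N := 0

/-- The even Lichnerowicz system. -/
def lichEven : System 7 where
  κ := ![-4, -4 * B, 2, 2, 4, 4 * B, -2 * B + B ^ 2]
  κi := ![2 * B - B ^ 2, 2 - B, -4 * B + 2 * B ^ 2, -4 * B + 2 * B ^ 2, -2 * B + B ^ 2, -2 + B, 4]
  δ := -4 * B + 2 * B ^ 2
  e := ![2, 1, 2, 2, 0, 1, 0]
  R :=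
    ![![⟨[⟨-1, 0, 0, 0, 2, 0⟩, ⟨-2, 2, 0, 0, 0, 0⟩, ⟨-1, 2, 0, 1, 0, 0⟩, ⟨-12, 3, 1, 0, 0, 0⟩,
        ⟨12, 3, 1, 1, 0, 0⟩, ⟨432, 4, 2, 0, 0, 0⟩]⟩, ⟨[⟨2, 2, 0, 1, 0, 0⟩, ⟨-24, 3, 1, 1, 0, 0⟩]⟩,
        ⟨[⟨-12, 2, 1, 0, 1, 0⟩]⟩, ⟨[⟨-12, 2, 1, 0, 1, 0⟩]⟩, 0, 0, 0],
      ![⟨[⟨2, 2, 0, 0, 0, 0⟩, ⟨-48, 3, 1, 0, 0, 0⟩, ⟨288, 4, 2, 0, 0, 0⟩]⟩, ⟨[⟨-1, 0, 0, 0, 2, 0⟩,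
        ⟨-1, 2, 0, 1, 0, 0⟩, ⟨12, 3, 1, 1, 0, 0⟩]⟩, 0, 0, 0, ⟨[⟨-12, 2, 1, 0, 1, 0⟩]⟩, 0],
      ![⟨[⟨-24, 2, 1, 0, 1, 0⟩]⟩, 0, ⟨[⟨-1, 0, 0, 0, 2, 0⟩, ⟨-1, 2, 0, 1, 0, 0⟩, ⟨-36, 3, 1, 0, 0,
        0⟩, ⟨12, 3, 1, 1, 0, 0⟩, ⟨504, 4, 2, 0, 0, 0⟩]⟩, ⟨[⟨-24, 3, 1, 0, 0, 0⟩, ⟨216, 4, 2, 0, 0,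
        0⟩]⟩, ⟨[⟨24, 3, 1, 0, 0, 0⟩]⟩, 0, 0],
      ![⟨[⟨-24, 2, 1, 0, 1, 0⟩]⟩, 0, ⟨[⟨-24, 3, 1, 0, 0, 0⟩, ⟨216, 4, 2, 0, 0, 0⟩]⟩, ⟨[⟨-1, 0, 0,
        0, 2, 0⟩, ⟨-4, 2, 0, 0, 0, 0⟩, ⟨-1, 2, 0, 1, 0, 0⟩, ⟨60, 3, 1, 0, 0, 0⟩, ⟨12, 3, 1, 1, 0,
        0⟩, ⟨-72, 4, 2, 0, 0, 0⟩]⟩, ⟨[⟨4, 2, 0, 0, 0, 0⟩, ⟨-72, 3, 1, 0, 0, 0⟩]⟩, ⟨[⟨4, 2, 0, 1,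
        0, 0⟩, ⟨-48, 3, 1, 1, 0, 0⟩]⟩, 0],
      ![0, 0, ⟨[⟨12, 3, 1, 0, 0, 0⟩, ⟨-288, 4, 2, 0, 0, 0⟩, ⟨1728, 5, 3, 0, 0, 0⟩]⟩, ⟨[⟨2, 2, 0,
        0, 0, 0⟩, ⟨-84, 3, 1, 0, 0, 0⟩, ⟨1152, 4, 2, 0, 0, 0⟩, ⟨-5184, 5, 3, 0, 0, 0⟩]⟩, ⟨[⟨-1, 0,
        0, 0, 2, 0⟩, ⟨-2, 2, 0, 0, 0, 0⟩, ⟨-1, 2, 0, 1, 0, 0⟩, ⟨60, 3, 1, 0, 0, 0⟩, ⟨12, 3, 1, 1,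
        0, 0⟩, ⟨-432, 4, 2, 0, 0, 0⟩]⟩, ⟨[⟨-2, 2, 0, 1, 0, 0⟩, ⟨48, 3, 1, 1, 0, 0⟩, ⟨-288, 4, 2,
        1, 0, 0⟩]⟩, 0],
      ![0, ⟨[⟨-12, 2, 1, 0, 1, 0⟩]⟩, 0, ⟨[⟨2, 2, 0, 0, 0, 0⟩, ⟨-48, 3, 1, 0, 0, 0⟩, ⟨288, 4, 2, 0,
        0, 0⟩]⟩, ⟨[⟨-2, 2, 0, 0, 0, 0⟩, ⟨24, 3, 1, 0, 0, 0⟩]⟩, ⟨[⟨-1, 0, 0, 0, 2, 0⟩, ⟨-4, 2, 0,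
        0, 0, 0⟩, ⟨-1, 2, 0, 1, 0, 0⟩, ⟨96, 3, 1, 0, 0, 0⟩, ⟨12, 3, 1, 1, 0, 0⟩, ⟨-576, 4, 2, 0,
        0, 0⟩]⟩, ⟨[⟨-2, 2, 0, 0, 0, 0⟩, ⟨1, 2, 0, 1, 0, 0⟩, ⟨24, 3, 1, 0, 0, 0⟩, ⟨-12, 3, 1, 1, 0,
        0⟩]⟩],
      ![0, 0, 0, 0, 0, ⟨[⟨4, 2, 0, 0, 0, 0⟩, ⟨-96, 3, 1, 0, 0, 0⟩, ⟨576, 4, 2, 0, 0, 0⟩]⟩, ⟨[⟨-1,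
        0, 0, 0, 2, 0⟩, ⟨2, 2, 0, 0, 0, 0⟩, ⟨-1, 2, 0, 1, 0, 0⟩, ⟨-36, 3, 1, 0, 0, 0⟩, ⟨12, 3, 1,
        1, 0, 0⟩, ⟨144, 4, 2, 0, 0, 0⟩]⟩]]
  W :=
    ![![pot 0, 0, (12 * x ^ 3 * u * B + 72 * x ^ 4 * u ^ 2) * (1 - 12 * u * x), 0, (-12 * x ^ 3 *
        u * B - 72 * x ^ 4 * u ^ 2) * (1 - 12 * u * x), 0, (-36 * x ^ 4 * u ^ 2 - 126 * x ^ 4 * u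
        ^ 2 * B) * (1 - 12 * u * x)],
      ![0, pot 1, 0, 0, 0, (20 * x ^ 3 * u * B) * (1 - 12 * u * x), 0],
      ![0, 0, pot 0, 0, 0, 0, (-12 * x ^ 3 * u * B - 72 * x ^ 4 * u ^ 2) * (1 - 12 * u * x)],
      ![0, 0, 0, pot 2, 0, 0, 0],
      ![0, 0, 0, 0, pot 0, 0, (12 * x ^ 3 * u * B + 72 * x ^ 4 * u ^ 2) * (1 - 12 * u * x)],
      ![0, 0, 0, 0, 0, pot 1, 0],
      ![0, 0, 0, 0, 0, 0, pot 0]]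
  a :=
    ![![⟨[⟨-48, 0, 1, 0, 3, 0⟩, ⟨-56, 1, 0, 1, 1, 0⟩, ⟨48, 2, 1, 0, 1, 0⟩, ⟨-48, 2, 1, 1, 1, 0⟩,
        ⟨288, 3, 2, 0, 1, 0⟩, ⟨-2880, 3, 2, 1, 1, 0⟩]⟩, ⟨[⟨32, 1, 0, 2, 1, 0⟩, ⟨96, 2, 1, 1, 1,
        0⟩, ⟨1152, 3, 2, 1, 1, 0⟩]⟩, ⟨[⟨-16, 0, 0, 1, 2, 0⟩, ⟨-432, 2, 2, 0, 2, 0⟩, ⟨-72, 3, 1, 1,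
        0, 0⟩, ⟨-3024, 4, 2, 1, 0, 0⟩, ⟨5184, 5, 3, 0, 0, 0⟩, ⟨19008, 5, 3, 1, 0, 0⟩, ⟨-20736, 6,
        4, 0, 0, 0⟩]⟩, ⟨[⟨8, 0, 0, 0, 2, 0⟩, ⟨-16, 0, 0, 1, 2, 0⟩, ⟨-144, 1, 1, 0, 2, 0⟩, ⟨-36, 2,
        0, 1, 0, 0⟩, ⟨144, 2, 2, 0, 2, 0⟩, ⟨-336, 3, 1, 1, 0, 0⟩, ⟨-192, 3, 1, 2, 0, 0⟩, ⟨1152, 4,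
        2, 0, 0, 0⟩, ⟨11952, 4, 2, 1, 0, 0⟩, ⟨2304, 4, 2, 2, 0, 0⟩, ⟨-15552, 5, 3, 0, 0, 0⟩,
        ⟨-60480, 5, 3, 1, 0, 0⟩, ⟨62208, 6, 4, 0, 0, 0⟩]⟩, ⟨[⟨16, 0, 0, 0, 2, 0⟩, ⟨-28, 0, 0, 1,
        2, 0⟩, ⟨48, 1, 1, 0, 2, 0⟩, ⟨36, 2, 0, 1, 0, 0⟩, ⟨552, 3, 1, 1, 0, 0⟩, ⟨192, 3, 1, 2, 0,
        0⟩, ⟨-1152, 4, 2, 0, 0, 0⟩, ⟨-12096, 4, 2, 1, 0, 0⟩, ⟨13824, 5, 3, 0, 0, 0⟩]⟩, ⟨[⟨8, 0, 0,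
        1, 2, 0⟩, ⟨144, 1, 1, 1, 2, 0⟩, ⟨24, 2, 0, 1, 0, 0⟩, ⟨24, 2, 0, 2, 0, 0⟩, ⟨-432, 3, 1, 1,
        0, 0⟩, ⟨1008, 3, 1, 2, 0, 0⟩, ⟨-1728, 4, 2, 1, 0, 0⟩, ⟨-10944, 4, 2, 2, 0, 0⟩, ⟨34560, 5,
        3, 1, 0, 0⟩]⟩, ⟨[⟨-4, 0, 0, 1, 2, 0⟩, ⟨2, 0, 0, 2, 2, 0⟩, ⟨12, 2, 0, 1, 0, 0⟩, ⟨-6, 2, 0,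
        2, 0, 0⟩, ⟨-72, 3, 1, 1, 0, 0⟩, ⟨228, 3, 1, 2, 0, 0⟩, ⟨-96, 3, 1, 3, 0, 0⟩, ⟨-1152, 4, 2,
        1, 0, 0⟩, ⟨576, 4, 2, 2, 0, 0⟩]⟩],
      ![⟨[⟨-24, 0, 1, 0, 3, 0⟩, ⟨-6, 1, 0, 1, 1, 0⟩, ⟨-10, 1, 0, 2, 1, 0⟩, ⟨-12, 2, 1, 0, 1, 0⟩,
        ⟨-228, 2, 1, 1, 1, 0⟩, ⟨120, 2, 1, 2, 1, 0⟩, ⟨-144, 3, 2, 0, 1, 0⟩]⟩, ⟨[⟨-12, 0, 1, 0, 3,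
        0⟩, ⟨10, 1, 0, 2, 1, 0⟩, ⟨12, 2, 1, 1, 1, 0⟩, ⟨120, 2, 1, 2, 1, 0⟩]⟩, ⟨[⟨-8, 0, 0, 1, 2,
        0⟩, ⟨36, 1, 1, 1, 2, 0⟩, ⟨-360, 2, 2, 0, 2, 0⟩, ⟨-60, 3, 1, 2, 0, 0⟩, ⟨-1080, 4, 2, 1, 0,
        0⟩, ⟨720, 4, 2, 2, 0, 0⟩, ⟨4320, 5, 3, 1, 0, 0⟩]⟩, ⟨[⟨-2, 0, 0, 1, 2, 0⟩, ⟨-12, 1, 1, 0,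
        2, 0⟩, ⟨-36, 1, 1, 1, 2, 0⟩, ⟨-30, 2, 0, 2, 0, 0⟩, ⟨-216, 2, 2, 0, 2, 0⟩, ⟨-240, 3, 1, 1,
        0, 0⟩, ⟨480, 3, 1, 2, 0, 0⟩, ⟨3240, 4, 2, 1, 0, 0⟩, ⟨-1440, 4, 2, 2, 0, 0⟩, ⟨-12960, 5, 3,
        1, 0, 0⟩]⟩, ⟨[⟨-6, 0, 0, 1, 2, 0⟩, ⟨12, 1, 1, 0, 2, 0⟩, ⟨30, 2, 0, 2, 0, 0⟩, ⟨240, 3, 1,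
        1, 0, 0⟩, ⟨-300, 3, 1, 2, 0, 0⟩, ⟨-2880, 4, 2, 1, 0, 0⟩]⟩, ⟨[⟨2, 0, 0, 1, 2, 0⟩, ⟨10, 0,
        0, 2, 2, 0⟩, ⟨-24, 1, 1, 0, 2, 0⟩, ⟨-12, 1, 1, 1, 2, 0⟩, ⟨20, 2, 0, 2, 0, 0⟩, ⟨20, 2, 0,
        3, 0, 0⟩, ⟨144, 2, 2, 0, 2, 0⟩, ⟨-120, 3, 1, 2, 0, 0⟩, ⟨-240, 3, 1, 3, 0, 0⟩]⟩, ⟨[⟨2, 0,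
        0, 1, 2, 0⟩, ⟨-1, 0, 0, 2, 2, 0⟩, ⟨-12, 1, 1, 0, 2, 0⟩, ⟨6, 1, 1, 1, 2, 0⟩, ⟨10, 2, 0, 2,
        0, 0⟩, ⟨-5, 2, 0, 3, 0, 0⟩, ⟨-60, 3, 1, 2, 0, 0⟩, ⟨30, 3, 1, 3, 0, 0⟩]⟩],
      ![⟨[⟨-16, 1, 0, 0, 1, 0⟩, ⟨16, 1, 0, 1, 1, 0⟩, ⟨-192, 2, 1, 0, 1, 0⟩, ⟨-192, 2, 1, 1, 1, 0⟩,
        ⟨-1152, 3, 2, 0, 1, 0⟩]⟩, ⟨[⟨16, 1, 0, 1, 1, 0⟩, ⟨-192, 2, 1, 1, 1, 0⟩]⟩, ⟨[⟨-12, 0, 0, 0,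
        2, 0⟩, ⟨-16, 0, 0, 1, 0, 0⟩, ⟨48, 1, 1, 0, 2, 0⟩, ⟨192, 1, 1, 1, 0, 0⟩, ⟨96, 3, 1, 1, 0,
        0⟩, ⟨-1728, 4, 2, 0, 0, 0⟩, ⟨-1152, 4, 2, 1, 0, 0⟩, ⟨6912, 5, 3, 0, 0, 0⟩]⟩, ⟨[⟨-4, 0, 0,
        0, 2, 0⟩, ⟨16, 0, 0, 1, 0, 0⟩, ⟨-48, 1, 1, 0, 2, 0⟩, ⟨-192, 1, 1, 1, 0, 0⟩, ⟨48, 2, 0, 1,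
        0, 0⟩, ⟨-384, 3, 1, 0, 0, 0⟩, ⟨-960, 3, 1, 1, 0, 0⟩, ⟨5184, 4, 2, 0, 0, 0⟩, ⟨4608, 4, 2,
        1, 0, 0⟩, ⟨-20736, 5, 3, 0, 0, 0⟩]⟩, ⟨[⟨-8, 0, 0, 0, 2, 0⟩, ⟨32, 0, 0, 1, 0, 0⟩, ⟨-48, 2,
        0, 1, 0, 0⟩, ⟨384, 3, 1, 0, 0, 0⟩, ⟨672, 3, 1, 1, 0, 0⟩, ⟨-4608, 4, 2, 0, 0, 0⟩]⟩, ⟨[⟨-16,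
        0, 0, 1, 2, 0⟩, ⟨-32, 2, 0, 1, 0, 0⟩, ⟨-32, 2, 0, 2, 0, 0⟩, ⟨1344, 3, 1, 1, 0, 0⟩, ⟨384,
        3, 1, 2, 0, 0⟩, ⟨-9216, 4, 2, 1, 0, 0⟩]⟩, ⟨[⟨-16, 2, 0, 1, 0, 0⟩, ⟨8, 2, 0, 2, 0, 0⟩,
        ⟨288, 3, 1, 1, 0, 0⟩, ⟨-144, 3, 1, 2, 0, 0⟩]⟩],
      ![⟨[⟨288, 0, 1, 0, 3, 0⟩, ⟨-8, 1, 0, 1, 1, 0⟩, ⟨4, 1, 0, 2, 1, 0⟩, ⟨-288, 2, 1, 0, 1, 0⟩,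
        ⟨480, 2, 1, 1, 1, 0⟩, ⟨-168, 2, 1, 2, 1, 0⟩, ⟨1728, 3, 2, 0, 1, 0⟩, ⟨-1728, 3, 2, 1, 1,
        0⟩, ⟨62208, 4, 3, 0, 1, 0⟩]⟩, ⟨[⟨576, 0, 1, 0, 3, 0⟩, ⟨-8, 1, 0, 2, 1, 0⟩, ⟨4, 1, 0, 3, 1,
        0⟩, ⟨192, 2, 1, 1, 1, 0⟩, ⟨-96, 2, 1, 2, 1, 0⟩, ⟨-3456, 3, 2, 1, 1, 0⟩]⟩, ⟨[⟨4, 0, 0, 1,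
        2, 0⟩, ⟨-2, 0, 0, 2, 2, 0⟩, ⟨4320, 2, 2, 0, 2, 0⟩, ⟨-96, 3, 1, 1, 0, 0⟩, ⟨12, 3, 1, 2, 0,
        0⟩, ⟨1728, 4, 2, 1, 0, 0⟩, ⟨-432, 4, 2, 2, 0, 0⟩]⟩, ⟨[⟨4, 0, 0, 1, 2, 0⟩, ⟨-2, 0, 0, 2, 2,
        0⟩, ⟨-288, 1, 1, 0, 2, 0⟩, ⟨-8, 2, 0, 1, 0, 0⟩, ⟨8, 2, 0, 2, 0, 0⟩, ⟨-2, 2, 0, 3, 0, 0⟩,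
        ⟨7776, 2, 2, 0, 2, 0⟩, ⟨144, 3, 1, 1, 0, 0⟩, ⟨-84, 3, 1, 2, 0, 0⟩, ⟨24, 3, 1, 3, 0, 0⟩,
        ⟨-432, 4, 2, 2, 0, 0⟩]⟩, ⟨[⟨288, 1, 1, 0, 2, 0⟩, ⟨8, 2, 0, 1, 0, 0⟩, ⟨-8, 2, 0, 2, 0, 0⟩,
        ⟨2, 2, 0, 3, 0, 0⟩, ⟨-240, 3, 1, 1, 0, 0⟩, ⟨48, 3, 1, 2, 0, 0⟩, ⟨1728, 4, 2, 1, 0, 0⟩]⟩,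
        ⟨[⟨16, 0, 0, 1, 2, 0⟩, ⟨-8, 0, 0, 2, 2, 0⟩, ⟨-576, 1, 1, 0, 2, 0⟩, ⟨-288, 1, 1, 1, 2, 0⟩,
        ⟨-16, 2, 0, 1, 0, 0⟩, ⟨16, 2, 0, 2, 0, 0⟩, ⟨-4, 2, 0, 3, 0, 0⟩, ⟨13824, 2, 2, 0, 2, 0⟩,
        ⟨672, 3, 1, 1, 0, 0⟩, ⟨-384, 3, 1, 2, 0, 0⟩, ⟨96, 3, 1, 3, 0, 0⟩, ⟨-9216, 4, 2, 1, 0, 0⟩,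
        ⟨1152, 4, 2, 2, 0, 0⟩, ⟨41472, 5, 3, 1, 0, 0⟩]⟩, ⟨[⟨24, 0, 0, 1, 2, 0⟩, ⟨-12, 0, 0, 2, 2,
        0⟩, ⟨-288, 1, 1, 0, 2, 0⟩, ⟨-288, 1, 1, 1, 2, 0⟩, ⟨-8, 2, 0, 1, 0, 0⟩, ⟨4, 2, 0, 2, 0, 0⟩,
        ⟨2, 2, 0, 3, 0, 0⟩, ⟨-1, 2, 0, 4, 0, 0⟩, ⟨10368, 2, 2, 0, 2, 0⟩, ⟨240, 3, 1, 1, 0, 0⟩,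
        ⟨-168, 3, 1, 2, 0, 0⟩, ⟨24, 3, 1, 3, 0, 0⟩, ⟨-1728, 4, 2, 1, 0, 0⟩, ⟨864, 4, 2, 2, 0,
        0⟩]⟩],
      ![⟨[⟨16, 1, 0, 0, 1, 0⟩, ⟨-16, 1, 0, 1, 1, 0⟩, ⟨192, 2, 1, 0, 1, 0⟩, ⟨192, 2, 1, 1, 1, 0⟩,
        ⟨1152, 3, 2, 0, 1, 0⟩]⟩, ⟨[⟨-16, 1, 0, 1, 1, 0⟩, ⟨192, 2, 1, 1, 1, 0⟩]⟩, ⟨[⟨12, 0, 0, 0,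
        2, 0⟩, ⟨-16, 0, 0, 1, 0, 0⟩, ⟨-48, 1, 1, 0, 2, 0⟩, ⟨192, 1, 1, 1, 0, 0⟩, ⟨-96, 3, 1, 1, 0,
        0⟩, ⟨1728, 4, 2, 0, 0, 0⟩, ⟨1152, 4, 2, 1, 0, 0⟩, ⟨-6912, 5, 3, 0, 0, 0⟩]⟩, ⟨[⟨4, 0, 0, 0,
        2, 0⟩, ⟨16, 0, 0, 1, 0, 0⟩, ⟨48, 1, 1, 0, 2, 0⟩, ⟨-192, 1, 1, 1, 0, 0⟩, ⟨-48, 2, 0, 1, 0,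
        0⟩, ⟨384, 3, 1, 0, 0, 0⟩, ⟨960, 3, 1, 1, 0, 0⟩, ⟨-5184, 4, 2, 0, 0, 0⟩, ⟨-4608, 4, 2, 1,
        0, 0⟩, ⟨20736, 5, 3, 0, 0, 0⟩]⟩, ⟨[⟨8, 0, 0, 0, 2, 0⟩, ⟨32, 0, 0, 1, 0, 0⟩, ⟨48, 2, 0, 1,
        0, 0⟩, ⟨-384, 3, 1, 0, 0, 0⟩, ⟨-672, 3, 1, 1, 0, 0⟩, ⟨4608, 4, 2, 0, 0, 0⟩]⟩, ⟨[⟨16, 0, 0,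
        1, 2, 0⟩, ⟨32, 2, 0, 1, 0, 0⟩, ⟨32, 2, 0, 2, 0, 0⟩, ⟨-1344, 3, 1, 1, 0, 0⟩, ⟨-384, 3, 1,
        2, 0, 0⟩, ⟨9216, 4, 2, 1, 0, 0⟩]⟩, ⟨[⟨16, 2, 0, 1, 0, 0⟩, ⟨-8, 2, 0, 2, 0, 0⟩, ⟨-288, 3,
        1, 1, 0, 0⟩, ⟨144, 3, 1, 2, 0, 0⟩]⟩],
      ![⟨[⟨-6, 1, 0, 1, 1, 0⟩, ⟨-288, 2, 1, 1, 1, 0⟩]⟩, ⟨[⟨12, 1, 0, 2, 1, 0⟩, ⟨-72, 2, 1, 1, 1,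
        0⟩]⟩, ⟨[⟨-6, 0, 0, 1, 2, 0⟩, ⟨-72, 3, 1, 1, 0, 0⟩]⟩, ⟨[⟨-6, 0, 0, 1, 2, 0⟩, ⟨-6, 2, 0, 1,
        0, 0⟩, ⟨-6, 2, 0, 2, 0, 0⟩, ⟨72, 3, 1, 2, 0, 0⟩]⟩, ⟨[⟨6, 2, 0, 1, 0, 0⟩, ⟨6, 2, 0, 2, 0,
        0⟩, ⟨-72, 3, 1, 1, 0, 0⟩]⟩, ⟨[⟨-6, 0, 0, 1, 2, 0⟩, ⟨-12, 2, 0, 1, 0, 0⟩, ⟨24, 2, 0, 2, 0,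
        0⟩, ⟨288, 3, 1, 1, 0, 0⟩, ⟨-144, 3, 1, 2, 0, 0⟩, ⟨-1728, 4, 2, 1, 0, 0⟩]⟩, ⟨[⟨-6, 2, 0, 1,
        0, 0⟩, ⟨9, 2, 0, 2, 0, 0⟩, ⟨-3, 2, 0, 3, 0, 0⟩, ⟨72, 3, 1, 1, 0, 0⟩, ⟨-36, 3, 1, 2, 0,
        0⟩]⟩],
      ![⟨[⟨-32, 1, 0, 0, 1, 0⟩, ⟨-576, 2, 1, 0, 1, 0⟩]⟩, ⟨[⟨32, 1, 0, 1, 1, 0⟩]⟩, ⟨[⟨-16, 0, 0, 0,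
        2, 0⟩, ⟨-288, 3, 1, 0, 0, 0⟩, ⟨1152, 4, 2, 0, 0, 0⟩]⟩, ⟨[⟨-16, 0, 0, 0, 2, 0⟩, ⟨-64, 2, 0,
        0, 0, 0⟩, ⟨-16, 2, 0, 1, 0, 0⟩, ⟨864, 3, 1, 0, 0, 0⟩, ⟨192, 3, 1, 1, 0, 0⟩, ⟨-3456, 4, 2,
        0, 0, 0⟩]⟩, ⟨[⟨64, 2, 0, 0, 0, 0⟩, ⟨16, 2, 0, 1, 0, 0⟩, ⟨-768, 3, 1, 0, 0, 0⟩]⟩, ⟨[⟨96, 2,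
        0, 1, 0, 0⟩, ⟨-768, 3, 1, 1, 0, 0⟩]⟩, ⟨[⟨16, 2, 0, 1, 0, 0⟩, ⟨-8, 2, 0, 2, 0, 0⟩]⟩]]
  b :=
    ![![⟨[⟨-32, 0, 0, 1, 1, 0⟩, ⟨48, 1, 1, 0, 1, 0⟩, ⟨-288, 2, 2, 0, 1, 0⟩]⟩, ⟨[⟨24, 0, 0, 1, 1,
        0⟩, ⟨-48, 1, 1, 1, 1, 0⟩]⟩, ⟨[⟨-24, 0, 1, 0, 2, 0⟩, ⟨-1152, 3, 2, 1, 0, 0⟩, ⟨1728, 4, 3,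
        0, 0, 0⟩]⟩, ⟨[⟨-24, 0, 1, 0, 2, 0⟩, ⟨-12, 1, 0, 1, 0, 0⟩, ⟨-312, 2, 1, 1, 0, 0⟩, ⟨576, 3,
        2, 0, 0, 0⟩, ⟨4320, 3, 2, 1, 0, 0⟩, ⟨-5184, 4, 3, 0, 0, 0⟩]⟩, ⟨[⟨12, 1, 0, 1, 0, 0⟩, ⟨456,
        2, 1, 1, 0, 0⟩, ⟨-576, 3, 2, 0, 0, 0⟩]⟩, ⟨[⟨24, 1, 0, 1, 0, 0⟩, ⟨-144, 2, 1, 1, 0, 0⟩,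
        ⟨384, 2, 1, 2, 0, 0⟩, ⟨-2304, 3, 2, 1, 0, 0⟩]⟩, ⟨[⟨12, 1, 0, 1, 0, 0⟩, ⟨-6, 1, 0, 2, 0,
        0⟩, ⟨72, 2, 1, 1, 0, 0⟩, ⟨-36, 2, 1, 2, 0, 0⟩]⟩],
      ![⟨[⟨-10, 0, 0, 1, 1, 0⟩, ⟨-12, 1, 1, 0, 1, 0⟩]⟩, ⟨[⟨-4, 0, 0, 1, 1, 0⟩, ⟨10, 0, 0, 2, 1,
        0⟩, ⟨60, 1, 1, 1, 1, 0⟩]⟩, ⟨[⟨-12, 0, 1, 0, 2, 0⟩, ⟨-360, 3, 2, 1, 0, 0⟩]⟩, ⟨[⟨-12, 0, 1,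
        0, 2, 0⟩, ⟨-10, 1, 0, 2, 0, 0⟩, ⟨-120, 2, 1, 1, 0, 0⟩, ⟨120, 2, 1, 2, 0, 0⟩, ⟨1080, 3, 2,
        1, 0, 0⟩]⟩, ⟨[⟨10, 1, 0, 2, 0, 0⟩, ⟨120, 2, 1, 1, 0, 0⟩]⟩, ⟨[⟨-12, 0, 1, 0, 2, 0⟩, ⟨20, 1,
        0, 2, 0, 0⟩, ⟨-120, 2, 1, 2, 0, 0⟩]⟩, ⟨[⟨10, 1, 0, 2, 0, 0⟩, ⟨-5, 1, 0, 3, 0, 0⟩]⟩],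
      ![⟨[⟨-16, 0, 0, 0, 1, 0⟩]⟩, ⟨[⟨-16, 0, 0, 1, 1, 0⟩]⟩, ⟨[⟨-576, 3, 2, 0, 0, 0⟩]⟩, ⟨[⟨16, 1,
        0, 1, 0, 0⟩, ⟨-192, 2, 1, 0, 0, 0⟩, ⟨-192, 2, 1, 1, 0, 0⟩, ⟨1728, 3, 2, 0, 0, 0⟩]⟩,
        ⟨[⟨-16, 1, 0, 1, 0, 0⟩, ⟨192, 2, 1, 0, 0, 0⟩]⟩, ⟨[⟨-32, 1, 0, 1, 0, 0⟩, ⟨576, 2, 1, 1, 0,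
        0⟩]⟩, ⟨[⟨-16, 1, 0, 1, 0, 0⟩, ⟨8, 1, 0, 2, 0, 0⟩]⟩],
      ![⟨[⟨8, 0, 0, 1, 1, 0⟩, ⟨-4, 0, 0, 2, 1, 0⟩, ⟨-288, 1, 1, 0, 1, 0⟩, ⟨5184, 2, 2, 0, 1, 0⟩]⟩,
        ⟨[⟨16, 0, 0, 1, 1, 0⟩, ⟨-8, 0, 0, 2, 1, 0⟩, ⟨-288, 1, 1, 1, 1, 0⟩]⟩, ⟨[⟨144, 0, 1, 0, 2,
        0⟩, ⟨-48, 2, 1, 1, 0, 0⟩, ⟨-12, 2, 1, 2, 0, 0⟩, ⟨864, 3, 2, 1, 0, 0⟩]⟩, ⟨[⟨144, 0, 1, 0,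
        2, 0⟩, ⟨-8, 1, 0, 1, 0, 0⟩, ⟨4, 1, 0, 2, 0, 0⟩, ⟨192, 2, 1, 1, 0, 0⟩, ⟨-60, 2, 1, 2, 0,
        0⟩, ⟨-864, 3, 2, 1, 0, 0⟩]⟩, ⟨[⟨8, 1, 0, 1, 0, 0⟩, ⟨-4, 1, 0, 2, 0, 0⟩, ⟨-144, 2, 1, 1, 0,
        0⟩]⟩, ⟨[⟨576, 0, 1, 0, 2, 0⟩, ⟨-16, 1, 0, 1, 0, 0⟩, ⟨4, 1, 0, 3, 0, 0⟩, ⟨480, 2, 1, 1, 0,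
        0⟩, ⟨-96, 2, 1, 2, 0, 0⟩, ⟨-3456, 3, 2, 1, 0, 0⟩]⟩, ⟨[⟨864, 0, 1, 0, 2, 0⟩, ⟨-8, 1, 0, 1,
        0, 0⟩, ⟨-4, 1, 0, 2, 0, 0⟩, ⟨4, 1, 0, 3, 0, 0⟩, ⟨144, 2, 1, 1, 0, 0⟩, ⟨-72, 2, 1, 2, 0,
        0⟩]⟩],
      ![⟨[⟨16, 0, 0, 0, 1, 0⟩]⟩, ⟨[⟨16, 0, 0, 1, 1, 0⟩]⟩, ⟨[⟨576, 3, 2, 0, 0, 0⟩]⟩, ⟨[⟨-16, 1, 0,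
        1, 0, 0⟩, ⟨192, 2, 1, 0, 0, 0⟩, ⟨192, 2, 1, 1, 0, 0⟩, ⟨-1728, 3, 2, 0, 0, 0⟩]⟩, ⟨[⟨16, 1,
        0, 1, 0, 0⟩, ⟨-192, 2, 1, 0, 0, 0⟩]⟩, ⟨[⟨32, 1, 0, 1, 0, 0⟩, ⟨-576, 2, 1, 1, 0, 0⟩]⟩,
        ⟨[⟨16, 1, 0, 1, 0, 0⟩, ⟨-8, 1, 0, 2, 0, 0⟩]⟩],
      ![⟨[⟨-12, 0, 0, 1, 1, 0⟩]⟩, ⟨[⟨-6, 0, 0, 1, 1, 0⟩]⟩, ⟨[⟨-36, 2, 1, 1, 0, 0⟩]⟩, ⟨[⟨-6, 1, 0,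
        1, 0, 0⟩, ⟨36, 2, 1, 1, 0, 0⟩]⟩, ⟨[⟨6, 1, 0, 1, 0, 0⟩]⟩, ⟨[⟨-12, 1, 0, 1, 0, 0⟩, ⟨12, 1,
        0, 2, 0, 0⟩, ⟨144, 2, 1, 1, 0, 0⟩]⟩, ⟨[⟨-6, 1, 0, 1, 0, 0⟩, ⟨3, 1, 0, 2, 0, 0⟩]⟩],
      ![⟨[⟨-32, 0, 0, 0, 1, 0⟩]⟩, 0, ⟨[⟨-96, 2, 1, 0, 0, 0⟩]⟩, ⟨[⟨-32, 1, 0, 0, 0, 0⟩, ⟨288, 2, 1,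
        0, 0, 0⟩]⟩, ⟨[⟨32, 1, 0, 0, 0, 0⟩]⟩, ⟨[⟨32, 1, 0, 1, 0, 0⟩]⟩, 0]]
  C :=
    ![![⟨[⟨512, 0, 0, 1, 4, 0⟩, ⟨-256, 0, 0, 2, 4, 0⟩]⟩, 0, ⟨[⟨-384, 0, 0, 1, 4, 0⟩, ⟨-1536, 0, 0,
        2, 2, 0⟩, ⟨1152, 0, 0, 2, 4, 0⟩, ⟨2560, 0, 0, 3, 2, 0⟩, ⟨-480, 0, 0, 3, 4, 0⟩, ⟨-896, 0,
        0, 4, 2, 0⟩]⟩, 0, ⟨[⟨384, 0, 0, 1, 4, 0⟩, ⟨-1536, 0, 0, 2, 2, 0⟩, ⟨-1152, 0, 0, 2, 4, 0⟩,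
        ⟨2560, 0, 0, 3, 2, 0⟩, ⟨480, 0, 0, 3, 4, 0⟩, ⟨-896, 0, 0, 4, 2, 0⟩]⟩, 0, ⟨[⟨-768, 0, 0, 1,
        4, 0⟩, ⟨4288, 0, 0, 2, 4, 0⟩, ⟨-3552, 0, 0, 3, 4, 0⟩, ⟨800, 0, 0, 4, 4, 0⟩]⟩],
      ![0, ⟨[⟨72, 0, 0, 2, 4, 0⟩, ⟨-36, 0, 0, 3, 4, 0⟩]⟩, 0, 0, 0, ⟨[⟨40, 0, 0, 2, 4, 0⟩, ⟨-412,
        0, 0, 3, 4, 0⟩, ⟨196, 0, 0, 4, 4, 0⟩]⟩, 0],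
      ![0, 0, ⟨[⟨256, 0, 0, 1, 4, 0⟩, ⟨-128, 0, 0, 2, 4, 0⟩, ⟨-4096, 0, 0, 3, 0, 0⟩, ⟨2048, 0, 0,
        4, 0, 0⟩]⟩, 0, ⟨[⟨-256, 0, 0, 1, 4, 0⟩, ⟨128, 0, 0, 2, 4, 0⟩, ⟨-4096, 0, 0, 3, 0, 0⟩,
        ⟨2048, 0, 0, 4, 0, 0⟩]⟩, 0, ⟨[⟨384, 0, 0, 1, 4, 0⟩, ⟨-1536, 0, 0, 2, 2, 0⟩, ⟨-1152, 0, 0,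
        2, 4, 0⟩, ⟨2560, 0, 0, 3, 2, 0⟩, ⟨480, 0, 0, 3, 4, 0⟩, ⟨-896, 0, 0, 4, 2, 0⟩]⟩],
      ![0, 0, 0, ⟨[⟨2304, 0, 0, 2, 4, 0⟩, ⟨-2304, 0, 0, 3, 4, 0⟩, ⟨576, 0, 0, 4, 4, 0⟩, ⟨-2985984,
        0, 2, 0, 6, 0⟩]⟩, 0, 0, 0],
      ![0, 0, ⟨[⟨-256, 0, 0, 1, 4, 0⟩, ⟨128, 0, 0, 2, 4, 0⟩, ⟨-4096, 0, 0, 3, 0, 0⟩, ⟨2048, 0, 0,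
        4, 0, 0⟩]⟩, 0, ⟨[⟨256, 0, 0, 1, 4, 0⟩, ⟨-128, 0, 0, 2, 4, 0⟩, ⟨-4096, 0, 0, 3, 0, 0⟩,
        ⟨2048, 0, 0, 4, 0, 0⟩]⟩, 0, ⟨[⟨-384, 0, 0, 1, 4, 0⟩, ⟨-1536, 0, 0, 2, 2, 0⟩, ⟨1152, 0, 0,
        2, 4, 0⟩, ⟨2560, 0, 0, 3, 2, 0⟩, ⟨-480, 0, 0, 3, 4, 0⟩, ⟨-896, 0, 0, 4, 2, 0⟩]⟩],
      ![0, 0, 0, 0, 0, ⟨[⟨72, 0, 0, 2, 4, 0⟩, ⟨-36, 0, 0, 3, 4, 0⟩]⟩, 0],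
      ![0, 0, 0, 0, 0, 0, ⟨[⟨512, 0, 0, 1, 4, 0⟩, ⟨-256, 0, 0, 2, 4, 0⟩]⟩]]
  Ci :=
    ![![⟨[⟨-2592, 0, 0, 2, 0, 0⟩]⟩, 0, ⟨[⟨486, 0, 0, 1, 2, 0⟩, ⟨-1944, 0, 0, 2, 0, 0⟩, ⟨-567, 0,
        0, 2, 2, 0⟩, ⟨4860, 0, 0, 3, 0, 0⟩]⟩, 0, ⟨[⟨486, 0, 0, 1, 2, 0⟩, ⟨1944, 0, 0, 2, 0, 0⟩,
        ⟨-567, 0, 0, 2, 2, 0⟩, ⟨-4860, 0, 0, 3, 0, 0⟩]⟩, 0, ⟨[⟨1944, 0, 0, 2, 0, 0⟩, ⟨-1620, 0, 0,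
        3, 0, 0⟩, ⟨14094, 0, 0, 4, 0, 0⟩]⟩],
      ![0, ⟨[⟨-18432, 0, 0, 1, 0, 0⟩]⟩, 0, 0, 0, ⟨[⟨10240, 0, 0, 1, 0, 0⟩, ⟨-100352, 0, 0, 2, 0,
        0⟩]⟩, 0],
      ![0, 0, ⟨[⟨81, 0, 0, 0, 4, 0⟩, ⟨-1296, 0, 0, 2, 0, 0⟩]⟩, 0, ⟨[⟨81, 0, 0, 0, 4, 0⟩, ⟨1296, 0,
        0, 2, 0, 0⟩]⟩, 0, ⟨[⟨486, 0, 0, 1, 2, 0⟩, ⟨1944, 0, 0, 2, 0, 0⟩, ⟨-567, 0, 0, 2, 2, 0⟩,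
        ⟨-4860, 0, 0, 3, 0, 0⟩]⟩],
      ![0, 0, 0, ⟨[⟨-2304, 0, 0, 3, 0, 0⟩, ⟨1152, 0, 0, 4, 0, 0⟩]⟩, 0, 0, 0],
      ![0, 0, ⟨[⟨81, 0, 0, 0, 4, 0⟩, ⟨1296, 0, 0, 2, 0, 0⟩]⟩, 0, ⟨[⟨81, 0, 0, 0, 4, 0⟩, ⟨-1296, 0,
        0, 2, 0, 0⟩]⟩, 0, ⟨[⟨486, 0, 0, 1, 2, 0⟩, ⟨-1944, 0, 0, 2, 0, 0⟩, ⟨-567, 0, 0, 2, 2, 0⟩,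
        ⟨4860, 0, 0, 3, 0, 0⟩]⟩],
      ![0, 0, 0, 0, 0, ⟨[⟨-18432, 0, 0, 1, 0, 0⟩]⟩, 0],
      ![0, 0, 0, 0, 0, 0, ⟨[⟨-2592, 0, 0, 2, 0, 0⟩]⟩]]
  den := 663552 * B ^ 3 * (B - 2) * w ^ 4
  ν := ![1, 1, 1, (B * (B - 2)) ^ 2 - 5184 * u ^ 2 * w ^ 2, 1, 1, 1]
  N := 0

/-- The even Lichnerowicz system in the Zerilli form. -/
def zerilliSys : System 7 where
  __ := lichEven
  W := fun i j => bif i == 3 && j == 3 then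
      (1 - 12 * u * x) * x ^ 2 * y ^ 2 * ((B - 2) * (B * (B - 2) + 36 * (B - 2) * u * x) +
        1296 * (B - 2) * u ^ 2 * x ^ 2 + 15552 * u ^ 3 * x ^ 3) + w ^ 2
    else lichEven.W i j
  a := fun i j => bif i == 3 then
      (![⟨[⟨-8, 1, 0, 0, 1, 1⟩, ⟨4, 1, 0, 1, 1, 1⟩, ⟨336, 2, 1, 0, 1, 1⟩, ⟨-168, 2, 1, 1, 1, 1⟩,
        ⟨-4320, 3, 2, 0, 1, 1⟩]⟩, ⟨[⟨-8, 1, 0, 1, 1, 1⟩, ⟨4, 1, 0, 2, 1, 1⟩, ⟨-96, 2, 1, 0, 1, 1⟩,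
        ⟨48, 2, 1, 1, 1, 1⟩]⟩, ⟨[⟨4, 0, 0, 0, 2, 1⟩, ⟨-2, 0, 0, 1, 2, 1⟩, ⟨-72, 1, 1, 0, 2, 1⟩,
        ⟨-96, 3, 1, 0, 0, 1⟩, ⟨12, 3, 1, 1, 0, 1⟩, ⟨1296, 4, 2, 0, 0, 1⟩, ⟨-432, 4, 2, 1, 0, 1⟩,
        ⟨-5184, 5, 3, 0, 0, 1⟩]⟩, ⟨[⟨4, 0, 0, 0, 2, 1⟩, ⟨-2, 0, 0, 1, 2, 1⟩, ⟨-72, 1, 1, 0, 2, 1⟩,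
        ⟨-8, 2, 0, 0, 0, 1⟩, ⟨8, 2, 0, 1, 0, 1⟩, ⟨-2, 2, 0, 2, 0, 1⟩, ⟨288, 3, 1, 0, 0, 1⟩, ⟨-156,
        3, 1, 1, 0, 1⟩, ⟨24, 3, 1, 2, 0, 1⟩, ⟨-3888, 4, 2, 0, 0, 1⟩, ⟨432, 4, 2, 1, 0, 1⟩, ⟨15552,
        5, 3, 0, 0, 1⟩]⟩, ⟨[⟨8, 2, 0, 0, 0, 1⟩, ⟨-8, 2, 0, 1, 0, 1⟩, ⟨2, 2, 0, 2, 0, 1⟩, ⟨-384, 3,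
        1, 0, 0, 1⟩, ⟨120, 3, 1, 1, 0, 1⟩, ⟨3456, 4, 2, 0, 0, 1⟩]⟩, ⟨[⟨16, 0, 0, 0, 2, 1⟩, ⟨-8, 0,
        0, 1, 2, 1⟩, ⟨-288, 1, 1, 0, 2, 1⟩, ⟨-16, 2, 0, 0, 0, 1⟩, ⟨16, 2, 0, 1, 0, 1⟩, ⟨-4, 2, 0,
        2, 0, 1⟩, ⟨384, 3, 1, 0, 0, 1⟩, ⟨-240, 3, 1, 1, 0, 1⟩, ⟨96, 3, 1, 2, 0, 1⟩, ⟨-2304, 4, 2,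
        0, 0, 1⟩, ⟨1152, 4, 2, 1, 0, 1⟩]⟩, ⟨[⟨24, 0, 0, 0, 2, 1⟩, ⟨-12, 0, 0, 1, 2, 1⟩, ⟨-432, 1,
        1, 0, 2, 1⟩, ⟨-8, 2, 0, 0, 0, 1⟩, ⟨4, 2, 0, 1, 0, 1⟩, ⟨2, 2, 0, 2, 0, 1⟩, ⟨-1, 2, 0, 3, 0,
        1⟩, ⟨96, 3, 1, 0, 0, 1⟩, ⟨-24, 3, 1, 1, 0, 1⟩, ⟨-12, 3, 1, 2, 0, 1⟩]⟩] : Fin 7 → RadPoly) j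
    else lichEven.a i j
  b := fun i j => bif i == 3 then
      (![⟨[⟨-4, 0, 0, 0, 1, 0⟩]⟩, ⟨[⟨-8, 0, 0, 0, 1, 0⟩]⟩, ⟨[⟨-48, 2, 1, 0, 0, 1⟩, ⟨-12, 2, 1, 1,
        0, 1⟩, ⟨432, 3, 2, 0, 0, 1⟩]⟩, ⟨[⟨-8, 1, 0, 0, 0, 1⟩, ⟨4, 1, 0, 1, 0, 1⟩, ⟨192, 2, 1, 0,
        0, 1⟩, ⟨-60, 2, 1, 1, 0, 1⟩, ⟨-1296, 3, 2, 0, 0, 1⟩]⟩, ⟨[⟨-4, 1, 0, 0, 0, 0⟩]⟩, ⟨[⟨-16, 1,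
        0, 0, 0, 1⟩, ⟨4, 1, 0, 2, 0, 1⟩, ⟨192, 2, 1, 0, 0, 1⟩, ⟨48, 2, 1, 1, 0, 1⟩]⟩, ⟨[⟨-8, 1, 0,
        0, 0, 1⟩, ⟨-4, 1, 0, 1, 0, 1⟩, ⟨4, 1, 0, 2, 0, 1⟩]⟩] : Fin 7 → RadPoly) j
    else lichEven.b i j
  C := fun i j => bif i == 3 && j == 3 then 576 * w ^ 4 else lichEven.C i j
  ν := fun _ => 1
  N := 4

end System

end

/-! ### The adjoint of an intertwiner -/

section

section Adjoint

variable {n : ℕ} {g : RatFun}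

/-- The intertwining relations of the adjoint operator. -/
theorem bar_of_morph {A B R₁ Rf R₀ W Γ : FunMatrix n} (hR : R₁ * Γ = Γ * R₁)
    (hΓ : dm g Γ = -(Γ * R₁)) (hR₀ : R₀ * Γ = Γ * Rf)
    (h₁ : 2 * dm g A + dm g (dm g B) - B * W =
      R₁ * (A + 2 * dm g B - R₁ * B) + dm g R₁ * B + Rf * B)
    (h₀ : dm g (dm g A) - A * W = Rf * (A + 2 * dm g B - R₁ * B) + dm g Rf * B)
    {q₀ q₁ t : FunMatrix n} (hq₀ : q₀ = Γ * (A + dm g B - R₁ * B)) (hq₁ : q₁ = Γ * -B)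
    (ht : t = q₀ + 2 * dm g q₁ + R₁ * q₁) :
    2 * dm g q₀ + dm g (dm g q₁) + R₁ * q₀ + R₁ * dm g q₁ + R₀ * q₁ = -(q₁ * W) ∧
      dm g (dm g q₀) + R₁ * dm g q₀ + R₀ * q₀ = -(t * W + q₁ * dm g W) := by
  -- Because DΓ = -ΓR₁, the factor Γ can be pulled out on the left of every term, and both claims
  -- become Γ times combinations of the transposed equations.
  have hd : ∀ X : FunMatrix n, dm g (Γ * X) = Γ * (dm g X - R₁ * X) := by
    intro X; rw [dm_mul, hΓ]; noncomm_ring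
  have hR' : ∀ X : FunMatrix n, R₁ * (Γ * X) = Γ * (R₁ * X) := by
    intro X; rw [← mul_assoc, hR, mul_assoc]
  have hR₀' : ∀ X : FunMatrix n, R₀ * (Γ * X) = Γ * (Rf * X) := by
    intro X; rw [← mul_assoc, hR₀, mul_assoc]
  have htwo : dm g (2 : FunMatrix n) = 0 := by
    rw [← one_add_one_eq_two, dm_add, dm_one, add_zero]
  -- In passing to the adjoint, the equation of order zero becomes the derivative of `h₁` minus
  -- `h₀`.
  have h₁' := congrArg (dm g) h₁
  simp only [dm_add, dm_sub, dm_mul, htwo, zero_mul, zero_add] at h₁'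
  subst hq₀ hq₁ ht
  simp only [hd, hR', hR₀', dm_add, dm_sub, dm_neg, dm_mul]
  constructor
  · rw [← sub_eq_zero] at h₁ ⊢
    have e : Γ * (2 * dm g A + dm g (dm g B) - B * W -
      (R₁ * (A + 2 * dm g B - R₁ * B) + dm g R₁ * B + Rf * B)) = 0 := by rw [h₁, mul_zero]
    rw [← e]
    noncomm_ring
  · rw [← sub_eq_zero] at h₀ h₁' ⊢
    have e := congrArg₂ (fun x y => Γ * (x - y)) h₁' h₀
    simp only [sub_zero, mul_zero] at e
    rw [← e]
    noncomm_ring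

end Adjoint

/-! ### Evaluation of polynomials at the parameters -/

/-- The values of `x, u, B, w, y`. -/
def vars (N : ℕ) (p : Params) : Fin 5 → RatFun :=
  ![r⁻¹, con (p.M / 6), con p.B, con (Complex.I * p.ω), if N = 0 then 0 else (zerilliFactor p)⁻¹]

/-- The values of `x, u, B, w, y` at `r = ∞`. -/
def vals (N : ℕ) (p : Params) : Fin 5 → ℂ :=
  ![0, p.M / 6, p.B, Complex.I * p.ω, if N = 0 then 0 else (p.B - 2)⁻¹]

/-- The parameters with the opposite frequency. -/
def Params.neg (p : Params) : Params := ⟨p.M, -p.ω, p.B⟩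

/-- If f were zero, differentiation would give 2M/r² = 0, hence M = 0, and then f = 1. -/
theorem Params.f_ne_zero (p : Params) : p.f ≠ 0 := by
  intro h
  have h1 := congrArg der h
  have h2 : p.f = 1 - con (2 * p.M) * r⁻¹ := by rw [Params.f, Params.f₁, div_eq_mul_inv]
  rw [h2, map_zero, map_sub, Derivation.leibniz, Derivation.leibniz_inv] at h1
  rw [h2] at h
  have hr := r_ne_zero
  simp [hr] at h1
  have hM : p.M = 0 := by
    by_contra hM
    exact con_ne_zero (mul_ne_zero two_ne_zero hM) h1
  simp [hM] at h

theorem Params.f_eq (p : Params) : p.f = 1 - 12 * con (p.M / 6) * r⁻¹ := by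
  rw [Params.f, Params.f₁, div_eq_mul_inv, con_div, con_mul, con_ofNat, con_ofNat]
  ring

theorem zerilliFactor_eq (p : Params) :
    zerilliFactor p = con p.B - 2 + 36 * con (p.M / 6) * r⁻¹ := by
  rw [zerilliFactor, Params.f₁, div_eq_mul_inv, con_div, con_mul, con_ofNat, con_ofNat, con_sub,
    con_ofNat]
  ring

/-- Only w = iω involves the frequency; in particular the Zerilli factor does not. -/
theorem ev_vars_negw (N : ℕ) (p : Params) (q : RadPoly) :
    q.negw.ev (vars N p) = q.ev (vars N p.neg) := by
  rw [RadPoly.ev_negw]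
  congr 1
  ext i
  fin_cases i <;> simp [vars, Params.neg, con_neg, zerilliFactor, Params.f₁]

theorem ev_vars_deriv (N : ℕ) (p : Params) (q : RadPoly) :
    q.deriv.ev (vars N p) = p.f * der (q.ev (vars N p)) := by
  refine RadPoly.ev_deriv (d := fun z => p.f * der z) _ (fun a b => by rw [map_add, mul_add])
    (fun a b => by simp only [Derivation.leibniz, smul_eq_mul]; ring) ?_ ?_ ?_ ?_ ?_ q
  · simp only [vars, Matrix.cons_val, Derivation.leibniz_inv, der_r, p.f_eq]
    simp only [inv_pow, smul_eq_mul]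
    ring
  · simp [vars]
  · simp [vars]
  · simp [vars]
  · simp only [vars, Matrix.cons_val]
    split
    · simp
    · rw [Derivation.leibniz_inv]
      conv_lhs => rw [zerilliFactor_eq]
      have h2 : (2 : RatFun) = con 2 := (con_ofNat 2).symm
      have h36 : (36 : RatFun) = con 36 := (con_ofNat 36).symm
      have e : der (con p.B - 2 + 36 * con (p.M / 6) * r⁻¹) =
          36 * con (p.M / 6) * -(r⁻¹ ^ 2) := by
        rw [h2, h36, ← con_mul]
        simp only [map_add, map_sub, der_con, Derivation.leibniz, Derivation.leibniz_inv, der_r,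
          smul_eq_mul, inv_pow]
        ring
      rw [e, ← zerilliFactor_eq, p.f_eq, smul_eq_mul, inv_pow]
      ring

theorem infty_lead_x : Place.infty.Lead 1 1 r⁻¹ := Place.infty.lead_t

theorem infty_lead_f (p : Params) : Place.infty.Lead 0 1 p.f := by
  rw [p.f_eq, ← con_ofNat 12, ← con_mul]
  have h := Place.infty.lead_one.sub
    ((infty_lead_x.con_mul (12 * (p.M / 6))).of_lt (by norm_num : (0 : ℤ) < 1))
  simpa using h

/-- The condition is needed for y alone, whose inverse takes the value 𝓑 - 2 at infinity. Systems
with N = 0 put y = 0. -/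
theorem infty_lead_vars {N : ℕ} {p : Params} (hN : N = 0 ∨ p.B ≠ 2) (i : Fin 5) :
    Place.infty.Lead 0 (vals N p i) (vars N p i) := by
  fin_cases i
  · exact infty_lead_x.of_lt (by norm_num)
  · exact Place.infty.lead_con _
  · exact Place.infty.lead_con _
  · exact Place.infty.lead_con _
  · simp only [vals, vars, Fin.reduceFinMk, Matrix.cons_val]
    split
    · exact Place.infty.lead_zero 0
    · next h =>
      have h0 : p.B - 2 ≠ 0 := sub_ne_zero.2 (hN.resolve_left h)
      have h1 : Place.infty.Lead 0 (p.B - 2) (zerilliFactor p) := by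
        rw [zerilliFactor_eq, ← con_ofNat 36, ← con_mul, ← con_ofNat 2, ← con_sub]
        have := (Place.infty.lead_con (p.B - 2)).add
          ((infty_lead_x.con_mul (36 * (p.M / 6))).of_lt (by norm_num : (0 : ℤ) < 1))
        simpa using this
      simpa using h1.inv h0

theorem Place.Lead.pow {P : Place} {n : ℤ} {c : ℂ} {z : RatFun} (h : P.Lead n c z) (k : ℕ) :
    P.Lead (k * n) (c ^ k) (z ^ k) := by
  induction k with
  | zero => simpa using P.lead_one
  | succ k ih =>
    rw [pow_succ, pow_succ]
    have := ih.mul h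
    rwa [show ((k + 1 : ℕ) : ℤ) * n = k * n + n by push_cast; ring]

theorem infty_lead_ev {N : ℕ} {p : Params} (hN : N = 0 ∨ p.B ≠ 2) (q : RadPoly) :
    Place.infty.Lead 0 (q.ev (vals N p)) (q.ev (vars N p)) := by
  unfold RadPoly.ev
  induction q.terms with
  | nil => exact Place.infty.lead_zero 0
  | cons t l ih =>
    rw [RadPoly.evList_cons, RadPoly.evList_cons]
    refine Place.Lead.add ?_ ih
    simp only [Term.ev]
    have h := fun i k => (infty_lead_vars hN i).pow k
    have := ((((h 0 t.i).mul (h 1 t.j)).mul (h 2 t.k)).mul (h 3 t.l)).mul (h 4 t.n)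
    have := this.con_mul t.c
    simpa [con_intCast] using this

theorem infty_ord_ev {N : ℕ} {p : Params} (hN : N = 0 ∨ p.B ≠ 2) {k : ℕ} {q : RadPoly}
    (hq : q.isOrd k = true) : Place.infty.Ord k (q.ev (vars N p)) := by
  unfold RadPoly.isOrd at hq
  unfold RadPoly.ev
  revert hq
  induction q.terms with
  | nil => exact fun _ => Place.ord_zero _
  | cons t l ih =>
    intro hq
    simp only [List.all_cons, Bool.and_eq_true, Bool.or_eq_true, beq_iff_eq, Nat.ble_eq] at hq
    rw [RadPoly.evList_cons]
    refine Place.Ord.add ?_ (ih hq.2)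
    rcases hq.1 with h0 | h0
    · simpa [Term.ev, h0] using Place.ord_zero _
    have h := fun i k => (infty_lead_vars hN i).pow k
    have h1 := (((infty_lead_x.pow t.i).mul (h 1 t.j)).mul (h 2 t.k)).mul (h 3 t.l)
    have h2 := ((h1.mul (h 4 t.n)).con_mul t.c).ord
    refine Place.Ord.of_le (n := t.i) ?_ (by exact_mod_cast h0)
    simpa [Term.ev, con_intCast, vars] using h2

end

/-! ### From polynomial identities to an equivalence diagram -/

section

theorem Place.Lead.zpow {P : Place} {n : ℤ} {c : ℂ} {z : RatFun} (h : P.Lead n c z) (hc : c ≠ 0)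
    (k : ℤ) : P.Lead (k * n) (c ^ k) (z ^ k) := by
  obtain ⟨m, rfl | rfl⟩ := k.eq_nat_or_neg
  · simpa using h.pow m
  · have := (h.pow m).inv (pow_ne_zero m hc)
    simpa using this

theorem diagonal_mul_eq_one {n : ℕ} {a b : Fin n → RatFun} (h : ∀ i, a i * b i = 1) :
    (Matrix.diagonal a : FunMatrix n) * Matrix.diagonal b = 1 := by
  rw [Matrix.diagonal_mul_diagonal, ← Matrix.diagonal_one]; congr 1; ext i; exact h i

theorem dm_diagonal {n : ℕ} (g : RatFun) (a : Fin n → RatFun) :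
    dm g (Matrix.diagonal a : FunMatrix n) = Matrix.diagonal fun i => g * der (a i) := by
  ext i j; by_cases h : i = j <;> simp [dm_apply, h]

theorem diagonal_comm {n : ℕ} (a b : Fin n → RatFun) :
    (Matrix.diagonal a : FunMatrix n) * Matrix.diagonal b = Matrix.diagonal b * Matrix.diagonal a := by
  rw [Matrix.diagonal_mul_diagonal, Matrix.diagonal_mul_diagonal]; congr 1; ext i; exact mul_comm _ _

theorem PMat.ev_d {n : ℕ} (N : ℕ) (p : Params) (A : PMat n) :
    A.d.ev (vars N p) = dm p.f (A.ev (vars N p)) := by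
  ext i j; exact ev_vars_deriv N p _

namespace System

variable {n : ℕ} (S : System n)

/-- The values of a matrix of polynomials. -/
def mat (p : Params) (A : PMat n) : FunMatrix n := A.ev (vars S.N p)

/-- The value of a polynomial. -/
def val (p : Params) (q : RadPoly) : RatFun := q.ev (vars S.N p)

theorem vars_x (N : ℕ) (p : Params) : vars N p 0 = r⁻¹ := rfl
theorem vars_u (N : ℕ) (p : Params) : vars N p 1 = con (p.M / 6) := rfl
theorem vars_B (N : ℕ) (p : Params) : vars N p 2 = con p.B := rfl
theorem vars_w (N : ℕ) (p : Params) : vars N p 3 = con (Complex.I * p.ω) := rfl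
theorem ev_zer (N : ℕ) (p : Params) : RadPoly.ev (vars N p) zer = zerilliFactor p := by
  simp only [zer, RadPoly.ev_add, RadPoly.ev_sub, RadPoly.ev_mul, RadPoly.ev_ofNat, RadPoly.ev_x,
    RadPoly.ev_u, RadPoly.ev_B, vars_x, vars_u, vars_B, zerilliFactor_eq]
theorem ev_f (N : ℕ) (p : Params) :
    RadPoly.ev (vars N p) (1 - 12 * RadPoly.u * RadPoly.x) = p.f := by
  simp only [RadPoly.ev_one, RadPoly.ev_sub, RadPoly.ev_mul, RadPoly.ev_ofNat, RadPoly.ev_x,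
    RadPoly.ev_u, vars_x, vars_u, Params.f_eq]

/-- The inverse of the matrix of leading coefficients. -/
def Γ (p : Params) : FunMatrix n :=
  Matrix.diagonal fun i => S.val p (S.κi i) / S.val p S.δ * p.f ^ (-(S.e i : ℤ))

/-- The diagonal matrix of the scales `1/ν`. -/
def scale (p : Params) : FunMatrix n := Matrix.diagonal fun i => (S.val p (S.ν i))⁻¹

/-- The coefficient data of the equivalence, for components rescaled by `f^pw/r` and a triangular
system with diagonal coefficients `lam`. -/
def hat (pw : Fin n → ℕ) (lam : Fin n → ℂ) (p : Params) : Hat n where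
  a := S.scale p * S.mat p S.a
  b := S.scale p * S.mat p S.b
  q₀ := S.Γ p * S.mat p S.c₀
  q₁ := S.Γ p * S.mat p S.c₁
  R₁ := S.mat p S.R₁
  R₀ := S.mat p S.R
  W := S.mat p S.W
  L := Matrix.diagonal fun i => con (1 / 2) * S.val p (S.κ i) * r * p.f ^ ((S.e i : ℤ) - 1 - pw i)
  Li := Matrix.diagonal fun i =>
    S.val p (S.κi i) / S.val p S.δ * r⁻¹ * p.f ^ (-((S.e i : ℤ) - 1 - pw i))
  S := Matrix.diagonal fun i => r⁻¹ * p.f ^ pw i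
  Si := Matrix.diagonal fun i => r * p.f ^ (-(pw i : ℤ))
  U := Matrix.diagonal fun i => con (lam i) / p.f
  Ui := Matrix.diagonal fun i => p.f / con (lam i)
  C := S.scale p * ((S.val p S.δ)⁻¹ • S.mat p S.C)
  Ci := (S.val p S.δ / S.val p S.den) • S.mat p S.Ci

variable {S} {p : Params}

theorem isZ_mat (hN : S.N = 0 ∨ zerilliFactor p ≠ 0) {A : PMat n} (h : S.IsZ A) :
    S.mat p A = 0 := by
  ext i j
  refine RadPoly.ev_eq_zero_of_isZeroY _ ?_ (h i j)
  by_cases h0 : S.N = 0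
  · exact Or.inl h0
  · right
    rw [ev_zer]
    simp [vars, h0, hN.resolve_left h0]

theorem isZ₀_mat (hN : S.N = 0 ∨ p.B ≠ 2) {A : PMat n} (h : S.IsZ₀ A) :
    A.ev (vals S.N p) = 0 := by
  ext i j
  refine RadPoly.ev_eq_zero_of_isZeroY _ ?_ (h i j)
  by_cases h0 : S.N = 0
  · exact Or.inl h0
  · right
    have h1 : (vals S.N p) 4 = (p.B - 2)⁻¹ := by simp [vals, h0]
    have h2 : (vals S.N p) 2 = p.B := rfl
    rw [RadPoly.ev_sub, RadPoly.ev_B, RadPoly.ev_ofNat, h1, h2,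
      mul_inv_cancel₀ (sub_ne_zero.2 (hN.resolve_left h0))]

theorem zerilliFactor_ne_zero (h : p.B ≠ 2) : zerilliFactor p ≠ 0 := by
  have h0 : p.B - 2 ≠ 0 := sub_ne_zero.2 h
  have h1 : Place.infty.Lead 0 (p.B - 2) (zerilliFactor p) := by
    rw [zerilliFactor_eq, ← con_ofNat 36, ← con_mul, ← con_ofNat 2, ← con_sub]
    have := (Place.infty.lead_con (p.B - 2)).add
      ((infty_lead_x.con_mul (36 * (p.M / 6))).of_lt (by norm_num : (0 : ℤ) < 1))
    simpa using this
  intro h2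
  rw [h2] at h1
  exact h0 h1.eq_zero

theorem mat_d (A : PMat n) : S.mat p A.d = dm p.f (S.mat p A) := PMat.ev_d _ _ _
theorem mat_add (A A' : PMat n) : S.mat p (A + A') = S.mat p A + S.mat p A' := PMat.ev_add _ _ _
theorem mat_sub (A A' : PMat n) : S.mat p (A - A') = S.mat p A - S.mat p A' := PMat.ev_sub _ _ _
theorem mat_mul (A A' : PMat n) : S.mat p (A * A') = S.mat p A * S.mat p A' := PMat.ev_mul _ _ _
theorem mat_diag (a : Fin n → RadPoly) :
    S.mat p (.diag a) = Matrix.diagonal fun i => S.val p (a i) := PMat.ev_diag _ _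

theorem dval {q : RadPoly} (h : q.deriv.isZero = true) : der (S.val p q) = 0 := by
  have h1 := RadPoly.ev_eq_zero (vars S.N p) h
  rw [ev_vars_deriv] at h1
  exact (mul_eq_zero.1 h1).resolve_left p.f_ne_zero

/-- The transposed matrix with the components in the opposite order. -/
def tr (A : FunMatrix n) : FunMatrix n := Matrix.of fun i j => A j.rev i

theorem tr_add (A A' : FunMatrix n) : tr (A + A') = tr A + tr A' := rfl
theorem tr_sub (A A' : FunMatrix n) : tr (A - A') = tr A - tr A' := rfl
-- The reversal in `tr` affects only the index belonging to the triangular side. Matrices of the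
-- wave side are therefore simply transposed, whereas W is reflected in the antidiagonal, as in
-- `tr_mul'`.
theorem tr_mul (A A' : FunMatrix n) : tr (A * A') = A'.transpose * tr A := by
  ext i j
  simp [tr, Matrix.mul_apply, mul_comm]
theorem tr_mul' {A A' A'' : FunMatrix n} (h : ∀ i j, A (Fin.rev j) (Fin.rev i) = A'' i j) :
    tr (A * A') = tr A' * A'' := by
  ext i j
  simp only [tr, Matrix.mul_apply, Matrix.of_apply]
  refine Fintype.sum_equiv Fin.revPerm _ _ fun k => ?_
  have := h k.rev j
  rw [Fin.rev_rev] at this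
  simp [this, mul_comm]

theorem R₁_eq (S : System n) (p : Params) : S.mat p S.R₁ =
    Matrix.diagonal fun i => (S.e i : RatFun) * (12 * con (p.M / 6) * r⁻¹ ^ 2) := by
  rw [R₁, mat_diag]
  congr 1
  ext1 i
  simp [val, RadPoly.ev, RadPoly.evList, Term.ev, vars]
  ring

/-- The constants κ and δ are killed by the derivation, so only f^(-e) contributes, and D f = f f'.
In other words R₁ is the logarithmic derivative of the leading coefficients, as for an operator
G⁻¹DGD. -/
theorem dΓ (hv : S.Valid) :
    dm p.f (S.Γ p) = -(S.Γ p * S.mat p S.R₁) := by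
  rw [R₁_eq, Γ, dm_diagonal, Matrix.diagonal_mul_diagonal]
  refine Eq.trans ?_ (Matrix.diagonal_neg _).symm
  congr 1
  ext1 i
  rw [Derivation.leibniz, Derivation.leibniz_zpow, Derivation.leibniz_div, dval hv.dδ, dval (hv.dκi i)]
  have hf : der p.f = 12 * con (p.M / 6) * r⁻¹ ^ 2 := by
    rw [p.f_eq, ← con_ofNat 12, ← con_mul]
    simp only [map_sub, Derivation.map_one_eq_zero, Derivation.leibniz, Derivation.leibniz_inv,
      der_r, der_con, smul_eq_mul, inv_pow]
    ring
  rw [hf]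
  simp only [smul_eq_mul, zsmul_eq_mul, mul_zero, sub_zero, add_zero, Int.cast_neg, Int.cast_natCast]
  rw [zpow_sub_one₀ p.f_ne_zero]
  have := p.f_ne_zero
  field_simp

/-- The polynomial identities give an equivalence diagram. -/
theorem Valid.isHat (hv : S.Valid)
    {pw : Fin n → ℕ} {lam : Fin n → ℂ} (hN : S.N = 0 ∨ p.B ≠ 2) (hω : p.ω ≠ 0)
    (hδ : S.val p S.δ ≠ 0) (hden : S.val p S.den ≠ 0) (hν : ∀ i, S.val p (S.ν i) ≠ 0)
    (hlam : ∀ i, lam i ≠ 0) : (S.hat pw lam p).IsHat p.f := by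
  have hf := p.f_ne_zero
  have hN' : S.N = 0 ∨ zerilliFactor p ≠ 0 := hN.imp_right zerilliFactor_ne_zero
  have hNn : S.N = 0 ∨ zerilliFactor p.neg ≠ 0 :=
    hN.imp_right fun h => zerilliFactor_ne_zero (p := p.neg) h
  have hκκ : ∀ i, S.val p (S.κ i) * S.val p (S.κi i) = 2 * S.val p S.δ := fun i => by
    have := RadPoly.ev_eq_zero (vars S.N p) (hv.κ_mul i)
    rw [RadPoly.ev_sub, RadPoly.ev_mul, RadPoly.ev_mul, RadPoly.ev_ofNat, sub_eq_zero] at this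
    exact this
  have hκ0 : ∀ i, S.val p (S.κ i) ≠ 0 := fun i h => by
    have h1 := hκκ i
    rw [h, zero_mul] at h1
    exact mul_ne_zero two_ne_zero hδ h1.symm
  have hκi0 : ∀ i, S.val p (S.κi i) ≠ 0 := fun i h => by
    have h1 := hκκ i
    rw [h, mul_zero] at h1
    exact mul_ne_zero two_ne_zero hδ h1.symm
  have hr := r_ne_zero
  set K := S.scale p with hK
  have hdK : dm p.f K = 0 := by
    rw [hK, scale, dm_diagonal, ← Matrix.diagonal_zero]
    congr 1
    ext1 i
    simp [Derivation.leibniz_inv, dval (hv.dν i)]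
  have hdK' : ∀ X, dm p.f (K * X) = K * dm p.f X := fun X => by
    rw [dm_mul, hdK, zero_mul, zero_add]
  have hKν : K * Matrix.diagonal (fun i => S.val p (S.ν i)) = 1 :=
    diagonal_mul_eq_one fun i => inv_mul_cancel₀ (hν i)
  have hKW : K * S.mat p S.W = S.mat p S.W * K := by
    have h1 := isZ_mat hN' hv.ν_comm
    rw [mat_sub, mat_mul, mat_mul, mat_diag, sub_eq_zero] at h1
    have h2 := mul_eq_one_comm.1 hKν
    calc K * S.mat p S.W = K * (S.mat p S.W * Matrix.diagonal (fun i => S.val p (S.ν i))) * K := by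
          rw [mul_assoc, mul_assoc, h2, mul_one]
      _ = (K * Matrix.diagonal (fun i => S.val p (S.ν i))) * S.mat p S.W * K := by
          rw [← h1]; simp only [mul_assoc]
      _ = _ := by rw [hKν, one_mul]
  have hCW : S.mat p S.C * S.mat p S.W = S.mat p S.W * S.mat p S.C := by
    have h1 := isZ_mat hN' hv.C_comm
    rwa [mat_sub, mat_mul, mat_mul, sub_eq_zero] at h1
  have hCC : S.mat p S.C * S.mat p S.Ci =
      S.val p S.den • Matrix.diagonal (fun i => S.val p (S.ν i)) := by
    have h1 := isZ_mat hN' hv.C_mul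
    rw [mat_sub, mat_mul, mat_diag, sub_eq_zero] at h1
    rw [h1]
    ext i j
    by_cases h : i = j <;> simp [h, val]
  -- The intertwining equations are kept for all parameters since they are used twice: at `p` for P,
  -- and at the opposite frequency for its adjoint.
  have m₁ : ∀ p : Params, (S.N = 0 ∨ zerilliFactor p ≠ 0) →
      2 * dm p.f (S.mat p S.a) + dm p.f (dm p.f (S.mat p S.b)) - S.mat p S.W * S.mat p S.b =
      S.mat p S.s * S.mat p S.R₁ + S.mat p S.b * dm p.f (S.mat p S.R₁) +
        S.mat p S.b * S.mat p S.R := fun p hp => by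
    have h1 := isZ_mat hp hv.morph₁
    simp only [mat_sub, mat_add, mat_mul, mat_d] at h1
    rw [two_mul, ← sub_eq_zero, ← h1]
    abel
  have m₀ : ∀ p : Params, (S.N = 0 ∨ zerilliFactor p ≠ 0) →
      dm p.f (dm p.f (S.mat p S.a)) - S.mat p S.W * S.mat p S.a =
      S.mat p S.s * S.mat p S.R + S.mat p S.b * dm p.f (S.mat p S.R) := fun p hp => by
    have h1 := isZ_mat hp hv.morph₀
    simp only [mat_sub, mat_mul, mat_d] at h1
    rw [← sub_eq_zero, ← h1]
    abel
  have hs : ∀ p : Params, S.mat p S.s = S.mat p S.a + 2 * dm p.f (S.mat p S.b) -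
      S.mat p S.b * S.mat p S.R₁ := fun p => by
    simp only [s, mat_sub, mat_add, mat_mul, mat_d, two_mul]; abel
  -- the adjoint
  have hfneg : p.neg.f = p.f := rfl
  have hc₁ : S.mat p S.c₁ = -tr (S.mat p.neg S.b) := by
    ext i j
    change RadPoly.ev (vars S.N p) (-(S.b j.rev i).negw) = _
    rw [RadPoly.ev_neg, ev_vars_negw]
    rfl
  have hc₀ : S.mat p S.c₀ = tr (S.mat p.neg S.s) - dm p.f (tr (S.mat p.neg S.b)) := by
    ext i j
    change RadPoly.ev (vars S.N p) (RadPoly.negw _) = _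
    rw [ev_vars_negw, RadPoly.ev_sub, ev_vars_deriv]
    rfl
  have hR₁neg : S.mat p.neg S.R₁ = S.mat p S.R₁ := by rw [R₁_eq, R₁_eq]; rfl
  have hR₁T : (S.mat p S.R₁).transpose = S.mat p S.R₁ := by rw [R₁_eq, Matrix.diagonal_transpose]
  have hW : ∀ i j, S.mat p.neg S.W (Fin.rev j) (Fin.rev i) = S.mat p S.W i j := fun i j => by
    have h1 := RadPoly.ev_eq_zero (vars S.N p.neg) (hv.W_symm i j)
    rw [RadPoly.ev_sub, ev_vars_negw, sub_eq_zero] at h1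
    have h2 : p.neg.neg = p := by simp [Params.neg]
    rw [h2] at h1
    exact h1
  set A := tr (S.mat p.neg S.a)
  set Bt := tr (S.mat p.neg S.b)
  set Rf := (S.mat p.neg S.R).transpose with hRf
  have hts : tr (S.mat p.neg S.s) = A + 2 * dm p.f Bt - S.mat p S.R₁ * Bt := by
    rw [hs, two_mul, two_mul, tr_sub, tr_add, tr_add, tr_mul, hR₁neg, hR₁T]; rfl
  -- The equation at frequency -ω, transposed; the antidiagonal symmetry of W brings back the
  -- frequency ω.
  have hT₁ : 2 * dm p.f A + dm p.f (dm p.f Bt) - Bt * S.mat p S.W = S.mat p S.R₁ *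
      (A + 2 * dm p.f Bt - S.mat p S.R₁ * Bt) + dm p.f (S.mat p S.R₁) * Bt + Rf * Bt := by
    have h1 := congrArg tr (m₁ p.neg hNn)
    rw [two_mul, tr_sub, tr_add, tr_add, tr_add, tr_add, tr_mul' hW, tr_mul, tr_mul, tr_mul, hts,
      hR₁neg, hR₁T] at h1
    rw [two_mul]
    refine h1.trans ?_
    congr 3
    ext i j
    rw [Matrix.transpose_apply, hfneg, dm_apply, dm_apply, R₁_eq]
    by_cases h : i = j
    · rw [h]
    · rw [Matrix.diagonal_apply_ne _ h, Matrix.diagonal_apply_ne _ (Ne.symm h)]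
  have hT₀ : dm p.f (dm p.f A) - A * S.mat p S.W =
      Rf * (A + 2 * dm p.f Bt - S.mat p S.R₁ * Bt) + dm p.f Rf * Bt := by
    have h1 := congrArg tr (m₀ p.neg hNn)
    rw [tr_sub, tr_add, tr_mul' hW, tr_mul, tr_mul, hts] at h1
    exact h1
  have hRΓ : S.mat p S.R₁ * S.Γ p = S.Γ p * S.mat p S.R₁ := by
    rw [R₁_eq, Γ, diagonal_comm]
  -- This is the symmetry of Γ⁻¹R under transposition with ω ↦ -ω, that is, the formal symmetry of
  -- the wave operator.
  have hRfΓ : S.mat p S.R * S.Γ p = S.Γ p * Rf := by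
    ext i j
    rw [Γ, Matrix.mul_diagonal, Matrix.diagonal_mul, hRf, Matrix.transpose_apply]
    have h1 := RadPoly.ev_eq_zero (vars S.N p) (hv.symm i j)
    rw [RadPoly.ev_sub, RadPoly.ev_mul, RadPoly.ev_mul, RadPoly.ev_mul, RadPoly.ev_mul,
      RadPoly.ev_pow, RadPoly.ev_pow, ev_f, ev_vars_negw, sub_eq_zero] at h1
    change S.val p (S.κ i) * _ * S.mat p S.R i j =
      S.val p (S.κ j) * _ * S.mat p.neg S.R j i at h1
    have hi := hκκ i
    have hj := hκκ j
    have k1 : S.val p (S.κi j) = 2 * S.val p S.δ / S.val p (S.κ j) := by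
      rw [eq_div_iff (hκ0 j), mul_comm, hj]
    have k2 : S.val p (S.κi i) = 2 * S.val p S.δ / S.val p (S.κ i) := by
      rw [eq_div_iff (hκ0 i), mul_comm, hi]
    have k3 := hκ0 i
    have k4 := hκ0 j
    rw [k1, k2, zpow_neg, zpow_neg, zpow_natCast, zpow_natCast]
    field_simp
    linear_combination h1
  obtain ⟨hb₁, hb₀⟩ := bar_of_morph (q₀ := S.Γ p * S.mat p S.c₀) (q₁ := S.Γ p * S.mat p S.c₁)
    hRΓ (dΓ hv) hRfΓ hT₁ hT₀ (by rw [hc₀, hts, two_mul]; congr 1; abel) (by rw [hc₁]) rfl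
  -- values at infinity
  have hlead : ∀ X : PMat n, LeadM (X.ev (vals S.N p)) (S.mat p X) := fun X i j =>
    infty_lead_ev hN _
  have hval : ∀ q : RadPoly, Place.infty.Lead 0 (q.ev (vals S.N p)) (S.val p q) :=
    fun q => infty_lead_ev hN q
  -- A function with zero derivative that vanishes at infinity vanishes there to all orders, since
  -- the derivation detects every leading term of nonzero order. Hence a nonzero constant has a
  -- nonzero value at infinity.
  have hconst : ∀ q : RadPoly, q.deriv.isZero = true → S.val p q ≠ 0 →
      q.ev (vals S.N p) ≠ 0 := by
    intro q hq h0 h1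
    have h2 := (h1 ▸ hval q).exists_succ
    refine h0 (Place.eq_zero_of_ord (P := Place.infty) 1 fun m hm => ?_)
    induction m, hm using Int.leInduction with
    | base => exact h2
    | succ m hm ih => exact ih.succ_of_der (by omega) (by rw [dval hq, mul_zero]; exact Place.ord_zero _)
  set G₀ : Matrix (Fin n) (Fin n) ℂ := Matrix.diagonal fun i =>
    (S.κi i).ev (vals S.N p) * (S.δ.ev (vals S.N p))⁻¹ with hG₀
  have hΓ : LeadM G₀ (S.Γ p) := by
    intro i j
    by_cases h : i = j
    · subst h
      rw [hG₀, Γ, Matrix.diagonal_apply_eq, Matrix.diagonal_apply_eq, div_eq_mul_inv]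
      have := ((hval (S.κi i)).mul ((hval S.δ).inv (hconst _ hv.dδ hδ))).mul
        ((infty_lead_f p).zpow one_ne_zero (-(S.e i : ℤ)))
      simpa using this
    · rw [hG₀, Γ, Matrix.diagonal_apply_ne _ h, Matrix.diagonal_apply_ne _ h]
      exact Place.infty.lead_zero 0
  have hKlead : LeadM (Matrix.diagonal fun i => ((S.ν i).ev (vals S.N p))⁻¹) K := by
    intro i j
    by_cases h : i = j
    · subst h
      rw [hK, scale, Matrix.diagonal_apply_eq, Matrix.diagonal_apply_eq]
      simpa using (hval (S.ν i)).inv (hconst _ (hv.dν i) (hν i))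
    · rw [hK, scale, Matrix.diagonal_apply_ne _ h, Matrix.diagonal_apply_ne _ h]
      exact Place.infty.lead_zero 0
  have hat0 : ∀ X : PMat n, X.at0.ev (vals S.N p) = X.ev (vals S.N p) := fun X => by
    ext i j
    exact RadPoly.ev_at0 _ (by simp [vals]) _
  have hG₀' : G₀ = (S.δ.ev (vals S.N p))⁻¹ • (PMat.diag S.κi).ev (vals S.N p) := by
    rw [PMat.ev_diag, hG₀]
    ext i j
    by_cases h : i = j <;> simp [h, mul_comm]
  have hWlead : LeadM ((PMat.diag fun _ : Fin n => RadPoly.w ^ 2).ev (vals S.N p))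
      (S.mat p S.W) := by
    intro i j
    have h1 := infty_ord_ev hN (hv.W_infty i j)
    have h2 := h1.choose_spec.of_lt (show (0 : ℤ) < (2 : ℕ) by norm_num)
    have h3 := h2.add (hlead (PMat.diag fun _ : Fin n => RadPoly.w ^ 2) i j)
    have e : RadPoly.ev (vars S.N p) ((S.W - .diag fun _ => RadPoly.w ^ 2 : PMat n) i j) +
        S.mat p (PMat.diag fun _ : Fin n => RadPoly.w ^ 2) i j = S.mat p S.W i j := by
      change RadPoly.ev (vars S.N p) (S.W i j - _) + _ = _
      rw [RadPoly.ev_sub]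
      exact sub_add_cancel _ _
    rwa [e, zero_add] at h3
  have z₁ := isZ₀_mat hN hv.comp₁
  have z₀ := isZ₀_mat hN hv.comp₀
  simp only [PMat.ev_sub, PMat.ev_add, PMat.ev_mul, hat0] at z₁ z₀
  refine Hat.isHat_of_infty (infty_lead_f p) (κ := (Complex.I * p.ω) ^ 2) (by simpa using hω)
    (V := S.mat p (S.W - .diag fun _ => RadPoly.w ^ 2)) ?_ ?_ ?_ ?_ ?_ ?_ ?_ ?_ ?_ ?_ hb₁ hb₀ ?_ ?_
  · change S.mat p S.W = _
    rw [mat_sub, mat_diag]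
    have e : (fun i : Fin n => S.val p (RadPoly.w ^ 2)) = fun _ => con ((Complex.I * p.ω) ^ 2) := by
      ext1 i; simp [val, vars, con_pow]
    rw [e, Matrix.scalar_apply, add_sub_cancel]
  · exact fun i j => infty_ord_ev hN (hv.W_infty i j)
  · refine diagonal_mul_eq_one fun i => ?_
    have h1 := hκκ i
    rw [zpow_neg]
    have h2 := zpow_ne_zero ((S.e i : ℤ) - 1 - pw i) hf
    rw [con_div, con_one, con_ofNat]
    field_simp
    linear_combination h1
  · refine diagonal_mul_eq_one fun i => ?_
    rw [zpow_neg, zpow_natCast]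
    field_simp
  · refine diagonal_mul_eq_one fun i => ?_
    have := con_ne_zero (hlam i)
    field_simp
  · change K * ((S.val p S.δ)⁻¹ • S.mat p S.C) * ((S.val p S.δ / S.val p S.den) • S.mat p S.Ci) = 1
    simp only [Matrix.mul_smul, Matrix.smul_mul, mul_assoc, hCC, hKν, smul_smul]
    have : (S.val p S.δ)⁻¹ * (S.val p S.δ / S.val p S.den) * S.val p S.den = 1 := by field_simp
    rw [show S.val p S.δ / S.val p S.den * ((S.val p S.δ)⁻¹ * S.val p S.den) = 1 by
      rw [← this]; ring, one_smul]
  · change dm p.f (K * ((S.val p S.δ)⁻¹ • S.mat p S.C)) = 0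
    have h1 : dm p.f (S.mat p S.C) = 0 := by rw [← mat_d]; exact isZ_mat hN' hv.dC
    rw [hdK']
    have h2 : dm p.f ((S.val p S.δ)⁻¹ • S.mat p S.C) = 0 := by
      ext i j
      have h3 : dm p.f (S.mat p S.C) i j = 0 := congrFun (congrFun h1 i) j
      rw [dm_apply] at h3 ⊢
      rw [Matrix.smul_apply, smul_eq_mul, Derivation.leibniz, Derivation.leibniz_inv, dval hv.dδ,
        smul_eq_mul, smul_eq_mul, smul_zero, mul_zero, add_zero, mul_left_comm, h3, mul_zero]
      rfl
    rw [h2, mul_zero]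
  · change K * ((S.val p S.δ)⁻¹ • S.mat p S.C) * S.mat p S.W =
      S.mat p S.W * (K * ((S.val p S.δ)⁻¹ • S.mat p S.C))
    rw [← mul_assoc, ← hKW, mul_assoc, mul_assoc, Matrix.smul_mul, hCW, Matrix.mul_smul (S.mat p S.W)]
  · change 2 * dm p.f (K * S.mat p S.a) + dm p.f (dm p.f (K * S.mat p S.b)) -
      S.mat p S.W * (K * S.mat p S.b) = (K * S.mat p S.a + 2 * dm p.f (K * S.mat p S.b) -
        K * S.mat p S.b * S.mat p S.R₁) * S.mat p S.R₁ +
        K * S.mat p S.b * dm p.f (S.mat p S.R₁) + K * S.mat p S.b * S.mat p S.R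
    have h1 := congrArg (K * ·) (m₁ p hN')
    simp only [hs] at h1
    simp only [hdK']
    rw [← mul_assoc (S.mat p S.W), ← hKW]
    rw [← sub_eq_zero] at h1 ⊢
    rw [← h1]
    noncomm_ring
  · change dm p.f (dm p.f (K * S.mat p S.a)) - S.mat p S.W * (K * S.mat p S.a) =
      (K * S.mat p S.a + 2 * dm p.f (K * S.mat p S.b) -
        K * S.mat p S.b * S.mat p S.R₁) * S.mat p S.R + K * S.mat p S.b * dm p.f (S.mat p S.R)
    have h1 := congrArg (K * ·) (m₀ p hN')
    simp only [hs] at h1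
    simp only [hdK']
    rw [← mul_assoc (S.mat p S.W), ← hKW]
    rw [← sub_eq_zero] at h1 ⊢
    rw [← h1]
    noncomm_ring
  · change LeadM 0 (K * S.mat p S.a * (S.Γ p * S.mat p S.c₁) +
      K * S.mat p S.b * (S.Γ p * S.mat p S.c₀) +
      K * S.mat p S.b * dm p.f (S.Γ p * S.mat p S.c₁))
    -- Values at infinity are multiplicative, derivatives vanish there, and Γ contributes only the
    -- constants κi/δ because f has the value 1. What remains is the tabulated identity `comp₁`, and
    -- below `comp₀`.
    have h1 := ((hKlead.mul (hlead S.a)).mul (hΓ.mul (hlead S.c₁))).add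
      ((hKlead.mul (hlead S.b)).mul (hΓ.mul (hlead S.c₀)))
    have h2 := h1.add ((hKlead.mul (hlead S.b)).mul ((hΓ.mul (hlead S.c₁)).dm (infty_lead_f p)))
    convert h2 using 1
    rw [mul_zero, add_zero, mul_assoc, mul_assoc, ← mul_add, hG₀', Matrix.smul_mul,
      Matrix.smul_mul, Matrix.mul_smul, Matrix.mul_smul, ← smul_add, z₁, smul_zero, mul_zero]
  · change LeadM 0 (K * S.mat p S.a * (S.Γ p * S.mat p S.c₀) +
      K * S.mat p S.b * dm p.f (S.Γ p * S.mat p S.c₀) +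
      K * S.mat p S.b * (S.Γ p * S.mat p S.c₁) * S.mat p S.W -
      K * ((S.val p S.δ)⁻¹ • S.mat p S.C))
    have h1 := ((hKlead.mul (hlead S.a)).mul (hΓ.mul (hlead S.c₀))).add
      ((hKlead.mul (hlead S.b)).mul ((hΓ.mul (hlead S.c₀)).dm (infty_lead_f p)))
    have hC : LeadM ((S.δ.ev (vals S.N p))⁻¹ • S.C.ev (vals S.N p))
        ((S.val p S.δ)⁻¹ • S.mat p S.C) := fun i j => by
      simpa using ((hval S.δ).inv (hconst _ hv.dδ hδ)).mul (hlead S.C i j)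
    have h2 := (h1.add (((hKlead.mul (hlead S.b)).mul (hΓ.mul (hlead S.c₁))).mul hWlead)).sub
      (hKlead.mul hC)
    convert h2 using 1
    rw [mul_zero, add_zero, hG₀', Matrix.smul_mul, Matrix.smul_mul, Matrix.mul_smul,
      Matrix.mul_smul, Matrix.mul_smul, Matrix.smul_mul, ← smul_add, ← smul_sub, mul_assoc, mul_assoc,
      mul_assoc, ← mul_add, ← mul_sub, ← mul_assoc (S.b.ev _), z₀, mul_zero, smul_zero]

end System

end

/-! ### Verification of the tables -/

section

namespace System
set_option maxHeartbeats 4000000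

/-- Each condition is a finite family of Boolean evaluations of integer polynomials, carried out by
reduction in the kernel. The link with rational functions is made by `ev_eq_zero`,
`ev_eq_zero_of_isZeroY` and `ev_deriv`. -/
theorem scalar_valid : scalar.Valid := by constructor <;> decide +kernel
theorem vecOdd_valid : vecOdd.Valid := by constructor <;> decide +kernel
theorem vecEven_valid : vecEven.Valid := by constructor <;> decide +kernel
theorem lichOdd_valid : lichOdd.Valid := by constructor <;> decide +kernel
theorem lichEven_valid : lichEven.Valid := by constructor <;> decide +kernel
theorem zerilliSys_valid : zerilliSys.Valid := by constructor <;> decide +kernel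

end System

end

/-! ### Conjugation of second-order operators to monic form -/

section

theorem Params.der_f (p : Params) : der p.f = (1 - p.f) / r := by
  have e : p.f = 1 - con (2 * p.M) * r⁻¹ := by rw [Params.f, Params.f₁, div_eq_mul_inv]
  rw [e]
  have := r_ne_zero
  simp only [map_sub, Derivation.map_one_eq_zero, Derivation.leibniz, Derivation.leibniz_inv,
    der_r, der_con, smul_eq_mul, inv_pow]
  field_simp
  ring

theorem der_div_r (z : RatFun) : der (z / r) = der z / r - z / r ^ 2 := by
  have := r_ne_zero
  rw [div_eq_mul_inv, Derivation.leibniz, Derivation.leibniz_inv, der_r]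
  simp only [smul_eq_mul]
  field_simp
  ring

theorem der_r_zpow (p : Params) (k : ℤ) :
    der (r * p.f ^ k) = r * p.f ^ k * (1 / r + k * (1 - p.f) / (r * p.f)) := by
  have := r_ne_zero
  have := p.f_ne_zero
  rw [Derivation.leibniz, Derivation.leibniz_zpow, der_r, p.der_f, zpow_sub_one₀ p.f_ne_zero]
  simp only [smul_eq_mul, zsmul_eq_mul]
  field_simp
  ring

theorem op2_apply {n : ℕ} (g : RatFun) (R₁ R₀ : FunMatrix n) (i j : Fin n) :
    op2 g R₁ R₀ i j = (if i = j then (mul g * D) ^ 2 else 0) + mul (R₁ i j) * (mul g * D) +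
      mul (R₀ i j) := by
  have h : (DD g : OpMatrix n) ^ 2 = Matrix.scalar (Fin n) ((mul g * D) ^ 2) := by
    rw [DD, ← map_pow]
  rw [op2, h]
  simp only [Matrix.add_apply, MM_apply, DD, Matrix.scalar_apply, Matrix.mul_diagonal,
    Matrix.diagonal_apply]

theorem diag_sandwich {n : ℕ} (a b : Fin n → RatFun) (X : OpMatrix n) (i j : Fin n) :
    (MM (Matrix.diagonal a) * X * MM (Matrix.diagonal b)) i j = mul (a i) * X i j * mul (b j) := by
  have h : ∀ a : Fin n → RatFun, MM (Matrix.diagonal a) = Matrix.diagonal fun i => mul (a i) := by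
    intro a
    exact Matrix.diagonal_map (f := mul) (map_zero mulHom)
  rw [h, h, Matrix.mul_diagonal, Matrix.diagonal_mul]

/-- For a weight κr²f^(e-2pw), conjugation with the scale f^pw/r removes r from the leading
coefficient and leaves e(1-f)/r as first-order coefficient, independent of pw. The derivatives of
the scale factors go into the term of order zero, which the hypothesis on `q` records. -/
theorem kineticOp_conj (p : Params) (κ : RatFun) (hκ : der κ = 0) (e pw : ℕ) (R₀ q : RatFun)
    (h : p.f * q = κ * r ^ 2 * p.f ^ ((e : ℤ) - 2 * pw) *
      (R₀ - con (p.ω ^ 2) + con p.B * p.f / r ^ 2 +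
        (1 - p.f) / r ^ 2 * ((1 + e) * p.f + (1 - p.f) * (pw * (pw - e))))) :
    kineticOp p (κ * r ^ 2 * p.f ^ ((e : ℤ) - 2 * pw)) + mul q =
      mul (κ * r * p.f ^ ((e : ℤ) - 1 - pw)) *
        ((mul p.f * D) ^ 2 + mul ((e : RatFun) * ((1 - p.f) / r)) * (mul p.f * D) + mul R₀) *
        mul (r * p.f ^ (-(pw : ℤ))) := by
  have hr := r_ne_zero
  have hf := p.f_ne_zero
  set G := r * p.f ^ (-(pw : ℤ)) with hG
  have hL : κ * r * p.f ^ ((e : ℤ) - 1 - pw) * p.f * G =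
      κ * r ^ 2 * p.f ^ ((e : ℤ) - 2 * pw) := by
    have : p.f ^ ((e : ℤ) - 2 * pw) = p.f ^ ((e : ℤ) - 1 - pw) * p.f * p.f ^ (-(pw : ℤ)) := by
      rw [← zpow_add_one₀ hf, ← zpow_add₀ hf]; congr 1; ring
    rw [hG, this]; ring
  have hw : der (κ * r ^ 2 * p.f ^ ((e : ℤ) - 2 * pw)) = κ * r ^ 2 * p.f ^ ((e : ℤ) - 2 * pw) *
      (2 / r + ((e : RatFun) - 2 * pw) * (1 - p.f) / (r * p.f)) := by
    have e1 : κ * r ^ 2 * p.f ^ ((e : ℤ) - 2 * pw) = κ * (r * (r * p.f ^ ((e : ℤ) - 2 * pw))) := by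
      ring
    rw [e1, Derivation.leibniz, hκ, Derivation.leibniz, der_r_zpow, der_r]
    simp only [smul_eq_mul]
    push_cast
    field_simp
    ring
  have hG' : der G = G * (1 / r + (-(pw : RatFun)) * (1 - p.f) / (r * p.f)) := by
    rw [hG, der_r_zpow]; push_cast; ring
  set w := κ * r ^ 2 * p.f ^ ((e : ℤ) - 2 * pw)
  set L := κ * r * p.f ^ ((e : ℤ) - 1 - pw)
  have hq : q = w * (R₀ - con (p.ω ^ 2) + con p.B * p.f / r ^ 2 +
        (1 - p.f) / r ^ 2 * ((1 + e) * p.f + (1 - p.f) * (pw * (pw - e)))) / p.f := by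
    rw [← h]; field_simp
  have hG'' : der (1 / r + (-(pw : RatFun)) * (1 - p.f) / (r * p.f)) = -1 / r ^ 2 +
      (pw : RatFun) * (1 - p.f) * (1 + p.f) / (r ^ 2 * p.f ^ 2) := by
    have : (1 / r + (-(pw : RatFun)) * (1 - p.f) / (r * p.f)) =
      (1 + con (-(pw : ℂ)) * (p.f⁻¹ - 1)) / r := by
      rw [con_neg, con_natCast]; field_simp
    rw [this, der_div_r]
    simp only [map_add, map_sub, Derivation.map_one_eq_zero, Derivation.leibniz,
      Derivation.leibniz_inv, der_con, p.der_f, smul_eq_mul]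
    rw [con_neg, con_natCast]
    field_simp
    ring
  obtain ⟨H, hH⟩ : ∃ H, H = 1 / r + (-(pw : RatFun)) * (1 - p.f) / (r * p.f) := ⟨_, rfl⟩
  rw [← hH] at hG' hG''
  ext1 z
  simp only [kineticOp, pow_two (mul p.f * D), Module.End.mul_apply, LinearMap.add_apply,
    mul_apply', D_apply, Derivation.leibniz, smul_eq_mul, hG', p.der_f, hw, map_add, hG'']
  rw [hH, hq, ← hL]
  field_simp
  ring

namespace System

variable {n : ℕ} {S : System n} {p : Params}

theorem mat_R₁_apply (S : System n) (p : Params) (i j : Fin n) : S.mat p S.R₁ i j =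
    if i = j then (S.e i : RatFun) * ((1 - p.f) / r) else 0 := by
  rw [R₁_eq, Matrix.diagonal_apply]
  split
  · rw [p.f_eq]; have := r_ne_zero; field_simp; ring
  · rfl

/-- Off the diagonal the entries are functions, so conjugation only multiplies them by powers of f
and r. The correction from differentiating the scales appears on the diagonal alone. -/
theorem E_eq_waveForm (hκ : ∀ i, (S.κ i).deriv.isZero = true) {pw : Fin n → ℕ} (lam : Fin n → ℂ)
    {w : Fin n → RatFun} {Q : FunMatrix n}
    (hw : ∀ i, w i = con (1 / 2) * S.val p (S.κ i) * r ^ 2 * p.f ^ ((S.e i : ℤ) - 2 * pw i))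
    (hQ : ∀ i j, p.f * Q i j = con (1 / 2) * S.val p (S.κ i) * r ^ 2 *
      p.f ^ ((S.e i : ℤ) - pw i - pw j) * (S.mat p S.R i j +
        if i = j then - con (p.ω ^ 2) + con p.B * p.f / r ^ 2 +
        (1 - p.f) / r ^ 2 * ((1 + S.e i) * p.f + (1 - p.f) * (pw i * (pw i - S.e i))) else 0)) :
    waveForm p w Q = (S.hat pw lam p).E p.f := by
  ext1 i j
  have hf := p.f_ne_zero
  change _ = (MM (Matrix.diagonal _) * op2 p.f (S.mat p S.R₁) (S.mat p S.R) *
    MM (Matrix.diagonal _) : OpMatrix n) i j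
  rw [diag_sandwich, op2_apply, waveForm, Matrix.add_apply, Matrix.map_apply, mat_R₁_apply]
  by_cases h : i = j
  · subst h
    rw [Matrix.diagonal_apply_eq, hw, if_pos rfl, if_pos rfl]
    refine kineticOp_conj p _ ?_ _ _ _ _ ?_
    · rw [Derivation.leibniz, der_con, dval (hκ i), smul_zero, smul_zero, add_zero]
    · rw [hQ, if_pos rfl, sub_sub, ← two_mul]
      ring
  · rw [Matrix.diagonal_apply_ne _ h, if_neg h, if_neg h, zero_add, zero_add, ← mulHom_apply 0,
      map_zero, zero_mul, zero_add, ← mulHom_apply, ← mulHom_apply, ← mulHom_apply, ← mulHom_apply,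
      ← map_mul, ← map_mul]
    congr 1
    have h1 := hQ i j
    rw [if_neg h, add_zero] at h1
    refine mul_left_cancel₀ hf (h1.trans ?_)
    have : p.f ^ ((S.e i : ℤ) - pw i - pw j) = p.f ^ ((S.e i : ℤ) - 1 - pw i) * p.f * p.f ^ (-(pw j : ℤ)) := by
      rw [← zpow_add_one₀ hf, ← zpow_add₀ hf]; congr 1; ring
    rw [this]
    ring

theorem E'_apply (S : System n) (pw : Fin n → ℕ) (lam : Fin n → ℂ) (i j : Fin n) :
    (S.hat pw lam p).E' p.f i j = (if i = j then lam i • (D * mul p.f * D) else 0) -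
      mul (con (lam i) / p.f * S.mat p S.W i j) := by
  have hf := p.f_ne_zero
  change (MM (Matrix.diagonal _) * op2 p.f 0 (-S.mat p S.W) : OpMatrix n) i j = _
  rw [← mul_one (MM (Matrix.diagonal _) * op2 _ _ _), ← map_one MM, ← Matrix.diagonal_one,
    diag_sandwich, op2_apply]
  ext1 z
  by_cases h : i = j
  · simp only [h, if_true, pow_two (mul p.f * D), Module.End.mul_apply, LinearMap.add_apply,
      LinearMap.sub_apply, LinearMap.smul_apply, mul_apply', D_apply, Matrix.zero_apply, zero_mul,
      Matrix.neg_apply, one_mul, RatFunc.smul_eq_C_mul]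
    rw [← con]
    field_simp
    ring
  · simp only [h, if_false, Module.End.mul_apply, LinearMap.add_apply, LinearMap.zero_apply,
      LinearMap.sub_apply, mul_apply', Matrix.zero_apply, zero_mul, Matrix.neg_apply, one_mul]
    ring

end System

end

/-! ### The wave operators and triangular systems in terms of the tables -/

section

theorem RadPoly.ev_mk_cons {K : Type*} [CommRing K] (v : Fin 5 → K) (t : Term) (l : List Term) :
    RadPoly.ev v ⟨t :: l⟩ = t.ev v + RadPoly.ev v ⟨l⟩ := RadPoly.evList_cons v t l

theorem RadPoly.ev_mk_nil {K : Type*} [CommRing K] (v : Fin 5 → K) : RadPoly.ev v ⟨[]⟩ = 0 := rfl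

theorem Term.ev_mk {K : Type*} [CommRing K] (v : Fin 5 → K) (c : ℤ) (i j k l n : ℕ) :
    Term.ev v ⟨c, i, j, k, l, n⟩ = c * (v 0 ^ i * v 1 ^ j * v 2 ^ k * v 3 ^ l * v 4 ^ n) := rfl

/-- Eliminating M in favour of f turns the comparisons with the tables into identities in r, f, 𝓑
and ω, where only r and f need to be known to be nonzero. -/
theorem con_M (p : Params) : con (p.M / 6) = r * (1 - p.f) / 12 := by
  rw [p.f_eq]; have := r_ne_zero; field_simp; ring

theorem vars_u' (N : ℕ) (p : Params) : vars N p 1 = r * (1 - p.f) / 12 := con_M p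

theorem con_w_sq (p : Params) : con (Complex.I * p.ω) ^ 2 = -con p.ω ^ 2 := by
  rw [con_mul, mul_pow, ← con_pow, Complex.I_sq, con_neg, con_one]; ring

theorem con_half : con (1 / 2) = 1 / 2 := by rw [con_div, con_one, con_ofNat]

theorem Params.f₁_eq (p : Params) : p.f₁ = 1 - p.f := by rw [Params.f]; ring

theorem con_A (p : Params) : con p.A = con p.B * (con p.B - 2) := by
  rw [Params.A, con_mul, con_sub, con_ofNat]

theorem System.mat_apply {n : ℕ} (S : System n) (p : Params) (A : PMat n) (i j : Fin n) :
    S.mat p A i j = (A i j).ev (vars S.N p) := rfl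

set_option linter.unusedSimpArgs false
set_option linter.unreachableTactic false
set_option linter.unusedTactic false
set_option linter.unnecessarySeqFocus false

theorem scalarOp_eq (p : Params) (lam : Fin 1 → ℂ) :
    scalarOp p = (System.scalar.hat ![0] lam p).E p.f := by
  have hr := r_ne_zero
  have hf := p.f_ne_zero
  refine System.E_eq_waveForm (by decide +kernel) lam ?_ ?_ <;> intro i <;> rw [con_half]
  · simp only [System.scalar]
    fin_cases i <;>
    simp [System.val, System.vars_B, con_A, -mul_eq_mul_left_iff,
      -mul_eq_mul_right_iff] <;> (try field_simp) <;> (try ring)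
  · intro j
    rw [System.mat_apply]
    simp only [System.val, System.scalar]
    fin_cases i <;> fin_cases j <;>
    simp [RadPoly.ev_mk_cons, RadPoly.ev_mk_nil, Term.ev_mk, System.vars_x, vars_u',
      System.vars_B, System.vars_w, con_w_sq, con_A, Params.f₁_eq, con_pow,
      -mul_eq_mul_left_iff, -mul_eq_mul_right_iff, -mul_eq_zero, -zero_eq_mul] <;>
    field_simp <;> ring

theorem vecOddOp_eq (p : Params) (lam : Fin 1 → ℂ) :
    vecOddOp p = (System.vecOdd.hat ![0] lam p).E p.f := by
  have hr := r_ne_zero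
  have hf := p.f_ne_zero
  refine System.E_eq_waveForm (by decide +kernel) lam ?_ ?_ <;> intro i <;> rw [con_half]
  · simp only [System.vecOdd]
    fin_cases i <;>
    simp [System.val, System.vars_B, con_A, -mul_eq_mul_left_iff,
      -mul_eq_mul_right_iff] <;> (try field_simp) <;> (try ring)
  · intro j
    rw [System.mat_apply]
    simp only [System.val, System.vecOdd]
    fin_cases i <;> fin_cases j <;>
    simp [RadPoly.ev_mk_cons, RadPoly.ev_mk_nil, Term.ev_mk, System.vars_x, vars_u',
      System.vars_B, System.vars_w, con_w_sq, con_A, Params.f₁_eq, con_pow,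
      -mul_eq_mul_left_iff, -mul_eq_mul_right_iff, -mul_eq_zero, -zero_eq_mul] <;>
    field_simp <;> ring

theorem vecEvenOp_eq (p : Params) (lam : Fin 3 → ℂ) :
    vecEvenOp p = (System.vecEven.hat ![1, 0, 0] lam p).E p.f := by
  have hr := r_ne_zero
  have hf := p.f_ne_zero
  refine System.E_eq_waveForm (by decide +kernel) lam ?_ ?_ <;> intro i <;> rw [con_half]
  · simp only [System.vecEven]
    fin_cases i <;>
    simp [System.val, System.vars_B, con_A, -mul_eq_mul_left_iff,
      -mul_eq_mul_right_iff] <;> (try field_simp) <;> (try ring)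
  · intro j
    rw [System.mat_apply]
    simp only [System.val, System.vecEven]
    fin_cases i <;> fin_cases j <;>
    simp [RadPoly.ev_mk_cons, RadPoly.ev_mk_nil, Term.ev_mk, System.vars_x, vars_u',
      System.vars_B, System.vars_w, con_w_sq, con_A, Params.f₁_eq, con_pow,
      -mul_eq_mul_left_iff, -mul_eq_mul_right_iff, -mul_eq_zero, -zero_eq_mul] <;>
    field_simp <;> ring

theorem lichOddOp_eq (p : Params) (lam : Fin 3 → ℂ) :
    lichOddOp p = (System.lichOdd.hat ![1, 0, 0] lam p).E p.f := by
  have hr := r_ne_zero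
  have hf := p.f_ne_zero
  refine System.E_eq_waveForm (by decide +kernel) lam ?_ ?_ <;> intro i <;> rw [con_half]
  · simp only [System.lichOdd]
    fin_cases i <;>
    simp [System.val, System.vars_B, con_A, -mul_eq_mul_left_iff,
      -mul_eq_mul_right_iff] <;> (try field_simp) <;> (try ring)
  · intro j
    rw [System.mat_apply]
    simp only [System.val, System.lichOdd]
    fin_cases i <;> fin_cases j <;>
    simp [RadPoly.ev_mk_cons, RadPoly.ev_mk_nil, Term.ev_mk, System.vars_x, vars_u',
      System.vars_B, System.vars_w, con_w_sq, con_A, Params.f₁_eq, con_pow,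
      -mul_eq_mul_left_iff, -mul_eq_mul_right_iff, -mul_eq_zero, -zero_eq_mul] <;>
    field_simp <;> ring

/-- The wave operator depends only on `κ`, `e` and `R`. Leaving the rest of the system free makes
the lemma serve for the Zerilli form too. -/
theorem lichEvenOp_eq (p : Params) (lam : Fin 7 → ℂ) {S : System 7}
    (hκ : S.κ = System.lichEven.κ) (he : S.e = System.lichEven.e)
    (hR : S.R = System.lichEven.R) :
    lichEvenOp p = (S.hat ![1, 1, 2, 0, 0, 0, 0] lam p).E p.f := by
  have hr := r_ne_zero
  have hf := p.f_ne_zero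
  refine System.E_eq_waveForm (by rw [hκ]; decide +kernel) lam ?_ ?_ <;> intro i <;> rw [con_half]
  · simp only [hκ, he, hR, System.lichEven]
    fin_cases i <;>
    simp [System.val, System.vars_B, con_A, -mul_eq_mul_left_iff,
      -mul_eq_mul_right_iff] <;> (try field_simp) <;> (try ring)
  · intro j
    rw [System.mat_apply]
    simp only [System.val, hκ, he, hR, System.lichEven]
    fin_cases i <;> fin_cases j <;>
    simp [RadPoly.ev_mk_cons, RadPoly.ev_mk_nil, Term.ev_mk, System.vars_x, vars_u',
      System.vars_B, System.vars_w, con_w_sq, con_A, Params.f₁_eq, con_pow,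
      -mul_eq_mul_left_iff, -mul_eq_mul_right_iff, -mul_eq_zero, -zero_eq_mul] <;>
    field_simp <;> ring

theorem RW_eq (N : ℕ) (p : Params) (s : ℕ) :
    RW p s = D * mul p.f * D - mul ((System.pot s).ev (vars N p) / p.f) := by
  have hr := r_ne_zero
  have hf := p.f_ne_zero
  have h : (System.pot s).ev (vars N p) / p.f =
      (con p.B + con (1 - (s : ℂ) ^ 2) * p.f₁) / r ^ 2 - con (p.ω ^ 2) / p.f := by
    rw [System.pot, RadPoly.ev_add, RadPoly.ev_mul, RadPoly.ev_mul, RadPoly.ev_add,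
      System.ev_f]
    simp only [RadPoly.ev_mk_cons, RadPoly.ev_mk_nil, Term.ev_mk, RadPoly.ev_pow, RadPoly.ev_x,
      RadPoly.ev_w, RadPoly.ev_B, System.vars_x, vars_u', System.vars_B, System.vars_w,
      con_w_sq, Params.f₁_eq, con_pow, con_sub, con_one, con_natCast]
    push_cast
    field_simp
    ring
  rw [h, RW, ← mulHom_apply (_ - _), map_sub, mulHom_apply, mulHom_apply]
  abel

theorem rwSystem_apply (s : Sector) (p : Params) (i j : Fin s.dim) :
    rwSystem s p i j = (if i = j then diagConst s p i • RW p (s.spin i) else 0) +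
      mul (coupling s p i j) := by
  rw [rwSystem, Matrix.add_apply, Matrix.diagonal_apply, Matrix.map_apply]

theorem smul_mul' (c : ℂ) (z : RatFun) : c • mul z = mul (con c * z) := by
  ext1 x
  simp only [LinearMap.smul_apply, mul_apply', RatFunc.smul_eq_C_mul, con]
  ring

/-- The coefficients of the equivalence diagram in each sector. -/
def Sector.system : (s : Sector) → System s.dim
  | .scalar => System.scalar
  | .vecOdd => System.vecOdd
  | .vecEven => System.vecEven
  | .lichOdd => System.lichOdd
  | .lichEven => System.lichEven

/-- The powers of `f` by which the components are rescaled. -/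
def Sector.pw : (s : Sector) → Fin s.dim → ℕ
  | .scalar => ![0]
  | .vecOdd => ![0]
  | .vecEven => ![1, 0, 0]
  | .lichOdd => ![1, 0, 0]
  | .lichEven => ![1, 1, 2, 0, 0, 0, 0]

theorem Sector.system_W (s : Sector) (p : Params) (i j : Fin s.dim) :
    con (diagConst s p i) / p.f * s.system.mat p s.system.W i j =
      (if i = j then con (diagConst s p i) / p.f * (System.pot (s.spin i)).ev (vars s.system.N p)
        else 0) - coupling s p i j := by
  have hr := r_ne_zero
  have hf := p.f_ne_zero
  rw [System.mat_apply]
  cases s <;>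
  simp only [Sector.system, System.scalar, System.vecOdd, System.vecEven, System.lichOdd,
    System.lichEven, diagConst, coupling, vecEvenCoupling, lichOddCoupling, lichEvenCoupling,
    couplingX, Sector.spin] <;>
  fin_cases i <;> fin_cases j <;>
  simp [System.vars_x, vars_u', System.vars_B, con_A, Params.f₁_eq, con_pow, con_div, con_neg, con_mul,
    con_ofNat, -mul_eq_mul_left_iff, -mul_eq_mul_right_iff, -mul_eq_zero, -zero_eq_mul] <;>
  field_simp <;> ring

theorem rwSystem_eq (s : Sector) (p : Params) :
    rwSystem s p = (s.system.hat s.pw (diagConst s p) p).E' p.f := by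
  ext1 i j
  rw [rwSystem_apply, System.E'_apply, s.system_W, ← mulHom_apply (_ - _), map_sub, sub_sub_eq_add_sub,
    add_sub_right_comm, mulHom_apply, mulHom_apply]
  congr 1
  by_cases h : i = j
  · rw [if_pos h, if_pos h, if_pos h, RW_eq s.system.N, smul_sub, smul_mul']
    congr 2
    ring
  · rw [if_neg h, if_neg h, if_neg h, ← mulHom_apply, map_zero, sub_zero]

theorem waveOp_eq (s : Sector) (p : Params) (lam : Fin s.dim → ℂ) :
    waveOp s p = (s.system.hat s.pw lam p).E p.f := by
  cases s
  exacts [scalarOp_eq p lam, vecOddOp_eq p lam, vecEvenOp_eq p lam, lichOddOp_eq p lam,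
    lichEvenOp_eq p lam rfl rfl rfl]

/-- The constant factors on the diagonal of `Ẽ⁺`. -/
def zerilliDiag (p : Params) : Fin 7 → ℂ := fun i =>
  if i = 3 then -2 * p.A / p.ω ^ 2 else diagConst .lichEven p i

theorem zerilli_eq (p : Params) : zerilli p = D * mul p.f * D -
    mul (System.zerilliSys.mat p System.zerilliSys.W 3 3 / p.f) := by
  have hr := r_ne_zero
  have hf := p.f_ne_zero
  have hy : vars 4 p 4 = (zerilliFactor p)⁻¹ := rfl
  have h : System.zerilliSys.mat p System.zerilliSys.W 3 3 / p.f =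
      (con (p.B - 2) * (con p.A + 3 * con (p.B - 2) * p.f₁) + 9 * con (p.B - 2) * p.f₁ ^ 2 +
        9 * p.f₁ ^ 3) / (r ^ 2 * zerilliFactor p ^ 2) - con (p.ω ^ 2) / p.f := by
    rw [System.mat_apply]
    simp [System.zerilliSys, hy, System.vars_x, vars_u', System.vars_B, System.vars_w, 
      con_A, Params.f₁_eq, con_pow, con_sub, con_ofNat, con_w_sq]
    field_simp
    ring
  rw [h, zerilli, ← mulHom_apply (_ - _), map_sub, mulHom_apply, mulHom_apply]
  abel

theorem spin_eq_two : ∀ i : Fin 7, Sector.spin .lichEven i = 2 ↔ i = 3 := by decide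

theorem zerilliSys_W_of_ne {i j : Fin 7} (h : ¬ (i = 3 ∧ j = 3)) :
    System.zerilliSys.W i j = System.lichEven.W i j := by
  have : (i == 3 && j == 3) = false := by simpa using h
  change (bif i == 3 && j == 3 then _ else _) = _
  rw [this, cond_false]

theorem ev_lichEven_W (N : ℕ) (p : Params) (i j : Fin 7) :
    (System.lichEven.W i j).ev (vars N p) = (System.lichEven.W i j).ev (vars 0 p) := by
  fin_cases i <;> fin_cases j <;>
    simp [System.lichEven, System.pot, System.vars_x, System.vars_u, System.vars_B, System.vars_w,
      RadPoly.ev_mk_cons, RadPoly.ev_mk_nil, Term.ev_mk]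

theorem zerilliSystem_eq (p : Params) : zerilliSystem .lichEven p =
    (System.zerilliSys.hat (Sector.pw .lichEven) (zerilliDiag p) p).E' p.f := by
  ext1 i j
  rw [System.E'_apply, zerilliSystem, Matrix.of_apply]
  simp only [spin_eq_two]
  by_cases h : i = j ∧ i = 3
  · obtain ⟨rfl, rfl⟩ := h
    rw [if_pos ⟨rfl, rfl⟩, if_pos rfl, zerilli_eq, smul_sub, smul_mul', zerilliDiag, if_pos rfl]
    congr 2
    ring
  · rw [if_neg h, rwSystem_eq, System.E'_apply]
    have hW : System.zerilliSys.mat p System.zerilliSys.W i j =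
        System.lichEven.mat p System.lichEven.W i j := by
      rw [System.mat_apply, System.mat_apply, zerilliSys_W_of_ne fun e => h ⟨e.1.trans e.2.symm, e.1⟩]
      exact ev_lichEven_W _ p i j
    -- Row 3 carries different constants in the two systems, with and without α, but its
    -- off-diagonal entries are zero. In the other rows the constants agree.
    by_cases h3 : i = 3
    · have hij : i ≠ j := fun e => h ⟨e, h3⟩
      rw [if_neg hij, if_neg hij, hW]
      change _ - mul (_ * System.lichEven.mat p System.lichEven.W i j) = _
      have : System.lichEven.mat p System.lichEven.W i j = 0 := by
        subst h3
        rw [System.mat_apply]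
        simp only [System.lichEven]
        fin_cases j <;> first | exact absurd rfl hij | simp
      rw [this, mul_zero, mul_zero]
    · rw [zerilliDiag, if_neg h3, hW]
      rfl

theorem waveOp_eq' (p : Params) :
    waveOp .lichEven p = (System.zerilliSys.hat (Sector.pw .lichEven) (zerilliDiag p) p).E p.f :=
  lichEvenOp_eq p _ rfl rfl rfl

end

section

/-! ### Rational families -/

/-- Evaluation of polynomials in the parameters and `r`. -/
def polyAt (N : MvPolynomial (Fin 4) ℂ) (p : Params) : RatFun :=
  MvPolynomial.aeval ![con p.M, con p.ω, con p.B, r] N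

/-- The nonvanishing family `δ` is polynomial on `dom`. -/
structure IsDen (dom : Params → Prop) (δ : Params → RatFun) : Prop where
  poly : ∃ N, ∀ p, dom p → δ p = polyAt N p
  ne : ∀ p, dom p → δ p ≠ 0

variable {dom : Params → Prop} {δ : Params → RatFun}

/-- The ring of rational families. -/
def ratFam (h : IsDen dom δ) : Subring (Params → RatFun) where
  carrier := {a | IsRationalFamily dom δ a}
  mul_mem' := by
    rintro a b ⟨N, m, ha⟩ ⟨N', m', hb⟩
    refine ⟨N * N', m + m', fun p hp => ?_⟩
    rw [Pi.mul_apply, ha p hp, hb p hp, map_mul, pow_add, div_mul_div_comm]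
  one_mem' := ⟨1, 0, fun p _ => by simp⟩
  add_mem' := by
    rintro a b ⟨N, m, ha⟩ ⟨N', m', hb⟩
    obtain ⟨Nδ, hδ⟩ := h.poly
    refine ⟨N * Nδ ^ m' + Nδ ^ m * N', m + m', fun p hp => ?_⟩
    have h0 := h.ne p hp
    rw [Pi.add_apply, ha p hp, hb p hp, map_add, map_mul, map_mul, map_pow, map_pow,
      div_add_div _ _ (pow_ne_zero m h0) (pow_ne_zero m' h0), pow_add, hδ p hp]
    rfl
  zero_mem' := ⟨0, 0, fun p _ => by simp⟩
  neg_mem' := by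
    rintro a ⟨N, m, ha⟩
    exact ⟨-N, m, fun p hp => by rw [Pi.neg_apply, ha p hp, map_neg]; exact (neg_div _ _).symm⟩

namespace IsDen

variable (h : IsDen dom δ)

theorem congr {a b : Params → RatFun} (ha : a ∈ ratFam h) (hab : ∀ p, dom p → b p = a p) :
    b ∈ ratFam h := by
  obtain ⟨N, m, hN⟩ := ha
  exact ⟨N, m, fun p hp => by rw [hab p hp, hN p hp]⟩

theorem poly_mem (N : MvPolynomial (Fin 4) ℂ) : polyAt N ∈ ratFam h :=
  ⟨N, 0, fun p _ => by rw [pow_zero, div_one]; rfl⟩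

theorem r_mem : (fun _ => r) ∈ ratFam h := by
  convert h.poly_mem (MvPolynomial.X 3); simp [polyAt]
theorem M_mem : (fun p => con p.M) ∈ ratFam h := by
  convert h.poly_mem (MvPolynomial.X 0); simp [polyAt]
theorem ω_mem : (fun p => con p.ω) ∈ ratFam h := by
  convert h.poly_mem (MvPolynomial.X 1); simp [polyAt]
theorem B_mem : (fun p => con p.B) ∈ ratFam h := by
  convert h.poly_mem (MvPolynomial.X 2); simp [polyAt]
theorem con_mem (z : ℂ) : (fun _ => con z) ∈ ratFam h := by
  convert h.poly_mem (MvPolynomial.C z); simp [polyAt, con]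

theorem inv_mem : (fun p => (δ p)⁻¹) ∈ ratFam h := ⟨1, 1, fun p _ => by simp⟩

theorem mul_mem {a b : Params → RatFun} (ha : a ∈ ratFam h) (hb : b ∈ ratFam h) :
    (fun p => a p * b p) ∈ ratFam h := (ratFam h).mul_mem ha hb
theorem add_mem {a b : Params → RatFun} (ha : a ∈ ratFam h) (hb : b ∈ ratFam h) :
    (fun p => a p + b p) ∈ ratFam h := (ratFam h).add_mem ha hb
theorem sub_mem {a b : Params → RatFun} (ha : a ∈ ratFam h) (hb : b ∈ ratFam h) :
    (fun p => a p - b p) ∈ ratFam h := (ratFam h).sub_mem ha hb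
theorem neg_mem {a : Params → RatFun} (ha : a ∈ ratFam h) :
    (fun p => -a p) ∈ ratFam h := (ratFam h).neg_mem ha
theorem pow_mem {a : Params → RatFun} (ha : a ∈ ratFam h) (n : ℕ) :
    (fun p => a p ^ n) ∈ ratFam h := (ratFam h).pow_mem ha n
theorem sum_mem {ι : Type*} {t : Finset ι} {a : ι → Params → RatFun}
    (ha : ∀ i ∈ t, a i ∈ ratFam h) : (fun p => ∑ i ∈ t, a i p) ∈ ratFam h := by
  convert (ratFam h).sum_mem ha using 1
  ext1 p
  rw [Finset.sum_apply]

theorem zpow_mem {a : Params → RatFun} (ha : a ∈ ratFam h) (ha' : (fun p => (a p)⁻¹) ∈ ratFam h)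
    (k : ℤ) : (fun p => a p ^ k) ∈ ratFam h := by
  obtain ⟨m, rfl | rfl⟩ := k.eq_nat_or_neg
  · simpa using h.pow_mem ha m
  · simpa using h.pow_mem ha' m

theorem der_poly_mem (N : MvPolynomial (Fin 4) ℂ) : (fun p => der (polyAt N p)) ∈ ratFam h := by
  induction N using MvPolynomial.induction_on with
  | C z =>
    convert (ratFam h).zero_mem using 1
    ext1 p
    rw [polyAt, MvPolynomial.aeval_C, ← con_eq_algebraMap, der_con]; rfl
  | add N N' h1 h2 =>
    convert h.add_mem h1 h2 using 1
    ext1 p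
    rw [polyAt, map_add, map_add]; rfl
  | mul_X N i h1 =>
    have h2 : (fun p => der (polyAt (MvPolynomial.X i) p)) ∈ ratFam h := by
      fin_cases i
      · convert (ratFam h).zero_mem using 1; ext1 p; simp [polyAt]
      · convert (ratFam h).zero_mem using 1; ext1 p; simp [polyAt]
      · convert (ratFam h).zero_mem using 1; ext1 p; simp [polyAt]
      · convert (ratFam h).one_mem using 1; ext1 p; simp [polyAt]
    convert h.add_mem (h.mul_mem (h.poly_mem N) h2)
      (h.mul_mem (h.poly_mem (MvPolynomial.X i)) h1) using 1
    ext1 p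
    rw [polyAt, map_mul, Derivation.leibniz]; rfl

/-- Differentiating N/δ^m in r raises the exponent of δ by one and creates no new denominator, as δ
is polynomial in r. -/
theorem der_mem {a : Params → RatFun} (ha : a ∈ ratFam h) : (fun p => der (a p)) ∈ ratFam h := by
  obtain ⟨N, m, hN⟩ := ha
  obtain ⟨Nδ, hδ⟩ := h.poly
  refine h.congr (a := fun p => der (polyAt N p) * (δ p)⁻¹ ^ m -
    con m * polyAt N p * der (polyAt Nδ p) * (δ p)⁻¹ ^ (m + 1))
    (h.sub_mem (h.mul_mem (h.der_poly_mem N) (h.pow_mem h.inv_mem m))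
      (h.mul_mem (h.mul_mem (h.mul_mem (h.con_mem _) (h.poly_mem N)) (h.der_poly_mem Nδ))
        (h.pow_mem h.inv_mem _))) fun p hp => ?_
  have h0 := h.ne p hp
  have h1 : a p = polyAt N p * δ p ^ (-(m : ℤ)) := by
    rw [hN p hp, zpow_neg, zpow_natCast, div_eq_mul_inv]; rfl
  rw [h1, Derivation.leibniz, Derivation.leibniz_zpow, ← hδ p hp, zpow_sub_one₀ h0, zpow_neg,
    zpow_natCast]
  simp only [smul_eq_mul, zsmul_eq_mul]
  push_cast
  rw [con_natCast, inv_pow, inv_pow]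
  field_simp
  ring

/-- Matrices of rational families. -/
def MemM {n : ℕ} (U : Params → FunMatrix n) : Prop := ∀ i j, (fun p => U p i j) ∈ ratFam h

variable {h} {n : ℕ} {U V : Params → FunMatrix n}

theorem MemM.add (hU : h.MemM U) (hV : h.MemM V) : h.MemM fun p => U p + V p :=
  fun i j => h.add_mem (hU i j) (hV i j)

theorem MemM.neg (hU : h.MemM U) : h.MemM fun p => -U p := fun i j => h.neg_mem (hU i j)

theorem MemM.sub (hU : h.MemM U) (hV : h.MemM V) : h.MemM fun p => U p - V p :=
  fun i j => h.sub_mem (hU i j) (hV i j)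

theorem MemM.mul (hU : h.MemM U) (hV : h.MemM V) : h.MemM fun p => U p * V p := fun i j => by
  simp only [Matrix.mul_apply]
  exact h.sum_mem fun k _ => h.mul_mem (hU i k) (hV k j)

theorem MemM.smul {c : Params → RatFun} (hc : c ∈ ratFam h) (hV : h.MemM V) :
    h.MemM fun p => c p • V p := fun i j => h.mul_mem hc (hV i j)

theorem MemM.dm {g : Params → RatFun} (hg : g ∈ ratFam h) (hU : h.MemM U) :
    h.MemM fun p => dm (g p) (U p) := fun i j => h.mul_mem hg (h.der_mem (hU i j))

theorem MemM.diagonal {a : Fin n → Params → RatFun} (ha : ∀ i, a i ∈ ratFam h) :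
    h.MemM fun p => Matrix.diagonal fun i => a i p := fun i j => by
  by_cases e : i = j
  · subst e; simpa using ha i
  · convert (ratFam h).zero_mem using 1; ext1 p; exact Matrix.diagonal_apply_ne _ e

end IsDen

theorem opOf_one (c : ℕ → RatFun) : opOf 1 c = mul (c 0) + mul (c 1) * D := by
  simp [opOf, Finset.sum_range_succ]

theorem op1_apply {n : ℕ} (g : RatFun) (u v : FunMatrix n) (i j : Fin n) :
    op1 g u v i j = opOf 1 fun m => if m = 0 then u i j else v i j * g := by
  rw [opOf_one, if_pos rfl, if_neg one_ne_zero, op1, Matrix.add_apply, MM_apply, DD,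
    Matrix.scalar_apply, Matrix.mul_diagonal, MM_apply, ← mul_assoc, ← mulHom_apply,
    ← mulHom_apply, ← mulHom_apply, ← mulHom_apply, map_mul]

theorem MM_op1_MM {n : ℕ} (g : RatFun) (A u v B : FunMatrix n) :
    MM A * op1 g u v * MM B = op1 g (A * (u * B + v * dm g B)) (A * (v * B)) := by
  rw [mul_assoc, op1_mul_MM, MM_mul_op1]

theorem IsDen.op1_family (h : IsDen dom δ) {n : ℕ} {U V : Params → FunMatrix n}
    {g : Params → RatFun} (hg : g ∈ ratFam h) (hU : h.MemM U) (hV : h.MemM V) :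
    IsRationalOpFamily dom δ 1 fun p => op1 (g p) (U p) (V p) := by
  refine ⟨fun m i j p => if m = 0 then U p i j else V p i j * g p,
    fun p _ i j => op1_apply _ _ _ _ _, fun m i j => ?_⟩
  by_cases hm : m = 0
  · simp only [hm, if_true]; exact hU i j
  · simp only [hm, if_false]; exact h.mul_mem (hV i j) hg

theorem IsRationalOpFamily.congr {n d : ℕ} {P Q : Params → OpMatrix n}
    (hP : IsRationalOpFamily dom δ d P) (hQ : ∀ p, dom p → Q p = P p) :
    IsRationalOpFamily dom δ d Q := by
  obtain ⟨c, h1, h2⟩ := hP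
  exact ⟨c, fun p hp i j => by rw [hQ p hp, h1 p hp], h2⟩

theorem IsDen.ev_mem (h : IsDen dom δ) {v : Params → Fin 5 → RatFun}
    (hv : ∀ i, (fun p => v p i) ∈ ratFam h) (q : RadPoly) : (fun p => q.ev (v p)) ∈ ratFam h := by
  obtain ⟨l⟩ := q
  induction l with
  | nil => exact (ratFam h).zero_mem
  | cons t l ih =>
    obtain ⟨c, i, j, k, l', n⟩ := t
    simp only [RadPoly.ev_mk_cons, Term.ev_mk, ← con_intCast]
    exact h.add_mem (h.mul_mem (h.con_mem _) (h.mul_mem (h.mul_mem (h.mul_mem (h.mul_mem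
      (h.pow_mem (hv 0) i) (h.pow_mem (hv 1) j)) (h.pow_mem (hv 2) k)) (h.pow_mem (hv 3) l'))
      (h.pow_mem (hv 4) n))) ih

/-- The families needed for the arrows of a system are rational. -/
structure System.IsFam {n : ℕ} (S : System n) (lam : Params → Fin n → ℂ) (h : IsDen dom δ) :
    Prop where
  r_inv : (fun _ => r⁻¹) ∈ ratFam h
  f_inv : (fun p => (p.f)⁻¹) ∈ ratFam h
  y : (fun p => vars S.N p 4) ∈ ratFam h
  δ_inv : (fun p => (S.val p S.δ)⁻¹) ∈ ratFam h
  den_inv : (fun p => (S.val p S.den)⁻¹) ∈ ratFam h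
  ν_inv : ∀ i, (fun p => (S.val p (S.ν i))⁻¹) ∈ ratFam h
  lam_mem : ∀ i, (fun p => con (lam p i)) ∈ ratFam h
  lam_inv : ∀ i, (fun p => (con (lam p i))⁻¹) ∈ ratFam h

namespace System.IsFam

variable {n : ℕ} {S : System n} {lam : Params → Fin n → ℂ} {h : IsDen dom δ}

theorem val (hS : S.IsFam lam h) (q : RadPoly) : (fun p => S.val p q) ∈ ratFam h := by
  refine h.ev_mem (fun i => ?_) q
  fin_cases i
  · exact hS.r_inv
  · change (fun p : Params => con (p.M / 6)) ∈ ratFam h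
    simp only [div_eq_mul_inv, con_mul]
    exact h.mul_mem h.M_mem (h.con_mem _)
  · exact h.B_mem
  · change (fun p : Params => con (Complex.I * p.ω)) ∈ ratFam h
    simp only [con_mul]
    exact h.mul_mem (h.con_mem _) h.ω_mem
  · exact hS.y

theorem f (hS : S.IsFam lam h) : (fun p => p.f) ∈ ratFam h := by
  simpa only [System.val, System.ev_f] using hS.val (1 - 12 * RadPoly.u * RadPoly.x)

theorem mat (hS : S.IsFam lam h) (A : PMat n) : h.MemM fun p => S.mat p A :=
  fun i j => hS.val (A i j)

theorem fpow (hS : S.IsFam lam h) (k : ℤ) : (fun p => p.f ^ k) ∈ ratFam h :=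
  h.zpow_mem hS.f hS.f_inv k

/-- The arrows are assembled from the tables and from the inverses listed in `IsFam` by ring
operations and derivations. Multiplying a first-order operator by function matrices on either side
does not raise its order, and the homotopies have order zero. -/
theorem arrows (hS : S.IsFam lam h) (pw : Fin n → ℕ) :
    IsRationalArrowFamily dom δ fun p => (S.hat pw (lam p) p).arrows p.f := by
  have hK : h.MemM fun p => S.scale p := IsDen.MemM.diagonal hS.ν_inv
  have ha : h.MemM fun p => (S.hat pw (lam p) p).a := hK.mul (hS.mat _)
  have hb : h.MemM fun p => (S.hat pw (lam p) p).b := hK.mul (hS.mat _)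
  have hΓ : h.MemM fun p => S.Γ p := IsDen.MemM.diagonal fun i =>
    h.mul_mem (by simpa only [div_eq_mul_inv] using h.mul_mem (hS.val _) hS.δ_inv) (hS.fpow _)
  have hq₀ : h.MemM fun p => (S.hat pw (lam p) p).q₀ := hΓ.mul (hS.mat _)
  have hq₁ : h.MemM fun p => (S.hat pw (lam p) p).q₁ := hΓ.mul (hS.mat _)
  have hR₁ : h.MemM fun p => (S.hat pw (lam p) p).R₁ := hS.mat _
  have hL : h.MemM fun p => (S.hat pw (lam p) p).L := IsDen.MemM.diagonal fun i =>
    h.mul_mem (h.mul_mem (h.mul_mem (h.con_mem _) (hS.val _)) h.r_mem) (hS.fpow _)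
  have hLi : h.MemM fun p => (S.hat pw (lam p) p).Li := IsDen.MemM.diagonal fun i =>
    h.mul_mem (h.mul_mem (by simpa only [div_eq_mul_inv] using h.mul_mem (hS.val _) hS.δ_inv)
      hS.r_inv) (hS.fpow _)
  have hSS : h.MemM fun p => (S.hat pw (lam p) p).S := IsDen.MemM.diagonal fun i =>
    h.mul_mem hS.r_inv (h.pow_mem hS.f _)
  have hSi : h.MemM fun p => (S.hat pw (lam p) p).Si := IsDen.MemM.diagonal fun i =>
    h.mul_mem h.r_mem (hS.fpow _)
  have hU : h.MemM fun p => (S.hat pw (lam p) p).U := IsDen.MemM.diagonal fun i => by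
    simpa only [div_eq_mul_inv] using h.mul_mem (hS.lam_mem i) hS.f_inv
  have hUi : h.MemM fun p => (S.hat pw (lam p) p).Ui := IsDen.MemM.diagonal fun i => by
    simpa only [div_eq_mul_inv] using h.mul_mem hS.f (hS.lam_inv i)
  have hCi : h.MemM fun p => (S.hat pw (lam p) p).Ci := IsDen.MemM.smul
    (by simpa only [div_eq_mul_inv] using h.mul_mem (hS.val _) hS.den_inv) (hS.mat _)
  have two : ∀ {V : Params → FunMatrix n}, h.MemM V → h.MemM fun p => 2 * V p := fun hV => by
    simpa only [two_mul] using hV.add hV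
  have hs : h.MemM fun p => (S.hat pw (lam p) p).s p.f :=
    (ha.add (two (hb.dm hS.f))).sub (hb.mul hR₁)
  have ht : h.MemM fun p => (S.hat pw (lam p) p).t p.f :=
    (hq₀.add (two (hq₁.dm hS.f))).add (hR₁.mul hq₁)
  have h1 : h.MemM fun _ => (1 : FunMatrix n) := fun i j => by
    by_cases e : i = j
    · convert (ratFam h).one_mem using 1; ext1 p; rw [e]; exact Matrix.one_apply_eq j
    · convert (ratFam h).zero_mem using 1; ext1 p; exact Matrix.one_apply_ne e
  have key : ∀ {A u v B : Params → FunMatrix n}, h.MemM A → h.MemM u → h.MemM v → h.MemM B →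
      IsRationalOpFamily dom δ 1 fun p => MM (A p) * op1 p.f (u p) (v p) * MM (B p) := by
    intro A u v B hA hu hv hB
    refine (h.op1_family hS.f (hA.mul ((hu.mul hB).add (hv.mul (hB.dm hS.f))))
      (hA.mul (hv.mul hB))).congr fun p _ => MM_op1_MM _ _ _ _ _
  have key0 : ∀ {A : Params → FunMatrix n}, h.MemM A →
      IsRationalOpFamily dom δ 1 fun p => MM (A p) := by
    intro A hA
    refine (h.op1_family (V := fun _ => 0) hS.f hA fun i j => (ratFam h).zero_mem).congr
      fun p _ => ?_
    rw [op1, map_zero, zero_mul, add_zero]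
  refine ⟨?_, key hU hs hb hLi, key hSS hq₀ hq₁ hCi, key hL ht hq₁ (hCi.mul hUi),
    key0 ((hSS.mul ((hq₁.mul hCi).mul hb)).mul hLi).neg,
    key0 (((hb.mul hq₁).mul hCi).mul hUi).neg⟩
  refine (key h1 ha hb hSi).congr fun p _ => ?_
  rw [map_one, one_mul]; rfl

end System.IsFam

end

section

/-! ### Values of rational functions and the massless limit -/

/-- Evaluation is defined through the reduced fraction. Its denominator divides `b`, so it does not
vanish at `z` either. -/
theorem evalAt_div {z : ℂ} {a b : Polynomial ℂ} (hb : b.eval z ≠ 0) :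
    evalAt z (algebraMap (Polynomial ℂ) RatFun a / algebraMap (Polynomial ℂ) RatFun b) =
      a.eval z / b.eval z := by
  have hb0 : b ≠ 0 := fun h => hb (by rw [h, Polynomial.eval_zero])
  set x : RatFun := algebraMap (Polynomial ℂ) RatFun a / algebraMap (Polynomial ℂ) RatFun b
  have key : x.num * b = a * x.denom := (RatFunc.num_mul_eq_mul_denom_iff hb0).2 rfl
  have hd : x.denom.eval z ≠ 0 := by
    obtain ⟨c, hc⟩ : x.denom ∣ b := RatFunc.denom_div_dvd a b
    intro h
    rw [hc, Polynomial.eval_mul, h, zero_mul] at hb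
    exact hb rfl
  have key' := congrArg (Polynomial.eval z) key
  rw [Polynomial.eval_mul, Polynomial.eval_mul] at key'
  rw [evalAt, RatFunc.eval, ← Polynomial.eval, ← Polynomial.eval]
  rwa [div_eq_div_iff hd hb]

/-- The polynomial in `r` obtained by fixing the parameters. -/
def polyIn (N : MvPolynomial (Fin 4) ℂ) (p : Params) : Polynomial ℂ :=
  MvPolynomial.aeval ![Polynomial.C p.M, Polynomial.C p.ω, Polynomial.C p.B, Polynomial.X] N

theorem polyAt_eq (N : MvPolynomial (Fin 4) ℂ) (p : Params) :
    polyAt N p = algebraMap (Polynomial ℂ) RatFun (polyIn N p) := by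
  rw [polyIn, ← MvPolynomial.aeval_algebraMap_apply, polyAt]
  congr 2
  ext i
  fin_cases i <;> simp [con, r]

/-- The values of the parameters and of `r`. -/
def pt (p : Params) (z : ℂ) : Fin 4 → ℂ := ![p.M, p.ω, p.B, z]

theorem eval_polyIn (N : MvPolynomial (Fin 4) ℂ) (p : Params) (z : ℂ) :
    (polyIn N p).eval z = MvPolynomial.eval (pt p z) N := by
  induction N using MvPolynomial.induction_on with
  | C c => simp [polyIn]
  | add N N' h1 h2 => rw [polyIn, map_add, Polynomial.eval_add, map_add, ← h1, ← h2]; rfl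
  | mul_X N i h1 =>
    rw [polyIn, map_mul, Polynomial.eval_mul, map_mul, ← h1, MvPolynomial.aeval_X,
      MvPolynomial.eval_X]
    congr 1
    fin_cases i <;> simp [pt]

theorem evalAt_polyAt_div {N Nδ : MvPolynomial (Fin 4) ℂ} {m : ℕ} {p : Params} {z : ℂ}
    (h : MvPolynomial.eval (pt p z) Nδ ≠ 0) : evalAt z (polyAt N p / polyAt Nδ p ^ m) =
      MvPolynomial.eval (pt p z) N / MvPolynomial.eval (pt p z) Nδ ^ m := by
  rw [polyAt_eq, polyAt_eq, ← map_pow, evalAt_div, Polynomial.eval_pow, eval_polyIn, eval_polyIn]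
  rw [Polynomial.eval_pow, eval_polyIn]
  exact pow_ne_zero m h

variable {dom : Params → Prop} {δ : Params → RatFun}

theorem continuous_eval_pt (N : MvPolynomial (Fin 4) ℂ) (z : ℂ) {g : ℂ → Params}
    (hg : Continuous (fun t => (g t).M) ∧ Continuous (fun t => (g t).ω) ∧
      Continuous (fun t => (g t).B)) :
    Continuous fun t => MvPolynomial.eval (pt (g t) z) N := by
  refine (MvPolynomial.continuous_eval N).comp (continuous_pi fun i => ?_)
  fin_cases i
  · exact hg.1
  · exact hg.2.1
  · exact hg.2.2
  · exact continuous_const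

/-- At a fixed point r ≠ 0 each coefficient is a quotient of polynomials in M whose denominator is
nonzero at M = 0, hence is continuous there. The admissible parameters form a neighbourhood of M = 0
along the line considered, so this formula holds for all small M. -/
theorem IsRationalOpFamily.massless {n d : ℕ} {P : Params → OpMatrix n}
    (hP : IsRationalOpFamily dom δ d P) (Nδ : MvPolynomial (Fin 4) ℂ)
    (hδ : ∀ p, dom p → δ p = polyAt Nδ p)
    (h0 : ∀ p z, dom p → p.M = 0 → z ≠ 0 → MvPolynomial.eval (pt p z) Nδ ≠ 0)
    (hdom : ∀ ω B, dom ⟨0, ω, B⟩ → ∀ᶠ M in 𝓝 (0 : ℂ), dom ⟨M, ω, B⟩) :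
    HasMasslessLimit dom d P := by
  obtain ⟨c, hc, hr⟩ := hP
  refine ⟨c, hc, fun ω B h m _ i j z hz => ?_⟩
  obtain ⟨N, k, hN⟩ := hr m i j
  have hcont : ∀ N, Continuous fun M : ℂ => MvPolynomial.eval (pt ⟨M, ω, B⟩ z) N := fun N =>
    continuous_eval_pt N z ⟨continuous_id, continuous_const, continuous_const⟩
  have h1 := h0 _ z h rfl hz
  have h2 : ∀ᶠ M in 𝓝 (0 : ℂ), MvPolynomial.eval (pt ⟨M, ω, B⟩ z) Nδ ≠ 0 :=
    (hcont Nδ).continuousAt.eventually_ne h1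
  have key : ∀ M : ℂ, dom ⟨M, ω, B⟩ → MvPolynomial.eval (pt ⟨M, ω, B⟩ z) Nδ ≠ 0 →
      evalAt z (c m i j ⟨M, ω, B⟩) = MvPolynomial.eval (pt ⟨M, ω, B⟩ z) N /
        MvPolynomial.eval (pt ⟨M, ω, B⟩ z) Nδ ^ k := fun M hM hM' => by
    rw [hN _ hM, hδ _ hM]; exact evalAt_polyAt_div hM'
  rw [key 0 h h1]
  have h3 : Tendsto (fun M : ℂ => MvPolynomial.eval (pt ⟨M, ω, B⟩ z) N /
      MvPolynomial.eval (pt ⟨M, ω, B⟩ z) Nδ ^ k) (𝓝 0) (𝓝 (MvPolynomial.eval (pt ⟨0, ω, B⟩ z) N /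
        MvPolynomial.eval (pt ⟨0, ω, B⟩ z) Nδ ^ k)) :=
    ((hcont N).tendsto 0).div (((hcont Nδ).pow k).tendsto 0) (pow_ne_zero k h1)
  refine (h3.mono_left nhdsWithin_le_nhds).congr' (Filter.Eventually.filter_mono nhdsWithin_le_nhds ?_)
  filter_upwards [h2, hdom ω B h] with M hM hM'
  exact (key M hM' hM).symm

/-! ### The denominators of the sectors -/

/-- `r (r - 2M)` as a polynomial. -/
def radialPoly : MvPolynomial (Fin 4) ℂ :=
  .X 3 * (.X 3 - .C 2 * .X 0)

theorem polyAt_radialPoly (p : Params) : polyAt radialPoly p = radialDen p := by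
  simp only [polyAt, radialPoly, radialDen, map_mul, map_sub, MvPolynomial.aeval_X,
    MvPolynomial.aeval_C, con_mul]
  rfl

theorem eval_radialPoly (p : Params) (z : ℂ) :
    MvPolynomial.eval (pt p z) radialPoly = z * (z - 2 * p.M) := by
  simp [radialPoly, pt]

theorem f_eq_div (p : Params) : p.f = (r - con (2 * p.M)) / r := by
  rw [Params.f, Params.f₁]
  have := r_ne_zero
  field_simp

theorem radialDen_ne_zero (p : Params) : radialDen p ≠ 0 := by
  have h := p.f_ne_zero
  rw [f_eq_div] at h
  exact mul_ne_zero r_ne_zero fun h1 => h (by rw [h1, zero_div])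

/-- The product of the polar factors as a polynomial. -/
def Sector.polarPoly : Sector → MvPolynomial (Fin 4) ℂ
  | .scalar => .X 1
  | .vecOdd => .X 1 * .X 2
  | .vecEven => .X 1 * .X 2
  | .lichOdd => .X 1 * (.X 2 * (.X 2 - .C 2))
  | .lichEven => .X 1 * (.X 2 * (.X 2 - .C 2)) *
      ((.C 12 * .X 0 * .X 1) ^ 2 + (.X 2 * (.X 2 - .C 2)) ^ 2)

theorem Sector.eval_polarPoly (s : Sector) (p : Params) (z : ℂ) :
    MvPolynomial.eval (pt p z) s.polarPoly = s.polar p := by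
  cases s <;> simp [polarPoly, polar, angular, pt, Params.α, Params.A]

theorem Sector.polyAt_polarPoly (s : Sector) (p : Params) :
    polyAt s.polarPoly p = con (s.polar p) := by
  have h : ∀ z : ℂ, RatFunc.C z = con z := fun _ => rfl
  cases s <;> simp [polyAt, polarPoly, polar, angular, Params.α, Params.A, con_mul, con_sub,
    con_add, con_pow, h]

theorem Sector.isDen (s : Sector) : IsDen s.regular fun p => radialDen p * con (s.polar p) where
  poly := ⟨radialPoly * s.polarPoly, fun p _ => by
    rw [polyAt, map_mul, ← polyAt, ← polyAt, polyAt_radialPoly, s.polyAt_polarPoly]⟩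
  ne p hp := mul_ne_zero (radialDen_ne_zero p) (con_ne_zero hp)

theorem isDen_radialDen : IsDen (fun _ => True) radialDen where
  poly := ⟨radialPoly, fun p _ => (polyAt_radialPoly p).symm⟩
  ne p _ := radialDen_ne_zero p

/-- At M = 0 the radial denominator is r² and the polar factor is nonzero by regularity, which is an
open condition. -/
theorem Sector.massless (s : Sector) {n d : ℕ} {P : Params → OpMatrix n}
    (hP : IsRationalOpFamily s.regular (fun p => radialDen p * con (s.polar p)) d P) :
    HasMasslessLimit s.regular d P := by
  refine hP.massless (radialPoly * s.polarPoly) (fun p _ => ?_) (fun p z hp hM hz => ?_)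
    fun ω B h => ?_
  · rw [polyAt, map_mul, ← polyAt, ← polyAt, polyAt_radialPoly, s.polyAt_polarPoly]
  · rw [map_mul, eval_radialPoly, s.eval_polarPoly, hM, mul_zero, sub_zero]
    exact mul_ne_zero (mul_ne_zero hz hz) hp
  · have h1 := continuous_eval_pt s.polarPoly 0 (g := fun M => ⟨M, ω, B⟩)
      ⟨continuous_id, continuous_const, continuous_const⟩
    simp only [s.eval_polarPoly] at h1
    exact h1.continuousAt.eventually_ne h

theorem massless_of_radialDen {n d : ℕ} {P : Params → OpMatrix n}
    (hP : IsRationalOpFamily (fun _ => True) radialDen d P) :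
    HasMasslessLimit (fun _ => True) d P :=
  hP.massless radialPoly (fun p _ => (polyAt_radialPoly p).symm)
    (fun p z _ hM hz => by rw [eval_radialPoly, hM, mul_zero, sub_zero]; exact mul_ne_zero hz hz)
    fun _ _ _ => .of_forall fun _ => trivial

namespace IsDen

variable (h : IsDen dom δ)

theorem radialDen_mem : radialDen ∈ ratFam h := by
  convert h.poly_mem radialPoly using 1
  ext1 p
  exact (polyAt_radialPoly p).symm

theorem r_inv_mem (hi : (fun p => (radialDen p)⁻¹) ∈ ratFam h) : (fun _ => r⁻¹) ∈ ratFam h := by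
  refine h.congr (h.mul_mem hi (h.sub_mem h.r_mem (h.mul_mem (h.con_mem 2) h.M_mem))) fun p _ => ?_
  have h0 := radialDen_ne_zero p
  rw [radialDen] at h0 ⊢
  have := left_ne_zero_of_mul h0
  have := right_ne_zero_of_mul h0
  rw [← con_mul]
  field_simp

theorem f_inv_mem (hi : (fun p => (radialDen p)⁻¹) ∈ ratFam h) :
    (fun p => (p.f)⁻¹) ∈ ratFam h := by
  refine h.congr (h.mul_mem hi (h.pow_mem h.r_mem 2)) fun p _ => ?_
  have h0 := radialDen_ne_zero p
  rw [f_eq_div]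
  rw [radialDen] at h0 ⊢
  have := left_ne_zero_of_mul h0
  have := right_ne_zero_of_mul h0
  field_simp

theorem inv_of_dvd {a b c : Params → RatFun} (hb : (fun p => (b p)⁻¹) ∈ ratFam h)
    (hc : c ∈ ratFam h) (hab : ∀ p, dom p → a p * c p = b p) (h0 : ∀ p, dom p → b p ≠ 0) :
    (fun p => (a p)⁻¹) ∈ ratFam h := by
  refine h.congr (h.mul_mem hc hb) fun p hp => ?_
  have h1 := h0 p hp
  rw [← hab p hp] at h1 ⊢
  have := left_ne_zero_of_mul h1
  have := right_ne_zero_of_mul h1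
  field_simp

end IsDen

end

/-! ### Invertible factors of the denominators, and the diagrams of the sectors -/

section

variable {dom : Params → Prop} {δ : Params → RatFun}

set_option linter.unusedSimpArgs false

theorem IsDen.M_poly (h : IsDen dom δ) (N : MvPolynomial (Fin 4) ℂ) {a : Params → RatFun}
    (ha : ∀ p, a p = polyAt N p) : a ∈ ratFam h :=
  h.congr (h.poly_mem N) fun p _ => ha p

/-- The angular factors as a polynomial. -/
def Sector.angularPoly : Sector → MvPolynomial (Fin 4) ℂ
  | .scalar => 1
  | .vecOdd => .X 2
  | .vecEven => .X 2
  | .lichOdd => .X 2 * (.X 2 - .C 2)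
  | .lichEven => .X 2 * (.X 2 - .C 2)

theorem Sector.polyAt_angularPoly (s : Sector) (p : Params) :
    polyAt s.angularPoly p = con (s.angular p) := by
  have h : ∀ z : ℂ, RatFunc.C z = con z := fun _ => rfl
  cases s <;> simp [polyAt, angularPoly, angular, con_mul, con_sub, h]

/-- `α` as a polynomial. -/
def alphaPoly : MvPolynomial (Fin 4) ℂ :=
  (.C 12 * .X 0 * .X 1) ^ 2 + (.X 2 * (.X 2 - .C 2)) ^ 2

theorem polyAt_alphaPoly (p : Params) : polyAt alphaPoly p = con p.α := by
  have h : ∀ z : ℂ, RatFunc.C z = con z := fun _ => rfl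
  simp [polyAt, alphaPoly, Params.α, Params.A, con_mul, con_sub, con_add, con_pow, h]

/-- The invertible rational families. -/
structure IsDen.IsUnit (h : IsDen dom δ) (u : Params → RatFun) : Prop where
  mem : u ∈ ratFam h
  inv_mem : (fun p => (u p)⁻¹) ∈ ratFam h
  ne : ∀ p, dom p → u p ≠ 0

namespace IsDen.IsUnit

variable {h : IsDen dom δ} {u v : Params → RatFun}

theorem mul (hu : h.IsUnit u) (hv : h.IsUnit v) : h.IsUnit fun p => u p * v p :=
  ⟨h.mul_mem hu.mem hv.mem, by simpa only [mul_inv] using h.mul_mem hu.inv_mem hv.inv_mem,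
    fun p hp => mul_ne_zero (hu.ne p hp) (hv.ne p hp)⟩

theorem inv (hu : h.IsUnit u) : h.IsUnit fun p => (u p)⁻¹ :=
  ⟨hu.inv_mem, by simpa only [inv_inv] using hu.mem, fun p hp => inv_ne_zero (hu.ne p hp)⟩

theorem pow (hu : h.IsUnit u) (n : ℕ) : h.IsUnit fun p => u p ^ n :=
  ⟨h.pow_mem hu.mem n, by simpa only [inv_pow] using h.pow_mem hu.inv_mem n,
    fun p hp => pow_ne_zero n (hu.ne p hp)⟩

theorem const {z : ℂ} (hz : z ≠ 0) : h.IsUnit fun _ => con z :=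
  ⟨h.con_mem z, by simpa only [con_inv] using h.con_mem z⁻¹, fun _ _ => con_ne_zero hz⟩

theorem one : h.IsUnit fun _ => 1 := by simpa using const (h := h) one_ne_zero

theorem congr (hu : h.IsUnit u) (huv : ∀ p, v p = u p) : h.IsUnit v := by
  rwa [show v = u from funext huv]

/-- Since 1/u = v/(uv), inverting the single product δ inverts each of its factors. All denominators
of the arrows are reached in this way. -/
theorem of_mul (h2 : h.IsUnit fun p => u p * v p) (hu : u ∈ ratFam h) (hv : v ∈ ratFam h) :
    h.IsUnit u :=
  ⟨hu, h.inv_of_dvd h2.inv_mem hv (fun _ _ => rfl) h2.ne,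
    fun p hp => left_ne_zero_of_mul (h2.ne p hp)⟩

end IsDen.IsUnit

/-- The factors of the denominators are invertible. -/
structure IsDen.Basic (h : IsDen dom δ) (s : Sector) : Prop where
  radial : h.IsUnit radialDen
  ω : h.IsUnit fun p => con p.ω
  ang : h.IsUnit fun p => con (s.angular p)

theorem Sector.angular_mem (s : Sector) (h : IsDen dom δ) :
    (fun p => con (s.angular p)) ∈ ratFam h :=
  h.M_poly s.angularPoly fun p => (s.polyAt_angularPoly p).symm

theorem alpha_mem (h : IsDen dom δ) : (fun p => con p.α) ∈ ratFam h :=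
  h.M_poly alphaPoly fun p => (polyAt_alphaPoly p).symm

theorem IsDen.isUnit (h : IsDen dom δ) : h.IsUnit δ := by
  obtain ⟨N, hN⟩ := h.poly
  exact ⟨h.congr (h.poly_mem N) hN, h.inv_mem, h.ne⟩

theorem Sector.polar_unit (s : Sector) : s.isDen.IsUnit fun p => con (s.polar p) :=
  (s.isDen.isUnit.congr fun _ => mul_comm _ _).of_mul
    (s.isDen.M_poly s.polarPoly fun p => (s.polyAt_polarPoly p).symm) s.isDen.radialDen_mem

theorem Sector.basic (s : Sector) : s.isDen.Basic s := by
  have h := s.isDen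
  have hB := s.angular_mem h
  -- β is the cofactor remaining in the polar product after ω and the angular factors: α in the even
  -- Lichnerowicz sector, 1 in the others.
  have key : ∃ β : Params → RatFun, β ∈ ratFam h ∧
      ∀ p, con p.ω * (con (s.angular p) * β p) = con (s.polar p) := by
    cases s
    case lichEven =>
      exact ⟨_, alpha_mem h, fun p => by simp only [angular, polar, con_mul]; ring⟩
    all_goals
      refine ⟨fun _ => 1, (ratFam _).one_mem, fun p => ?_⟩
      simp only [angular, polar, con_mul, con_one]
      ring
  obtain ⟨β, hβ, h1⟩ := key
  have h2 := s.polar_unit.congr h1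
  exact ⟨h.isUnit.of_mul h.radialDen_mem s.polar_unit.mem, h2.of_mul h.ω_mem (h.mul_mem hB hβ),
    (h2.congr fun p => (by ring : con (s.angular p) * (con p.ω * β p) = _)).of_mul hB
      (h.mul_mem h.ω_mem hβ)⟩

theorem alpha_unit : (Sector.isDen .lichEven).IsUnit fun p => con p.α := by
  have h := Sector.isDen .lichEven
  have hB := Sector.angular_mem .lichEven h
  refine ((Sector.polar_unit .lichEven).congr (v := fun p => con p.α *
    (con p.ω * con (Sector.angular .lichEven p))) fun p => ?_).of_mul (alpha_mem h)
    (h.mul_mem h.ω_mem hB)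
  simp only [Sector.angular, Sector.polar, con_mul]
  ring

namespace IsDen.Basic

variable {h : IsDen dom δ}

theorem w {s : Sector} (hb : h.Basic s) : h.IsUnit fun p => con (Complex.I * p.ω) :=
  ((IsUnit.const Complex.I_ne_zero).mul hb.ω).congr fun _ => con_mul _ _

end IsDen.Basic

/-- The denominators of a system are invertible. -/
structure System.Units {n : ℕ} (S : System n) (lam : Params → Fin n → ℂ) (h : IsDen dom δ) :
    Prop where
  δ : h.IsUnit fun p => S.val p S.δ
  den : h.IsUnit fun p => S.val p S.den
  ν : ∀ i, h.IsUnit fun p => S.val p (S.ν i)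
  lam : ∀ i, h.IsUnit fun p => con (lam p i)

theorem System.Units.isFam {n : ℕ} {S : System n} {lam : Params → Fin n → ℂ} {h : IsDen dom δ}
    (hS : S.Units lam h) {s : Sector} (hb : h.Basic s)
    (hy : (fun p => vars S.N p 4) ∈ ratFam h) : S.IsFam lam h :=
  ⟨h.r_inv_mem hb.radial.inv_mem, h.f_inv_mem hb.radial.inv_mem, hy, hS.δ.inv_mem, hS.den.inv_mem,
    fun i => (hS.ν i).inv_mem, fun i => (hS.lam i).mem, fun i => (hS.lam i).inv_mem⟩

theorem System.Units.isHat {n : ℕ} {S : System n} {lam : Params → Fin n → ℂ} {h : IsDen dom δ}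
    (hS : S.Units lam h) {s : Sector} (hb : h.Basic s) (hv : S.Valid) (pw : Fin n → ℕ) {p : Params}
    (hN : S.N = 0 ∨ p.B ≠ 2) (hp : dom p) : (S.hat pw (lam p) p).IsHat p.f := by
  have h0 : ∀ {z : ℂ}, con z ≠ 0 → z ≠ 0 := fun hz e => hz (by rw [e, con_zero])
  exact hv.isHat hN (h0 (hb.ω.ne p hp)) (hS.δ.ne p hp) (hS.den.ne p hp) (fun i => (hS.ν i).ne p hp)
    fun i => h0 ((hS.lam i).ne p hp)

theorem lich_den (h : IsDen dom δ) (hb : h.Basic .lichEven) :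
    (h.IsUnit fun p => con p.B) ∧ (h.IsUnit fun p => con (p.B - 2)) ∧ h.IsUnit fun p => con p.A := by
  have h2 : (fun p : Params => con (p.B - 2)) ∈ ratFam h := by
    simpa only [con_sub] using h.sub_mem h.B_mem (h.con_mem 2)
  have h1 : h.IsUnit fun p => con (p.B - 2) * con p.B :=
    hb.ang.congr fun p => by simp only [Sector.angular, con_mul]; ring
  exact ⟨(h1.congr fun p => mul_comm _ _).of_mul h.B_mem h2, h1.of_mul h2 h.B_mem, hb.ang⟩

/-- All denominators are products of numbers, ω, angular factors and, in the even Lichnerowicz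
sector, α. The latter enters through the scale of row 3 and through the diagonal constant of Ẽ in
that row. -/
theorem Sector.units (s : Sector) : s.system.Units (diagConst s) s.isDen := by
  have hb := s.basic
  have hw := hb.w
  have hω := (hb.ω.pow 2).inv
  have c2 : s.isDen.IsUnit fun _ => con (-2) := IsDen.IsUnit.const (by norm_num)
  cases s
  · refine ⟨.congr .one fun p => ?_, .congr .one fun p => ?_, fun i => .congr .one fun p => ?_,
      fun i => hω.congr fun p => ?_⟩ <;> try fin_cases i
    all_goals simp [system, System.scalar, System.val, diagConst, con_pow, con_inv]
  · refine ⟨hb.ang.congr fun p => ?_, .congr .one fun p => ?_, fun i => .congr .one fun p => ?_,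
      fun i => (hb.ang.mul hω).congr fun p => ?_⟩ <;> try fin_cases i
    all_goals simp [system, System.vecOdd, System.val, System.vars_B, diagConst, con_pow, con_inv,
      con_div, con_mul, angular, div_eq_mul_inv]
  · refine ⟨hb.ang.congr fun p => ?_, (((IsDen.IsUnit.const (by norm_num : (4 : ℂ) ≠ 0)).mul hb.ang).mul
      (hw.pow 2)).congr fun p => ?_,
      fun i => .congr .one fun p => ?_, fun i => ?_⟩ <;> try fin_cases i
    on_goal 6 => refine hω.congr fun p => ?_
    on_goal 7 => refine (hb.ang.mul hω).congr fun p => ?_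
    on_goal 8 => refine hω.congr fun p => ?_
    all_goals simp [system, System.vecEven, System.val, System.vars_B, System.vars_w, diagConst,
      con_pow, con_inv, con_div, con_mul, con_ofNat, angular, div_eq_mul_inv]
  · obtain ⟨h1, h2, h3⟩ := lich_den (Sector.isDen .lichOdd) ⟨hb.radial, hb.ω, hb.ang⟩
    refine ⟨((IsDen.IsUnit.const (by norm_num : (2 : ℂ) ≠ 0)).mul h3).congr fun p => ?_,
      ((((IsDen.IsUnit.const (by norm_num : (1296 : ℂ) ≠ 0)).mul (h1.pow 2)).mul h2).mul
      (hw.pow 2)).congr fun p => ?_,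
      fun i => .congr .one fun p => ?_, fun i => ?_⟩ <;> try fin_cases i
    on_goal 6 => refine ((c2.mul h1).mul hω).congr fun p => ?_
    on_goal 7 => refine ((c2.mul h3).mul hω).congr fun p => ?_
    on_goal 8 => refine ((c2.mul h1).mul hω).congr fun p => ?_
    all_goals simp [system, System.lichOdd, System.val, System.vars_B, System.vars_w, diagConst,
      con_pow, con_inv, con_div, con_ofNat, con_mul, con_sub, con_neg, Params.A, div_eq_mul_inv]
    all_goals ring
  · obtain ⟨h1, h2, h3⟩ := lich_den _ hb
    have hα := alpha_unit
    refine ⟨((IsDen.IsUnit.const (by norm_num : (2 : ℂ) ≠ 0)).mul h3).congr fun p => ?_,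
      ((((IsDen.IsUnit.const (by norm_num : (663552 : ℂ) ≠ 0)).mul (h1.pow 3)).mul h2).mul
      (hw.pow 4)).congr fun p => ?_, fun i => ?_, fun i => ?_⟩
    on_goal 3 =>
      by_cases hi : i = 3
      on_goal 1 => refine hα.congr fun p => ?_
      on_goal 2 => refine .congr .one fun p => ?_
    on_goal 5 =>
      fin_cases i
      on_goal 1 => refine (c2.mul hω).congr fun p => ?_
      on_goal 2 => refine ((c2.mul h1).mul hω).congr fun p => ?_
      on_goal 3 => refine (c2.mul hω).congr fun p => ?_
      on_goal 4 => refine ((c2.mul (hα.mul h3)).mul hω).congr fun p => ?_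
      on_goal 5 => refine (c2.mul hω).congr fun p => ?_
      on_goal 6 => refine ((c2.mul h1).mul hω).congr fun p => ?_
      on_goal 7 => refine (c2.mul hω).congr fun p => ?_
    on_goal 4 => clear hα; revert i; intro i hi; fin_cases i <;> first | exact absurd rfl hi | skip
    on_goal 3 => subst hi
    all_goals simp [system, System.lichEven, System.val, System.vars_B, System.vars_w,
      System.vars_u, diagConst, con_pow, con_inv, con_div, con_ofNat, con_mul, con_sub, con_add,
      con_neg, Params.A, Params.α, div_eq_mul_inv]
    all_goals
      have hI : con Complex.I ^ 2 = -1 := by rw [← con_pow, Complex.I_sq, con_neg, con_one]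
      first
      | ring1
      | linear_combination (-144 * con p.M ^ 2 * con p.ω ^ 2) * hI

theorem Sector.system_valid (s : Sector) : s.system.Valid := by
  cases s
  exacts [System.scalar_valid, System.vecOdd_valid, System.vecEven_valid, System.lichOdd_valid,
    System.lichEven_valid]

theorem Sector.system_N (s : Sector) : s.system.N = 0 := by cases s <;> rfl

/-- The arrows of the equivalence diagrams. -/
def Sector.arrows (s : Sector) (p : Params) : Arrows s.dim :=
  (s.system.hat s.pw (diagConst s p) p).arrows p.f

theorem Sector.isHat (s : Sector) {p : Params} (hp : s.regular p) :
    (s.system.hat s.pw (diagConst s p) p).IsHat p.f :=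
  s.units.isHat s.basic s.system_valid s.pw (.inl s.system_N) hp

theorem Sector.isEquivalence (s : Sector) {p : Params} (hp : s.regular p) :
    IsEquivalence (waveOp s p) (rwSystem s p) (s.arrows p) := by
  rw [waveOp_eq s p (diagConst s p), rwSystem_eq]
  exact (s.isHat hp).isEquivalence p.f_ne_zero

theorem Sector.isFam (s : Sector) : s.system.IsFam (diagConst s) s.isDen :=
  s.units.isFam s.basic (by rw [s.system_N]; exact (ratFam _).zero_mem)

theorem Sector.arrows_rational (s : Sector) :
    IsRationalArrowFamily s.regular (fun p => radialDen p * con (s.polar p)) s.arrows :=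
  s.isFam.arrows s.pw

end

section

variable {dom : Params → Prop} {δ : Params → RatFun}

/-! ### The Zerilli form -/

/-- The denominators of the Zerilli form. -/
def zerilliDen (p : Params) : RatFun :=
  radialDen p * con (p.ω * (p.B * (p.B - 2))) * (con (p.B - 2) * r + con (6 * p.M))

theorem r_mul_zerilliFactor (p : Params) :
    r * zerilliFactor p = con (p.B - 2) * r + con (6 * p.M) := by
  have := r_ne_zero
  rw [zerilliFactor, Params.f₁, con_mul, con_mul, con_ofNat, con_ofNat]
  field_simp
  ring

/-- `(B - 2) r + 6 M` as a polynomial. -/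
def factorPoly : MvPolynomial (Fin 4) ℂ := (.X 2 - .C 2) * .X 3 + .C 6 * .X 0

theorem polyAt_factorPoly (p : Params) :
    polyAt factorPoly p = con (p.B - 2) * r + con (6 * p.M) := by
  have h : ∀ z : ℂ, RatFunc.C z = con z := fun _ => rfl
  simp [polyAt, factorPoly, con_sub, con_mul]
  simp only [h, con_ofNat]

theorem isDen_zerilli : IsDen zerilliRegular zerilliDen where
  poly := ⟨radialPoly * Sector.polarPoly .lichOdd * factorPoly, fun p _ => by
    rw [polyAt, map_mul, map_mul, ← polyAt, ← polyAt, ← polyAt, polyAt_radialPoly,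
      Sector.polyAt_polarPoly, polyAt_factorPoly]; rfl⟩
  ne p hp := by
    rw [zerilliDen, ← r_mul_zerilliFactor]
    exact mul_ne_zero (mul_ne_zero (radialDen_ne_zero p) (con_ne_zero hp))
      (mul_ne_zero r_ne_zero (System.zerilliFactor_ne_zero
        (sub_ne_zero.1 (right_ne_zero_of_mul (right_ne_zero_of_mul hp)))))

theorem factor_mem (h : IsDen dom δ) : (fun p => con (p.B - 2) * r + con (6 * p.M)) ∈ ratFam h :=
  h.M_poly factorPoly fun p => (polyAt_factorPoly p).symm

theorem zerilli_units : (isDen_zerilli.Basic .lichEven) ∧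
    isDen_zerilli.IsUnit fun p => con (p.B - 2) * r + con (6 * p.M) := by
  have h := isDen_zerilli
  have hp : (fun p : Params => con (p.ω * (p.B * (p.B - 2)))) ∈ ratFam h :=
    h.M_poly (Sector.polarPoly .lichOdd) fun p => (Sector.polyAt_polarPoly .lichOdd p).symm
  have hB := Sector.angular_mem .lichEven h
  have h1 : h.IsUnit fun p => radialDen p * con (p.ω * (p.B * (p.B - 2))) :=
    h.isUnit.of_mul (h.mul_mem h.radialDen_mem hp) (factor_mem h)
  have h2 : h.IsUnit fun p => con (p.ω * (p.B * (p.B - 2))) :=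
    (h1.congr fun p => mul_comm _ _).of_mul hp h.radialDen_mem
  have h3 : h.IsUnit fun p => con p.ω * con (Sector.angular .lichEven p) :=
    h2.congr fun p => (con_mul _ _).symm
  exact ⟨⟨h1.of_mul h.radialDen_mem hp, h3.of_mul h.ω_mem hB,
    (h3.congr fun p => mul_comm _ _).of_mul hB h.ω_mem⟩,
    (h.isUnit.congr fun p => mul_comm _ _).of_mul (factor_mem h) (h.mul_mem h.radialDen_mem hp)⟩

/-- Here the scales ν are 1 and the diagonal constants do not contain α, so α is never inverted. The
price is the variable y, whose denominator is (𝓑-2)r + 6M. -/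
theorem zerilliSys_units : System.zerilliSys.Units zerilliDiag isDen_zerilli := by
  have hb := zerilli_units.1
  have hw := hb.w
  have hω := (hb.ω.pow 2).inv
  have c2 : isDen_zerilli.IsUnit fun _ => con (-2) := IsDen.IsUnit.const (by norm_num)
  obtain ⟨h1, h2, h3⟩ := lich_den _ hb
  refine ⟨((IsDen.IsUnit.const (by norm_num : (2 : ℂ) ≠ 0)).mul h3).congr fun p => ?_,
    ((((IsDen.IsUnit.const (by norm_num : (663552 : ℂ) ≠ 0)).mul (h1.pow 3)).mul h2).mul
    (hw.pow 4)).congr fun p => ?_, fun i => .congr .one fun p => ?_, fun i => ?_⟩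
  on_goal 4 =>
    fin_cases i
    on_goal 1 => refine (c2.mul hω).congr fun p => ?_
    on_goal 2 => refine ((c2.mul h1).mul hω).congr fun p => ?_
    on_goal 3 => refine (c2.mul hω).congr fun p => ?_
    on_goal 4 => refine ((c2.mul h3).mul hω).congr fun p => ?_
    on_goal 5 => refine (c2.mul hω).congr fun p => ?_
    on_goal 6 => refine ((c2.mul h1).mul hω).congr fun p => ?_
    on_goal 7 => refine (c2.mul hω).congr fun p => ?_
  all_goals simp [System.zerilliSys, System.lichEven, System.val, System.vars_B, System.vars_w,
      zerilliDiag, diagConst, con_pow, con_inv, con_ofNat, con_mul, con_sub,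
      con_neg, Params.A, div_eq_mul_inv]
  all_goals ring1

theorem vars_y_mem : (fun p => vars System.zerilliSys.N p 4) ∈ ratFam isDen_zerilli := by
  refine isDen_zerilli.congr (isDen_zerilli.mul_mem isDen_zerilli.r_mem zerilli_units.2.inv_mem)
    fun p hp => ?_
  have := r_ne_zero
  rw [← r_mul_zerilliFactor, mul_inv, ← mul_assoc, mul_inv_cancel₀ this, one_mul]
  rfl

/-- The arrows of the equivalence diagram with the Zerilli form. -/
def zerilliArrows (p : Params) : Arrows 7 :=
  (System.zerilliSys.hat (Sector.pw .lichEven) (zerilliDiag p) p).arrows p.f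

theorem zerilli_isHat {p : Params} (hp : zerilliRegular p) :
    (System.zerilliSys.hat (Sector.pw .lichEven) (zerilliDiag p) p).IsHat p.f :=
  zerilliSys_units.isHat zerilli_units.1 System.zerilliSys_valid _
    (.inr (sub_ne_zero.1 (right_ne_zero_of_mul (right_ne_zero_of_mul hp)))) hp

theorem zerilli_isEquivalence {p : Params} (hp : zerilliRegular p) :
    IsEquivalence (waveOp .lichEven p) (zerilliSystem .lichEven p) (zerilliArrows p) := by
  rw [waveOp_eq', zerilliSystem_eq]
  exact (zerilli_isHat hp).isEquivalence p.f_ne_zero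

theorem zerilliArrows_rational : IsRationalArrowFamily zerilliRegular zerilliDen zerilliArrows :=
  (zerilliSys_units.isFam zerilli_units.1 vars_y_mem).arrows _

/-! ### Second order operators -/

theorem sandwich_eq_opOf (e a g b c s : RatFun) :
    mul a * (mul e * (mul g * D) ^ 2 + mul b * (mul g * D) + mul c) * mul s =
      opOf 2 fun m =>
        if m = 2 then a * e * g ^ 2 * s
        else if m = 1 then a * (e * g * (der g * s + 2 * g * der s) + b * g * s)
        else a * (e * g * (der g * der s + g * der (der s)) + b * g * der s + c * s) := by
  ext1 z
  simp only [opOf, Finset.sum_range_succ, Finset.sum_range_zero, zero_add, if_true,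
    pow_two, pow_one, pow_zero, mul_one, Module.End.mul_apply, LinearMap.add_apply, mul_apply', D_apply,
    Derivation.leibniz, smul_eq_mul, map_add, show (1 : ℕ) ≠ 2 by decide, show (0 : ℕ) ≠ 2 by decide,
    show (0 : ℕ) ≠ 1 by decide, if_false]
  ring

/-- The coefficients of `a (e (g ∂)² + b g ∂ + c) s`. -/
def sandwichCoeff (e a g b c s : RatFun) (m : ℕ) : RatFun :=
  if m = 2 then a * e * g ^ 2 * s
  else if m = 1 then a * (e * g * (der g * s + 2 * g * der s) + b * g * s)
  else a * (e * g * (der g * der s + g * der (der s)) + b * g * der s + c * s)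

theorem sandwichCoeff_mem {h : IsDen dom δ} {e a g b c s : Params → RatFun} (he : e ∈ ratFam h)
    (ha : a ∈ ratFam h) (hg : g ∈ ratFam h) (hb : b ∈ ratFam h) (hc : c ∈ ratFam h)
    (hs : s ∈ ratFam h) (m : ℕ) :
    (fun p => sandwichCoeff (e p) (a p) (g p) (b p) (c p) (s p) m) ∈ ratFam h := by
  have hs' := h.der_mem hs
  have hs'' := h.der_mem hs'
  have hg' := h.der_mem hg
  have h2 : (fun _ => (2 : RatFun)) ∈ ratFam h := by simpa only [con_ofNat] using h.con_mem 2
  unfold sandwichCoeff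
  split_ifs
  · exact h.mul_mem (h.mul_mem (h.mul_mem ha he) (h.pow_mem hg 2)) hs
  · exact h.mul_mem ha (h.add_mem (h.mul_mem (h.mul_mem he hg)
      (h.add_mem (h.mul_mem hg' hs) (h.mul_mem (h.mul_mem h2 hg) hs')))
      (h.mul_mem (h.mul_mem hb hg) hs))
  · exact h.mul_mem ha (h.add_mem (h.add_mem (h.mul_mem (h.mul_mem he hg)
      (h.add_mem (h.mul_mem hg' hs') (h.mul_mem hg hs''))) (h.mul_mem (h.mul_mem hb hg) hs'))
      (h.mul_mem hc hs))

theorem sandwich_apply {n : ℕ} (a s : Fin n → RatFun) (g : RatFun) (R₁ R₀ : FunMatrix n)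
    (i j : Fin n) : (MM (Matrix.diagonal a) * op2 g R₁ R₀ * MM (Matrix.diagonal s)) i j =
      opOf 2 (sandwichCoeff (if i = j then 1 else 0) (a i) g (R₁ i j) (R₀ i j) (s j)) := by
  rw [diag_sandwich, op2_apply]
  refine Eq.trans ?_ (sandwich_eq_opOf _ _ _ _ _ _)
  congr 4
  split_ifs
  · rw [show mul 1 = 1 from map_one mulHom, one_mul]
  · rw [show mul 0 = 0 from map_zero mulHom, zero_mul]

theorem IsDen.sandwich_family (h : IsDen dom δ) {n : ℕ} {a s : Params → Fin n → RatFun}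
    {g : Params → RatFun} {R₁ R₀ : Params → FunMatrix n} (ha : ∀ i, (fun p => a p i) ∈ ratFam h)
    (hs : ∀ i, (fun p => s p i) ∈ ratFam h) (hg : g ∈ ratFam h) (h1 : h.MemM R₁) (h0 : h.MemM R₀)
    (m : ℕ) (i j : Fin n) : IsRationalFamily dom δ fun p =>
      sandwichCoeff (if i = j then 1 else 0) (a p i) (g p) (R₁ p i j) (R₀ p i j) (s p j) m := by
  refine sandwichCoeff_mem (h := h) ?_ (ha i) hg (h1 i j) (h0 i j) (hs j) m
  split_ifs
  · exact (ratFam h).one_mem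
  · exact (ratFam h).zero_mem

theorem radialDen_unit : isDen_radialDen.IsUnit radialDen := isDen_radialDen.isUnit

theorem isDen_radialDen_val {n : ℕ} (S : System n) (hN : S.N = 0) (q : RadPoly) :
    (fun p => S.val p q) ∈ ratFam isDen_radialDen := by
  have h := isDen_radialDen
  refine h.ev_mem (fun i => ?_) q
  fin_cases i
  · exact h.r_inv_mem radialDen_unit.inv_mem
  · change (fun p : Params => con (p.M / 6)) ∈ ratFam h
    simp only [div_eq_mul_inv, con_mul]
    exact h.mul_mem h.M_mem (h.con_mem _)
  · exact h.B_mem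
  · change (fun p : Params => con (Complex.I * p.ω)) ∈ ratFam h
    simp only [con_mul]
    exact h.mul_mem (h.con_mem _) h.ω_mem
  · rw [hN]; exact (ratFam h).zero_mem

theorem f_unit (h : IsDen dom δ) (hr : h.IsUnit radialDen) : h.IsUnit fun p => p.f := by
  refine ⟨?_, h.f_inv_mem hr.inv_mem, fun p _ => p.f_ne_zero⟩
  simp only [f_eq_div, div_eq_mul_inv, con_mul]
  exact h.mul_mem (h.sub_mem h.r_mem (h.mul_mem (h.con_mem 2) h.M_mem)) (h.r_inv_mem hr.inv_mem)

/-- The coefficients of the wave operators. -/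
def Sector.waveCoeff (s : Sector) (m : ℕ) (i j : Fin s.dim) (p : Params) : RatFun :=
  sandwichCoeff (if i = j then 1 else 0)
    (con (1 / 2) * s.system.val p (s.system.κ i) * r * p.f ^ ((s.system.e i : ℤ) - 1 - s.pw i)) p.f
    (s.system.mat p s.system.R₁ i j) (s.system.mat p s.system.R i j)
    (r * p.f ^ (-(s.pw j : ℤ))) m

theorem Sector.waveCoeff_spec (s : Sector) :
    HasCoeffs (fun _ => True) 2 (waveOp s) s.waveCoeff ∧
      ∀ m i j, IsRationalFamily (fun _ => True) radialDen (s.waveCoeff m i j) := by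
  have h := isDen_radialDen
  have hf := f_unit h radialDen_unit
  have hv := isDen_radialDen_val s.system s.system_N
  refine ⟨fun p _ i j => ?_, h.sandwich_family (fun i => ?_) (fun i => ?_) hf.mem
    (fun i j => hv _) fun i j => hv _⟩
  · rw [waveOp_eq s p 0]
    exact sandwich_apply _ _ _ _ _ _ _
  · exact h.mul_mem (h.mul_mem (h.mul_mem (h.con_mem _) (hv _)) h.r_mem)
      (h.zpow_mem hf.mem hf.inv_mem _)
  · exact h.mul_mem h.r_mem (h.zpow_mem hf.mem hf.inv_mem _)

theorem Sector.rwSystem_rational (s : Sector) : IsRationalOpFamily s.regular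
    (fun p => radialDen p * con (s.polar p)) 2 (rwSystem s) := by
  have h := s.isDen
  have hf := f_unit h s.basic.radial
  refine ⟨fun m i j p => _, fun p _ i j => ?_, h.sandwich_family
    (a := fun p i => con (diagConst s p i) / p.f) (s := fun _ _ => 1) (R₁ := fun _ => 0)
    (R₀ := fun p => -s.system.mat p s.system.W) (fun i => ?_) (fun i => ?_)
    hf.mem (fun i j => (ratFam h).zero_mem) fun i j => ?_⟩
  · rw [rwSystem_eq]
    have := sandwich_apply (fun i => con (diagConst s p i) / p.f) (fun _ => 1) p.f 0
      (-s.system.mat p s.system.W) i j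
    rw [Matrix.diagonal_one, map_one, mul_one] at this
    exact this
  · simpa only [div_eq_mul_inv] using h.mul_mem (s.units.lam i).mem hf.inv_mem
  · exact (ratFam h).one_mem
  · exact h.neg_mem (s.isFam.mat _ i j)

end

section

/-! ### Values -/

/-- `x` is regular at `z`, with value `v`. -/
def IsValue (z : ℂ) (x : RatFun) (v : ℂ) : Prop := ∃ a b : Polynomial ℂ, b.eval z ≠ 0 ∧
  x = algebraMap (Polynomial ℂ) RatFun a / algebraMap (Polynomial ℂ) RatFun b ∧
  v = a.eval z / b.eval z

namespace IsValue

variable {z : ℂ} {x y : RatFun} {v w : ℂ}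

theorem evalAt_eq (h : IsValue z x v) : evalAt z x = v := by
  obtain ⟨a, b, hb, rfl, rfl⟩ := h
  exact evalAt_div hb

theorem poly (z : ℂ) (a : Polynomial ℂ) : IsValue z (algebraMap (Polynomial ℂ) RatFun a) (a.eval z) :=
  ⟨a, 1, by simp, by simp, by simp⟩

theorem con (z c : ℂ) : IsValue z (con c) c := by
  simpa [Schw.con] using poly z (Polynomial.C c)

theorem r (z : ℂ) : IsValue z r z := by
  simpa [Schw.r] using poly z Polynomial.X

theorem mul (hx : IsValue z x v) (hy : IsValue z y w) : IsValue z (x * y) (v * w) := by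
  obtain ⟨a, b, hb, rfl, rfl⟩ := hx
  obtain ⟨a', b', hb', rfl, rfl⟩ := hy
  exact ⟨a * a', b * b', by rw [Polynomial.eval_mul]; exact mul_ne_zero hb hb',
    by rw [map_mul, map_mul, div_mul_div_comm], by
    rw [Polynomial.eval_mul, Polynomial.eval_mul, div_mul_div_comm]⟩

theorem add (hx : IsValue z x v) (hy : IsValue z y w) : IsValue z (x + y) (v + w) := by
  obtain ⟨a, b, hb, rfl, rfl⟩ := hx
  obtain ⟨a', b', hb', rfl, rfl⟩ := hy
  have h0 : ∀ {b : Polynomial ℂ}, b.eval z ≠ 0 → algebraMap (Polynomial ℂ) RatFun b ≠ 0 :=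
    fun hb => algebraMap_ne_zero' fun h => hb (by rw [h, Polynomial.eval_zero])
  refine ⟨a * b' + b * a', b * b', by rw [Polynomial.eval_mul]; exact mul_ne_zero hb hb', ?_, ?_⟩
  · rw [div_add_div _ _ (h0 hb) (h0 hb')]; simp only [map_add, map_mul]
  · rw [div_add_div _ _ hb hb']; simp only [Polynomial.eval_add, Polynomial.eval_mul]

theorem neg (hx : IsValue z x v) : IsValue z (-x) (-v) := by
  have := (con z (-1)).mul hx
  rwa [con_neg, con_one, neg_one_mul, neg_one_mul] at this

theorem sub (hx : IsValue z x v) (hy : IsValue z y w) : IsValue z (x - y) (v - w) := by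
  rw [sub_eq_add_neg, sub_eq_add_neg]; exact hx.add hy.neg

theorem inv (hx : IsValue z x v) (hv : v ≠ 0) : IsValue z x⁻¹ v⁻¹ := by
  obtain ⟨a, b, hb, rfl, rfl⟩ := hx
  exact ⟨b, a, fun h => hv (by rw [h, zero_div]), by rw [inv_div], by rw [inv_div]⟩

theorem div (hx : IsValue z x v) (hy : IsValue z y w) (hw : w ≠ 0) : IsValue z (x / y) (v / w) := by
  rw [div_eq_mul_inv, div_eq_mul_inv]; exact hx.mul (hy.inv hw)

theorem one (z : ℂ) : IsValue z 1 1 := by simpa using con z 1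

theorem pow (hx : IsValue z x v) (n : ℕ) : IsValue z (x ^ n) (v ^ n) := by
  induction n with
  | zero => simpa using one z
  | succ n ih => rw [pow_succ, pow_succ]; exact ih.mul hx

theorem zpow (hx : IsValue z x v) (hv : v ≠ 0) (k : ℤ) : IsValue z (x ^ k) (v ^ k) := by
  obtain ⟨m, rfl | rfl⟩ := k.eq_nat_or_neg
  · simpa using hx.pow m
  · simpa using (hx.inv hv).pow m

theorem f (p : Params) (hz : z ≠ 0) : IsValue z p.f ((z - 2 * p.M) / z) := by
  rw [f_eq_div]
  exact ((r z).sub (con z _)).div (r z) hz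

end IsValue

/-- The eigenderivation at infinity multiplies a leading coefficient by its order, so a nonzero x
with zero derivative has order zero there. Subtracting its value leaves a function that vanishes to
all orders. -/
theorem eq_con_of_der {x : RatFun} (h : der x = 0) : ∃ c, x = con c := by
  by_cases hx : x = 0
  · exact ⟨0, by rw [hx, con_zero]⟩
  obtain ⟨n, c, hc, hn⟩ := Place.infty.exists_lead hx
  have h1 := hn.der
  rw [h, mul_zero] at h1
  have hn0 : n = 0 := by simpa [hc] using h1.eq_zero
  subst hn0
  refine ⟨c, sub_eq_zero.1 (Place.eq_zero_of_ord (P := Place.infty) 1 fun m hm => ?_)⟩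
  have h2 := (hn.sub (Place.infty.lead_con c))
  rw [sub_self] at h2
  induction m, hm using Int.leInduction with
  | base => exact h2.exists_succ
  | succ m hm ih =>
    refine ih.succ_of_der (by omega) ?_
    rw [map_sub, h, der_con, sub_zero, mul_zero]
    exact Place.ord_zero _

theorem Sector.deriv_kappa : (s : Sector) → ∀ i, (s.system.κ i).deriv.isZero = true
  | .scalar => by decide +kernel
  | .vecOdd => by decide +kernel
  | .vecEven => by decide +kernel
  | .lichOdd => by decide +kernel
  | .lichEven => by decide +kernel

theorem Sector.kappa_con (s : Sector) {p : Params} (hp : s.angular p ≠ 0) (i : Fin s.dim) :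
    ∃ c, c ≠ 0 ∧ s.system.val p (s.system.κ i) = con c := by
  have h1 := RadPoly.ev_eq_zero (vars s.system.N p) (s.system_valid.κ_mul i)
  rw [RadPoly.ev_sub, RadPoly.ev_mul, RadPoly.ev_mul, RadPoly.ev_ofNat, sub_eq_zero] at h1
  have h2 : s.system.val p s.system.δ ≠ 0 := by
    have h := con_ne_zero hp
    cases s
    all_goals simp [angular, con_mul, con_sub, con_ofNat, system, System.val, System.scalar,
      System.vecOdd, System.vecEven, System.lichOdd, System.lichEven, System.vars_B] at h ⊢
    · exact h
    · exact h
    all_goals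
      rw [show -(4 * con p.B) + 2 * con p.B ^ 2 = 2 * (con p.B * (con p.B - 2)) by ring]
      exact mul_ne_zero two_ne_zero (mul_ne_zero h.1 h.2)
  have h3 : s.system.val p (s.system.κ i) ≠ 0 := fun h => by
    change s.system.val p (s.system.κ i) * _ = 2 * s.system.val p s.system.δ at h1
    rw [h, zero_mul] at h1
    exact mul_ne_zero two_ne_zero h2 h1.symm
  have h4 := s.deriv_kappa i
  obtain ⟨c, hc⟩ := eq_con_of_der (System.dval (S := s.system) (p := p) h4)
  exact ⟨c, fun h => h3 (by rw [hc, h, con_zero]), hc⟩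

/-- Second derivatives occur only in the diagonal kinetic terms. Their coefficients are nonzero
constants times r² times powers of f. -/
theorem Sector.waveCoeff_det (s : Sector) {p : Params} (hp : s.angular p ≠ 0) {z : ℂ} (hz : z ≠ 0)
    (hz' : z ≠ 2 * p.M) : (Matrix.of fun i j => evalAt z (s.waveCoeff 2 i j p)).det ≠ 0 := by
  have hf := IsValue.f p hz
  have hf0 : (z - 2 * p.M) / z ≠ 0 := div_ne_zero (sub_ne_zero.2 hz') hz
  choose c hc hκ using s.kappa_con hp
  have e : (Matrix.of fun i j => evalAt z (s.waveCoeff 2 i j p)) = Matrix.diagonal fun i =>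
      (1 / 2 * c i * z * ((z - 2 * p.M) / z) ^ ((s.system.e i : ℤ) - 1 - s.pw i)) * 1 *
        ((z - 2 * p.M) / z) ^ 2 * (z * ((z - 2 * p.M) / z) ^ (-(s.pw i : ℤ))) := by
    ext i j
    rw [Matrix.of_apply, waveCoeff, sandwichCoeff, if_pos rfl, hκ]
    by_cases h : i = j
    · subst h
      rw [Matrix.diagonal_apply_eq, if_pos rfl]
      exact ((((((IsValue.con z _).mul (IsValue.con z _)).mul (IsValue.r z)).mul
        (hf.zpow hf0 _)).mul (IsValue.one z)).mul (hf.pow 2) |>.mul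
        ((IsValue.r z).mul (hf.zpow hf0 _))).evalAt_eq
    · rw [Matrix.diagonal_apply_ne _ h, if_neg h, mul_zero, zero_mul, zero_mul]
      simpa using (IsValue.con z 0).evalAt_eq
  rw [e, Matrix.det_diagonal]
  refine Finset.prod_ne_zero_iff.2 fun i _ => ?_
  have := hc i
  have h1 := zpow_ne_zero ((s.system.e i : ℤ) - 1 - s.pw i) hf0
  have h2 := zpow_ne_zero (-(s.pw i : ℤ)) hf0
  exact mul_ne_zero (mul_ne_zero (mul_ne_zero (mul_ne_zero (mul_ne_zero (mul_ne_zero (by norm_num)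
    this) hz) h1) one_ne_zero) (pow_ne_zero 2 hf0)) (mul_ne_zero hz h2)

/-! ### The form of the triangular systems -/

theorem coupling_lower (s : Sector) (p : Params) {i j : Fin s.dim} (h : j ≤ i) :
    coupling s p i j = 0 := by
  cases s <;>
  simp only [coupling, vecEvenCoupling, lichOddCoupling, lichEvenCoupling] <;>
  fin_cases i <;> fin_cases j <;> first | (exfalso; revert h; decide) | simp

theorem coupling_spin (s : Sector) (p : Params) {i j : Fin s.dim} (h : s.spin i ≠ s.spin j) :
    coupling s p i j = 0 := by
  cases s <;>
  simp only [coupling, vecEvenCoupling, lichOddCoupling, lichEvenCoupling] <;>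
  fin_cases i <;> fin_cases j <;> first | (exfalso; revert h; decide) | simp

theorem coupling_massless (s : Sector) {p : Params} (h : p.M = 0) (i j : Fin s.dim) :
    coupling s p i j = 0 := by
  have h1 : p.f₁ = 0 := by rw [Params.f₁, h, mul_zero, con_zero, zero_div]
  cases s <;>
  simp only [coupling, vecEvenCoupling, lichOddCoupling, lichEvenCoupling, couplingX, h1] <;>
  fin_cases i <;> fin_cases j <;> simp

theorem mul_zero' : mul 0 = 0 := map_zero mulHom

theorem mul_add' (a b : RatFun) : mul (a + b) = mul a + mul b := map_add mulHom a b

theorem rwSystem_of_ne (s : Sector) (p : Params) {i j : Fin s.dim} (h : i ≠ j) :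
    rwSystem s p i j = mul (coupling s p i j) := by
  rw [rwSystem_apply, if_neg h, zero_add]

theorem rwSystem_diag (s : Sector) (p : Params) (i : Fin s.dim) :
    rwSystem s p i i = diagConst s p i • RW p (s.spin i) := by
  rw [rwSystem_apply, if_pos rfl, coupling_lower s p le_rfl, mul_zero', add_zero]

theorem rwSystem_lower (s : Sector) (p : Params) {i j : Fin s.dim} (h : j < i) :
    rwSystem s p i j = 0 := by
  rw [rwSystem_of_ne s p h.ne', coupling_lower s p h.le, mul_zero']

theorem rwSystem_spin (s : Sector) (p : Params) {i j : Fin s.dim} (h : s.spin i ≠ s.spin j) :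
    rwSystem s p i j = 0 := by
  rw [rwSystem_of_ne s p fun e => h (by rw [e]), coupling_spin s p h, mul_zero']

theorem diagConst_ne_zero (s : Sector) {p : Params} (hp : s.regular p) (i : Fin s.dim) :
    diagConst s p i ≠ 0 := fun h => (s.units.lam i).ne p hp (by rw [h, con_zero])

/-! ### Boundedness of the couplings -/

/-- Polynomials in `1/r`. -/
def invPoly : Subring RatFun := (Polynomial.aeval (r⁻¹ : RatFun) : Polynomial ℂ →ₐ[ℂ] RatFun).range.toSubring

theorem evalAt_invPoly {x : RatFun} (hx : x ∈ invPoly) :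
    ∃ g : Polynomial ℂ, ∀ z, z ≠ 0 → evalAt z x = g.eval z⁻¹ := by
  obtain ⟨g, rfl⟩ := hx
  refine ⟨g, fun z hz => IsValue.evalAt_eq ?_⟩
  change IsValue z (Polynomial.aeval (r⁻¹ : RatFun) g) _
  induction g using Polynomial.induction_on' with
  | add g g' h h' => rw [map_add, Polynomial.eval_add]; exact h.add h'
  | monomial n a =>
    rw [Polynomial.aeval_monomial, Polynomial.eval_monomial]
    exact (IsValue.con z a).mul (((IsValue.r z).inv hz).pow n)

/-- For r > 2m the point 1/r stays in a compact disc, on which a polynomial is bounded. -/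
theorem invPoly_bounded {x : RatFun} (hx : x ∈ invPoly) {m : ℝ} (hm : 0 < m) :
    ∃ K : ℝ, ∀ t : ℝ, 2 * m < t → ‖evalAt t x‖ ≤ K := by
  obtain ⟨g, hg⟩ := evalAt_invPoly hx
  obtain ⟨K, hK⟩ := (isCompact_closedBall (0 : ℂ) (2 * m)⁻¹).exists_bound_of_continuousOn
    (f := fun w => g.eval w) g.continuous.continuousOn
  refine ⟨K, fun t ht => ?_⟩
  have ht0 : 0 < t := by linarith
  rw [hg t (by exact_mod_cast ht0.ne')]
  refine hK _ ?_
  rw [mem_closedBall_zero_iff, norm_inv, Complex.norm_real, Real.norm_of_nonneg ht0.le]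
  gcongr

theorem con_mem_invPoly (c : ℂ) : con c ∈ invPoly := ⟨Polynomial.C c, by simp [con]⟩
theorem r_inv_mem_invPoly : r⁻¹ ∈ invPoly := ⟨Polynomial.X, by simp⟩
theorem f₁_mem_invPoly (p : Params) : p.f₁ ∈ invPoly := by
  rw [Params.f₁, div_eq_mul_inv]; exact invPoly.mul_mem (con_mem_invPoly _) r_inv_mem_invPoly

theorem coupling_mem_invPoly (s : Sector) (p : Params) (i j : Fin s.dim) :
    coupling s p i j ∈ invPoly := by
  have hB := con_mem_invPoly p.B
  have h1 := f₁_mem_invPoly p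
  have hr := r_inv_mem_invPoly
  have hx : p.f₁ / r ^ 2 ∈ invPoly := by
    rw [div_eq_mul_inv, ← inv_pow]; exact invPoly.mul_mem h1 (invPoly.pow_mem hr 2)
  have hn : ∀ n : ℕ, ∀ [n.AtLeastTwo], (ofNat(n) : RatFun) ∈ invPoly := fun n _ => by
    rw [← con_ofNat]; exact con_mem_invPoly _
  have hi : ∀ n : ℕ, ∀ [n.AtLeastTwo], (ofNat(n) : RatFun)⁻¹ ∈ invPoly := fun n _ => by
    rw [← con_ofNat, ← con_inv]; exact con_mem_invPoly _
  have hX : couplingX p ∈ invPoly := by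
    refine invPoly.mul_mem hx (invPoly.add_mem hB ?_)
    rw [div_eq_mul_inv]; exact invPoly.mul_mem h1 (hi 2)
  have hZ : con p.B ^ 2 * (p.f₁ / r ^ 2) ∈ invPoly := invPoly.mul_mem (invPoly.pow_mem hB 2) hx
  have hY : p.f₁ ^ 2 / (8 * r ^ 2) * (7 * con p.B + 2) ∈ invPoly := by
    have : p.f₁ ^ 2 / (8 * r ^ 2) = p.f₁ ^ 2 * 8⁻¹ * (r⁻¹) ^ 2 := by
      rw [div_eq_mul_inv, mul_inv, inv_pow]; ring
    rw [this]
    exact invPoly.mul_mem (invPoly.mul_mem (invPoly.mul_mem (invPoly.pow_mem h1 2) (hi 8))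
      (invPoly.pow_mem hr 2)) (invPoly.add_mem (invPoly.mul_mem (hn 7) hB) (hn 2))
  have h3 : con p.B ^ 2 / 3 * (p.f₁ / r ^ 2) ∈ invPoly := by
    rw [div_eq_mul_inv, mul_right_comm]; exact invPoly.mul_mem hZ (hi 3)
  have h5 : -(5 / 3) * con p.B ^ 2 * (p.f₁ / r ^ 2) ∈ invPoly := by
    rw [mul_assoc]
    refine invPoly.mul_mem (invPoly.neg_mem ?_) hZ
    rw [div_eq_mul_inv]; exact invPoly.mul_mem (hn 5) (hi 3)
  have hc := con_mem_invPoly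
  have key : ∀ {n : ℕ} {A : Matrix (Fin n) (Fin n) RatFun} {c : ℂ} (i j : Fin n),
      A i j ∈ invPoly → (con c • A) i j ∈ invPoly := fun i j h => invPoly.mul_mem (hc _) h
  cases s
  · exact invPoly.zero_mem
  · exact invPoly.zero_mem
  · refine key _ _ ?_
    fin_cases i <;> fin_cases j <;> first | exact invPoly.zero_mem | exact invPoly.neg_mem hX
  · refine key _ _ ?_
    fin_cases i <;> fin_cases j <;> first | exact invPoly.zero_mem | exact h3
  · refine key _ _ ?_
    fin_cases i <;> fin_cases j <;>
      first | exact invPoly.zero_mem | exact hX | exact invPoly.neg_mem hX | exact hY | exact h5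

/-- The off-diagonal entries have no first-order part, so Δ₁ = 0, and Δ₀ is f times the coupling, a
polynomial in 1/r. -/
theorem rwSystem_offdiag (s : Sector) (p : Params) {m : ℝ} (hm : 0 < m) {i j : Fin s.dim}
    (h : i ≠ j) : ∃ Δ₀ Δ₁ : RatFun, rwSystem s p i j = mul (Δ₀ / p.f) + mul Δ₁ * D ∧
      ∃ K : ℝ, ∀ x : ℝ, 2 * m < x → ‖evalAt x Δ₀‖ ≤ K ∧ ‖evalAt x Δ₁‖ ≤ K := by
  have h0 : p.f * coupling s p i j ∈ invPoly := by
    refine invPoly.mul_mem ?_ (coupling_mem_invPoly s p i j)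
    rw [Params.f]; exact invPoly.sub_mem invPoly.one_mem (f₁_mem_invPoly p)
  obtain ⟨K, hK⟩ := invPoly_bounded h0 hm
  obtain ⟨K', hK'⟩ := invPoly_bounded invPoly.zero_mem hm
  refine ⟨_, 0, ?_, max K K', fun x hx => ⟨(hK x hx).trans (le_max_left _ _),
    (hK' x hx).trans (le_max_right _ _)⟩⟩
  rw [rwSystem_of_ne s p h, mul_zero', zero_mul, add_zero, mul_div_cancel_left₀ _ p.f_ne_zero]

/-! ### Formal self-adjointness -/

/-- The matrix exchanging opposite components. -/
def revMat (n : ℕ) : Matrix (Fin n) (Fin n) ℂ := Matrix.of fun i j => if j = i.rev then 1 else 0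

theorem revMat_mul (n : ℕ) : revMat n * revMat n = 1 := by
  ext i j
  rw [Matrix.mul_apply, Finset.sum_eq_single i.rev]
  · simp [revMat, Matrix.one_apply, eq_comm]
  · intro b _ hb
    simp [revMat, hb]
  · simp

theorem revMat_conjTranspose (n : ℕ) : (revMat n).conjTranspose = revMat n := by
  ext i j
  have : i = j.rev ↔ j = i.rev := ⟨fun h => by rw [h, Fin.rev_rev], fun h => by rw [h, Fin.rev_rev]⟩
  simp [revMat, Matrix.conjTranspose_apply, apply_ite, this]

theorem constOp_revMat_mul {n : ℕ} (X : OpMatrix n) (i j : Fin n) :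
    (constOp (revMat n) * X) i j = X i.rev j := by
  rw [Matrix.mul_apply, Finset.sum_eq_single i.rev]
  · simp only [constOp, Matrix.map_apply, revMat, Matrix.of_apply, if_true, con_one]
    rw [show mul 1 = 1 from map_one mulHom, one_mul]
  · intro b _ hb
    simp only [constOp, Matrix.map_apply, revMat, Matrix.of_apply, if_neg hb, con_zero]
    rw [mul_zero', zero_mul]
  · simp

theorem conj_algebraMap (a : Polynomial ℂ) : conj (algebraMap (Polynomial ℂ) RatFun a) =
    algebraMap (Polynomial ℂ) RatFun (a.map (starRingEnd ℂ)) := by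
  have := RatFunc.map_apply_div (Polynomial.mapRingHom (starRingEnd ℂ))
    nonZeroDivisors_le_comap_conj a 1
  simpa [conj, RatFunc.coe_mapRingHom_eq_coe_map] using this

theorem conj_con (z : ℂ) : conj (con z) = con (starRingEnd ℂ z) := by
  have := conj_algebraMap (Polynomial.C z)
  simpa [con] using this

theorem conj_r : conj r = r := by
  have := conj_algebraMap Polynomial.X
  simpa [r] using this

/-- Real constants. -/
theorem conj_con_real {z : ℂ} (hz : z.im = 0) : conj (con z) = con z := by
  rw [conj_con, Complex.conj_eq_iff_im.2 hz]

theorem isFormalAdjoint_self {c : ℂ} {f v : RatFun} (hc : conj (con c) = con c) (hf : conj f = f)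
    (hdf : conj (der f) = der f) (hv : conj v = v) :
    IsFormalAdjoint (c • (D * mul f * D) + mul v) (c • (D * mul f * D) + mul v) := by
  have hC : RatFunc.C c = con c := rfl
  refine ⟨2, fun m => if m = 2 then con c * f else if m = 1 then con c * der f else v, ?_, ?_⟩
  all_goals
    ext1 z
    simp only [opOf, Finset.sum_range_succ, Finset.sum_range_zero, zero_add, if_true,
      pow_two, pow_one, pow_zero, mul_one, one_mul, one_smul, neg_mul, neg_smul, neg_neg, 
      Module.End.mul_apply, LinearMap.add_apply, LinearMap.smul_apply, LinearMap.neg_apply,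
      mul_apply', D_apply, Derivation.leibniz, smul_eq_mul, map_add, map_mul, der_con,
      show (1 : ℕ) ≠ 2 by decide, show (0 : ℕ) ≠ 2 by decide,
      show (0 : ℕ) ≠ 1 by decide, if_false, RatFunc.smul_eq_C_mul, hc, hf, hv, hdf, hC, map_zero]
    ring

theorem conj_f {p : Params} (hp : p.IsReal) : conj p.f₁ = p.f₁ ∧ conj p.f = p.f := by
  have h1 : conj p.f₁ = p.f₁ := by
    rw [Params.f₁, map_div₀, conj_r, conj_con_real]
    simp [hp.1]
  exact ⟨h1, by rw [Params.f, map_sub, map_one, h1]⟩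

theorem conj_ofNat (n : ℕ) [n.AtLeastTwo] : conj ofNat(n) = ofNat(n) := map_ofNat conj n

theorem conj_coupling (s : Sector) {p : Params} (hp : p.IsReal) (i j : Fin s.dim) :
    conj (coupling s p i j) = coupling s p i j := by
  obtain ⟨h1, hf⟩ := conj_f hp
  have hB := conj_con_real hp.2.2
  have hω := conj_con_real hp.2.1
  cases s <;>
  simp only [coupling, vecEvenCoupling, lichOddCoupling, lichEvenCoupling, couplingX] <;>
  fin_cases i <;> fin_cases j <;>
  simp [h1, hB, hω, conj_r, con_div, con_inv, con_neg, con_pow, con_ofNat, conj_ofNat]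

theorem coupling_rev (s : Sector) (p : Params) (i j : Fin s.dim) :
    coupling s p i.rev j = coupling s p j.rev i := by
  cases s <;>
  simp only [coupling, vecEvenCoupling, lichOddCoupling, lichEvenCoupling] <;>
  fin_cases i <;> fin_cases j <;> rfl

theorem diagConst_rev (s : Sector) (p : Params) (i : Fin s.dim) :
    diagConst s p i.rev = diagConst s p i := by
  cases s <;> fin_cases i <;> rfl

theorem conj_diagConst (s : Sector) {p : Params} (hp : p.IsReal) (i : Fin s.dim) :
    conj (con (diagConst s p i)) = con (diagConst s p i) := by
  have hM := conj_con_real hp.1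
  have hω := conj_con_real hp.2.1
  have hB := conj_con_real hp.2.2
  cases s <;> fin_cases i <;>
  simp [diagConst, hω, hB, hM, con_div, con_inv, con_neg, con_pow, con_ofNat, conj_ofNat, con_mul, Params.A,
    Params.α, con_sub, con_add]

/-- Reversal of the components exchanges places with the same spin and the same diagonal constant,
and the coupling matrix is symmetric with respect to the antidiagonal. For real parameters each
entry is moreover equal to its own formal adjoint. -/
theorem selfAdjoint (s : Sector) {p : Params} (hp : p.IsReal) :
    IsFormallySelfAdjoint (constOp (revMat s.dim) * rwSystem s p) := by
  obtain ⟨h1, hf⟩ := conj_f hp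
  intro i j
  rw [constOp_revMat_mul, constOp_revMat_mul, rwSystem_apply, rwSystem_apply, coupling_rev s p j i]
  have hRW : ∀ n : ℕ, RW p n = D * mul p.f * D +
      mul (con (p.ω ^ 2) / p.f - (con p.B + con (1 - (n : ℂ) ^ 2) * p.f₁) / r ^ 2) := fun n => by
    rw [RW, ← mulHom_apply (_ - _), map_sub, mulHom_apply, mulHom_apply]; abel
  have hdf : conj (der p.f) = der p.f := by rw [p.der_f, map_div₀, map_sub, map_one, hf, conj_r]
  by_cases h : i.rev = j
  · subst h
    rw [if_pos rfl, Fin.rev_rev, if_pos rfl, diagConst_rev]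
    have hs : s.spin i.rev = s.spin i := by cases s <;> fin_cases i <;> rfl
    rw [hs, hRW, smul_add, smul_mul', add_assoc, ← mul_add']
    refine isFormalAdjoint_self (conj_diagConst s hp i) hf hdf ?_
    have hn : conj (con (1 - (s.spin i : ℂ) ^ 2)) = con (1 - (s.spin i : ℂ) ^ 2) := by
      rw [conj_con]; simp
    have hω := conj_con_real hp.2.1
    rw [map_add, map_mul, conj_diagConst s hp, conj_coupling s hp, map_sub, map_div₀, map_div₀,
      map_add, map_mul, hn, hf, h1, map_pow, conj_r, con_pow, map_pow, hω,
      conj_con_real hp.2.2]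
  · have h' : ¬ j.rev = i := fun e => h (by rw [← e, Fin.rev_rev])
    rw [if_neg h, if_neg h']
    have := isFormalAdjoint_self (c := 0) (f := p.f) (by rw [con_zero, map_zero]) hf hdf
      (conj_coupling s hp i.rev j)
    rwa [zero_smul] at this

end

section

/-! ### The Chandrasekhar transformation -/

/-- Polynomials without `y` do not depend on the last variable. -/
theorem RadPoly.ev_congr {K : Type*} [CommRing K] {v v' : Fin 5 → K} {p : RadPoly}
    (h : p.degY 0 = true) (h0 : v 0 = v' 0) (h1 : v 1 = v' 1) (h2 : v 2 = v' 2) (h3 : v 3 = v' 3) :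
    p.ev v = p.ev v' := by
  unfold degY at h
  unfold ev
  revert h
  induction p.terms with
  | nil => intro _; rfl
  | cons t l ih =>
    intro h
    simp only [List.all_cons, Bool.and_eq_true, Bool.or_eq_true, beq_iff_eq, Nat.ble_eq] at h
    rw [evList_cons, evList_cons, ih h.2]
    congr 1
    rcases h.1 with h | h
    · simp [Term.ev, h]
    · simp [Term.ev, Nat.le_zero.1 h, h0, h1, h2, h3]

theorem ev_vars_congr {q : RadPoly} (h : q.degY 0 = true) (p : Params) (N N' : ℕ) :
    q.ev (vars N p) = q.ev (vars N' p) := RadPoly.ev_congr h rfl rfl rfl rfl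

namespace System

/-- The matrix does not depend on `y`. -/
def NoY {n : ℕ} (A : PMat n) : Prop := ∀ i j, (A i j).degY 0 = true

instance {n : ℕ} (A : PMat n) : Decidable (NoY A) := inferInstanceAs (Decidable (∀ _ _, _))

theorem NoY.ev {n : ℕ} {A : PMat n} (h : NoY A) (p : Params) (N N' : ℕ) :
    A.ev (vars N p) = A.ev (vars N' p) := by ext i j; exact ev_vars_congr (h i j) p N N'

/-- The coefficient of order zero of the transformation. -/
def chandra₀ : PMat 7 := .diag fun i => bif i == 3 then
  RadPoly.B * (RadPoly.B - 2) + 2592 * RadPoly.u ^ 2 * RadPoly.x ^ 2 *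
    (1 - 12 * RadPoly.u * RadPoly.x) * RadPoly.y else 1

/-- The coefficient of order one of the transformation. -/
def chandra₁ : PMat 7 := .diag fun i => bif i == 3 then 72 * RadPoly.u else 0

/-- The polynomial identities behind the transformation. -/
structure ChandraValid : Prop where
  left₀ : zerilliSys.IsZ (chandra₀ * lichEven.a + chandra₁ * lichEven.a.d -
    chandra₁ * lichEven.b * zerilliSys.R - .diag lichEven.ν * zerilliSys.a)
  left₁ : zerilliSys.IsZ (chandra₀ * lichEven.b + chandra₁ * lichEven.a + chandra₁ * lichEven.b.d -
    chandra₁ * lichEven.b * zerilliSys.R₁ - .diag lichEven.ν * zerilliSys.b)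
  right₀ : zerilliSys.IsZ (lichEven.c₀ * chandra₀ + lichEven.c₁ * chandra₀.d -
    lichEven.c₁ * chandra₁ * zerilliSys.W - zerilliSys.c₀ * .diag lichEven.ν)
  right₁ : zerilliSys.IsZ (lichEven.c₁ * chandra₀ - lichEven.c₀ * chandra₁ -
    lichEven.c₁ * chandra₁.d - zerilliSys.c₁ * .diag lichEven.ν)
  W_comm : zerilliSys.IsZ (.diag lichEven.ν * zerilliSys.W - zerilliSys.W * .diag lichEven.ν)
  C_comm₀ : zerilliSys.IsZ (lichEven.Ci * chandra₀ - chandra₀ * lichEven.Ci)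
  C_comm₁ : zerilliSys.IsZ (lichEven.Ci * chandra₁ - chandra₁ * lichEven.Ci)
  C_comm : zerilliSys.IsZ (lichEven.Ci * .diag lichEven.ν - .diag lichEven.ν * lichEven.Ci)
  a : NoY lichEven.a
  b : NoY lichEven.b
  c₀ : NoY lichEven.c₀
  c₁ : NoY lichEven.c₁
  R : NoY lichEven.R
  R₁ : NoY lichEven.R₁
  Ci : NoY lichEven.Ci
  ν : NoY (.diag lichEven.ν)

-- The products with the Chandrasekhar operators are compared modulo the respective second-order
-- operators. Keeping α as a factor ν on the other side makes these identities polynomial.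
set_option maxHeartbeats 4000000 in
theorem chandraValid : ChandraValid := by constructor <;> decide +kernel

end System

end

/-! ### The transformed arrows -/

section

section

variable {n : ℕ} {g : RatFun} {H Z : Hat n}

/-- A first order transformation of the target of a morphism. -/
theorem Hat.transform_k {u v : FunMatrix n} (hL : H.L * H.Li = 1) (hS : Z.Si = H.Si)
    (h₀ : u * H.a + v * dm g H.a - v * H.b * H.R₀ = Z.a)
    (h₁ : u * H.b + v * H.a + v * dm g H.b - v * H.b * H.R₁ = Z.b) :
    (Z.arrows g).k = op1 g u v * (H.arrows g).k + MM (-(v * H.b * H.Li)) * H.E g := by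
  change op1 g Z.a Z.b * MM Z.Si = op1 g u v * (op1 g H.a H.b * MM H.Si) + MM (-(v * H.b * H.Li)) *
    (MM H.L * op2 g H.R₁ H.R₀ * MM H.Si)
  have e : MM (-(v * H.b * H.Li)) * (MM H.L * op2 g H.R₁ H.R₀ * MM H.Si) =
      -(MM (v * H.b) * op2 g H.R₁ H.R₀ * MM H.Si) := by
    rw [← mul_assoc, ← mul_assoc, ← map_mul, neg_mul, mul_assoc (v * H.b), mul_eq_one_comm.1 hL,
      mul_one, map_neg, neg_mul, neg_mul]
  rw [e, ← mul_assoc, op1_mul_op1 g u v _ _ H.R₁ H.R₀, h₀, h₁, hS]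
  noncomm_ring

/-- A first order transformation of the source of a morphism. -/
theorem Hat.transform_kbar {u v : FunMatrix n} (hZ : Z.IsHat g) (hS : Z.S = H.S) (hC : Z.Ci = H.Ci)
    (hu : H.Ci * u = u * H.Ci) (hv : H.Ci * v = v * H.Ci)
    (h₀ : H.q₀ * u + H.q₁ * dm g u + H.q₁ * v * Z.W = Z.q₀)
    (h₁ : H.q₀ * v + H.q₁ * u + H.q₁ * dm g v = Z.q₁) :
    (Z.arrows g).kbar = (H.arrows g).kbar * op1 g u v +
      MM (-(H.S * (H.q₁ * v) * H.Ci * Z.Ui)) * Z.E' g := by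
  change MM Z.S * op1 g Z.q₀ Z.q₁ * MM Z.Ci = MM H.S * op1 g H.q₀ H.q₁ * MM H.Ci * op1 g u v +
    MM (-(H.S * (H.q₁ * v) * H.Ci * Z.Ui)) * (MM Z.U * tri g Z.W)
  have e : MM (-(H.S * (H.q₁ * v) * H.Ci * Z.Ui)) * (MM Z.U * tri g Z.W) =
      -(MM H.S * (MM (H.q₁ * v) * tri g Z.W) * MM H.Ci) := by
    have h := hZ.tri_comm_Ci
    rw [hC] at h
    have hU : MM Z.Ui * MM Z.U = 1 := by rw [← map_mul, mul_eq_one_comm.1 hZ.U_mul, map_one]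
    calc _ = -(MM H.S * MM (H.q₁ * v) * MM H.Ci * (MM Z.Ui * MM Z.U) * tri g Z.W) := by
          rw [map_neg, map_mul, map_mul, map_mul MM H.S]; noncomm_ring
      _ = -(MM H.S * MM (H.q₁ * v) * (MM H.Ci * tri g Z.W)) := by rw [hU]; noncomm_ring
      _ = _ := by rw [← h]; noncomm_ring
  have hd := hZ.dCi
  rw [hC] at hd
  have e2 : MM H.Ci * op1 g u v = op1 g u v * MM H.Ci := by
    rw [MM_mul_op1, op1_mul_MM, hd, mul_zero, add_zero, hu, hv]
  have e3 : MM H.S * op1 g H.q₀ H.q₁ * MM H.Ci * op1 g u v =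
      MM H.S * (op1 g H.q₀ H.q₁ * op1 g u v) * MM H.Ci := by
    rw [mul_assoc _ (MM H.Ci), e2]; noncomm_ring
  rw [e, e3, op1_mul_op1 g H.q₀ H.q₁ u v 0 (-Z.W), mul_neg, sub_neg_eq_add, h₀, mul_zero, sub_zero, h₁, hS,
    hC, tri]
  noncomm_ring

end

theorem isDiffOpMatrix_MM {n : ℕ} (a : FunMatrix n) : IsDiffOpMatrix (MM a) := fun i j =>
  ⟨0, fun _ => a i j, by simp [opOf, MM_apply]⟩

namespace System

theorem onSpinTwo_eq (T : Op) (u v : FunMatrix 7) (g : RatFun)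
    (h : ∀ i j, op1 g u v i j = if i = j then (if i = 3 then T else 1) else 0) :
    onSpinTwo .lichEven T = op1 g u v := by
  ext1 i j
  rw [h, onSpinTwo, Matrix.diagonal_apply]
  simp only [spin_eq_two]

theorem mat_chandra₀ (p : Params) : zerilliSys.mat p chandra₀ = Matrix.diagonal fun i =>
    if i = 3 then con p.A + con (36 * p.M) * p.f * p.f₁ / (r * zerilliFactor p) else 1 := by
  rw [chandra₀, mat_diag]
  congr 1
  ext1 i
  by_cases h : i = 3
  · have hy : vars 4 p 4 = (zerilliFactor p)⁻¹ := rfl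
    have hr := r_ne_zero
    have e : (i == 3) = true := by simp [h]
    rw [if_pos h, e, cond_true]
    simp [val, zerilliSys, hy, vars_x, vars_u', vars_B, con_A, Params.f₁_eq, con_mul, con_ofNat]
    have e2 : con p.M = r * (1 - p.f) / 2 := by
      have := con_M p
      rw [con_div, con_ofNat] at this
      linear_combination 6 * this
    rw [e2]
    field_simp
    ring
  · have e : (i == 3) = false := by simp [h]
    rw [if_neg h, e, cond_false]
    simp [val]

theorem mat_chandra₁ (p : Params) : zerilliSys.mat p chandra₁ = Matrix.diagonal fun i =>
    if i = 3 then con (12 * p.M) else 0 := by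
  rw [chandra₁, mat_diag]
  congr 1
  ext1 i
  by_cases h : i = 3
  · have e : (i == 3) = true := by simp [h]
    rw [if_pos h, e, cond_true]
    simp only [val, RadPoly.ev_mul, RadPoly.ev_ofNat, RadPoly.ev_u, vars_u]
    rw [← con_ofNat 72, ← con_mul]
    congr 1
    ring
  · have e : (i == 3) = false := by simp [h]
    rw [if_neg h, e, cond_false]
    simp [val]

theorem val_ν (p : Params) (i : Fin 7) : zerilliSys.val p (lichEven.ν i) =
    if i = 3 then con p.α else 1 := by
  by_cases h : i = 3
  · subst h
    rw [if_pos rfl]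
    simp [val, lichEven, vars_u, vars_B, vars_w, Params.α, Params.A, con_add, con_mul, con_pow,
      con_div, con_sub, con_ofNat]
    have hI : con Complex.I ^ 2 = -1 := by rw [← con_pow, Complex.I_sq, con_neg, con_one]
    linear_combination (-144 * con p.M ^ 2 * con p.ω ^ 2) * hI
  · rw [if_neg h]
    fin_cases i <;> first | exact absurd rfl h | simp [val, lichEven]

theorem lichEven_val_ν (p : Params) (i : Fin 7) : lichEven.val p (lichEven.ν i) =
    if i = 3 then con p.α else 1 := by
  rw [← val_ν]
  have := chandraValid.ν i i
  simp only [PMat.diag, beq_self_eq_true, cond_true] at this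
  exact ev_vars_congr this p _ _

theorem onSpinTwo_chandra (p : Params) : onSpinTwo .lichEven (chandra p 1) =
    op1 p.f (zerilliSys.mat p chandra₀) (zerilliSys.mat p chandra₁) := by
  refine onSpinTwo_eq _ _ _ _ fun i j => ?_
  rw [op1_apply, opOf_one, if_pos rfl, if_neg one_ne_zero, mat_chandra₀, mat_chandra₁,
    Matrix.diagonal_apply, Matrix.diagonal_apply]
  by_cases h : i = j
  · by_cases h3 : i = 3
    · simp only [if_pos h, if_pos h3, chandra, one_mul]
      rw [add_comm]
    · simp only [if_pos h, if_neg h3, zero_mul, mul_zero']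
      exact (add_zero _).trans (map_one mulHom)
  · simp only [if_neg h, zero_mul, mul_zero', add_zero]

theorem onSpinTwo_chandra_neg (p : Params) :
    onSpinTwo .lichEven ((1 / p.α) • chandra p (-1)) = op1 p.f
      (lichEven.scale p * zerilliSys.mat p chandra₀)
      (-(lichEven.scale p * zerilliSys.mat p chandra₁)) := by
  refine onSpinTwo_eq _ _ _ _ fun i j => ?_
  rw [op1_apply, opOf_one, if_pos rfl, if_neg one_ne_zero, mat_chandra₀, mat_chandra₁, scale,
    Matrix.diagonal_mul_diagonal, Matrix.diagonal_mul_diagonal, Matrix.neg_apply,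
    Matrix.diagonal_apply, Matrix.diagonal_apply]
  rw [lichEven_val_ν]
  by_cases h : i = j
  · by_cases h3 : i = 3
    · simp only [if_pos h, if_pos h3, chandra, smul_add, ← smul_mul_assoc, smul_mul']
      rw [add_comm, con_div, con_one, one_div]
      congr 3
      rw [show (-1 * 12 * p.M : ℂ) = -(12 * p.M) by ring, con_neg]
      ring
    · simp only [if_pos h, if_neg h3, mul_zero, neg_zero, zero_mul, mul_zero', inv_one, mul_one]
      exact (add_zero _).trans (map_one mulHom)
  · simp only [if_neg h, neg_zero, zero_mul, mul_zero', add_zero]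

theorem mat_eq {A : PMat 7} (h : NoY A) (p : Params) : lichEven.mat p A = zerilliSys.mat p A :=
  h.ev p _ _

theorem Γ_eq (p : Params) : lichEven.Γ p = zerilliSys.Γ p := by
  have hδ : lichEven.δ.degY 0 = true := by decide +kernel
  have hκ : ∀ i, (lichEven.κi i).degY 0 = true := by decide +kernel
  have h1 : lichEven.val p lichEven.δ = zerilliSys.val p zerilliSys.δ := ev_vars_congr hδ p _ _
  have h2 : ∀ i, lichEven.val p (lichEven.κi i) = zerilliSys.val p (zerilliSys.κi i) :=
    fun i => ev_vars_congr (hκ i) p _ _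
  simp only [Γ, h1, h2]
  rfl

theorem hat_Ci_eq (p : Params) (pw : Fin 7 → ℕ) (lam lam' : Fin 7 → ℂ) :
    (zerilliSys.hat pw lam p).Ci = (lichEven.hat pw lam' p).Ci := by
  have hδ : lichEven.δ.degY 0 = true := by decide +kernel
  have hd : lichEven.den.degY 0 = true := by decide +kernel
  have h1 : lichEven.val p lichEven.δ = zerilliSys.val p zerilliSys.δ := ev_vars_congr hδ p _ _
  have h2 : lichEven.val p lichEven.den = zerilliSys.val p zerilliSys.den := ev_vars_congr hd p _ _
  change (_ / _) • _ = (_ / _) • _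
  rw [h1, h2, mat_eq chandraValid.Ci]
  rfl

theorem scale_mul {p : Params} (hα : p.α ≠ 0) :
    zerilliSys.mat p (.diag lichEven.ν) * lichEven.scale p = 1 := by
  rw [mat_diag, scale]
  refine diagonal_mul_eq_one fun i => ?_
  rw [lichEven_val_ν, val_ν]
  split_ifs
  · exact mul_inv_cancel₀ (con_ne_zero hα)
  · simp

theorem dm_scale (p : Params) : dm p.f (lichEven.scale p) = 0 := by
  rw [scale, dm_diagonal, ← Matrix.diagonal_zero]
  congr 1
  ext1 i
  simp [Derivation.leibniz_inv, dval (lichEven_valid.dν i)]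

theorem zerilli_scale (p : Params) : zerilliSys.scale p = 1 := by
  rw [scale, ← Matrix.diagonal_one]
  congr 1
  ext1 i
  simp [zerilliSys, val]

section

variable {p : Params}

theorem zerilliRegular_of_regular (hp : Sector.regular .lichEven p) : zerilliRegular p := left_ne_zero_of_mul hp

/-- Applied to the undivided row 3 of P, 𝓒₊ gives α times the Zerilli row modulo the wave operator.
The division of that row by α in `k` cancels the factor, which explains why α disappears from the
denominators. -/
theorem chandra_k (hp : Sector.regular .lichEven p) : ∃ g : OpMatrix 7, IsDiffOpMatrix g ∧ (zerilliArrows p).k =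
    onSpinTwo .lichEven (chandra p 1) * (Sector.arrows .lichEven p).k + g * waveOp .lichEven p := by
  have hα : p.α ≠ 0 := right_ne_zero_of_mul hp
  have hz := zerilliRegular_of_regular hp
  have hN : zerilliSys.N = 0 ∨ zerilliFactor p ≠ 0 := .inr (zerilliFactor_ne_zero
    (sub_ne_zero.1 (right_ne_zero_of_mul (right_ne_zero_of_mul hz))))
  have hv := chandraValid
  have hν := scale_mul hα
  have e0 := isZ_mat hN hv.left₀
  have e1 := isZ_mat hN hv.left₁
  simp only [mat_sub, mat_add, mat_mul, mat_d, sub_eq_zero] at e0 e1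
  set K := lichEven.scale p with hK
  have hdK : ∀ X, dm p.f (K * X) = K * dm p.f X := fun X => by
    rw [dm_mul, dm_scale, zero_mul, zero_add]
  have c0 : zerilliSys.mat p chandra₀ * K = K * zerilliSys.mat p chandra₀ := by
    rw [mat_chandra₀]; exact diagonal_comm _ _
  have c1 : zerilliSys.mat p chandra₁ * K = K * zerilliSys.mat p chandra₁ := by
    rw [mat_chandra₁]; exact diagonal_comm _ _
  have c0' : ∀ X, zerilliSys.mat p chandra₀ * (K * X) = K * (zerilliSys.mat p chandra₀ * X) :=
    fun X => by rw [← mul_assoc, c0, mul_assoc]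
  have c1' : ∀ X, zerilliSys.mat p chandra₁ * (K * X) = K * (zerilliSys.mat p chandra₁ * X) :=
    fun X => by rw [← mul_assoc, c1, mul_assoc]
  have hν' : ∀ X, K * (zerilliSys.mat p (.diag lichEven.ν) * X) = X := fun X => by
    rw [← mul_assoc, mul_eq_one_comm.1 hν, one_mul]
  set H := lichEven.hat (Sector.pw .lichEven) (diagConst .lichEven p) p with hH
  refine ⟨MM (-(zerilliSys.mat p chandra₁ * H.b * H.Li)), isDiffOpMatrix_MM _, ?_⟩
  rw [onSpinTwo_chandra, waveOp_eq .lichEven p (diagConst .lichEven p)]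
  refine Hat.transform_k (Sector.isHat .lichEven hp).L_mul rfl ?_ ?_
  · change _ * (K * lichEven.mat p lichEven.a) + _ * dm p.f (K * lichEven.mat p lichEven.a) -
      _ * (K * lichEven.mat p lichEven.b) * lichEven.mat p lichEven.R = zerilliSys.scale p * _
    rw [zerilli_scale, one_mul, mat_eq hv.a, mat_eq hv.b, mat_eq hv.R, hdK, c0', c1', c1', mul_assoc K,
      ← mul_add, ← mul_sub]
    exact (congrArg (K * ·) e0).trans (hν' _)
  · change _ * (K * lichEven.mat p lichEven.b) + _ * (K * lichEven.mat p lichEven.a) +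
      _ * dm p.f (K * lichEven.mat p lichEven.b) -
      _ * (K * lichEven.mat p lichEven.b) * lichEven.mat p lichEven.R₁ = zerilliSys.scale p * _
    rw [zerilli_scale, one_mul, mat_eq hv.a, mat_eq hv.b, mat_eq hv.R₁, hdK, c0', c1', c1', c1', mul_assoc K,
      ← mul_add, ← mul_add, ← mul_sub]
    exact (congrArg (K * ·) e1).trans (hν' _)

/-- The adjoint identity: 𝓒₋ composed on the right gives the Zerilli column times α, and Q itself
has not been divided by α, whence the factor 1/α. The scale matrix commutes with the matrices of the
triangular side because place 3 is decoupled from the others. -/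
theorem chandra_kbar (hp : Sector.regular .lichEven p) : ∃ g : OpMatrix 7, IsDiffOpMatrix g ∧ (zerilliArrows p).kbar =
    (Sector.arrows .lichEven p).kbar * onSpinTwo .lichEven ((1 / p.α) • chandra p (-1)) +
      g * zerilliSystem .lichEven p := by
  have hα : p.α ≠ 0 := right_ne_zero_of_mul hp
  have hz := zerilliRegular_of_regular hp
  have hN : zerilliSys.N = 0 ∨ zerilliFactor p ≠ 0 := .inr (zerilliFactor_ne_zero
    (sub_ne_zero.1 (right_ne_zero_of_mul (right_ne_zero_of_mul hz))))
  have hv := chandraValid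
  have hν := scale_mul hα
  have e0 := isZ_mat hN hv.right₀
  have e1 := isZ_mat hN hv.right₁
  have eW := isZ_mat hN hv.W_comm
  have eC := isZ_mat hN hv.C_comm
  have eC0 := isZ_mat hN hv.C_comm₀
  have eC1 := isZ_mat hN hv.C_comm₁
  simp only [mat_sub, mat_add, mat_mul, mat_d, sub_eq_zero] at e0 e1 eW eC eC0 eC1
  set K := lichEven.scale p with hK
  set ν := zerilliSys.mat p (.diag lichEven.ν) with hνd
  have hν2 := mul_eq_one_comm.1 hν
  have comm : ∀ X, ν * X = X * ν → K * X = X * K := fun X h => by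
    calc K * X = K * (X * ν) * K := by rw [mul_assoc, mul_assoc, hν, mul_one]
      _ = X * K := by rw [← h, ← mul_assoc, hν2, one_mul]
  have c0 : K * zerilliSys.mat p chandra₀ = zerilliSys.mat p chandra₀ * K := by
    rw [mat_chandra₀]; exact diagonal_comm _ _
  have c1 : K * zerilliSys.mat p chandra₁ = zerilliSys.mat p chandra₁ * K := by
    rw [mat_chandra₁]; exact diagonal_comm _ _
  have cW := comm _ eW
  have cC := comm _ eC.symm
  have hd : ∀ X, dm p.f (X * K) = dm p.f X * K := fun X => by
    rw [dm_mul, dm_scale, mul_zero, add_zero]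
  have hν' : ∀ X, X * ν * K = X := fun X => by rw [mul_assoc, hν, mul_one]
  set H := lichEven.hat (Sector.pw .lichEven) (diagConst .lichEven p) p with hH
  refine ⟨MM (-(H.S * (H.q₁ * -(zerilliSys.mat p chandra₁ * K)) * H.Ci *
    (zerilliSys.hat (Sector.pw .lichEven) (zerilliDiag p) p).Ui)), isDiffOpMatrix_MM _, ?_⟩
  rw [onSpinTwo_chandra_neg, zerilliSystem_eq, ← hK, c0, c1]
  refine Hat.transform_kbar (zerilli_isHat hz) rfl (hat_Ci_eq _ _ _ _) ?_ ?_ ?_ ?_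
  · change (_ • lichEven.mat p lichEven.Ci) * _ = _ * (_ • lichEven.mat p lichEven.Ci)
    rw [Matrix.smul_mul, Matrix.mul_smul, mat_eq hv.Ci, ← mul_assoc, eC0, mul_assoc, ← cC,
      ← mul_assoc]
  · change (_ • lichEven.mat p lichEven.Ci) * _ = _ * (_ • lichEven.mat p lichEven.Ci)
    rw [Matrix.smul_mul, Matrix.mul_smul, mat_eq hv.Ci, mul_neg, neg_mul, ← mul_assoc, eC1,
      mul_assoc, ← cC, ← mul_assoc]
  · change (lichEven.Γ p * lichEven.mat p lichEven.c₀) * _ +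
      (lichEven.Γ p * lichEven.mat p lichEven.c₁) * _ +
      (lichEven.Γ p * lichEven.mat p lichEven.c₁) * _ * zerilliSys.mat p zerilliSys.W =
        zerilliSys.Γ p * zerilliSys.mat p zerilliSys.c₀
    rw [mat_eq hv.c₀, mat_eq hv.c₁, Γ_eq, hd, ← hν' (zerilliSys.mat p zerilliSys.c₀), ← e0]
    have : zerilliSys.mat p chandra₁ * K * zerilliSys.mat p zerilliSys.W =
      zerilliSys.mat p chandra₁ * zerilliSys.mat p zerilliSys.W * K := by
      rw [mul_assoc, cW, mul_assoc]
    rw [mul_neg, neg_mul, mul_assoc _ (zerilliSys.mat p chandra₁ * K), this]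
    noncomm_ring
  · change (lichEven.Γ p * lichEven.mat p lichEven.c₀) * _ +
      (lichEven.Γ p * lichEven.mat p lichEven.c₁) * _ +
      (lichEven.Γ p * lichEven.mat p lichEven.c₁) * _ =
        zerilliSys.Γ p * zerilliSys.mat p zerilliSys.c₁
    rw [mat_eq hv.c₀, mat_eq hv.c₁, Γ_eq, dm_neg, hd, ← hν' (zerilliSys.mat p zerilliSys.c₁), ← e1]
    noncomm_ring

end

end System

end

section

/-! ### Poles in the parameters -/

/-- Applying the operators to the function 1 isolates the coefficient of order zero; applying them
to r then isolates the next one. -/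
theorem opOf_one_inj {c c' : ℕ → RatFun} (h : opOf 1 c = opOf 1 c') : c 1 = c' 1 := by
  rw [opOf_one, opOf_one] at h
  have h1 := LinearMap.congr_fun h 1
  have h2 := LinearMap.congr_fun h r
  simp only [LinearMap.add_apply, Module.End.mul_apply, mul_apply', D_apply, der_r,
    Derivation.map_one_eq_zero, mul_one, mul_zero, add_zero] at h1 h2
  rw [h1] at h2
  exact add_left_cancel h2

theorem IsValue.polyAt (z : ℂ) (N : MvPolynomial (Fin 4) ℂ) (p : Params) :
    IsValue z (polyAt N p) (N.eval (pt p z)) := by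
  have h := IsValue.poly z (polyIn N p)
  rwa [← polyAt_eq, eval_polyIn] at h

theorem IsValue.unique {z : ℂ} {x : RatFun} {v w : ℂ} (h : IsValue z x v) (h' : IsValue z x w) :
    v = w := by rw [← h.evalAt_eq, h'.evalAt_eq]

/-- The coefficient of `∂_r` in an entry of the first arrow. -/
theorem arrows_k_apply {n : ℕ} (S : System n) (pw : Fin n → ℕ) (lam : Fin n → ℂ) (p : Params)
    {i j : Fin n} {c : ℕ → RatFun} (h : ((S.hat pw lam p).arrows p.f).k i j = opOf 1 c) :
    c 1 = (S.val p (S.ν i))⁻¹ * S.val p (S.b i j) * (r * p.f ^ (-(pw j : ℤ))) * p.f := by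
  change (op1 p.f (S.scale p * _) (S.scale p * S.mat p S.b) * MM (Matrix.diagonal _) :
    OpMatrix n) i j = _ at h
  rw [op1_mul_MM, op1_apply] at h
  have h1 := opOf_one_inj h
  rw [if_neg one_ne_zero] at h1
  rw [← h1, Matrix.mul_diagonal, System.scale, Matrix.diagonal_mul]
  rfl

theorem isValue_radialDen (p : Params) (z : ℂ) : IsValue z (radialDen p) (z * (z - 2 * p.M)) :=
  (IsValue.r z).mul ((IsValue.r z).sub (IsValue.con z _))

theorem eq_of_eventually_punctured {F G : ℂ → ℂ} (hF : Continuous F) (hG : Continuous G) {z : ℂ}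
    (h : ∀ᶠ t in 𝓝[≠] z, F t = G t) : F z = G z :=
  tendsto_nhds_unique_of_eventuallyEq ((hF.tendsto z).mono_left nhdsWithin_le_nhds)
    ((hG.tendsto z).mono_left nhdsWithin_le_nhds) h

/-- Both algebraically special frequencies are poles of the arrows. -/
theorem not_rational_arrows {ε : ℂ} (hε : ε = 1 ∨ ε = -1) :
    ¬ IsRationalArrowFamily (Sector.regular .lichEven) (fun p => radialDen p *
      con (p.ω * (p.B * (p.B - 2)) * (12 * p.M * p.ω + ε * Complex.I * p.A)))
        (Sector.arrows .lichEven) := by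
  intro h
  obtain ⟨c, hc, hr⟩ := h.1
  obtain ⟨N, m, hN⟩ := hr 1 (3 : Fin 7) (6 : Fin 7)
  have hε2 : ε ^ 2 = 1 := by rcases hε with rfl | rfl <;> norm_num
  have hI := Complex.I_sq
  -- The test family has M = 1, 𝓑 = 3 and variable frequency t, so that 𝓐 = 3 and α = 144t² + 9. The
  -- entry (3, 6) of `k`, counted from 0, is examined at r = 1.
  set q : ℂ → Params := fun t => ⟨1, t, 3⟩ with hq
  have hα : ∀ t, (q t).α = 144 * t ^ 2 + 9 := fun t => by
    simp only [hq, Params.α, Params.A]; ring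
  -- The coefficient of ∂_r in that entry is (144t² - 12)/α at r = 1. If only one linear factor of α
  -- were allowed in the denominators, clearing them would give this identity.
  have key : ∀ t, t ≠ 0 → 144 * t ^ 2 + 9 ≠ 0 →
      N.eval (pt (q t) 1) * (144 * t ^ 2 + 9) = (144 * t ^ 2 - 12) *
        (1 * (1 - 2 * 1) * (t * (3 * (3 - 2)) * (12 * 1 * t + ε * Complex.I * (3 * (3 - 2))))) ^ m := by
    intro t ht ht'
    have hp : Sector.regular .lichEven (q t) :=
      mul_ne_zero (mul_ne_zero ht (by norm_num [hq])) (by rw [hα]; exact ht')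
    have e1 := arrows_k_apply System.lichEven (Sector.pw .lichEven) _ (q t)
      (hc (q t) hp (3 : Fin 7) (6 : Fin 7))
    rw [hN _ hp] at e1
    have e2 : System.lichEven.val (q t) (System.lichEven.ν 3) = con (144 * t ^ 2 + 9) := by
      rw [← hα]
      exact (System.lichEven_val_ν (q t) 3).trans (if_pos rfl)
    have e3 : System.lichEven.val (q t) (System.lichEven.b 3 6) = con (-144 * t ^ 2) +
        con 48 * r⁻¹ - con 36 * r⁻¹ ^ 2 := by
      have hI' : con Complex.I ^ 2 = -1 := by rw [← con_pow, Complex.I_sq, con_neg, con_one]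
      simp [System.val, System.lichEven, RadPoly.ev_mk_cons, RadPoly.ev_mk_nil, Term.ev_mk,
        System.vars_x, System.vars_u, System.vars_B, System.vars_w, con_mul, con_neg, con_pow, con_inv,
        con_ofNat, hq]
      linear_combination 144 * con t ^ 2 * hI'
    have e4 : polyAt N (q t) * con (144 * t ^ 2 + 9) = (con (-144 * t ^ 2) + con 48 * r⁻¹ -
        con 36 * r⁻¹ ^ 2) * r * (q t).f * (radialDen (q t) *
      con (t * (3 * (3 - 2)) * (12 * 1 * t + ε * Complex.I * (3 * (3 - 2))))) ^ m := by
      have hd : radialDen (q t) *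
        con (t * (3 * (3 - 2)) * (12 * 1 * t + ε * Complex.I * (3 * (3 - 2)))) ≠ 0 := by
        refine mul_ne_zero (radialDen_ne_zero _) (con_ne_zero (mul_ne_zero
          (mul_ne_zero ht (by norm_num)) fun h0 => ht' ?_))
        linear_combination (12 * t - 3 * ε * Complex.I) * h0 + 9 * ε ^ 2 * hI - 9 * hε2
      rw [e2, e3] at e1
      have hd' := pow_ne_zero m hd
      have hα0 : con (144 * t ^ 2 + 9) ≠ 0 := con_ne_zero ht'
      have hδ : con ((q t).ω * ((q t).B * ((q t).B - 2)) *
          (12 * (q t).M * (q t).ω + ε * Complex.I * (q t).A)) =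
          con (t * (3 * (3 - 2)) * (12 * 1 * t + ε * Complex.I * (3 * (3 - 2)))) := by
        simp only [hq, Params.A]
      beta_reduce at e1
      rw [hδ, div_eq_iff hd', ← polyAt] at e1
      rw [e1]
      simp [Sector.pw]
      field_simp
    have v1 := (IsValue.polyAt 1 N (q t)).mul (IsValue.con 1 (144 * t ^ 2 + 9))
    rw [e4] at v1
    have v2 := (((((IsValue.con 1 (-144 * t ^ 2)).add ((IsValue.con 1 48).mul
      ((IsValue.r 1).inv one_ne_zero))).sub ((IsValue.con 1 36).mul
      (((IsValue.r 1).inv one_ne_zero).pow 2))).mul (IsValue.r 1)).mul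
      (IsValue.f (q t) one_ne_zero)).mul (((isValue_radialDen (q t) 1).mul (IsValue.con 1 (t * (3 * (3 - 2)) *
        (12 * 1 * t + ε * Complex.I * (3 * (3 - 2)))))).pow m)
    rw [v1.unique v2]
    congr 1
    simp only [hq]
    ring
  -- This root of α is the one at which the permitted factor does not vanish: 12t₀ + 3εi = 6εi. By
  -- continuity the identity extends to t₀, where its left side is zero and its right side is not,
  -- as 144t₀² - 12 = -21.
  set t₀ : ℂ := ε * Complex.I / 4 with ht₀
  have ht₀2 : 144 * t₀ ^ 2 + 9 = 0 := by
    rw [ht₀]; linear_combination 9 * ε ^ 2 * hI - 9 * hε2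
  have ht0 : t₀ ≠ 0 := fun h0 => by norm_num [h0] at ht₀2
  have h9 : Continuous fun t : ℂ => 144 * t ^ 2 + 9 := by fun_prop
  have hN' : Continuous fun t => N.eval (pt (q t) 1) :=
    continuous_eval_pt N 1 (g := q) ⟨continuous_const, continuous_id, continuous_const⟩
  have hL := hN'.mul h9
  have hR : Continuous fun t : ℂ => (144 * t ^ 2 - 12) * (1 * (1 - 2 * 1) * (t * (3 * (3 - 2)) *
      (12 * 1 * t + ε * Complex.I * (3 * (3 - 2))))) ^ m := by fun_prop
  have hev : ∀ᶠ t in 𝓝[≠] t₀, t ≠ 0 ∧ 144 * t ^ 2 + 9 ≠ 0 := by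
    have h1 : ∀ᶠ t in 𝓝 t₀, t ≠ 0 ∧ t + t₀ ≠ 0 :=
      (isOpen_ne.eventually_mem ht0).and
        ((isOpen_ne.preimage (continuous_id.add continuous_const)).eventually_mem
          (show t₀ + t₀ ≠ 0 by rw [← two_mul]; exact mul_ne_zero two_ne_zero ht0))
    filter_upwards [h1.filter_mono nhdsWithin_le_nhds, self_mem_nhdsWithin] with t h2 h3
    refine ⟨h2.1, fun h0 => ?_⟩
    have : (t - t₀) * (t + t₀) = 0 := by linear_combination (h0 - ht₀2) / 144
    exact (mul_ne_zero (sub_ne_zero.2 h3) h2.2) this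
  have heq : N.eval (pt (q t₀) 1) * (144 * t₀ ^ 2 + 9) = (144 * t₀ ^ 2 - 12) *
      (1 * (1 - 2 * 1) * (t₀ * (3 * (3 - 2)) * (12 * 1 * t₀ + ε * Complex.I * (3 * (3 - 2))))) ^ m :=
    eq_of_eventually_punctured hL hR (hev.mono fun t h => key t h.1 h.2)
  rw [ht₀2, mul_zero] at heq
  refine mul_ne_zero (fun h0 => ?_) (pow_ne_zero m ?_) heq.symm
  · have : (21 : ℂ) = 0 := by linear_combination ht₀2 - h0
    norm_num at this
  · refine mul_ne_zero (by norm_num) (mul_ne_zero (mul_ne_zero ht0 (by norm_num)) fun h0 => ht0 ?_)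
    rw [ht₀] at h0 ⊢
    linear_combination h0 / 24

/-- The zero of the Zerilli factor is a pole of the arrows. -/
theorem not_rational_zerilliArrows : ¬ IsRationalArrowFamily zerilliRegular (fun p => radialDen p *
    con (p.ω * (p.B * (p.B - 2)))) zerilliArrows := by
  intro h
  obtain ⟨c, hc, hr⟩ := h.1
  obtain ⟨N, m, hN⟩ := hr 1 (3 : Fin 7) (6 : Fin 7)
  -- At M = ω = 1 and 𝓑 = 3 the Zerilli factor is (r + 6)/r, and the coefficient of ∂_r in the entry
  -- (3, 6) of `k` is 16rf/(r + 6). It has a pole at r = -6, where the permitted denominators are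
  -- nonzero.
  set q : Params := ⟨1, 1, 3⟩ with hq
  have hp : zerilliRegular q := by norm_num [zerilliRegular, hq]
  have e1 := arrows_k_apply System.zerilliSys (Sector.pw .lichEven) _ q
    (hc q hp (3 : Fin 7) (6 : Fin 7))
  have e2 : System.zerilliSys.val q (System.zerilliSys.ν 3) = 1 := by
    simp [System.val, System.zerilliSys]
  have hz := r_mul_zerilliFactor q
  have hz0 : zerilliFactor q ≠ 0 := System.zerilliFactor_ne_zero (by norm_num [hq])
  have e3 : System.zerilliSys.val q (System.zerilliSys.b 3 6) = 16 * r⁻¹ * (zerilliFactor q)⁻¹ := by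
    have hy : vars 4 (⟨1, 1, 3⟩ : Params) 4 = (zerilliFactor ⟨1, 1, 3⟩)⁻¹ := rfl
    simp [System.val, System.zerilliSys, RadPoly.ev_mk_cons, RadPoly.ev_mk_nil, Term.ev_mk,
      System.vars_x, System.vars_u, System.vars_B, System.vars_w, hy, con_ofNat, hq]
    ring
  rw [hN q hp, e2, e3] at e1
  have hd : radialDen q * con 3 ≠ 0 := mul_ne_zero (radialDen_ne_zero _) (con_ne_zero (by norm_num))
  have e0 : q.ω * (q.B * (q.B - 2)) = 3 := by norm_num [hq]
  beta_reduce at e1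
  rw [e0] at e1
  have e1' : polyAt N q / (radialDen q * con 3) ^ m = _ := e1
  rw [div_eq_iff (pow_ne_zero m hd)] at e1'
  have hr := r_ne_zero
  have e4 : polyAt N q * (r + con 6) = con 16 * r * q.f * (radialDen q * con 3) ^ m := by
    have hz' : r + con 6 = r * zerilliFactor q := by
      rw [hz]; norm_num [hq, con_one]
    rw [e1', hz']
    simp [Sector.pw]
    rw [con_ofNat 16]
    field_simp
  have h6 : (-6 : ℂ) ≠ 0 := by norm_num
  have v1 := (IsValue.polyAt (-6) N q).mul ((IsValue.r (-6)).add (IsValue.con (-6) 6))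
  rw [e4] at v1
  have v2 := (((IsValue.con (-6) 16).mul (IsValue.r (-6))).mul (IsValue.f q h6)).mul
    (((isValue_radialDen q (-6)).mul (IsValue.con (-6) 3)).pow m)
  have e5 := v2.unique v1
  rw [neg_add_cancel, mul_zero] at e5
  exact mul_ne_zero (by norm_num [hq]) (pow_ne_zero m (by norm_num [hq])) e5

end

section

/-! ### Rational solutions of the equations of a morphism -/

namespace Place

variable {P : Place} {u v : RatFun}

theorem exists_ord (P : Place) (z : RatFun) : ∃ N : ℤ, ∀ n ≤ N, P.Ord n z := by
  by_cases h : z = 0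
  · exact ⟨0, fun n _ => h ▸ ord_zero n⟩
  · obtain ⟨n, c, -, hc⟩ := P.exists_lead h
    exact ⟨n, fun m hm => Ord.of_le ⟨c, hc⟩ hm⟩

/-- If the leading coefficients of a pair of functions vanish below some order, the pair has
that order. -/
theorem ord_of_step {k N : ℤ} (step : ∀ n < N, ∀ a b, P.Lead (n + k) a u → P.Lead n b v →
    a = 0 ∧ b = 0) : P.Ord (N + k) u ∧ P.Ord N v := by
  obtain ⟨N₁, h₁⟩ := P.exists_ord u
  obtain ⟨N₂, h₂⟩ := P.exists_ord v
  set n₀ := min N (min (N₁ - k) N₂) with hn₀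
  have key : ∀ j : ℕ, n₀ + j ≤ N → P.Ord (n₀ + j + k) u ∧ P.Ord (n₀ + j) v := by
    intro j
    induction j with
    | zero => exact fun _ => ⟨h₁ _ (by push_cast; omega), h₂ _ (by push_cast; omega)⟩
    | succ j ih =>
      intro hj
      push_cast at hj ⊢
      obtain ⟨⟨a, ha⟩, ⟨b, hb⟩⟩ := ih (by omega)
      obtain ⟨rfl, rfl⟩ := step (n₀ + j) (by omega) a b ha hb
      refine ⟨?_, by rw [← add_assoc]; exact hb.exists_succ⟩
      have := ha.exists_succ
      rwa [show n₀ + (j + 1) + k = n₀ + j + k + 1 by ring]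
  have := key (N - n₀).toNat (by omega)
  rwa [show n₀ + ((N - n₀).toNat : ℤ) = N by omega] at this

theorem Lead.dot {ν n : ℤ} {q₀ c : ℂ} {q f z : RatFun} (h : P.Lead n c z)
    (hq : P.Lead ν q₀ q) (hf : f = q * P.e) : P.Lead (ν + n) (q₀ * (n * c)) (f * Schw.der z) := by
  rw [hf, mul_assoc]; exact hq.mul h.der

/-- A rational function without poles on the Riemann sphere is constant. -/
theorem eq_con {z : RatFun} (h : ∀ c, (at_ c).Ord 0 z) (h' : infty.Ord 0 z) : ∃ c, z = con c := by
  have hd : z.denom.degree = 0 := by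
    by_contra hd
    obtain ⟨c, hc⟩ := Complex.exists_root (Polynomial.degree_pos_of_ne_zero_of_nonunit
      z.denom_ne_zero fun hu => hd (Polynomial.degree_eq_zero_of_isUnit hu))
    obtain ⟨a, q, hq, e⟩ := (h c).choose_spec.mem
    have hq0 : q ≠ 0 := fun h => hq (by rw [h, Polynomial.eval_zero])
    have h1 := congrArg (Polynomial.eval c) ((RatFunc.num_mul_eq_mul_denom_iff hq0).2 e)
    rw [Polynomial.eval_mul, Polynomial.eval_mul, hc.eq_zero, mul_zero] at h1
    have h2 := (mul_eq_zero.1 h1).resolve_right hq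
    obtain ⟨x, y, hxy⟩ := z.isCoprime_num_denom
    have h3 := congrArg (Polynomial.eval c) hxy
    rw [Polynomial.eval_add, Polynomial.eval_mul, Polynomial.eval_mul, h2, hc.eq_zero] at h3
    simp at h3
  have hd1 : z.denom = 1 :=
    Polynomial.eq_one_of_monic_natDegree_zero z.monic_denom
      (Polynomial.natDegree_eq_zero_iff_degree_le_zero.2 hd.le)
  obtain ⟨a, q, hq, hdeg, e⟩ := h'.choose_spec.mem
  have h1 := (RatFunc.num_mul_eq_mul_denom_iff hq).2 e
  rw [hd1, mul_one] at h1
  have hn : z.num.natDegree = 0 := by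
    by_cases hz : z.num = 0
    · rw [hz, Polynomial.natDegree_zero]
    · rw [← h1, Polynomial.natDegree_mul hz hq] at hdeg
      omega
  refine ⟨z.num.coeff 0, ?_⟩
  conv_lhs => rw [← RatFunc.num_div_denom z, hd1, Polynomial.eq_C_of_natDegree_eq_zero hn]
  simp [con]

end Place

/-- The potential of `(f ∂)²` in the Regge–Wheeler operator. -/
def modePot (p : Params) (s : ℕ) : RatFun :=
  p.f * (con p.B * r⁻¹ ^ 2 + con (2 * p.M * (1 - (s : ℂ) ^ 2)) * r⁻¹ ^ 3) - con (p.ω ^ 2)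

/-- The equations of a first order morphism `u + v f ∂` between Regge–Wheeler operators of spins
`s'` and `s`. -/
structure ModeEq (p : Params) (s s' : ℕ) (u v : RatFun) (φ₃ φ₄ : ℂ) : Prop where
  eq₁ : con 2 * (p.f * der u) + p.f * der (p.f * der v) -
    p.f * (con (2 * p.M * ((s' : ℂ) ^ 2 - (s : ℂ) ^ 2)) * r⁻¹ ^ 3) * v = 0
  eq₀ : p.f * der (p.f * der u) - p.f * (con (2 * p.M * ((s' : ℂ) ^ 2 - (s : ℂ) ^ 2)) * r⁻¹ ^ 3) * u +
    con 2 * (p.f * der v * modePot p s') + v * (p.f * der (modePot p s')) -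
      p.f * (con φ₃ * r⁻¹ ^ 3 + con φ₄ * r⁻¹ ^ 4) = 0

namespace ModeEq

open Place

variable {p : Params} {s s' : ℕ} {u v : RatFun} {φ₃ φ₄ : ℂ}

theorem lead_x {c : ℂ} (hc : c ≠ 0) : (at_ c).Lead 0 c⁻¹ r⁻¹ := by
  have h : (at_ c).Lead 0 c r := by
    have h1 := ((at_ c).lead_con c).add ((at_ c).lead_t.of_lt zero_lt_one)
    rw [add_zero] at h1
    convert h1 using 1
    exact (add_sub_cancel (con c) r).symm
  simpa using h.inv hc

theorem lead_x_zero : (at_ 0).Lead (-1) 1 r⁻¹ := by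
  have h1 := (at_ 0).lead_t.inv one_ne_zero
  have h2 : (at_ 0).t = r := by change r - con 0 = r; rw [con_zero, sub_zero]
  rw [h2] at h1
  simpa using h1

theorem f_eq_x (p : Params) : p.f = 1 - con (2 * p.M) * r⁻¹ := by
  rw [Params.f, Params.f₁, div_eq_mul_inv]

theorem _root_.Schw.Place.Lead.cast {P : Place} {n m : ℤ} {c d : ℂ} {z : RatFun} (h : P.Lead n c z)
    (hn : n = m) (hc : c = d) : P.Lead m d z := hn ▸ hc ▸ h

theorem _root_.Schw.Place.Lead.trunc {P : Place} {n N : ℤ} {c : ℂ} {z : RatFun} (h : P.Lead n c z)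
    (hN : N ≤ n) : P.Lead N (if N = n then c else 0) z := by
  split_ifs with e
  · exact e ▸ h
  · exact h.of_lt (lt_of_le_of_ne hN e)

section

variable {P : Place} {q : RatFun} {q₀ w₀ κ₀ a b : ℂ} {ν w d n k N e : ℤ}

/-- The coefficient of t^N in `eq₁`, when v starts at order n and u at order n + k. Each conditional
records whether the corresponding term reaches down to order N; `lead₀` does the same for `eq₀`. -/
theorem lead₁ (h : ModeEq p s s' u v φ₃ φ₄) (hq : P.Lead ν q₀ q) (hf : p.f = q * P.e)
    (hK : P.Lead d κ₀ (p.f * (con (2 * p.M * ((s' : ℂ) ^ 2 - (s : ℂ) ^ 2)) * r⁻¹ ^ 3)))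
    (ha : P.Lead (n + k) a u) (hb : P.Lead n b v) (h₁ : N ≤ ν + (n + k)) (h₂ : N ≤ ν + (ν + n))
    (h₃ : N ≤ d + n) :
    2 * (if N = ν + (n + k) then q₀ * ((n + k : ℤ) * a) else 0) +
      (if N = ν + (ν + n) then q₀ * ((ν + n : ℤ) * (q₀ * (n * b))) else 0) -
      (if N = d + n then κ₀ * b else 0) = 0 := by
  have h := (((((ha.dot hq hf).trunc h₁).con_mul 2).add (((hb.dot hq hf).dot hq hf).trunc h₂)).sub
    ((hK.mul hb).trunc h₃))
  rw [‹ModeEq p s s' u v φ₃ φ₄›.eq₁] at h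
  exact h.eq_zero

theorem lead₀ (h : ModeEq p s s' u v φ₃ φ₄) (hq : P.Lead ν q₀ q) (hf : p.f = q * P.e)
    (hK : P.Lead d κ₀ (p.f * (con (2 * p.M * ((s' : ℂ) ^ 2 - (s : ℂ) ^ 2)) * r⁻¹ ^ 3)))
    (hW : P.Lead w w₀ (modePot p s'))
    (hΦ : P.Ord e (p.f * (con φ₃ * r⁻¹ ^ 3 + con φ₄ * r⁻¹ ^ 4)))
    (ha : P.Lead (n + k) a u) (hb : P.Lead n b v) (h₁ : N ≤ ν + (ν + (n + k)))
    (h₂ : N ≤ d + (n + k)) (h₃ : N ≤ ν + n + w) (h₄ : N < e) :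
    (if N = ν + (ν + (n + k)) then q₀ * ((ν + (n + k) : ℤ) * (q₀ * ((n + k : ℤ) * a))) else 0) -
      (if N = d + (n + k) then κ₀ * a else 0) +
      2 * (if N = ν + n + w then q₀ * (n * b) * w₀ else 0) +
      (if N = n + (ν + w) then b * (q₀ * (w * w₀)) else 0) = 0 := by
  have h5 := (((((ha.dot hq hf).dot hq hf).trunc h₁).sub ((hK.mul ha).trunc h₂)).add
    ((((hb.dot hq hf).mul hW).trunc h₃).con_mul 2)).add
    ((hb.mul (hW.dot hq hf)).trunc (show N ≤ n + (ν + w) by omega))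
  have h6 := h5.sub (hΦ.choose_spec.of_lt h₄)
  rw [h.eq₀, sub_zero] at h6
  exact h6.eq_zero

end

/-- The angular part of the potential vanishes at infinity because of the powers of 1/r, and at the
horizon because of the factor f. In both cases only -ω² is left. -/
theorem lead_modePot {P : Place} {p : Params} {s : ℕ} {ν : ℤ} {c : ℂ} (hf : P.Lead ν c p.f)
    {n : ℤ} {x : ℂ} (hx : P.Lead n x r⁻¹) (hν : 0 ≤ ν) (hn : 0 ≤ n) (h : ν ≠ 0 ∨ n ≠ 0) :
    P.Lead 0 (-p.ω ^ 2) (modePot p s) := by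
  have h2 : P.Ord (n + n) (con p.B * r⁻¹ ^ 2 + con (2 * p.M * (1 - (s : ℂ) ^ 2)) * r⁻¹ ^ 3) := by
    refine Ord.add ?_ ?_
    · exact Ord.of_le ((hx.pow 2).con_mul _).ord (by push_cast; omega)
    · exact Ord.of_le ((hx.pow 3).con_mul _).ord (by push_cast; omega)
  have h3 := ((hf.ord.mul h2).choose_spec.of_lt (show 0 < ν + (n + n) by omega)).sub
    (P.lead_con (p.ω ^ 2))
  exact h3.cast rfl (by ring)

theorem ord_source {P : Place} {p : Params} {φ₃ φ₄ : ℂ} {ν : ℤ} {c : ℂ} (hf : P.Lead ν c p.f)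
    {n : ℤ} {x : ℂ} (hx : P.Lead n x r⁻¹) {e : ℤ} (h₃ : e ≤ ν + 3 * n) (h₄ : e ≤ ν + 4 * n) :
    P.Ord e (p.f * (con φ₃ * r⁻¹ ^ 3 + con φ₄ * r⁻¹ ^ 4)) := by
  have h2 : P.Ord (e - ν) (con φ₃ * r⁻¹ ^ 3 + con φ₄ * r⁻¹ ^ 4) := by
    refine Ord.add ?_ ?_
    · exact Ord.of_le ((hx.pow 3).con_mul _).ord (by push_cast; omega)
    · exact Ord.of_le ((hx.pow 4).con_mul _).ord (by push_cast; omega)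
  exact (hf.ord.mul h2).of_le (by omega)

/-- At an order n < 0 the leading terms of the two equations are n a = 0 and n ω² b = 0, up to
numerical factors. -/
theorem infty_ord (h : ModeEq p s s' u v φ₃ φ₄) (hω : p.ω ≠ 0) :
    infty.Ord 0 u ∧ infty.Ord 0 v := by
  have hx : infty.Lead 1 1 r⁻¹ := infty.lead_t
  have hf : infty.Lead 0 1 p.f := infty_lead_f p
  have hq : infty.Lead 1 (-1) (-(p.f * r⁻¹)) := (hf.mul hx).neg.cast rfl (by ring)
  have hqe : p.f = -(p.f * r⁻¹) * infty.e := by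
    change p.f = -(p.f * r⁻¹) * -r
    have := r_ne_zero
    field_simp
  have hW := lead_modePot (s := s') hf hx le_rfl zero_le_one (.inr one_ne_zero)
  have hK := hf.mul ((hx.pow 3).con_mul (2 * p.M * ((s' : ℂ) ^ 2 - (s : ℂ) ^ 2)))
  have hΦ := ord_source (φ₃ := φ₃) (φ₄ := φ₄) hf hx (e := 3) (by norm_num) (by norm_num)
  refine ord_of_step (k := 0) (N := 0) fun n hn a b ha hb => ?_
  have hn' : (n : ℂ) ≠ 0 := by exact_mod_cast hn.ne
  have e₁ := h.lead₁ hq hqe hK ha hb (N := n + 1) (by omega) (by omega) (by push_cast; omega)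
  have e₀ := h.lead₀ hq hqe hK hW hΦ ha hb (N := n + 1) (by omega) (by push_cast; omega) (by omega)
    (by omega)
  rw [if_pos (by omega), if_neg (by omega), if_neg (by push_cast; omega)] at e₁
  rw [if_neg (by omega), if_neg (by push_cast; omega), if_pos (by omega), if_pos (by omega)] at e₀
  push_cast at e₁ e₀
  constructor
  · refine (mul_eq_zero.1 (show (n : ℂ) * a = 0 by linear_combination -e₁ / 2)).resolve_left hn'
  · refine (mul_eq_zero.1 (show (n * p.ω ^ 2 : ℂ) * b = 0 by linear_combination e₀ / 2)).resolve_left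
      (mul_ne_zero hn' (pow_ne_zero 2 hω))

/-- At a pole away from 0 and 2M the second derivatives dominate, and their factor n(n - 1) is
nonzero for n < 0. -/
theorem ordinary_ord (h : ModeEq p s s' u v φ₃ φ₄) {c : ℂ} (hc : c ≠ 0) (hc' : c ≠ 2 * p.M) :
    (at_ c).Ord 0 u ∧ (at_ c).Ord 0 v := by
  have hx := lead_x hc
  have hf : (at_ c).Lead 0 (1 - 2 * p.M * c⁻¹) p.f := by
    rw [f_eq_x]; exact (at_ c).lead_one.sub (hx.con_mul _)
  have hf0 : 1 - 2 * p.M * c⁻¹ ≠ 0 := by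
    intro h0
    refine hc' ?_
    field_simp at h0
    linear_combination h0
  have hq := hf.mul ((at_ c).lead_t.inv one_ne_zero)
  have hqe : p.f = p.f * (at_ c).t⁻¹ * (at_ c).e := by
    change p.f = p.f * (at_ c).t⁻¹ * (at_ c).t
    rw [mul_assoc, inv_mul_cancel₀ (at_ c).t_ne_zero, mul_one]
  have hW : ∃ w₀, (at_ c).Lead 0 w₀ (modePot p s') :=
    ⟨_, (hf.mul (((hx.pow 2).con_mul p.B).add (((hx.pow 3).con_mul
      (2 * p.M * (1 - (s' : ℂ) ^ 2))).cast (by norm_num) rfl))).sub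
        (((at_ c).lead_con (p.ω ^ 2)).cast (by norm_num) rfl) |>.cast (by norm_num) rfl⟩
  obtain ⟨w₀, hW⟩ := hW
  have hK := hf.mul ((hx.pow 3).con_mul (2 * p.M * ((s' : ℂ) ^ 2 - (s : ℂ) ^ 2)))
  have hΦ := ord_source (φ₃ := φ₃) (φ₄ := φ₄) hf hx (e := 0) (by norm_num) (by norm_num)
  refine ord_of_step (k := 0) (N := 0) fun n hn a b ha hb => ?_
  have hn' : (n : ℂ) ≠ 0 := by exact_mod_cast hn.ne
  have hn1 : (n - 1 : ℂ) ≠ 0 := by exact_mod_cast (show n - 1 ≠ 0 by omega)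
  have e₁ := h.lead₁ hq hqe hK ha hb (N := n - 2) (by omega) (by omega) (by push_cast; omega)
  have e₀ := h.lead₀ hq hqe hK hW hΦ ha hb (N := n - 2) (by omega) (by push_cast; omega) (by omega)
    (by omega)
  rw [if_neg (by omega), if_pos (by omega), if_neg (by push_cast; omega)] at e₁
  rw [if_pos (by omega), if_neg (by push_cast; omega), if_neg (by omega), if_neg (by omega)] at e₀
  push_cast at e₁ e₀
  have hm : (1 - 2 * p.M * c⁻¹) ^ 2 * (n * (n - 1)) ≠ 0 :=
    mul_ne_zero (pow_ne_zero 2 hf0) (mul_ne_zero hn' hn1)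
  constructor
  · exact (mul_eq_zero.1 ((by linear_combination e₀ :
      (1 - 2 * p.M * c⁻¹) ^ 2 * (n * (n - 1)) * a = 0))).resolve_left hm
  · exact (mul_eq_zero.1 ((by linear_combination e₁ :
      (1 - 2 * p.M * c⁻¹) ^ 2 * (n * (n - 1)) * b = 0))).resolve_left hm

/-- Eliminating the leading coefficient of u gives a nonzero multiple of n(n² + 16M²ω²)b = 0. The
bracket vanishes only for n = ±4iMω, which is excluded by non-resonance. -/
theorem horizon_ord (h : ModeEq p s s' u v φ₃ φ₄) (hM : p.M ≠ 0)
    (hn4 : ∀ n : ℤ, 4 * Complex.I * p.M * p.ω ≠ n) :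
    (at_ (2 * p.M)).Ord 0 u ∧ (at_ (2 * p.M)).Ord 0 v := by
  have hc : 2 * p.M ≠ 0 := mul_ne_zero two_ne_zero hM
  have hx := lead_x hc
  have hqe : p.f = r⁻¹ * (at_ (2 * p.M)).e := by
    change p.f = r⁻¹ * (r - con (2 * p.M))
    rw [f_eq_x, mul_sub, inv_mul_cancel₀ r_ne_zero, mul_comm]
  have hf : (at_ (2 * p.M)).Lead 1 (2 * p.M)⁻¹ p.f := by
    rw [hqe]
    exact (hx.mul (at_ (2 * p.M)).lead_t).cast rfl (by ring)
  have hW := lead_modePot (s := s') hf hx zero_le_one le_rfl (.inl one_ne_zero)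
  have hK := hf.mul ((hx.pow 3).con_mul (2 * p.M * ((s' : ℂ) ^ 2 - (s : ℂ) ^ 2)))
  have hΦ := ord_source (φ₃ := φ₃) (φ₄ := φ₄) hf hx (e := 0) (by norm_num) (by norm_num)
  refine ord_of_step (k := 0) (N := 0) fun n hn a b ha hb => ?_
  have hn' : (n : ℂ) ≠ 0 := by exact_mod_cast hn.ne
  have e₁ := h.lead₁ hx hqe hK ha hb (N := n) (by omega) (by omega) (by push_cast; omega)
  have e₀ := h.lead₀ hx hqe hK hW hΦ ha hb (N := n) (by omega) (by push_cast; omega) (by omega)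
    (by omega)
  rw [if_pos (by omega), if_pos (by omega), if_neg (by push_cast; omega)] at e₁
  rw [if_pos (by omega), if_neg (by push_cast; omega), if_pos (by omega), if_pos (by omega)] at e₀
  push_cast at e₁ e₀
  have hI := Complex.I_sq
  set q : ℂ := (2 * p.M)⁻¹ with hq
  have hqM : q * (2 * p.M) = 1 := inv_mul_cancel₀ hc
  have hq0 : q ≠ 0 := inv_ne_zero hc
  have hd : (q * n) ^ 2 + 4 * p.ω ^ 2 ≠ 0 := by
    intro h0
    have : (4 * Complex.I * p.M * p.ω - n) * (4 * Complex.I * p.M * p.ω - (-n : ℤ)) = 0 := by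
      push_cast
      linear_combination (16 * p.M ^ 2 * p.ω ^ 2) * hI - 4 * p.M ^ 2 * h0 +
        n ^ 2 * (q * (2 * p.M) + 1) * hqM
    rcases mul_eq_zero.1 this with h1 | h1
    · exact hn4 n (sub_eq_zero.1 h1)
    · exact hn4 (-n) (sub_eq_zero.1 h1)
  have hb0 : b = 0 := (mul_eq_zero.1 ((by linear_combination (q * n) * e₁ - 2 * e₀ :
    q * n * ((q * n) ^ 2 + 4 * p.ω ^ 2) * b = 0))).resolve_left
      (mul_ne_zero (mul_ne_zero hq0 hn') hd)
  refine ⟨?_, hb0⟩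
  rw [hb0] at e₁
  exact (mul_eq_zero.1 ((by linear_combination e₁ / 2 : q * n * a = 0))).resolve_left
    (mul_ne_zero hq0 hn')

/-- Near r = 0 the solutions of the Regge–Wheeler equation of spin s have exponents 1 ± s, and
correspondingly the indicial polynomial of v is the product of the four factors n - 2 ± s ± s'. None
of them vanishes for n < 2 - s - s'. The bound N ≤ 1 keeps the source term out of the comparison.
The function u starts two orders below v. -/
theorem origin_ord (h : ModeEq p s s' u v φ₃ φ₄) (hM : p.M ≠ 0) {N : ℤ} (hN : N ≤ 1)
    (hs : N ≤ 2 - s - s') : (at_ 0).Ord N v := by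
  have hx := lead_x_zero
  have hM2 : 2 * p.M ≠ 0 := mul_ne_zero two_ne_zero hM
  have hf : (at_ 0).Lead (-1) (-(2 * p.M)) p.f := by
    rw [f_eq_x]
    exact (((at_ 0).lead_one.of_lt (by norm_num)).sub (hx.con_mul (2 * p.M))).cast rfl (by ring)
  have hq := hf.mul hx
  have hqe : p.f = p.f * r⁻¹ * (at_ 0).e := by
    have : (at_ 0).e = r := by change r - con 0 = r; rw [con_zero, sub_zero]
    rw [this, mul_assoc, inv_mul_cancel₀ r_ne_zero, mul_one]
  have hW : (at_ 0).Lead (-4) (-(2 * p.M) * (2 * p.M * (1 - (s' : ℂ) ^ 2))) (modePot p s') :=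
    ((hf.mul ((((hx.pow 2).con_mul p.B).of_lt (by norm_num)).add ((hx.pow 3).con_mul
      (2 * p.M * (1 - (s' : ℂ) ^ 2))))).sub (((at_ 0).lead_con (p.ω ^ 2)).of_lt (by norm_num))).cast
        (by norm_num) (by ring)
  have hK := (hf.mul ((hx.pow 3).con_mul (2 * p.M * ((s' : ℂ) ^ 2 - (s : ℂ) ^ 2)))).cast
    (by norm_num : _ = (-4 : ℤ)) (by ring : _ = -(2 * p.M) * (2 * p.M * ((s' : ℂ) ^ 2 - (s : ℂ) ^ 2)))
  have hΦ := ord_source (φ₃ := φ₃) (φ₄ := φ₄) hf hx (e := -5) (by norm_num) (by norm_num)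
  refine (ord_of_step (u := u) (k := -2) (N := N) fun n hn a b ha hb => ?_).2
  have e₁ := h.lead₁ hq hqe hK ha hb (N := n - 4) (by omega) (by omega) (by omega)
  have e₀ := h.lead₀ hq hqe hK hW hΦ ha hb (N := n - 6) (by omega) (by omega) (by omega) (by omega)
  rw [if_pos (by omega), if_pos (by omega), if_pos (by omega)] at e₁
  rw [if_pos (by omega), if_pos (by omega), if_pos (by omega), if_pos (by omega)] at e₀
  have fac : ∀ z : ℤ, z ≠ 0 → (z : ℂ) ≠ 0 := fun z hz => by exact_mod_cast hz
  have f0 : (n : ℂ) - 2 ≠ 0 := by exact_mod_cast fac (n - 2) (by omega)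
  have f1 : (n : ℂ) - 2 - (s + s') ≠ 0 := by exact_mod_cast fac (n - 2 - (s + s')) (by omega)
  have f2 : (n : ℂ) - 2 + (s + s') ≠ 0 := by exact_mod_cast fac (n - 2 + (s + s')) (by omega)
  have f3 : (n : ℂ) - 2 - (s - s') ≠ 0 := by exact_mod_cast fac (n - 2 - (s - s')) (by omega)
  have f4 : (n : ℂ) - 2 + (s - s') ≠ 0 := by exact_mod_cast fac (n - 2 + (s - s')) (by omega)
  push_cast at e₁ e₀
  generalize p.M = M at *
  have hb0 : b = 0 := by
    refine (mul_eq_zero.1 (show (2 * M) ^ 2 * ((n - 2 - (s + s')) * (n - 2 + (s + s')) *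
      (n - 2 - (s - s')) * (n - 2 + (s - s'))) * b = 0 from ?_)).resolve_left
      (mul_ne_zero (pow_ne_zero 2 hM2) (mul_ne_zero (mul_ne_zero (mul_ne_zero f1 f2) f3) f4))
    refine mul_left_cancel₀ hM ?_
    -- Up to a common factor and sign, the multipliers are the coefficients of a in the other
    -- equation, so that a drops out.
    linear_combination M * ((n - 2) * (n - 4) + ((s' : ℂ) ^ 2 - (s : ℂ) ^ 2)) * e₁ + (n - 2) * e₀
  refine ⟨?_, hb0⟩
  rw [hb0] at e₁
  exact (mul_eq_zero.1 ((by linear_combination -e₁ / 2 : 2 * M * (n - 2) * a = 0))).resolve_left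
    (mul_ne_zero hM2 f0)

end ModeEq

end

/-! ### Morphisms polynomial in 1/r and their classification -/

section

namespace Place

/-- The polar part at r = 0 is subtracted one power of 1/r at a time. These powers are regular
elsewhere, and what is left at the end has no pole on the sphere, hence is constant. -/
theorem exists_poly_inv_r {z : RatFun} (h : ∀ c, c ≠ 0 → (at_ c).Ord 0 z) (h' : infty.Ord 0 z) :
    ∀ n : ℕ, (at_ 0).Ord (-n) z → ∃ b : ℕ → ℂ, z = ∑ k ∈ Finset.range (n + 1), con (b k) * r⁻¹ ^ k
  | 0, h0 => by
    obtain ⟨c, hc⟩ := eq_con (z := z) (fun c => by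
      by_cases hc : c = 0
      · rw [hc]; simpa using h0
      · exact h c hc) h'
    exact ⟨fun _ => c, by simpa using hc⟩
  | n + 1, ⟨a, ha⟩ => by
    have h1 := (ha.sub (((ModeEq.lead_x_zero.pow (n + 1)).con_mul a).cast (by push_cast; ring)
      (by ring : _ = a))).cast rfl (sub_self a)
    obtain ⟨b, hb⟩ := exists_poly_inv_r (z := z - con a * r⁻¹ ^ (n + 1))
      (fun c hc => (h c hc).sub
        (by simpa using (((ModeEq.lead_x hc).pow (n + 1)).con_mul a).ord))
      (h'.sub ((((infty.lead_t.pow (n + 1)).con_mul a).ord).of_le (by push_cast; omega))) n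
      (by
        have := h1.exists_succ
        rwa [show (-((n + 1 : ℕ) : ℤ) + 1) = -n by push_cast; ring] at this)
    refine ⟨fun k => if k = n + 1 then a else b k, ?_⟩
    rw [Finset.sum_range_succ]
    beta_reduce
    rw [if_pos rfl, ← sub_eq_iff_eq_add, hb]
    refine Finset.sum_congr rfl fun k hk => ?_
    rw [if_neg (Finset.mem_range.1 hk).ne]

/-- Evaluation at infinity. Iterated along a Horner form it reads off the coefficients of a
polynomial in 1/r. -/
theorem con_add_inv_r_mul_eq_zero {a : ℂ} {y : RatFun} (h : con a + r⁻¹ * y = 0)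
    (hy : infty.Ord 0 y) : a = 0 ∧ y = 0 := by
  have hx : infty.Lead 1 1 r⁻¹ := infty.lead_t
  have h1 := (infty.lead_con a).add ((hx.mul hy.choose_spec).of_lt (by norm_num))
  rw [h, add_zero] at h1
  have ha := h1.eq_zero
  rw [ha, con_zero, zero_add] at h
  exact ⟨ha, (mul_eq_zero.1 h).resolve_left (inv_ne_zero r_ne_zero)⟩

theorem ord_con_add_inv_r_mul (a : ℂ) {y : RatFun} (hy : infty.Ord 0 y) :
    infty.Ord 0 (con a + r⁻¹ * y) :=
  Ord.add (infty.lead_con a).ord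
    (((infty.lead_t : infty.Lead 1 1 r⁻¹).ord.mul hy).of_le (by norm_num))

end Place

theorem der_inv_r : der r⁻¹ = -r⁻¹ ^ 2 := by
  rw [Derivation.leibniz_inv, der_r, smul_eq_mul, mul_one]

namespace ModeEq

open Place

variable {p : Params} {s s' : ℕ} {u v : RatFun} {φ₃ φ₄ : ℂ}

/-- By the local analysis v is finite everywhere except at r = 0, where its pole has order at most s
+ s' - 2 if s + s' ≥ 2. For s + s' ≤ 1 it vanishes at r = 0, and being constant it is then zero. -/
theorem exists_poly (h : ModeEq p s s' u v φ₃ φ₄) (hM : p.M ≠ 0)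
    (hn4 : ∀ n : ℤ, 4 * Complex.I * p.M * p.ω ≠ n) (hs : s ≤ 2) (hs' : s' ≤ 2) :
    ∃ b₀ b₁ b₂ : ℂ, v = con b₀ + con b₁ * r⁻¹ + con b₂ * r⁻¹ ^ 2 ∧
      (s + s' ≤ 1 → b₀ = 0) ∧ (s + s' ≤ 2 → b₁ = 0) ∧ (s + s' ≤ 3 → b₂ = 0) := by
  have hω : p.ω ≠ 0 := fun h0 => hn4 0 (by rw [h0]; simp)
  have h1 : ∀ c, c ≠ 0 → (at_ c).Ord 0 v := fun c hc => by
    by_cases hc' : c = 2 * p.M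
    · rw [hc']; exact (h.horizon_ord hM hn4).2
    · exact (h.ordinary_ord hc hc').2
  have h2 := (h.infty_ord hω).2
  have h0 : ∀ N : ℤ, N ≤ 1 → N ≤ 2 - s - s' → (at_ 0).Ord N v := fun N => h.origin_ord hM
  have h3 := exists_poly_inv_r h1 h2
  rcases Nat.lt_or_ge (s + s') 2 with h4 | h4
  · obtain ⟨b, hb⟩ := h3 0 (h0 _ (by norm_num) (by push_cast; omega))
    simp only [zero_add, Finset.sum_range_one, pow_zero, mul_one] at hb
    obtain ⟨c, hc⟩ := h0 1 le_rfl (by omega)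
    have h5 := ((at_ 0).lead_con (b 0)).sub (hc.of_lt zero_lt_one)
    rw [← hb, sub_self, sub_zero] at h5
    rw [h5.eq_zero, con_zero] at hb
    exact ⟨0, 0, 0, by simp [hb], fun _ => rfl, fun _ => rfl, fun _ => rfl⟩
  rcases Nat.lt_or_ge (s + s') 3 with h5 | h5
  · obtain ⟨b, hb⟩ := h3 0 (h0 _ (by norm_num) (by push_cast; omega))
    simp only [zero_add, Finset.sum_range_one, pow_zero, mul_one] at hb
    exact ⟨b 0, 0, 0, by simp [hb], fun h => by omega, fun _ => rfl, fun _ => rfl⟩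
  rcases Nat.lt_or_ge (s + s') 4 with h6 | h6
  · obtain ⟨b, hb⟩ := h3 1 (h0 _ (by norm_num) (by push_cast; omega))
    simp only [Finset.sum_range_succ, Finset.sum_range_zero, zero_add, pow_zero, mul_one,
      pow_one] at hb
    exact ⟨b 0, b 1, 0, by simp [hb], fun h => by omega, fun h => by omega, fun _ => rfl⟩
  · obtain ⟨b, hb⟩ := h3 2 (h0 _ (by norm_num) (by push_cast; omega))
    simp only [Finset.sum_range_succ, Finset.sum_range_zero, zero_add, pow_zero, mul_one,
      pow_one] at hb
    exact ⟨b 0, b 1, b 2, hb, fun h => by omega, fun h => by omega, fun h => by omega⟩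

/-- The conditions on a first order morphism with coefficients polynomial in `1/r`. -/
theorem coeffs (h : ModeEq p s s' u v φ₃ φ₄) {b₀ b₁ b₂ : ℂ}
    (hv : v = con b₀ + con b₁ * r⁻¹ + con b₂ * r⁻¹ ^ 2) :
    ∃ c, (v = 0 → u = con c) ∧ 2 * p.ω ^ 2 * b₁ = 0 ∧
      -(2 * p.M * ((s' : ℂ) ^ 2 - (s : ℂ) ^ 2)) * c + 4 * p.ω ^ 2 * b₂ - 2 * p.B * b₀ = φ₃ ∧
      (b₁ = 0 → 3 * p.M * b₀ * ((s : ℂ) ^ 2 + (s' : ℂ) ^ 2 - 2 + 2 * p.B) = φ₄) := by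
  set k : ℂ := 2 * p.M * ((s' : ℂ) ^ 2 - (s : ℂ) ^ 2) with hk
  set g : ℂ := 2 * p.M * (1 - (s' : ℂ) ^ 2) with hg
  obtain ⟨e₁, e₀⟩ := h
  rw [modePot, ← hg] at e₀
  rw [← hk] at e₁ e₀
  -- With these coefficients the first equation reads ∂u = a₃r⁻³ + a₄r⁻⁴ + a₅r⁻⁵, so u is found by
  -- integration up to a constant c.
  obtain ⟨a₃, ha₃⟩ : ∃ a, a = k * b₀ / 2 - b₁ := ⟨_, rfl⟩
  obtain ⟨a₄, ha₄⟩ : ∃ a, a = k * b₁ / 2 + 3 * p.M * b₁ - 3 * b₂ := ⟨_, rfl⟩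
  obtain ⟨a₅, ha₅⟩ : ∃ a, a = k * b₂ / 2 + 8 * p.M * b₂ := ⟨_, rfl⟩
  have hf := p.f_ne_zero
  have hf' := f_eq_x p
  have hdx := der_inv_r
  have hd2 : der (2 : RatFun) = 0 := by rw [← con_ofNat 2, der_con]
  have hd3 : der (3 : RatFun) = 0 := by rw [← con_ofNat 3, der_con]
  have hd4 : der (4 : RatFun) = 0 := by rw [← con_ofNat 4, der_con]
  have e₁' : con 2 * der u + der (p.f * der v) - con k * r⁻¹ ^ 3 * v = 0 :=
    mul_left_cancel₀ hf (by linear_combination e₁)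
  have e₀' : der (p.f * der u) - con k * r⁻¹ ^ 3 * u + con 2 * (der v *
      (p.f * (con p.B * r⁻¹ ^ 2 + con g * r⁻¹ ^ 3) - con (p.ω ^ 2))) +
      v * der (p.f * (con p.B * r⁻¹ ^ 2 + con g * r⁻¹ ^ 3) - con (p.ω ^ 2)) -
      (con φ₃ * r⁻¹ ^ 3 + con φ₄ * r⁻¹ ^ 4) = 0 :=
    mul_left_cancel₀ hf (by linear_combination e₀)
  obtain ⟨c, hc⟩ := eq_con_of_der (x := u + con (a₃ / 2) * r⁻¹ ^ 2 + con (a₄ / 3) * r⁻¹ ^ 3 +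
      con (a₅ / 4) * r⁻¹ ^ 4) (by
    refine (mul_eq_zero.1 (?_ : con 2 * _ = 0)).resolve_left (con_ne_zero two_ne_zero)
    generalize r⁻¹ = x at *
    rw [hf', hv] at e₁'
    simp only [Derivation.leibniz, Derivation.leibniz_pow, map_add, map_sub, map_neg, der_con, hdx,
      smul_eq_mul, nsmul_eq_mul, Derivation.map_one_eq_zero, Nat.cast_ofNat, hd2, map_zero, Nat.add_one_sub_one, pow_one] at e₁' ⊢
    rw [ha₃, ha₄, ha₅]
    simp only [con_add, con_sub, con_mul, con_div, con_ofNat] at e₁' ⊢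
    linear_combination e₁')
  have hu : u = con c - con (a₃ / 2) * r⁻¹ ^ 2 - con (a₄ / 3) * r⁻¹ ^ 3 - con (a₅ / 4) * r⁻¹ ^ 4 := by
    rw [← hc]; ring
  -- The second equation in Horner form in 1/r. Only the coefficients of r⁻², r⁻³ and r⁻⁴ are
  -- needed.
  have key : r⁻¹ ^ 2 * (con (2 * p.ω ^ 2 * b₁) + r⁻¹ * (con (-k * c + 4 * p.ω ^ 2 * b₂ - 2 * p.B * b₀ - φ₃) +
      r⁻¹ * (con (-3 * a₃ - 3 * (g - 2 * p.M * p.B) * b₀ - 4 * p.B * b₁ - φ₄) + r⁻¹ *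
      (con (-4 * (a₄ - 2 * p.M * a₃) + k * a₃ / 2 - 5 * (g - 2 * p.M * p.B) * b₁ - 6 * p.B * b₂ +
        8 * p.M * g * b₀) + r⁻¹ * (con (-5 * (a₅ - 2 * p.M * a₄) + k * a₄ / 3 + 12 * p.M * g * b₁ -
        7 * (g - 2 * p.M * p.B) * b₂) + r⁻¹ * con (12 * p.M * a₅ + k * a₅ / 4 +
        16 * p.M * g * b₂)))))) = 0 := by
    generalize r⁻¹ = x at *
    rw [hf', hv, hu] at e₀'
    simp only [Derivation.leibniz, Derivation.leibniz_pow, map_add, map_sub, map_neg, der_con, hdx,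
      smul_eq_mul, nsmul_eq_mul, Derivation.map_one_eq_zero, Nat.cast_ofNat, hd2, hd3, hd4, map_zero, Nat.add_one_sub_one, pow_one] at e₀'
    clear_value k g
    clear ha₃ ha₄ ha₅ e₁' e₁ e₀ hc hu
    simp only [con_add, con_sub, con_neg, con_mul, con_div, con_pow, con_ofNat] at e₀' ⊢
    linear_combination e₀'
  have o0 := (infty.lead_con (12 * p.M * a₅ + k * a₅ / 4 + 16 * p.M * g * b₂)).ord
  have o1 := ord_con_add_inv_r_mul (-5 * (a₅ - 2 * p.M * a₄) + k * a₄ / 3 + 12 * p.M * g * b₁ -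
        7 * (g - 2 * p.M * p.B) * b₂) o0
  have o2 := ord_con_add_inv_r_mul (-4 * (a₄ - 2 * p.M * a₃) + k * a₃ / 2 -
    5 * (g - 2 * p.M * p.B) * b₁ - 6 * p.B * b₂ + 8 * p.M * g * b₀) o1
  have o3 := ord_con_add_inv_r_mul (-3 * a₃ - 3 * (g - 2 * p.M * p.B) * b₀ - 4 * p.B * b₁ - φ₄) o2
  have o4 := ord_con_add_inv_r_mul (-k * c + 4 * p.ω ^ 2 * b₂ - 2 * p.B * b₀ - φ₃) o3
  have key' := (mul_eq_zero.1 key).resolve_left (pow_ne_zero 2 (inv_ne_zero r_ne_zero))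
  obtain ⟨k2, key3⟩ := con_add_inv_r_mul_eq_zero key' o4
  obtain ⟨k3, key4⟩ := con_add_inv_r_mul_eq_zero key3 o3
  obtain ⟨k4, -⟩ := con_add_inv_r_mul_eq_zero key4 o2
  refine ⟨c, fun hv0 => ?_, k2, by linear_combination k3, fun hb₁ => ?_⟩
  · have z : con b₀ + r⁻¹ * (con b₁ + r⁻¹ * con b₂) = 0 := by
      rw [← hv0, hv]; ring
    obtain ⟨z0, z'⟩ := con_add_inv_r_mul_eq_zero z
      (ord_con_add_inv_r_mul _ (infty.lead_con _).ord)
    obtain ⟨z1, z''⟩ := con_add_inv_r_mul_eq_zero z' (infty.lead_con _).ord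
    have z2 : b₂ = 0 := con_inj.1 (z''.trans con_zero.symm)
    rw [hu, ha₃, ha₄, ha₅, z0, z1, z2]
    simp
  · rw [ha₃, hb₁, hk, hg] at k4
    linear_combination k4

/-- The classification of the first order morphisms between Regge–Wheeler operators. -/
theorem classify (h : ModeEq p s s' u v φ₃ φ₄) (hM : p.M ≠ 0)
    (hn4 : ∀ n : ℤ, 4 * Complex.I * p.M * p.ω ≠ n) (hs : s ≤ 2) (hs' : s' ≤ 2)
    (hB : 2 ≤ s + s' → (s : ℂ) ^ 2 + (s' : ℂ) ^ 2 - 2 + 2 * p.B ≠ 0)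
    (h₃ : s ≠ s' ∨ s = 2 → φ₃ = 0) (h₄ : 2 ≤ s + s' → φ₄ = 0) :
    v = 0 ∧ φ₃ = 0 ∧ φ₄ = 0 ∧ ∃ c, u = con c ∧ (s ≠ s' → c = 0) := by
  have hω : p.ω ≠ 0 := fun h0 => hn4 0 (by rw [h0]; simp)
  obtain ⟨b₀, b₁, b₂, hv, c₀, c₁, c₂⟩ := h.exists_poly hM hn4 hs hs'
  obtain ⟨c, hc, k₁, k₃, k₄⟩ := h.coeffs hv
  have hb₁ : b₁ = 0 := (mul_eq_zero.1 k₁).resolve_left (mul_ne_zero two_ne_zero (pow_ne_zero 2 hω))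
  have k₄ := k₄ hb₁
  -- For s + s' ≥ 2 there is no source at order r⁻⁴, and the factor multiplying b₀ is nonzero by
  -- `hB`.
  have hb₀ : b₀ = 0 := by
    rcases Nat.lt_or_ge (s + s') 2 with h4 | h4
    · exact c₀ (by omega)
    · rw [h₄ h4] at k₄
      exact (mul_eq_zero.1 ((mul_eq_zero.1 k₄).resolve_right (hB h4))).resolve_left
        (mul_ne_zero three_ne_zero hM)
  -- A term in r⁻² can survive only for s = s' = 2, and there the source at order r⁻³ is absent by
  -- `h₃`.
  have hb₂ : b₂ = 0 := by
    rcases Nat.lt_or_ge (s + s') 4 with h4 | h4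
    · exact c₂ (by omega)
    · obtain rfl : s = 2 := by omega
      obtain rfl : s' = 2 := by omega
      rw [h₃ (.inr rfl), hb₀] at k₃
      have : (4 * p.ω ^ 2) * b₂ = 0 := by linear_combination k₃
      exact (mul_eq_zero.1 this).resolve_left (mul_ne_zero (by norm_num) (pow_ne_zero 2 hω))
  have hv0 : v = 0 := by rw [hv, hb₀, hb₁, hb₂]; simp
  rw [hb₀, hb₂] at k₃
  -- For different spins the r⁻³ terms of the potentials differ by a multiple of s'² - s² ≠ 0, and
  -- nothing compensates the constant c. For equal spins this difference vanishes, and the same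
  -- equation instead forces φ₃ = 0.
  have hc0 : s ≠ s' → c = 0 := fun hne => by
    rw [h₃ (.inl hne)] at k₃
    have h1 : (2 * p.M) * (((s' : ℂ) - s) * (s' + s)) * c = 0 := by linear_combination -k₃
    refine (mul_eq_zero.1 h1).resolve_left (mul_ne_zero (mul_ne_zero two_ne_zero hM)
      (mul_ne_zero (sub_ne_zero.2 fun e => hne (by exact_mod_cast e.symm)) ?_))
    have : s' + s ≠ 0 := by omega
    exact_mod_cast this
  refine ⟨hv0, ?_, ?_, c, hc hv0, hc0⟩
  · by_cases hne : s = s'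
    · rw [← k₃, hne]; ring
    · exact h₃ (.inl hne)
  · rw [← k₄, hb₀]; ring

end ModeEq

end

section

/-! ### The ring of rational differential operators -/

theorem opOf_extend (d k : ℕ) (c : ℕ → RatFun) :
    opOf d c = opOf (d + k) fun m => if m ≤ d then c m else 0 := by
  rw [opOf, opOf, show d + k + 1 = (d + 1) + k by omega, Finset.sum_range_add _ (d + 1) k]
  refine (add_zero _).symm.trans (congrArg₂ _ (Finset.sum_congr rfl fun m hm => ?_)
    (Finset.sum_eq_zero fun m _ => ?_).symm)
  · rw [if_pos (by have := Finset.mem_range.1 hm; omega)]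
  · rw [if_neg (by omega), mul_zero', zero_mul]

theorem IsDiffOp.add {P Q : Op} (hP : IsDiffOp P) (hQ : IsDiffOp Q) : IsDiffOp (P + Q) := by
  obtain ⟨d, c, rfl⟩ := hP
  obtain ⟨e, b, rfl⟩ := hQ
  rw [opOf_extend d e, opOf_extend e d, add_comm e d]
  refine ⟨d + e, fun m => (if m ≤ d then c m else 0) + if m ≤ e then b m else 0, ?_⟩
  simp only [opOf, ← Finset.sum_add_distrib, ← add_mul, ← mul_add']

theorem IsDiffOp.mul_fun_mul {P : Op} (a : RatFun) (hP : IsDiffOp P) : IsDiffOp (mul a * P) := by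
  obtain ⟨d, c, rfl⟩ := hP
  refine ⟨d, fun m => a * c m, ?_⟩
  simp only [opOf, Finset.mul_sum, ← mul_assoc, ← mulHom_apply, map_mul]

theorem isDiffOp_D_pow (m : ℕ) : IsDiffOp (D ^ m) := by
  refine ⟨m, fun k => if k = m then 1 else 0, ?_⟩
  rw [opOf, Finset.sum_range_succ, if_pos rfl, Finset.sum_eq_zero, zero_add, ← mulHom_apply,
    map_one, one_mul]
  intro k hk
  rw [if_neg (Finset.mem_range.1 hk).ne, mul_zero', zero_mul]

theorem isDiffOp_mul (a : RatFun) : IsDiffOp (mul a) := ⟨0, fun _ => a, by simp [opOf]⟩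

theorem IsDiffOp.sum {ι : Type*} {s : Finset ι} {F : ι → Op} (h : ∀ i ∈ s, IsDiffOp (F i)) :
    IsDiffOp (∑ i ∈ s, F i) :=
  Finset.sum_induction F IsDiffOp (fun _ _ => IsDiffOp.add) (mul_zero' ▸ isDiffOp_mul 0) h

theorem IsDiffOp.D_mul {P : Op} (hP : IsDiffOp P) : IsDiffOp (D * P) := by
  obtain ⟨d, c, rfl⟩ := hP
  rw [opOf, Finset.mul_sum]
  refine IsDiffOp.sum fun m _ => ?_
  have h : D * (mul (c m) * D ^ m) = mul (der (c m)) * D ^ m + mul (c m) * D ^ (m + 1) := by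
    have h1 := Schw.D_mul 1 (c m)
    rw [← mulHom_apply 1, map_one, one_mul, one_mul] at h1
    rw [← mul_assoc, h1, add_mul, mul_assoc, ← pow_succ']
  rw [h]
  exact ((isDiffOp_D_pow _).mul_fun_mul _).add ((isDiffOp_D_pow _).mul_fun_mul _)

theorem IsDiffOp.mul {P Q : Op} (hP : IsDiffOp P) (hQ : IsDiffOp Q) : IsDiffOp (P * Q) := by
  obtain ⟨d, c, rfl⟩ := hP
  rw [opOf, Finset.sum_mul]
  refine IsDiffOp.sum fun m hm => ?_
  rw [mul_assoc]
  refine IsDiffOp.mul_fun_mul _ ?_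
  clear hm
  induction m with
  | zero => simpa using hQ
  | succ m ih => rw [pow_succ', mul_assoc]; exact ih.D_mul

section

variable {n : ℕ} {g : RatFun} {X Y : OpMatrix n}

theorem isDiffOpMatrix_add (hX : IsDiffOpMatrix X) (hY : IsDiffOpMatrix Y) :
    IsDiffOpMatrix (X + Y) := fun i j => (hX i j).add (hY i j)

theorem isDiffOpMatrix_mul (hX : IsDiffOpMatrix X) (hY : IsDiffOpMatrix Y) :
    IsDiffOpMatrix (X * Y) := fun i j => by
  rw [Matrix.mul_apply]; exact IsDiffOp.sum fun k _ => (hX i k).mul (hY k j)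

theorem isDiffOpMatrix_DD (g : RatFun) : IsDiffOpMatrix (DD g : OpMatrix n) := fun i j => by
  rw [DD, Matrix.scalar_apply, Matrix.diagonal_apply]
  split_ifs
  · simpa using (isDiffOp_D_pow 1).mul_fun_mul g
  · exact mul_zero' ▸ isDiffOp_mul 0

theorem FinOrd.isDiffOpMatrix (h : FinOrd g X) : IsDiffOpMatrix X := by
  obtain ⟨N, a, h⟩ := h
  induction N generalizing a X with
  | zero => rw [show X = MM a from h]; exact isDiffOpMatrix_MM a
  | succ N ih =>
    obtain ⟨b, Y, hY, rfl⟩ := h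
    refine isDiffOpMatrix_add (isDiffOpMatrix_mul (isDiffOpMatrix_MM a) ?_) (ih _ hY)
    clear ih hY
    induction N + 1 with
    | zero => rw [pow_zero, ← map_one MM]; exact isDiffOpMatrix_MM 1
    | succ m ih => rw [pow_succ]; exact isDiffOpMatrix_mul ih (isDiffOpMatrix_DD g)

/-- Since ∂ = g⁻¹(g∂), operators of finite order in ∂ are of finite order in g∂. The entries are
first padded to a common order. -/
theorem IsDiffOpMatrix.finOrd (hg : g ≠ 0) (h : IsDiffOpMatrix X) : FinOrd g X := by
  choose d c hc using h
  obtain ⟨N, hN⟩ : ∃ N, ∀ i j, d i j ≤ N :=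
    ⟨∑ i, ∑ j, d i j, fun i j => (Finset.single_le_sum (fun _ _ => Nat.zero_le _)
      (Finset.mem_univ j)).trans (Finset.single_le_sum (f := fun i => ∑ j, d i j)
        (fun _ _ => Nat.zero_le _) (Finset.mem_univ i))⟩
  have hD : (Matrix.scalar (Fin n) D : OpMatrix n) = MM (Matrix.scalar (Fin n) g⁻¹) * DD g := by
    ext1 i j
    by_cases h : i = j
    · subst h
      simp [DD, MM_apply, Matrix.scalar_apply, ← mul_assoc, ← mulHom_apply, ← map_mul, hg]
    · simp [DD, MM_apply, Matrix.scalar_apply, h, mul_zero']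
  have hX : X = ∑ m ∈ Finset.range (N + 1),
      MM (Matrix.of fun i j => if m ≤ d i j then c i j m else 0) * Matrix.scalar (Fin n) D ^ m := by
    ext1 i j
    rw [Matrix.sum_apply, hc, opOf_extend _ (N - d i j), Nat.add_sub_cancel' (hN i j), opOf]
    refine Finset.sum_congr rfl fun m _ => ?_
    rw [← map_pow, Matrix.scalar_apply, Matrix.mul_diagonal, MM_apply, Matrix.of_apply]
  rw [hX]
  refine Finset.sum_induction _ (FinOrd g) (fun _ _ => FinOrd.add) (map_zero MM ▸ FinOrd.mM 0)
    fun m hm => ?_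
  clear hm
  induction m with
  | zero => simpa using FinOrd.mM _
  | succ m ih =>
    rw [pow_succ, ← mul_assoc, hD, ← mul_assoc]
    have key : ∀ a : FunMatrix n, FinOrd g (MM a * (MM (Matrix.scalar (Fin n) g⁻¹) * DD g) ^ m) := by
      intro a
      clear ih
      induction m with
      | zero => simpa using FinOrd.mM a
      | succ m ih => rw [pow_succ, ← mul_assoc, ← mul_assoc]; exact (ih.mul_MM _).mul_DD
    exact ((key _).mul_MM _).mul_DD

/-- An endomorphism of `U ((g ∂)² - W)` is homotopic to one of order one, whose coefficients
satisfy the equations of an endomorphism of `(g ∂)² - W`. -/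
theorem exists_endo_reduction (hg : g ≠ 0) {U Ui W : FunMatrix n} (hU : Ui * U = 1)
    {T T' : OpMatrix n} (hT : IsDiffOpMatrix T) (hT' : IsDiffOpMatrix T')
    (h : MM U * tri g W * T = T' * (MM U * tri g W)) :
    ∃ (u v : FunMatrix n) (k : OpMatrix n), IsDiffOpMatrix k ∧
      T = op1 g u v + k * (MM U * tri g W) ∧
      T' = MM U * op1 g (u + 2 * dm g v) v * MM Ui + MM U * tri g W * k ∧
      2 * dm g u + dm g (dm g v) - W * v = -(v * W) ∧
      dm g (dm g u) - W * u = -((u + 2 * dm g v) * W + v * dm g W) := by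
  -- The quotient of T by D² - W supplies the homotopy, and the same homotopy is subtracted from T'.
  -- What remains is a morphism of first order, to which `endo_equations` applies.
  obtain ⟨Y, u, v, hY, hX⟩ := exists_div_op2 0 (-W) (hT.finOrd hg)
  rw [← tri] at hX
  have hM : MM Ui * MM U = 1 := by rw [← map_mul, hU, map_one]
  have hM' : MM U * MM Ui = 1 := by rw [← map_mul, mul_eq_one_comm.1 hU, map_one]
  have hk : IsDiffOpMatrix (Y * MM Ui) := isDiffOpMatrix_mul hY.isDiffOpMatrix (isDiffOpMatrix_MM _)
  have hYt : Y * MM Ui * (MM U * tri g W) = Y * tri g W := by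
    rw [mul_assoc, ← mul_assoc (MM Ui), hM, one_mul]
  have hE : IsDiffOpMatrix (MM U * tri g W) :=
    isDiffOpMatrix_mul (isDiffOpMatrix_MM _) (FinOrd.op2 (g := g) _ _).isDiffOpMatrix
  have hR : IsDiffOpMatrix (MM Ui * (T' + MM (-1) * (MM U * tri g W * (Y * MM Ui))) * MM U) :=
    isDiffOpMatrix_mul (isDiffOpMatrix_mul (isDiffOpMatrix_MM _) (isDiffOpMatrix_add hT'
      (isDiffOpMatrix_mul (isDiffOpMatrix_MM _) (isDiffOpMatrix_mul hE hk)))) (isDiffOpMatrix_MM _)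
  rw [map_neg, map_one, neg_one_mul, ← sub_eq_add_neg] at hR
  have e : tri g W * op1 g u v =
      MM Ui * (T' - MM U * tri g W * (Y * MM Ui)) * MM U * tri g W := by
    rw [mul_assoc _ (MM U), mul_assoc (MM Ui), sub_mul, ← h, mul_assoc (MM U * tri g W) (Y * MM Ui),
      hYt, ← mul_sub, hX, add_sub_cancel_right, ← mul_assoc, ← mul_assoc, hM, one_mul]
  obtain ⟨e1, e2, e3⟩ := endo_equations hg (hR.finOrd hg) e
  refine ⟨u, v, Y * MM Ui, hk, by rw [hYt, hX], ?_, e2, e3⟩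
  rw [← e1, ← mul_assoc, ← mul_assoc, ← mul_assoc, hM', one_mul, mul_assoc _ (MM U), hM', mul_one,
    mul_assoc (_ * _) Y, sub_add_cancel]

end

end

section

/-! ### The potential matrix of the triangular systems -/

/-- The `r⁻³` part of the couplings, relative to the diagonal constants. -/
def coupling₃ : (s : Sector) → Params → Matrix (Fin s.dim) (Fin s.dim) ℂ
  | .scalar, _ => 0
  | .vecOdd, _ => 0
  | .vecEven, p => !![0, 0, -(2 * p.M * p.B); 0, 0, 0; 0, 0, 0]
  | .lichOdd, p => !![0, 0, 2 * p.M * p.B / 3; 0, 0, 0; 0, 0, 0]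
  | .lichEven, p =>
    !![0, 0, -(2 * p.M * p.B), 0, 2 * p.M * p.B, 0, 0;
       0, 0, 0, 0, 0, -(10 / 3 * p.M * p.B), 0;
       0, 0, 0, 0, 0, 0, 2 * p.M * p.B;
       0, 0, 0, 0, 0, 0, 0;
       0, 0, 0, 0, 0, 0, -(2 * p.M * p.B);
       0, 0, 0, 0, 0, 0, 0;
       0, 0, 0, 0, 0, 0, 0]

/-- The `r⁻⁴` part of the couplings, relative to the diagonal constants. -/
def coupling₄ : (s : Sector) → Params → Matrix (Fin s.dim) (Fin s.dim) ℂ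
  | .scalar, _ => 0
  | .vecOdd, _ => 0
  | .vecEven, p => !![0, 0, -(2 * p.M ^ 2); 0, 0, 0; 0, 0, 0]
  | .lichOdd, _ => 0
  | .lichEven, p =>
    !![0, 0, -(2 * p.M ^ 2), 0, 2 * p.M ^ 2, 0, p.M ^ 2 * (7 * p.B + 2) / 2;
       0, 0, 0, 0, 0, 0, 0;
       0, 0, 0, 0, 0, 0, 2 * p.M ^ 2;
       0, 0, 0, 0, 0, 0, 0;
       0, 0, 0, 0, 0, 0, -(2 * p.M ^ 2);
       0, 0, 0, 0, 0, 0, 0;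
       0, 0, 0, 0, 0, 0, 0]

theorem coupling_eq (s : Sector) (p : Params) (i j : Fin s.dim) :
    coupling s p i j = con (diagConst s p i) *
      (con (coupling₃ s p i j) * r⁻¹ ^ 3 + con (coupling₄ s p i j) * r⁻¹ ^ 4) := by
  have hr := r_ne_zero
  cases s <;>
  simp only [coupling, vecEvenCoupling, lichOddCoupling, lichEvenCoupling, couplingX, diagConst,
    coupling₃, coupling₄, Params.f₁] <;>
  fin_cases i <;> fin_cases j <;>
  simp [con_div, con_neg, con_mul, con_pow, con_add, con_ofNat, -mul_eq_mul_left_iff,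
    -mul_eq_mul_right_iff, -mul_eq_zero, -zero_eq_mul] <;>
  field_simp <;> ring

theorem coupling₃_spin (s : Sector) (p : Params) {i j : Fin s.dim} :
    coupling₃ s p i j = 0 ∨ s.spin i = s.spin j ∧ i < j ∧ s.spin i ≠ 2 := by
  cases s <;> fin_cases i <;> fin_cases j <;>
  first | (right; decide) | (left; simp [coupling₃])

theorem coupling₄_spin (s : Sector) (p : Params) {i j : Fin s.dim} :
    coupling₄ s p i j = 0 ∨ s.spin i = 0 ∧ s.spin j = 0 ∧ i < j := by
  cases s <;> fin_cases i <;> fin_cases j <;>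
  first | (right; decide) | (left; simp [coupling₄])

/-- The potential matrix of `Ẽ`, in the normalization `(f ∂)² - W`. -/
def potential (s : Sector) (p : Params) : FunMatrix s.dim :=
  Matrix.diagonal (fun i => modePot p (s.spin i)) - Matrix.of fun i j =>
    p.f * (con (coupling₃ s p i j) * r⁻¹ ^ 3 + con (coupling₄ s p i j) * r⁻¹ ^ 4)

theorem RW_eq_modePot (p : Params) (s : ℕ) :
    RW p s = mul p.f⁻¹ * ((mul p.f * D) ^ 2 - mul (modePot p s)) := by
  have hf := p.f_ne_zero
  have hr := r_ne_zero
  have h1 : p.f₁ = con (2 * p.M) * r⁻¹ := by rw [Params.f₁, div_eq_mul_inv]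
  ext x
  simp only [RW, pow_two, LinearMap.add_apply, LinearMap.sub_apply, Module.End.mul_apply,
    mul_apply', D_apply, modePot, h1, con_mul]
  field_simp
  ring

theorem rwSystem_eq_tri (s : Sector) (p : Params) :
    rwSystem s p = MM (Matrix.diagonal fun i => con (diagConst s p i) / p.f) *
      tri p.f (potential s p) := by
  have hf := p.f_ne_zero
  ext1 i j
  rw [rwSystem_apply, coupling_eq, MM_eq_map, Matrix.diagonal_map mul_zero', Matrix.diagonal_mul]
  rw [tri, op2, map_zero, zero_mul, add_zero, Matrix.add_apply, MM_apply, DD, ← map_pow,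
    Matrix.scalar_apply, Matrix.diagonal_apply, Matrix.neg_apply, potential, Matrix.sub_apply,
    Matrix.diagonal_apply, Matrix.of_apply, neg_sub]
  generalize con (coupling₃ s p i j) * r⁻¹ ^ 3 + con (coupling₄ s p i j) * r⁻¹ ^ 4 = z
  by_cases h : i = j
  · rw [if_pos h, if_pos h, if_pos h, RW_eq_modePot]
    ext x
    simp only [LinearMap.add_apply, LinearMap.sub_apply, Module.End.mul_apply, mul_apply',
      LinearMap.smul_apply, RatFunc.smul_eq_C_mul]
    rw [← con]
    field_simp
    ring
  · rw [if_neg h, if_neg h, if_neg h, zero_add, zero_add, sub_zero]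
    ext x
    simp only [Module.End.mul_apply, mul_apply']
    field_simp

theorem diagConst_spin (s : Sector) (p : Params) {i j : Fin s.dim} (h : s.spin i = s.spin j) :
    diagConst s p i = diagConst s p j := by
  cases s <;> fin_cases i <;> fin_cases j <;>
  first | rfl | (exfalso; revert h; decide)

theorem modePot_sub (p : Params) (s s' : ℕ) : modePot p s - modePot p s' =
    p.f * (con (2 * p.M * ((s' : ℂ) ^ 2 - (s : ℂ) ^ 2)) * r⁻¹ ^ 3) := by
  simp only [modePot, con_mul, con_sub]
  ring

/-- A constant matrix, as a matrix of rational functions. -/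
def conMat {n : ℕ} (C : Matrix (Fin n) (Fin n) ℂ) : FunMatrix n := C.map con

theorem constOp_eq {n : ℕ} (C : Matrix (Fin n) (Fin n) ℂ) : constOp C = MM (conMat C) := rfl

theorem dm_conMat {n : ℕ} (g : RatFun) (C : Matrix (Fin n) (Fin n) ℂ) : dm g (conMat C) = 0 := by
  ext i j
  rw [dm_apply, conMat, Matrix.map_apply, der_con, mul_zero, Matrix.zero_apply]

theorem conMat_mul {n : ℕ} (A C : Matrix (Fin n) (Fin n) ℂ) :
    conMat (A * C) = conMat A * conMat C := Matrix.map_mul (f := RatFunc.C (K := ℂ))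

theorem diagonal_conMat {s : Sector} {C : Matrix (Fin s.dim) (Fin s.dim) ℂ}
    (hC : ∀ i j, s.spin i ≠ s.spin j → C i j = 0) {w : Fin s.dim → RatFun}
    (hw : ∀ i j, s.spin i = s.spin j → w i = w j) :
    Matrix.diagonal w * conMat C = conMat C * Matrix.diagonal w := by
  ext i j
  rw [Matrix.diagonal_mul, Matrix.mul_diagonal]
  by_cases h : s.spin i = s.spin j
  · rw [hw i j h, mul_comm]
  · rw [conMat, Matrix.map_apply, hC i j h, con_zero, mul_zero, zero_mul]

theorem potential_eq (s : Sector) (p : Params) : potential s p =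
    Matrix.diagonal (fun i => modePot p (s.spin i)) - ((p.f * r⁻¹ ^ 3) • conMat (coupling₃ s p) +
      (p.f * r⁻¹ ^ 4) • conMat (coupling₄ s p)) := by
  ext i j
  simp only [potential, conMat, Matrix.sub_apply, Matrix.of_apply, Matrix.add_apply,
    Matrix.smul_apply, Matrix.map_apply, smul_eq_mul]
  ring

/-- A constant matrix which is block diagonal with respect to the spin and commutes with the
couplings commutes with the triangular system. -/
theorem rwSystem_comm {s : Sector} (p : Params) {C : Matrix (Fin s.dim) (Fin s.dim) ℂ}
    (hC : ∀ i j, s.spin i ≠ s.spin j → C i j = 0) (h₃ : C * coupling₃ s p = coupling₃ s p * C)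
    (h₄ : C * coupling₄ s p = coupling₄ s p * C) :
    rwSystem s p * constOp C = constOp C * rwSystem s p := by
  have hW : conMat C * potential s p = potential s p * conMat C := by
    rw [potential_eq, mul_sub, sub_mul, mul_add, add_mul, Matrix.mul_smul, Matrix.mul_smul,
      Matrix.smul_mul, Matrix.smul_mul, ← conMat_mul, ← conMat_mul, ← conMat_mul, ← conMat_mul, h₃,
      h₄, diagonal_conMat hC fun i j h => by rw [h]]
  rw [rwSystem_eq_tri, constOp_eq, mul_assoc, Hat.tri_comm (dm_conMat _ _) hW, ← mul_assoc,
    ← map_mul, diagonal_conMat hC fun i j h => by rw [diagConst_spin s p h], map_mul, mul_assoc]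

end

section

/-! ### Rational automorphisms of the triangular systems -/

theorem IsNonResonant.M_ne_zero {s : Sector} {p : Params} (hp : IsNonResonant s p) : p.M ≠ 0 := by
  obtain ⟨⟨m, hm, e⟩, -, -⟩ := hp
  rw [e]; exact_mod_cast hm.ne'

theorem IsNonResonant.ω_ne_zero {s : Sector} {p : Params} (hp : IsNonResonant s p) : p.ω ≠ 0 :=
  fun h => hp.2.2 0 (by rw [h]; simp)

theorem dvd_factorial_four (l : ℕ) : 24 ∣ (l + 1) * (l + 2) * (l + 3) * (l + 4) := by
  have h := Nat.factorial_dvd_ascFactorial (l + 1) 4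
  simp only [Nat.ascFactorial, Nat.factorial] at h
  convert h using 1
  ring

theorem IsNonResonant.B_ne_zero {s : Sector} {p : Params} (hp : IsNonResonant s p)
    (hs : 1 ≤ s.minL) : p.B ≠ 0 := by
  obtain ⟨-, ⟨l, hl, e⟩, -⟩ := hp
  rw [e]
  have : l * (l + 1) ≠ 0 := mul_ne_zero (by omega) (by omega)
  exact_mod_cast this

/-- For 𝓑 = l(l+1) one has 𝓐 = (l-1)l(l+1)(l+2), a product of four consecutive integers. -/
theorem IsNonResonant.A_eq {s : Sector} {p : Params} (hp : IsNonResonant s p)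
    (hs : 2 ≤ s.minL) : ∃ k : ℕ, k ≠ 0 ∧ p.A = 24 * k := by
  obtain ⟨-, ⟨l, hl, e⟩, -⟩ := hp
  obtain ⟨j, rfl⟩ := Nat.exists_eq_add_of_le (hs.trans hl)
  obtain ⟨k, hk⟩ := dvd_factorial_four j
  refine ⟨k, fun h => ?_, ?_⟩
  · rw [h, mul_zero] at hk
    simp at hk
  · have : (((j + 1) * (j + 2) * (j + 3) * (j + 4) : ℕ) : ℂ) = (24 * k : ℕ) := by rw [hk]
    push_cast at this
    rw [Params.A, e, ← this]
    push_cast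
    ring

/-- The point is α ≠ 0: otherwise 4iMω = ±𝓐/3, which is an integer because 24 divides 𝓐. The
algebraically special frequencies are thus resonant. -/
theorem IsNonResonant.regular {s : Sector} {p : Params} (hp : IsNonResonant s p) : s.regular p := by
  have hω := hp.ω_ne_zero
  have hA : 2 ≤ s.minL → p.B * (p.B - 2) ≠ 0 := fun hs => by
    obtain ⟨k, hk, e⟩ := hp.A_eq hs
    rw [← Params.A, e]
    exact_mod_cast mul_ne_zero (by norm_num : 24 ≠ 0) hk
  have hB := hp.B_ne_zero
  have hα : 2 ≤ s.minL → p.α ≠ 0 := fun hs h => by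
    obtain ⟨k, hk, e⟩ := hp.A_eq hs
    have h1 : (4 * Complex.I * p.M * p.ω - 8 * k) * (4 * Complex.I * p.M * p.ω + 8 * k) = 0 := by
      rw [Params.α, e] at h
      linear_combination -h / 9 + 16 * p.M ^ 2 * p.ω ^ 2 * Complex.I_sq
    rcases mul_eq_zero.1 h1 with h2 | h2
    · exact hp.2.2 (8 * k) (by push_cast; linear_combination h2)
    · exact hp.2.2 (-(8 * k)) (by push_cast; linear_combination h2)
  cases s
  · exact mul_ne_zero hω one_ne_zero
  · exact mul_ne_zero hω (hB le_rfl)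
  · exact mul_ne_zero hω (hB le_rfl)
  · exact mul_ne_zero hω (hA le_rfl)
  · exact mul_ne_zero (mul_ne_zero hω (hA le_rfl)) (hα le_rfl)

theorem Sector.spin_le : (s : Sector) → ∀ i, s.spin i ≤ 2
  | .scalar => by decide
  | .vecOdd => by decide
  | .vecEven => by decide
  | .lichOdd => by decide
  | .lichEven => by decide

theorem Sector.minL_of_spin : (s : Sector) → ∀ i, s.spin i ≠ 0 → 1 ≤ s.minL
  | .scalar => by decide
  | .vecOdd => by decide
  | .vecEven => by decide
  | .lichOdd => by decide
  | .lichEven => by decide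

/-- Two spins of sum at least 2 have squares of sum at least 2. One of them is nonzero, hence l ≥ 1
and 𝓑 > 0. -/
theorem IsNonResonant.spin_condition {s : Sector} {p : Params} (hp : IsNonResonant s p)
    (i j : Fin s.dim) (h : 2 ≤ s.spin i + s.spin j) :
    (s.spin i : ℂ) ^ 2 + (s.spin j : ℂ) ^ 2 - 2 + 2 * p.B ≠ 0 := by
  obtain ⟨-, ⟨l, hl, e⟩, -⟩ := hp
  have hl1 : 1 ≤ l := by
    refine le_trans ?_ hl
    by_cases h0 : s.spin i = 0
    · exact s.minL_of_spin j (by omega)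
    · exact s.minL_of_spin i h0
  have h2 : 2 ≤ s.spin i ^ 2 + s.spin j ^ 2 := by nlinarith [sq_nonneg ((s.spin i : ℤ) - s.spin j)]
  obtain ⟨k, hk⟩ := Nat.exists_eq_add_of_le h2
  have hk' : (s.spin i : ℂ) ^ 2 + (s.spin j : ℂ) ^ 2 = 2 + k := by exact_mod_cast hk
  rw [hk', e]
  have h3 : k + 2 * (l * (l + 1)) ≠ 0 := by
    have : 0 < l * (l + 1) := by positivity
    omega
  have h4 : (2 + k - 2 + 2 * (l * (l + 1)) : ℂ) = (k + 2 * (l * (l + 1)) : ℕ) := by push_cast; ring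
  rw [h4]
  exact_mod_cast h3

/-- As the couplings are strictly upper triangular, the equations at (i, j) involve other entries
only from row i to the left of j and from column j below i. Proceeding from the lower left corner,
those are already known to be constants with v = 0, and they enter as a source made from the
commutators of C with the two coupling matrices. Thus `ModeEq.classify` applies at each place, and
its conclusion that the source vanishes is the commutation relation. -/
theorem endo_classification {s : Sector} {p : Params} (hp : IsNonResonant s p)
    {u v : FunMatrix s.dim}
    (h₁ : 2 * dm p.f u + dm p.f (dm p.f v) - potential s p * v = -(v * potential s p))
    (h₀ : dm p.f (dm p.f u) - potential s p * u =
      -((u + 2 * dm p.f v) * potential s p + v * dm p.f (potential s p))) :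
    v = 0 ∧ ∃ C : Matrix (Fin s.dim) (Fin s.dim) ℂ, u = conMat C ∧
      (∀ i j, s.spin i ≠ s.spin j → C i j = 0) ∧ C * coupling₃ s p = coupling₃ s p * C ∧
      C * coupling₄ s p = coupling₄ s p * C := by
  classical
  -- The matrix is fixed before its entries are known to exist: an entry of u not yet known to be
  -- constant gets the default value 0.
  obtain ⟨C, hC⟩ : ∃ C : Matrix (Fin s.dim) (Fin s.dim) ℂ, ∀ i j c, u i j = con c → C i j = c :=
    ⟨Matrix.of fun i j => if h : ∃ c, u i j = con c then h.choose else 0, fun i j c hc => by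
      have h : ∃ c, u i j = con c := ⟨c, hc⟩
      rw [Matrix.of_apply, dif_pos h]
      exact con_inj.1 (h.choose_spec.symm.trans hc)⟩
  set F : FunMatrix s.dim := Matrix.of fun i j =>
    p.f * (con (coupling₃ s p i j) * r⁻¹ ^ 3 + con (coupling₄ s p i j) * r⁻¹ ^ 4) with hF
  set w : Fin s.dim → RatFun := fun i => modePot p (s.spin i) with hw
  have hP : potential s p = Matrix.diagonal w - F := rfl
  have hF0 : ∀ i j, j ≤ i → F i j = 0 := fun i j hij => by
    have e₃ := (coupling₃_spin s p (i := i) (j := j)).resolve_right fun h => absurd h.2.1 (not_lt.2 hij)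
    have e₄ := (coupling₄_spin s p (i := i) (j := j)).resolve_right fun h => absurd h.2.2 (not_lt.2 hij)
    simp [hF, e₃, e₄]
  have hdw : dm p.f (Matrix.diagonal w - F) = Matrix.diagonal (fun i => p.f * der (w i)) - dm p.f F := by
    rw [dm_sub]
    congr 1
    ext i j
    by_cases h : i = j
    · subst h; rw [dm_apply, Matrix.diagonal_apply_eq, Matrix.diagonal_apply_eq]
    · rw [dm_apply, Matrix.diagonal_apply_ne _ h, Matrix.diagonal_apply_ne _ h, map_zero, mul_zero]
  have hdF0 : ∀ i j, j ≤ i → dm p.f F i j = 0 := fun i j hij => by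
    rw [dm_apply, hF0 i j hij, map_zero, mul_zero]
  rw [hP, sub_mul, mul_sub] at h₁
  rw [hP, hdw, sub_mul, mul_sub, mul_sub] at h₀
  -- The shift by the dimension turns j - i into a natural number that is at least 1, so the case N
  -- = 0 is empty.
  have key : ∀ N : ℕ, ∀ i j : Fin s.dim, s.dim + j - i ≤ N → v i j = 0 ∧ u i j = con (C i j) ∧
      (s.spin i ≠ s.spin j → C i j = 0) ∧ (C * coupling₃ s p) i j = (coupling₃ s p * C) i j ∧
      (C * coupling₄ s p) i j = (coupling₄ s p * C) i j := by
    intro N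
    induction N with
    | zero => intro i j h; omega
    | succ N ih =>
      intro i j hN
      have row : ∀ k, k < j → v i k = 0 ∧ u i k = con (C i k) ∧ (s.spin i ≠ s.spin k → C i k = 0) :=
        fun k hk => by
          obtain ⟨a, b, c, -, -⟩ := ih i k (by omega)
          exact ⟨a, b, c⟩
      have col : ∀ k, i < k → v k j = 0 ∧ u k j = con (C k j) ∧ (s.spin k ≠ s.spin j → C k j = 0) :=
        fun k hk => by
          obtain ⟨a, b, c, -, -⟩ := ih k j (by omega)
          exact ⟨a, b, c⟩
      have vF : (v * F) i j = 0 := by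
        rw [Matrix.mul_apply]
        refine Finset.sum_eq_zero fun k _ => ?_
        rcases lt_or_ge k j with hk | hk
        · rw [(row k hk).1, zero_mul]
        · rw [hF0 k j hk, mul_zero]
      have dvF : (dm p.f v * F) i j = 0 := by
        rw [Matrix.mul_apply]
        refine Finset.sum_eq_zero fun k _ => ?_
        rcases lt_or_ge k j with hk | hk
        · rw [dm_apply, (row k hk).1, map_zero, mul_zero, zero_mul]
        · rw [hF0 k j hk, mul_zero]
      have vdF : (v * dm p.f F) i j = 0 := by
        rw [Matrix.mul_apply]
        refine Finset.sum_eq_zero fun k _ => ?_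
        rcases lt_or_ge k j with hk | hk
        · rw [(row k hk).1, zero_mul]
        · rw [hdF0 k j hk, mul_zero]
      have Fv : (F * v) i j = 0 := by
        rw [Matrix.mul_apply]
        refine Finset.sum_eq_zero fun k _ => ?_
        rcases lt_or_ge i k with hk | hk
        · rw [(col k hk).1, mul_zero]
        · rw [hF0 i k hk, zero_mul]
      have uF : (u * F) i j = p.f * (con ((C * coupling₃ s p) i j) * r⁻¹ ^ 3 +
          con ((C * coupling₄ s p) i j) * r⁻¹ ^ 4) := by
        have : (u * F) i j = (conMat C * F) i j := by
          rw [Matrix.mul_apply, Matrix.mul_apply]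
          refine Finset.sum_congr rfl fun k _ => ?_
          rcases lt_or_ge k j with hk | hk
          · rw [(row k hk).2.1]; rfl
          · rw [hF0 k j hk, mul_zero, mul_zero]
        rw [this, Matrix.mul_apply, Matrix.mul_apply, Matrix.mul_apply, con, con, map_sum, map_sum,
          Finset.sum_mul, Finset.sum_mul, ← Finset.sum_add_distrib, Finset.mul_sum]
        refine Finset.sum_congr rfl fun k _ => ?_
        rw [hF, Matrix.of_apply, map_mul, map_mul, conMat, Matrix.map_apply]
        simp only [con]
        ring
      have Fu : (F * u) i j = p.f * (con ((coupling₃ s p * C) i j) * r⁻¹ ^ 3 +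
          con ((coupling₄ s p * C) i j) * r⁻¹ ^ 4) := by
        have : (F * u) i j = (F * conMat C) i j := by
          rw [Matrix.mul_apply, Matrix.mul_apply]
          refine Finset.sum_congr rfl fun k _ => ?_
          rcases lt_or_ge i k with hk | hk
          · rw [(col k hk).2.1]; rfl
          · rw [hF0 i k hk, zero_mul, zero_mul]
        rw [this, Matrix.mul_apply, Matrix.mul_apply, Matrix.mul_apply, con, con, map_sum, map_sum,
          Finset.sum_mul, Finset.sum_mul, ← Finset.sum_add_distrib, Finset.mul_sum]
        refine Finset.sum_congr rfl fun k _ => ?_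
        rw [hF, Matrix.of_apply, map_mul, map_mul, conMat, Matrix.map_apply]
        simp only [con]
        ring
      have e₁ := congrFun (congrFun h₁ i) j
      have e₀ := congrFun (congrFun h₀ i) j
      simp only [Matrix.sub_apply, Matrix.add_apply, Matrix.neg_apply, add_mul, two_mul, vF, Fv, dvF,
        vdF, uF, Fu, Matrix.diagonal_mul, Matrix.mul_diagonal, dm_apply] at e₁ e₀
      have hsub := modePot_sub p (s.spin i) (s.spin j)
      change w i - w j = _ at hsub
      have hdw : modePot p (s.spin j) = w j := rfl
      have mode : ModeEq p (s.spin i) (s.spin j) (u i j) (v i j)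
          ((C * coupling₃ s p) i j - (coupling₃ s p * C) i j)
          ((C * coupling₄ s p) i j - (coupling₄ s p * C) i j) := by
        constructor
        · rw [← hsub, con_ofNat]
          linear_combination e₁
        · rw [← hsub, con_ofNat, hdw, con_sub, con_sub]
          linear_combination e₀
      -- The couplings join equal spins other than 2. In these cases every term therefore contains
      -- either a zero coupling or an earlier entry of C between different spins, already known to
      -- vanish.
      have comm₃ : s.spin i ≠ s.spin j ∨ s.spin i = 2 →
          (C * coupling₃ s p) i j = 0 ∧ (coupling₃ s p * C) i j = 0 := fun h => by
        rw [Matrix.mul_apply, Matrix.mul_apply]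
        constructor <;> refine Finset.sum_eq_zero fun k _ => ?_
        · rcases coupling₃_spin s p (i := k) (j := j) with h0 | ⟨hk, hlt, h2⟩
          · rw [h0, mul_zero]
          · rw [(row k hlt).2.2 (by omega), zero_mul]
        · rcases coupling₃_spin s p (i := i) (j := k) with h0 | ⟨hk, hlt, h2⟩
          · rw [h0, zero_mul]
          · rw [(col k hlt).2.2 (by omega), mul_zero]
      have comm₄ : 2 ≤ s.spin i + s.spin j →
          (C * coupling₄ s p) i j = 0 ∧ (coupling₄ s p * C) i j = 0 := fun h => by
        rw [Matrix.mul_apply, Matrix.mul_apply]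
        constructor <;> refine Finset.sum_eq_zero fun k _ => ?_
        · rcases coupling₄_spin s p (i := k) (j := j) with h0 | ⟨hk, hk', hlt⟩
          · rw [h0, mul_zero]
          · rw [(row k hlt).2.2 (by omega), zero_mul]
        · rcases coupling₄_spin s p (i := i) (j := k) with h0 | ⟨hk, hk', hlt⟩
          · rw [h0, zero_mul]
          · rw [(col k hlt).2.2 (by omega), mul_zero]
      obtain ⟨hv, h3, h4, c, hu, hc⟩ := mode.classify hp.M_ne_zero hp.2.2 (s.spin_le i) (s.spin_le j)
        (hp.spin_condition i j) (fun h => by rw [(comm₃ h).1, (comm₃ h).2, sub_zero])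
        (fun h => by rw [(comm₄ h).1, (comm₄ h).2, sub_zero])
      have hCc := hC i j c hu
      exact ⟨hv, by rw [hCc, hu], fun h => by rw [hCc, hc h], sub_eq_zero.1 h3, sub_eq_zero.1 h4⟩
  have key' := fun i j => key _ i j le_rfl
  refine ⟨?_, C, ?_, fun i j => (key' i j).2.2.1, ?_, ?_⟩ <;> ext i j
  · exact (key' i j).1
  · exact (key' i j).2.1
  · exact (key' i j).2.2.2.1
  · exact (key' i j).2.2.2.2

/-- The rational automorphisms of the triangular systems are constant up to homotopy. -/
theorem automorphism_classification {s : Sector} {p : Params} (hp : IsNonResonant s p)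
    {T T' : OpMatrix s.dim} (hT : IsDiffOpMatrix T) (hT' : IsDiffOpMatrix T')
    (h : rwSystem s p * T = T' * rwSystem s p) :
    ∃ (C : Matrix (Fin s.dim) (Fin s.dim) ℂ) (k : OpMatrix s.dim), IsDiffOpMatrix k ∧
      T = constOp C + k * rwSystem s p ∧ T' = constOp C + rwSystem s p * k ∧
      (∀ i j, s.spin i ≠ s.spin j → C i j = 0) ∧ C * coupling₃ s p = coupling₃ s p * C ∧
      C * coupling₄ s p = coupling₄ s p * C := by
  have hf := p.f_ne_zero
  set d : Fin s.dim → RatFun := fun i => con (diagConst s p i) / p.f with hd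
  have hd0 : ∀ i, d i ≠ 0 := fun i =>
    div_ne_zero (con_ne_zero (diagConst_ne_zero s hp.regular i)) hf
  have hU : Matrix.diagonal (fun i => (d i)⁻¹) * Matrix.diagonal d = 1 := by
    rw [Matrix.diagonal_mul_diagonal, ← Matrix.diagonal_one]
    congr 1
    ext1 i
    exact inv_mul_cancel₀ (hd0 i)
  rw [rwSystem_eq_tri] at h ⊢
  obtain ⟨u, v, k, hk, e, e', h₁, h₀⟩ := exists_endo_reduction hf hU hT hT' h
  obtain ⟨rfl, C, rfl, hC, h₃, h₄⟩ := endo_classification hp h₁ h₀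
  refine ⟨C, k, hk, ?_, ?_, hC, h₃, h₄⟩
  · rw [e, op1, map_zero, zero_mul, add_zero, constOp_eq]
  · rw [e', op1, map_zero, zero_mul, add_zero, dm_zero, mul_zero, add_zero, constOp_eq, ← map_mul,
      diagonal_conMat hC fun i j h => by simp only [hd, diagConst_spin s p h], map_mul,
      mul_assoc (MM (conMat C)),
      ← map_mul, mul_eq_one_comm.1 hU, map_one, mul_one]

end

section

/-! ### The order of the components by spin -/

/-- The order of the components in which the triangular system is block diagonal. -/
def Sector.order : (s : Sector) → Equiv.Perm (Fin s.dim)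
  | .scalar => 1
  | .vecOdd => 1
  | .vecEven => ⟨![0, 2, 1], ![0, 2, 1], by decide, by decide⟩
  | .lichOdd => ⟨![0, 2, 1], ![0, 2, 1], by decide, by decide⟩
  | .lichEven => ⟨![0, 2, 4, 6, 1, 5, 3], ![0, 4, 1, 6, 2, 5, 3], by decide, by decide⟩

theorem Sector.order_mono : (s : Sector) → ∀ i j, i ≤ j → s.spin (s.order i) ≤ s.spin (s.order j)
  | .scalar => by decide
  | .vecOdd => by decide
  | .vecEven => by decide
  | .lichOdd => by decide
  | .lichEven => by decide

theorem Sector.order_lt : (s : Sector) → ∀ i j, j < i →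
    s.spin (s.order i) ≠ s.spin (s.order j) ∨ s.order j < s.order i
  | .scalar => by decide
  | .vecOdd => by decide
  | .vecEven => by decide
  | .lichOdd => by decide
  | .lichEven => by decide

theorem rwSystem_order_lower (s : Sector) (p : Params) {i j : Fin s.dim} (h : j < i) :
    rwSystem s p (s.order i) (s.order j) = 0 := by
  rcases s.order_lt i j h with h | h
  · exact rwSystem_spin s p h
  · exact rwSystem_lower s p h

theorem vecEven_order : ∀ i j : Fin 3, j < i →
    Sector.spin .vecEven (Sector.order .vecEven i) = Sector.spin .vecEven (Sector.order .vecEven j) →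
    Sector.order .vecEven i = 2 ∧ Sector.order .vecEven j = 0 := by decide

theorem lichOdd_order : ∀ i j : Fin 3, j < i →
    Sector.spin .lichOdd (Sector.order .lichOdd i) = Sector.spin .lichOdd (Sector.order .lichOdd j) →
    Sector.order .lichOdd i = 2 ∧ Sector.order .lichOdd j = 0 := by decide

theorem lichEven_order : ∀ i j : Fin 7, j < i → Sector.spin .lichEven (Sector.order .lichEven i) ≠ 0 →
    Sector.spin .lichEven (Sector.order .lichEven i) =
      Sector.spin .lichEven (Sector.order .lichEven j) →
    Sector.order .lichEven i = 5 ∧ Sector.order .lichEven j = 1 := by decide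

/-- Each block in question has at most two components, say a < b, joined by a single coupling K_ab,
which is nonzero as M and 𝓑 are. The diagonal entry (b, b) of CK = KC reads C_ba K_ab = 0. -/
theorem commutant_upper {s : Sector} {p : Params} (hM : p.M ≠ 0) (hp : s.regular p)
    {C : Matrix (Fin s.dim) (Fin s.dim) ℂ} (hC : ∀ i j, s.spin i ≠ s.spin j → C i j = 0)
    (h : C * coupling₃ s p = coupling₃ s p * C) {i j : Fin s.dim} (hij : j < i)
    (hs : ¬ (s = Sector.lichEven ∧ s.spin (s.order i) = 0)) : C (s.order i) (s.order j) = 0 := by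
  by_cases hspin : s.spin (s.order i) = s.spin (s.order j)
  swap
  · exact hC _ _ hspin
  cases s with
  | scalar => exact absurd (Subsingleton.elim (α := Fin 1) j i) hij.ne
  | vecOdd => exact absurd (Subsingleton.elim (α := Fin 1) j i) hij.ne
  | vecEven =>
    obtain ⟨e, e'⟩ := vecEven_order i j hij hspin
    rw [e, e']
    have hB : p.B ≠ 0 := right_ne_zero_of_mul hp
    have h22 := congrFun (congrFun h (2 : Fin 3)) (2 : Fin 3)
    simpa [coupling₃, Matrix.mul_apply, Fin.sum_univ_succ, hM, hB] using h22
  | lichOdd =>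
    obtain ⟨e, e'⟩ := lichOdd_order i j hij hspin
    rw [e, e']
    have hB : p.B ≠ 0 := left_ne_zero_of_mul (right_ne_zero_of_mul hp)
    have h22 := congrFun (congrFun h (2 : Fin 3)) (2 : Fin 3)
    simpa [coupling₃, Matrix.mul_apply, Fin.sum_univ_succ, hM, hB] using h22
  | lichEven =>
    obtain ⟨e, e'⟩ := lichEven_order i j hij (fun h0 => hs ⟨rfl, h0⟩) hspin
    rw [e, e']
    have hB : p.B ≠ 0 := left_ne_zero_of_mul (right_ne_zero_of_mul (left_ne_zero_of_mul hp))
    have h55 := congrFun (congrFun h (5 : Fin 7)) (5 : Fin 7)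
    rw [Matrix.mul_apply, Matrix.mul_apply] at h55
    simpa [coupling₃, Fin.sum_univ_seven, hM, hB] using h55

/-- A constant matrix which mixes the two middle scalar components of the even Lichnerowicz
system. -/
def scalarMixing : Matrix (Fin 7) (Fin 7) ℂ :=
  !![0, 0, 0, 0, 0, 0, 0;
     0, 0, 0, 0, 0, 0, 0;
     0, 0, 1, 0, 1, 0, 0;
     0, 0, 0, 0, 0, 0, 0;
     0, 0, 1, 0, 1, 0, 0;
     0, 0, 0, 0, 0, 0, 0;
     0, 0, 0, 0, 0, 0, 0]

theorem scalarMixing_spin (i j : Fin 7) (h : Sector.spin .lichEven i ≠ Sector.spin .lichEven j) :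
    scalarMixing i j = 0 := by
  fin_cases i <;> fin_cases j <;> first | (exfalso; revert h; decide) | simp [scalarMixing]

/-- Components 2 and 4, counted from 0, couple to components 0 and 6 with opposite signs. Their
symmetric mixing is therefore annihilated by the couplings from both sides. -/
theorem scalarMixing_comm (p : Params) :
    rwSystem .lichEven p * constOp scalarMixing = constOp scalarMixing * rwSystem .lichEven p := by
  refine rwSystem_comm (s := .lichEven) p scalarMixing_spin ?_ ?_ <;>
  · ext i j
    rw [Matrix.mul_apply, Matrix.mul_apply, Fin.sum_univ_seven, Fin.sum_univ_seven]
    fin_cases i <;> fin_cases j <;> simp [scalarMixing, coupling₃, coupling₄]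

end

end Schw

end

theorem theorem2p1 (s : Sector) :
    -- `E` is a rational ODE, polynomial in `M`, `ω`, `𝓑_l`, singular only at `0`, `2M`, `∞`
    (∃ c, HasCoeffs (fun _ => True) 2 (waveOp s) c ∧
      (∀ m i j, IsRationalFamily (fun _ => True) radialDen (c m i j)) ∧
      ∀ p, s.angular p ≠ 0 → ∀ z : ℂ, z ≠ 0 → z ≠ 2 * p.M →
        (Matrix.of fun i j => evalAt z (c 2 i j p)).det ≠ 0) ∧
    -- `Ẽ` is rational and upper triangular with Regge–Wheeler operators on the diagonal
    IsRationalOpFamily s.regular (fun p => radialDen p * con (s.polar p)) 2 (rwSystem s) ∧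
    (∀ p, s.regular p → ∀ i j, j < i → rwSystem s p i j = 0) ∧
    (∀ p, s.regular p → ∀ i, diagConst s p i ≠ 0 ∧
      rwSystem s p i i = diagConst s p i • RW p (s.spin i)) ∧
    (∃ a : Params → Arrows s.dim,
      -- the equivalence diagram, of first order operators, and its poles
      (∀ p, s.regular p → IsEquivalence (waveOp s p) (rwSystem s p) (a p)) ∧
      IsRationalArrowFamily s.regular (fun p => radialDen p * con (s.polar p)) a ∧
      -- the exceptional sector: both algebraically special frequencies are poles, and they
      -- are removed by the Chandrasekhar transformation to the Zerilli operator
      (s = Sector.lichEven →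
        (∀ ε : ℂ, ε = 1 ∨ ε = -1 →
          ¬ IsRationalArrowFamily s.regular (fun p => radialDen p *
            con (p.ω * (p.B * (p.B - 2)) * (12 * p.M * p.ω + ε * Complex.I * p.A))) a) ∧
        ∃ b : Params → Arrows s.dim,
          (∀ p, zerilliRegular p → IsEquivalence (waveOp s p) (zerilliSystem s p) (b p)) ∧
          IsRationalArrowFamily zerilliRegular (fun p => radialDen p *
            con (p.ω * (p.B * (p.B - 2))) * (con (p.B - 2) * r + con (6 * p.M))) b ∧
          ¬ IsRationalArrowFamily zerilliRegular (fun p => radialDen p *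
            con (p.ω * (p.B * (p.B - 2)))) b ∧
          ∀ p, s.regular p → ∃ g g' : OpMatrix s.dim, IsDiffOpMatrix g ∧ IsDiffOpMatrix g' ∧
            (b p).kbar = (a p).kbar * onSpinTwo s ((1 / p.α) • chandra p (-1)) +
              g * zerilliSystem s p ∧
            (b p).k = onSpinTwo s (chandra p 1) * (a p).k + g' * waveOp s p) ∧
      -- the massless limit
      HasMasslessLimit (fun _ => True) 2 (waveOp s) ∧
      HasMasslessLimit s.regular 2 (rwSystem s) ∧
      HasMasslessLimit s.regular 1 (fun p => (a p).k) ∧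
      HasMasslessLimit s.regular 1 (fun p => (a p).k') ∧
      HasMasslessLimit s.regular 1 (fun p => (a p).kbar) ∧
      HasMasslessLimit s.regular 1 (fun p => (a p).kbar') ∧
      HasMasslessLimit s.regular 1 (fun p => (a p).h) ∧
      HasMasslessLimit s.regular 1 (fun p => (a p).htilde)) ∧
    (∀ p, s.regular p → p.M = 0 → ∀ i j, i ≠ j → rwSystem s p i j = 0) ∧
    -- the off-diagonal elements
    (∀ p, s.regular p → ∀ m : ℝ, 0 < m → p.M = m → ∀ i j, i ≠ j →
      ∃ Δ₀ Δ₁ : RatFun, rwSystem s p i j = mul (Δ₀ / p.f) + mul Δ₁ * D ∧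
        ∃ K : ℝ, ∀ x : ℝ, 2 * m < x → ‖evalAt x Δ₀‖ ≤ K ∧ ‖evalAt x Δ₁‖ ≤ K) ∧
    -- block form after a permutation, and the classification of rational automorphisms
    (∃ σ : Equiv.Perm (Fin s.dim),
      Monotone (fun i => s.spin (σ i)) ∧
      (∀ p, s.regular p → (∀ i j, j < i → rwSystem s p (σ i) (σ j) = 0) ∧
        ∀ i j, s.spin i ≠ s.spin j → rwSystem s p i j = 0) ∧
      (∀ p, IsNonResonant s p → ∀ T T' : OpMatrix s.dim, IsDiffOpMatrix T → IsDiffOpMatrix T' →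
        rwSystem s p * T = T' * rwSystem s p →
        ∃ (C : Matrix (Fin s.dim) (Fin s.dim) ℂ) (h : OpMatrix s.dim), IsDiffOpMatrix h ∧
          T = constOp C + h * rwSystem s p ∧ T' = constOp C + rwSystem s p * h ∧
          rwSystem s p * constOp C = constOp C * rwSystem s p ∧
          (∀ i j, s.spin i ≠ s.spin j → C i j = 0) ∧
          ∀ i j, j < i → ¬ (s = Sector.lichEven ∧ s.spin (σ i) = 0) → C (σ i) (σ j) = 0) ∧
      (s = Sector.lichEven → ∀ p, s.regular p → ∃ C : Matrix (Fin s.dim) (Fin s.dim) ℂ,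
        rwSystem s p * constOp C = constOp C * rwSystem s p ∧
        (∀ i j, s.spin i ≠ s.spin j → C i j = 0) ∧
        ∃ i j, j < i ∧ s.spin (σ i) = 0 ∧ C (σ i) (σ j) ≠ 0)) ∧
    -- twisted formal self-adjointness
    (∃ S : Matrix (Fin s.dim) (Fin s.dim) ℂ, S * S = 1 ∧ S.conjTranspose = S ∧
      ∀ p, s.regular p → p.IsReal → IsFormallySelfAdjoint (constOp S * rwSystem s p)) := by
  have hw := s.waveCoeff_spec
  have hr := s.rwSystem_rational
  have ha := s.arrows_rational
  refine ⟨⟨s.waveCoeff, hw.1, hw.2, fun p hp z hz hz' => s.waveCoeff_det hp hz hz'⟩, hr,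
    fun p _ i j h => rwSystem_lower s p h,
    fun p hp i => ⟨diagConst_ne_zero s hp i, rwSystem_diag s p i⟩,
    ⟨s.arrows, fun p hp => s.isEquivalence hp, ha, ?_, massless_of_radialDen ⟨_, hw⟩, s.massless hr,
      s.massless ha.1, s.massless ha.2.1, s.massless ha.2.2.1, s.massless ha.2.2.2.1,
      s.massless ha.2.2.2.2.1, s.massless ha.2.2.2.2.2⟩,
    fun p _ hM i j h => by rw [rwSystem_of_ne s p h, coupling_massless s hM, mul_zero'],
    fun p _ m hm _ i j h => rwSystem_offdiag s p hm h,
    ⟨s.order, fun i j h => s.order_mono i j h,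
      fun p _ => ⟨fun i j h => rwSystem_order_lower s p h, fun i j h => rwSystem_spin s p h⟩,
      fun p hp T T' hT hT' h => ?_, ?_⟩,
    ⟨revMat s.dim, revMat_mul _, revMat_conjTranspose _, fun p _ hp => selfAdjoint s hp⟩⟩
  · rintro rfl
    refine ⟨fun ε hε => not_rational_arrows hε, zerilliArrows, fun p hp => zerilli_isEquivalence hp,
      zerilliArrows_rational, not_rational_zerilliArrows, fun p hp => ?_⟩
    obtain ⟨g, hg, e⟩ := System.chandra_kbar hp
    obtain ⟨g', hg', e'⟩ := System.chandra_k hp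
    exact ⟨g, g', hg, hg', e, e'⟩
  · obtain ⟨C, k, hk, e, e', hC, h₃, h₄⟩ := automorphism_classification hp hT hT' h
    exact ⟨C, k, hk, e, e', rwSystem_comm p hC h₃ h₄, hC,
      fun i j hij hs => commutant_upper hp.M_ne_zero hp.regular hC h₃ hij hs⟩
  · rintro rfl p -
    -- In the order by spin the positions 2 and 1 hold the scalar components 4 and 2, so the entry
    -- exhibited below the diagonal is the one at (4, 2).
    exact ⟨scalarMixing, scalarMixing_comm p, scalarMixing_spin, 2, 1, by decide, rfl,
      show (1 : ℂ) ≠ 0 from one_ne_zero⟩
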